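/- **Spacetime.** Let $r_b>0$, and let $\Psi(r,R)$, $Y(r,R)$ be functions that are of class $C^3$ at every point of the closed region $0\le R\le r<r_b$ (i.e. $C^3$ on a neighbourhood of it), with $Y>0$ on this region, $\Psi>0$ there for $r>0$, and $Y(0,0)=1$ (regular centre). Put $$u^2=Y^2+\frac{2\Psi}{R}-1,\qquad G(r,R)=\int_R^r\frac{1}{Y(r,\sigma)}\,\frac{\partial(1/u)}{\partial r}(r,\sigma)\,d\sigma+\frac{1}{Y(r,r)\,u(r,r)},$$ with $u$ the positive root, and assume $u^2>0$ and $G>0$ for $0<R\le r<r_b$. On $0<R<r<r_b$ consider the metric $$ds^2=-A\,dr^2-2B\,dR\,dr-C\,dR^2+R^2(d\theta^2+\sin^2\theta\,d\varphi^2),\qquad A=\Big(1-\frac{2\Psi}{R}\Big)G^2,\quad B=-\frac{GY}{u},\quad C=\frac1{u^2},$$ time-oriented by the velocity $-u\,\partial_R$ of the matter. Assume that for some $\alpha>0$ and some $\beta,\gamma,\delta,\xi\in\mathbb R$ $$Ru^2=\alpha r^3+\beta r^2R+\gamma rR^2+\delta R^3+o\big((r^2+R^2)^{3/2}\big)\quad\text{as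 }(r,R)\to(0,0),\ 0<R\le r,$$ $$G(r,0)=\xi r^2+o(r^2)\quad\text{as }r\to0^+ .$$ **Singular geodesics.** A *singular geodesic* is a future-pointing, affinely parametrized null geodesic in the plane $\theta=\pi/2$, with angular momentum $\ell=R^2\,d\varphi/d\kappa\ge0$ and $dr/d\kappa>0$, hence given by functions $R(r)$, $\varphi(r)$ of $r\in(0,r_0)$ for some $0<r_0\le r_b$, such that $R(r)/r\to0$ as $r\to0^+$ (it emanates from the central singularity; the regular centre corresponds to positive limits of $R/r$) and $R(r)>2\Psi(r,R(r))$ for all small $r>0$ (it escapes the trapped region). It is *radial* if $\ell=0$ and *nonradial* if $\ell>0$. In counting, geodesics with the same $R(r)$ for all small $r$ are identified. **Proposition.** Let $\alpha>0$ and $\xi>\alpha\,\omega_{\rm crit}$, where $\omega_{\rm crit}=\frac{26+15\sqrt3}{2}$. There are numbers $x_c>x_2>x_1>\alpha$, depending only on $\alpha$ and $\xi$, such that in every spacetime as above there are infinitely many singular geodesics, and each of them belongs to exactly one of the following classes: 1. radial and nonradial geodesics with $R(r)=x_1r^3+o(r^3)$; there are infinitely many radial and infinitely many nonradial ones, and for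 each nonradial one $\lim_{r\to0^+}\varphi(r)$ exists and is finite; 2. nonradial geodesics with $R(r)=x_2r^3+o(r^3)$; there are infinitely many, and $\lim_{r\to0^+}\varphi(r)=-\infty$ for each of them; 3. radial geodesics with $R_c(r)=x_cr^3+o(r^3)$ (Cauchy horizon); there is one, it is unique (any two have the same $R_c(r)$ for all $r$ at which both are defined), and for every singular geodesic $R_g$ that is not in this class, $R_c(r)>R_g(r)$ for all $r>0$ at which both are defined. -/

import Mathlib

open Filter Topology Asymptotics Set

noncomputable section

namespace Collapse

/-- The critical value `(26 + 15 √3) / 2`. -/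
def omegaCrit : ℝ := (26 + 15 * √3) / 2

/-- `u² = Y² + 2Ψ/R - 1` (used only for `R > 0`). -/
def uSq (Ψ Y : ℝ → ℝ → ℝ) (r R : ℝ) : ℝ := Y r R ^ 2 + 2 * Ψ r R / R - 1

/-- `u`, the positive square root of `u²`. -/
def u (Ψ Y : ℝ → ℝ → ℝ) (r R : ℝ) : ℝ := √(uSq Ψ Y r R)

/-- `G(r,R) = ∫_R^r (1/Y(r,σ)) ∂_r(1/u)(r,σ) dσ + 1/(Y(r,r) u(r,r))`. -/
def G (Ψ Y : ℝ → ℝ → ℝ) (r R : ℝ) : ℝ :=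
  (∫ σ in R..r, 1 / Y r σ * deriv (fun ρ => 1 / u Ψ Y ρ σ) r)
    + 1 / (Y r r * u Ψ Y r r)

/-- `A = (1 - 2Ψ/R) G²`. -/
def A (Ψ Y : ℝ → ℝ → ℝ) (r R : ℝ) : ℝ := (1 - 2 * Ψ r R / R) * G Ψ Y r R ^ 2

/-- `B = - G Y / u`. -/
def B (Ψ Y : ℝ → ℝ → ℝ) (r R : ℝ) : ℝ := -(G Ψ Y r R * (Y r R / u Ψ Y r R))

/-- `C = 1 / u²`. -/
def C (Ψ Y : ℝ → ℝ → ℝ) (r R : ℝ) : ℝ := 1 / u Ψ Y r R ^ 2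

/-- The collapsing spacetimes: mass function `Ψ`, function `Y`, coordinate radius `rb` of the
ball of matter. The spacetime region is `0 < R < r < rb` in area-radius coordinates `(r, R)`
(times the sphere); `R = r` is the initial hypersurface, `R = 0` the singularity. -/
structure IsCollapse (Ψ Y : ℝ → ℝ → ℝ) (rb α ξ : ℝ) : Prop where
  rb_pos : 0 < rb
  /-- the data are regular (`C³`, up to the boundary, including the centre) -/
  contDiff_Psi : ∀ r R, 0 ≤ R → R ≤ r → r < rb →
    ContDiffAt ℝ 3 (fun x : ℝ × ℝ => Ψ x.1 x.2) (r, R)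
  contDiff_Y : ∀ r R, 0 ≤ R → R ≤ r → r < rb →
    ContDiffAt ℝ 3 (fun x : ℝ × ℝ => Y x.1 x.2) (r, R)
  Psi_pos : ∀ r R, 0 ≤ R → R ≤ r → 0 < r → r < rb → 0 < Ψ r R
  Y_pos : ∀ r R, 0 ≤ R → R ≤ r → r < rb → 0 < Y r R
  /-- regularity of the centre before the singularity forms -/
  Y_centre : Y 0 0 = 1
  /-- `u` is real and non-zero: the collapse goes on until `R = 0` -/
  uSq_pos : ∀ r R, 0 < R → R ≤ r → r < rb → 0 < uSq Ψ Y r R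
  /-- the metric does not degenerate (the determinant of its `(r, R)` block is `- G²`) -/
  G_pos : ∀ r R, 0 < R → R ≤ r → r < rb → 0 < G Ψ Y r R
  alpha_pos : 0 < α
  /-- `R u² = α r³ + β r² R + γ r R² + δ R³ + o((r² + R²)^{3/2})` -/
  taylor : ∃ β γ δ : ℝ,
    (fun x : ℝ × ℝ => x.2 * uSq Ψ Y x.1 x.2
        - (α * x.1 ^ 3 + β * x.1 ^ 2 * x.2 + γ * x.1 * x.2 ^ 2 + δ * x.2 ^ 3))
      =o[𝓝[{x : ℝ × ℝ | 0 < x.2 ∧ x.2 ≤ x.1}] (0, 0)]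
        (fun x : ℝ × ℝ => (x.1 ^ 2 + x.2 ^ 2) ^ (3 / 2 : ℝ))
  /-- `G(r,0) = ξ r² + o(r²)` -/
  G_zero : (fun r : ℝ => G Ψ Y r 0 - ξ * r ^ 2) =o[𝓝[>] 0] (fun r : ℝ => r ^ 2)

/-- The metric `- A dr² - 2 B dR dr - C dR² + R² (dθ² + sin²θ dφ²)` in the coordinates
`x = (r, R, θ, φ)`. -/
def metric (Ψ Y : ℝ → ℝ → ℝ) (x : Fin 4 → ℝ) : Matrix (Fin 4) (Fin 4) ℝ :=
  !![-A Ψ Y (x 0) (x 1), -B Ψ Y (x 0) (x 1), 0, 0;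
     -B Ψ Y (x 0) (x 1), -C Ψ Y (x 0) (x 1), 0, 0;
     0, 0, x 1 ^ 2, 0;
     0, 0, 0, x 1 ^ 2 * Real.sin (x 2) ^ 2]

/-- The partial derivative `∂_i f` at `x`. -/
def partialDeriv (f : (Fin 4 → ℝ) → ℝ) (i : Fin 4) (x : Fin 4 → ℝ) : ℝ :=
  deriv (fun s => f (Function.update x i s)) (x i)

/-- Christoffel symbols of the first kind
`Γ_{μνλ} = (∂_ν g_{μλ} + ∂_λ g_{μν} - ∂_μ g_{νλ}) / 2`. -/
def christoffel (g : (Fin 4 → ℝ) → Matrix (Fin 4) (Fin 4) ℝ) (μ ν l : Fin 4)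
    (x : Fin 4 → ℝ) : ℝ :=
  (partialDeriv (fun y => g y μ l) ν x + partialDeriv (fun y => g y μ ν) l x
    - partialDeriv (fun y => g y ν l) μ x) / 2

/-- A light ray in the equatorial plane, described with the coordinate `r` as parameter, for
`0 < r < rmax`: the functions `R(r)`, `φ(r)` and `k(r) = κ^r`, the `r`-component of the tangent
vector with respect to an affine parameter `κ`. Values outside `(0, rmax)` are never used. -/
structure Ray where
  rmax : ℝ
  R : ℝ → ℝ
  φ : ℝ → ℝ
  k : ℝ → ℝ

namespace Ray

/-- The point `(r, R(r), π/2, φ(r))`. -/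
def point (c : Ray) (r : ℝ) : Fin 4 → ℝ := ![r, c.R r, Real.pi / 2, c.φ r]

/-- The affine tangent vector `K = dx/dκ = k (1, dR/dr, 0, dφ/dr)`. -/
def tangent (c : Ray) (r : ℝ) : Fin 4 → ℝ :=
  ![c.k r, c.k r * deriv c.R r, 0, c.k r * deriv c.φ r]

/-- `c` is a future-pointing, affinely parametrized null geodesic of the spacetime, with `r`
increasing along it, and with the orientation of `φ` such that its angular momentum
is non-negative. As `d/dκ = k d/dr`, the geodesic equation `∇_K K = 0` (with lowered index) reads
`∑_ν g_{μν} k dK^ν/dr + ∑_{ν,λ} Γ_{μνλ} K^ν K^λ = 0`. Time orientation is given by the velocity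
`- u ∂_R` of the collapsing matter. -/
structure IsNullGeodesic (Ψ Y : ℝ → ℝ → ℝ) (rb : ℝ) (c : Ray) : Prop where
  rmax_pos : 0 < c.rmax
  rmax_le : c.rmax ≤ rb
  mem_region : ∀ r ∈ Ioo 0 c.rmax, 0 < c.R r ∧ c.R r < r
  differentiable_R : ∀ r ∈ Ioo 0 c.rmax, DifferentiableAt ℝ c.R r
  differentiable_φ : ∀ r ∈ Ioo 0 c.rmax, DifferentiableAt ℝ c.φ r
  differentiable_tangent : ∀ r ∈ Ioo 0 c.rmax, DifferentiableAt ℝ c.tangent r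
  k_pos : ∀ r ∈ Ioo 0 c.rmax, 0 < c.k r
  null : ∀ r ∈ Ioo 0 c.rmax,
    ∑ μ, ∑ ν, metric Ψ Y (c.point r) μ ν * c.tangent r μ * c.tangent r ν = 0
  future : ∀ r ∈ Ioo 0 c.rmax,
    ∑ μ, metric Ψ Y (c.point r) μ 1 * c.tangent r μ * (-u Ψ Y r (c.R r)) < 0
  geodesic : ∀ r ∈ Ioo 0 c.rmax, ∀ μ,
    ∑ ν, metric Ψ Y (c.point r) μ ν * (c.k r * deriv (fun s => c.tangent s ν) r)
      + ∑ ν, ∑ l, christoffel (metric Ψ Y) μ ν l (c.point r) * c.tangent r ν * c.tangent r l = 0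
  oriented : ∀ r ∈ Ioo 0 c.rmax, 0 ≤ c.tangent r 3

/-- `c` is a null geodesic that emanates from the central singularity and escapes the trapped
region. In the coordinates `(r, R)` the whole history of the centre is collapsed to the point
`(0, 0)`: a curve with `R / r → a > 0` comes from the regular centre, at the time at which the
matter near the centre has contracted by the factor `a`; the central singularity is `R / r → 0`.
Escaping means that the ray starts in the untrapped region `R > 2Ψ`. -/
structure IsSingular (Ψ Y : ℝ → ℝ → ℝ) (rb : ℝ) (c : Ray) : Prop where
  isNullGeodesic : c.IsNullGeodesic Ψ Y rb
  emanates : Tendsto (fun r => c.R r / r) (𝓝[>] 0) (𝓝 0)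
  escapes : ∀ᶠ r in 𝓝[>] 0, 2 * Ψ r (c.R r) < c.R r

/-- The angular momentum `R² dφ/dκ` of `c` is `ℓ`. -/
def HasAngularMomentum (c : Ray) (ℓ : ℝ) : Prop :=
  ∀ r ∈ Ioo 0 c.rmax, c.R r ^ 2 * c.tangent r 3 = ℓ

/-- Radial: `ℓ = 0`. -/
def IsRadial (c : Ray) : Prop := c.HasAngularMomentum 0

/-- Non radial: `ℓ > 0`. -/
def IsNonradial (c : Ray) : Prop := ∃ ℓ : ℝ, 0 < ℓ ∧ c.HasAngularMomentum ℓ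

/-- `R(r) = x r³ + o(r³)` as `r → 0⁺`. -/
def HasDirection (c : Ray) (x : ℝ) : Prop :=
  (fun r => c.R r - x * r ^ 3) =o[𝓝[>] 0] (fun r : ℝ => r ^ 3)

end Ray

/-- Infinitely many rays with the property `P`, where rays whose functions `R(r)` coincide for
all small `r > 0` are counted once. So neither shortening a ray, nor a rotation in `φ`, nor an
affine rescaling of the parameter yields a new ray. -/
def InfinitelyMany (P : Ray → Prop) : Prop :=
  {g : Germ (𝓝[>] (0 : ℝ)) ℝ | ∃ c : Ray, P c ∧ g = (c.R : Germ (𝓝[>] (0 : ℝ)) ℝ)}.Infinite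

end Collapse

end

/-! Write the slope of a light ray as dR/dr = K (Y - u q) with K = u G. The null condition then
makes the squared angular momentum a positive multiple of q² - 1. Hence q ≥ 1, with q = 1 exactly
for radial rays, and the geodesic equation becomes dq/dr = (q² - 1) · `rayTurn`. The passage between
geodesics and pairs (R, q) is `Ray.IsNullGeodesic.exists_isLightRay` and `IsLightRay.exists_ray`.

In the variables t = -log r and v = √(α r³ / R) the rays are trajectories of the planar field
`rayField`. The expansions of R u² and of G at the singularity show that, uniformly on compact sets,
this field tends as t → ∞ to an autonomous one: v' = (v/2)(h (1 - v q) - 3), q' = (q² - 1)(q h -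
(3/2) ω v⁴), where h = 1 + ω v³ and ω = ξ/α (`IsCollapse.asymptotic`). For ω > ω_crit the limit
field has three equilibria with v > 0 and q ≥ 1: (uc, 1), (u₁, 1) and (u₂, q₂) with q₂ > 1, where uc
< √3 - 1 < u₂ < u₁ < 1. A limit v of a trajectory means R ~ (α/v²) r³, so the three directions are
α/v² at these values.

The limit field is gradient-like: each component is a nonnegative multiple of the corresponding
partial derivative of `lyap`. So every trajectory in a compact set converges to an equilibrium
(`Asymptotic.tendsto_equilibrium`). Singular geodesics do stay in a compact set
(`IsLightRay.exists_isTrajectory`). A weighted integral of 1/(uY) from 0 to R obeys a differential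
inequality which gives R = O(r³), escape from the trapped region gives R ≥ α r³/4, and a large q
would blow up at finite t. This yields the classification.

As t → ∞ the point (u₁, 1) is a sink, (u₂, q₂) a saddle and (uc, 1) a source. Around the sink a
rectangle is forward invariant, which gives two infinite families, with q = 1 and with q > 1. At the
saddle a shooting argument gives a one-parameter family, and at the source, on the line q = 1, a
radial trajectory. Nonradial rays cannot tend to (uc, 1), because q - 1 grows there. Distinct
trajectories have distinct germs of R, since v and its derivative determine q.

The angle satisfies dφ/dt = -(r K/R) √(q² - 1) with r K/R → h > 0. At the sink q² - 1 decays
exponentially and φ converges; at the saddle φ tends to -∞. In the direction α/uc² the quotient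
slope/R of radial rays decreases in R, so two such rays have the same germ
(`IsCollapse.eventuallyEq_of_direction`). A comparison argument propagates this equality, and the
strict inequality with all other rays, to larger r, because nonradial slopes never exceed the radial
slope at the same point. -/

noncomputable section
namespace Collapse

/-! ### Scalar barriers and Lyapunov functions -/

/-- A function whose derivative is positive whenever it takes the value `b` cannot fall
below `b`. -/
theorem le_of_deriv_pos_at_level {y y' : ℝ → ℝ} {T b : ℝ}
    (hy : ∀ t, T ≤ t → HasDerivWithinAt y (y' t) (Ici T) t) (h0 : b ≤ y T)
    (hpos : ∀ t, T ≤ t → y t = b → 0 < y' t) : ∀ t, T ≤ t → b ≤ y t := by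
  intro t ht
  have key := image_le_of_deriv_right_lt_deriv_boundary' (f := fun s => -y s)
    (f' := fun s => -y' s) (a := T) (b := t) (B := fun _ => -b) (B' := fun _ => 0)
    (fun s hs => ((hy s hs.1).neg.continuousWithinAt.mono Icc_subset_Ici_self))
    (fun s hs => ((hy s hs.1).neg.mono (Ici_subset_Ici.2 hs.1)))
    (by simpa using h0) continuousOn_const
    (fun s _ => hasDerivWithinAt_const _ _ _)
    (fun s hs h => by
      have := hpos s hs.1 (by simpa using h)
      simpa using this)
  simpa using key ⟨ht, le_rfl⟩

/-- The trajectory need not solve an autonomous equation; it suffices that the growth rate of V is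
asymptotically W. Finiteness of the zero set of W is used twice: V takes finitely many values there,
which forbids oscillation of V(z), and its points are isolated, which forces a single limit. -/
theorem tendsto_of_lyapunov {E : Type*} [MetricSpace E] {K : Set E} (hK : IsCompact K)
    {W V : E → ℝ} (hW : ContinuousOn W K) (hW0 : ∀ x ∈ K, 0 ≤ W x)
    (hZ : {x ∈ K | W x = 0}.Finite) (hV : ContinuousOn V K) {z : ℝ → E} {T : ℝ} {L : NNReal}
    (hzK : ∀ t, T ≤ t → z t ∈ K) (hzL : LipschitzOnWith L z (Ici T)) {ν : ℝ → ℝ}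
    (hν : ∀ t, T ≤ t → HasDerivAt (fun s => V (z s)) (ν t) t)
    (hlim : Tendsto (fun t => ν t - W (z t)) atTop (𝓝 0)) :
    ∃ e ∈ K, W e = 0 ∧ Tendsto z atTop (𝓝 e) := by
  set Z := {x ∈ K | W x = 0} with hZdef
  set v : ℝ → ℝ := fun s => V (z s) with hv
  have hzc : ContinuousOn z (Ici T) := hzL.continuousOn
  have hpos : ∀ S ⊆ K, IsClosed S → (∀ x ∈ S, x ∉ Z) → ∃ c > 0, ∀ x ∈ S, c ≤ W x := by
    intro S hSK hSc hSZ
    have hSco : IsCompact S := hK.of_isClosed_subset hSc hSK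
    rcases S.eq_empty_or_nonempty with h | h
    · exact ⟨1, one_pos, by simp [h]⟩
    · obtain ⟨x, hx, hmin⟩ := hSco.exists_isMinOn h (hW.mono hSK)
      refine ⟨W x, lt_of_le_of_ne (hW0 x (hSK hx)) fun h0 => hSZ x hx ⟨hSK hx, h0.symm⟩,
        fun y hy => hmin hy⟩
  have hsmall : ∀ ε > 0, ∀ᶠ t in atTop, T ≤ t ∧ |ν t - W (z t)| < ε := by
    intro ε hε
    filter_upwards [eventually_ge_atTop T, hlim.eventually (Metric.ball_mem_nhds 0 hε)] with t h1 h2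
    exact ⟨h1, by simpa [Real.dist_eq] using h2⟩
  -- the values converge
  have hvK : IsCompact (V '' K) := hK.image_of_continuousOn hV
  have hconv : ∃ c, Tendsto v atTop (𝓝 c) := by
    have hmem : ∀ᶠ t in atTop, v t ∈ V '' K := by
      filter_upwards [eventually_ge_atTop T] with t ht using mem_image_of_mem _ (hzK t ht)
    obtain ⟨M, hM⟩ := hvK.isBounded.exists_norm_le
    refine tendsto_of_no_upcrossings (dense_univ (X := ℝ)) ?_ ⟨M, ?_⟩ ⟨-M, ?_⟩
    · rintro a - b - hab ⟨h1, h2⟩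
      -- On a level of V free of zeros, W is bounded below, so this level can eventually be crossed
      -- only upwards.
      obtain ⟨b', ⟨hab', hbb'⟩, hb'⟩ : ∃ b' ∈ Ioo a b, b' ∉ V '' Z :=
        (Ioo_infinite hab).exists_notMem_finite (hZ.image V)
      have hScl : IsClosed (K ∩ V ⁻¹' {b'}) :=
        hV.preimage_isClosed_of_isClosed hK.isClosed isClosed_singleton
      obtain ⟨c, hc, hcW⟩ := hpos (K ∩ V ⁻¹' {b'}) inter_subset_left hScl
        (fun x hx hxZ => hb' ⟨x, hxZ, hx.2⟩)
      obtain ⟨t0, ht0⟩ := eventually_atTop.1 (hsmall c hc)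
      obtain ⟨t1, ht1, hbt1⟩ := frequently_atTop.1 h2 t0
      have hstay : ∀ t, t1 ≤ t → b' ≤ v t := by
        refine le_of_deriv_pos_at_level (y' := ν)
          (fun t ht => (hν t (ht0 t (ht1.trans ht)).1).hasDerivWithinAt)
          (hbb'.le.trans hbt1.le) ?_
        intro t ht hvt
        obtain ⟨h3, h4⟩ := ht0 t (ht1.trans ht)
        have := hcW (z t) ⟨hzK t h3, hvt⟩
        have := abs_lt.1 h4
        linarith
      obtain ⟨t2, ht2, hat2⟩ := frequently_atTop.1 h1 t1
      have := hstay t2 ht2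
      linarith
    · refine eventually_map.2 (hmem.mono fun t ht => (abs_le.1 (hM _ ht)).2)
    · refine eventually_map.2 (hmem.mono fun t ht => (abs_le.1 (hM _ ht)).1)
  obtain ⟨vl, hvl⟩ := hconv
  -- the trajectory approaches the zero set
  have happ : ∀ U : Set E, IsOpen U → Z ⊆ U → ∀ᶠ t in atTop, z t ∈ U := by
    intro U hU hZU
    by_contra hcon
    obtain ⟨c, hc, hcW⟩ := hpos (K \ U) sdiff_subset (hK.isClosed.sdiff hU)
      (fun x hx hxZ => hx.2 (hZU hxZ))
    have hunif := hK.uniformContinuousOn_of_continuous hW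
    obtain ⟨δ, hδ, hδW⟩ := Metric.uniformContinuousOn_iff.1 hunif (c / 4) (by positivity)
    -- During a time τ the trajectory moves by less than δ, so W stays large and V gains at least c
    -- τ / 2. This cannot recur once V(z) converges.
    set τ : ℝ := δ / (L + 1) with hτ
    have hL1 : (0 : ℝ) < L + 1 := by positivity
    have hτpos : 0 < τ := by positivity
    have hshift : Tendsto (fun t => v (t + τ) - v t) atTop (𝓝 0) := by
      have := (hvl.comp (tendsto_atTop_add_const_right atTop τ tendsto_id)).sub hvl
      simpa using this
    have hsh : ∀ᶠ t in atTop, v (t + τ) - v t < c / 2 * τ :=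
      hshift.eventually (gt_mem_nhds (by positivity))
    obtain ⟨t0, ht0⟩ := eventually_atTop.1 ((hsmall (c / 4) (by positivity)).and hsh)
    obtain ⟨t1, ht1, hU1⟩ := frequently_atTop.1 (not_eventually.1 hcon) t0
    have hT1 := (ht0 t1 ht1).1.1
    have hW1 := hcW (z t1) ⟨hzK t1 hT1, hU1⟩
    obtain ⟨ξ, hξ, hξd⟩ := exists_hasDerivAt_eq_slope v ν (show t1 < t1 + τ by linarith)
      (fun s hs => (hν s (hT1.trans hs.1)).continuousAt.continuousWithinAt)
      (fun s hs => hν s (hT1.trans hs.1.le))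
    have hTξ : T ≤ ξ := hT1.trans hξ.1.le
    have hdist : dist (z ξ) (z t1) < δ := by
      have h1 := hzL.dist_le_mul ξ hTξ t1 hT1
      have h2 : dist ξ t1 < τ := by
        rw [Real.dist_eq, abs_of_pos (by linarith [hξ.1])]; linarith [hξ.2]
      calc dist (z ξ) (z t1) ≤ L * dist ξ t1 := h1
        _ ≤ L * τ := by gcongr
        _ < (L + 1) * τ := by linarith
        _ = δ := by rw [hτ]; field_simp
    have h3 := hδW (z ξ) (hzK ξ hTξ) (z t1) (hzK t1 hT1) hdist
    rw [Real.dist_eq] at h3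
    have h4 := (ht0 ξ (ht1.trans hξ.1.le)).1.2
    have h5 := (ht0 t1 ht1).2
    rw [abs_lt] at h3 h4
    have h6 : c / 2 < ν ξ := by linarith
    rw [hξd, lt_div_iff₀ (by linarith)] at h6
    linarith
  -- a single limit point
  obtain ⟨e, heK, he⟩ := hK.exists_mapClusterPt (f := atTop) (u := z)
    (le_principal_iff.2 (mem_map.2 (by
      filter_upwards [eventually_ge_atTop T] with t ht using hzK t ht)))
  have hfreq : ∀ U ∈ 𝓝 e, ∃ᶠ t in atTop, z t ∈ U := fun U hU => mapClusterPt_iff_frequently.1 he U hU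
  have heZ : e ∈ Z := by
    by_contra hne
    obtain ⟨U1, U2, h1, h2, h3, h4, h5⟩ :=
      SeparatedNhds.of_isCompact_isCompact (s := {e}) (t := Z) isCompact_singleton
        hZ.isCompact (by simpa using hne)
    obtain ⟨t, ht1, ht2⟩ := ((hfreq U1 (h1.mem_nhds (h3 rfl))).and_eventually (happ U2 h2 h4)).exists
    exact h5.le_bot ⟨ht1, ht2⟩
  refine ⟨e, heK, heZ.2, ?_⟩
  obtain ⟨d, hd, hdZ⟩ : ∃ d > 0, ∀ x ∈ Z, x ≠ e → d ≤ dist x e := by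
    have hfin : (Z \ {e}).Finite := hZ.subset sdiff_subset
    have hcl : (Z \ {e})ᶜ ∈ 𝓝 e := hfin.isClosed.isOpen_compl.mem_nhds (by simp)
    obtain ⟨d, hd, hball⟩ := Metric.mem_nhds_iff.1 hcl
    refine ⟨d, hd, fun x hx hxe => ?_⟩
    by_contra hlt
    exact hball (Metric.mem_ball.2 (not_le.1 hlt)) ⟨hx, hxe⟩
  rw [Metric.tendsto_atTop]
  intro ε hε
  -- The sphere of radius ρ about e contains no zero of W, so it is eventually not met, and a
  -- trajectory inside it stays inside.
  set ρ := min ε (d / 2) with hρ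
  have hρpos : 0 < ρ := by positivity
  have hUopen : IsOpen {x : E | dist x e ≠ ρ} :=
    isOpen_ne_fun (continuous_id.dist continuous_const) continuous_const
  obtain ⟨t0, ht0⟩ := eventually_atTop.1 ((happ _ hUopen (by
    intro x hx
    by_cases hxe : x = e
    · simp [hxe, hρpos.ne]
    · have := hdZ x hx hxe
      have : ρ < dist x e := (min_le_right _ _).trans_lt (by linarith)
      exact this.ne')).and (eventually_ge_atTop T))
  obtain ⟨t1, ht1, hb⟩ := frequently_atTop.1 (hfreq _ (Metric.ball_mem_nhds e hρpos)) t0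
  refine ⟨t1, fun t ht => ?_⟩
  by_contra hge
  have hcont : ContinuousOn (fun s => dist (z s) e) (Icc t1 t) :=
    continuous_dist.comp_continuousOn
      ((hzc.mono fun s (hs : s ∈ Icc t1 t) => (ht0 t1 ht1).2.trans hs.1).prodMk continuousOn_const)
  have hmem : ρ ∈ Icc (dist (z t1) e) (dist (z t) e) :=
    ⟨(Metric.mem_ball.1 hb).le, (min_le_left _ _).trans (not_lt.1 hge)⟩
  obtain ⟨s, hs, hse⟩ := intermediate_value_Icc ht hcont hmem
  exact (ht0 s (ht1.trans hs.1)).1 hse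

end Collapse
end

noncomputable section
namespace Collapse

/-! ### Global solutions of clipped differential equations -/

/-- A field that is bounded and Lipschitz on each time interval has solutions on every [T, T + n];
uniqueness glues them. -/
theorem exists_global_solution {E : Type*} [NormedAddCommGroup E] [NormedSpace ℝ E]
    [CompleteSpace E] {F : ℝ → E → E} {T : ℝ}
    (hL : ∀ T', ∃ K : NNReal, ∀ t ∈ Icc T T', LipschitzWith K (F t))
    (hC : ∀ x, ContinuousOn (fun t => F t x) (Ici T))
    (hB : ∀ T', ∃ M : NNReal, ∀ t ∈ Icc T T', ∀ x, ‖F t x‖ ≤ M) (x₀ : E) :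
    ∃ z : ℝ → E, z T = x₀ ∧ ∀ t, T ≤ t → HasDerivWithinAt z (F t (z t)) (Ici T) t := by
  have hloc : ∀ n : ℕ, ∃ z : ℝ → E, z T = x₀ ∧
      ∀ t ∈ Icc T (T + n), HasDerivWithinAt z (F t (z t)) (Icc T (T + n)) t := by
    intro n
    obtain ⟨K, hK⟩ := hL (T + n)
    obtain ⟨M, hM⟩ := hB (T + n)
    have hn : T ≤ T + n := by simp
    -- With speed at most M no solution leaves the ball of radius M n within time n, so one
    -- application covers the whole interval.
    have hpl : IsPicardLindelof F (tmin := T) (tmax := T + n) ⟨T, left_mem_Icc.2 hn⟩ x₀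
        (M * n) 0 M K :=
      { lipschitzOnWith := fun t ht => (hK t ht).lipschitzOnWith
        continuousOn := fun x _ => (hC x).mono Icc_subset_Ici_self
        norm_le := fun t ht x _ => hM t ht x
        mul_max_le := by simp }
    exact hpl.exists_eq_forall_mem_Icc_hasDerivWithinAt₀
  choose ζ hζ0 hζ using hloc
  have hag : ∀ m n : ℕ, m ≤ n → EqOn (ζ m) (ζ n) (Icc T (T + m)) := by
    intro m n hmn
    obtain ⟨K, hK⟩ := hL (T + m)
    have hmn' : (m : ℝ) ≤ n := by exact_mod_cast hmn
    have hsub : Icc T (T + m) ⊆ Icc T (T + n) := Icc_subset_Icc_right (by linarith)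
    have hder : ∀ k : ℕ, Icc T (T + m) ⊆ Icc T (T + k) → (m : ℝ) ≤ k → ∀ t ∈ Ico T (T + m),
        HasDerivWithinAt (ζ k) (F t (ζ k t)) (Ici t) t := by
      intro k hk hmk t ht
      have h1 := hζ k t (hk ⟨ht.1, ht.2.le⟩)
      have h2 : Icc t (T + k) ∈ 𝓝[≥] t := Icc_mem_nhdsGE (by linarith [ht.2])
      exact (h1.mono (Icc_subset_Icc_left ht.1)).mono_of_mem_nhdsWithin h2
    refine ODE_solution_unique_of_mem_Icc_right (K := K) (s := fun _ => univ) (v := F)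
      (fun t ht => (hK t ⟨ht.1, ht.2.le⟩).lipschitzOnWith)
      (fun t ht => (hζ m t ht).continuousWithinAt) (hder m le_rfl le_rfl) (fun _ _ => trivial)
      (fun t ht => (hζ n t (hsub ht)).continuousWithinAt.mono hsub)
      (hder n hsub hmn') (fun _ _ => trivial) (by rw [hζ0, hζ0])
  -- The extra 1 keeps t strictly below the right end of the interval of the chosen solution, so its
  -- derivative is one within `Ici T`.
  refine ⟨fun t => ζ (⌈t - T⌉₊ + 1) t, hζ0 _, fun t ht => ?_⟩
  set n := ⌈t - T⌉₊ + 1 with hn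
  have htn : t < T + n := by
    have := Nat.le_ceil (t - T)
    rw [hn]; push_cast; linarith
  have hnhds : Icc T (T + n) ∈ 𝓝[≥] t → True := fun _ => trivial
  have h1 := hζ n t ⟨ht, htn.le⟩
  have h2 : Icc T (T + n) ∈ 𝓝[Ici T] t := by
    rw [← Ici_inter_Iic]
    exact inter_mem self_mem_nhdsWithin (mem_nhdsWithin_of_mem_nhds (Iic_mem_nhds htn))
  refine (h1.mono_of_mem_nhdsWithin h2).congr_of_eventuallyEq ?_ rfl
  filter_upwards [h2] with s hs
  have hsn : ⌈s - T⌉₊ ≤ n := Nat.ceil_le.2 (by linarith [hs.2])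
  have hs' : s ∈ Icc T (T + ⌈s - T⌉₊) := ⟨hs.1, by linarith [Nat.le_ceil (s - T)]⟩
  have e1 := hag _ _ (Nat.le_succ ⌈s - T⌉₊) hs'
  have e2 := hag _ _ hsn hs'
  exact e1.symm.trans e2

/-- Gronwall with one constant for all pairs of solutions: the continuous dependence on initial
values that shooting needs. -/
theorem dist_le_of_global_solutions {E : Type*} [NormedAddCommGroup E] [NormedSpace ℝ E]
    {F : ℝ → E → E} {T : ℝ}
    (hL : ∀ T', ∃ K : NNReal, ∀ t ∈ Icc T T', LipschitzWith K (F t)) (T' : ℝ) (hT : T ≤ T') :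
    ∃ C : ℝ, 0 ≤ C ∧ ∀ z z' : ℝ → E,
      (∀ t, T ≤ t → HasDerivWithinAt z (F t (z t)) (Ici T) t) →
      (∀ t, T ≤ t → HasDerivWithinAt z' (F t (z' t)) (Ici T) t) →
      dist (z T') (z' T') ≤ dist (z T) (z' T) * C := by
  obtain ⟨K, hK⟩ := hL T'
  refine ⟨Real.exp (K * (T' - T)), (Real.exp_pos _).le, fun z z' hz hz' => ?_⟩
  exact dist_le_of_trajectories_ODE_of_mem (v := F) (K := K) (s := fun _ => univ)
    (fun t ht => (hK t ⟨ht.1, ht.2.le⟩).lipschitzOnWith)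
    (fun t ht => ((hz t ht.1).continuousWithinAt).mono Icc_subset_Ici_self)
    (fun t ht => (hz t ht.1).mono (Ici_subset_Ici.2 ht.1)) (fun _ _ => trivial)
    (fun t ht => ((hz' t ht.1).continuousWithinAt).mono Icc_subset_Ici_self)
    (fun t ht => (hz' t ht.1).mono (Ici_subset_Ici.2 ht.1)) (fun _ _ => trivial) le_rfl
    T' ⟨hT, le_rfl⟩

/-- The nearest point of `[a, b]`. -/
def clamp (a b x : ℝ) : ℝ := max a (min b x)

theorem clamp_mem {a b : ℝ} (h : a ≤ b) (x : ℝ) : clamp a b x ∈ Icc a b :=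
  ⟨le_max_left _ _, max_le h (min_le_left _ _)⟩

theorem clamp_of_mem {a b x : ℝ} (h : x ∈ Icc a b) : clamp a b x = x := by
  rw [clamp, min_eq_right h.2, max_eq_right h.1]

theorem clamp_of_ge {a b x : ℝ} (hab : a ≤ b) (h : b ≤ x) : clamp a b x = b := by
  rw [clamp, min_eq_left h, max_eq_right hab]

theorem clamp_of_le {a b x : ℝ} (hab : a ≤ b) (h : x ≤ a) : clamp a b x = a := by
  rw [clamp, min_eq_right (h.trans hab), max_eq_left h]

theorem lipschitzWith_clamp (a b : ℝ) : LipschitzWith 1 (clamp a b) :=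
  (LipschitzWith.id.const_min b).const_max a

/-- The nearest point of a rectangle. -/
def clampRect (a₁ b₁ a₂ b₂ : ℝ) (z : ℝ × ℝ) : ℝ × ℝ := (clamp a₁ b₁ z.1, clamp a₂ b₂ z.2)

theorem lipschitzWith_clampRect (a₁ b₁ a₂ b₂ : ℝ) : LipschitzWith 1 (clampRect a₁ b₁ a₂ b₂) := by
  have h := ((lipschitzWith_clamp a₁ b₁).comp LipschitzWith.prod_fst).prodMk
    ((lipschitzWith_clamp a₂ b₂).comp LipschitzWith.prod_snd)
  simp only [mul_one, max_self] at h
  exact h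

/-- Regularity of a time-dependent planar vector field on a set from time `T` on. -/
structure RegularField (F : ℝ → ℝ × ℝ → ℝ × ℝ) (S : Set (ℝ × ℝ)) (T : ℝ) : Prop where
  lipschitz : ∀ T', ∃ K : NNReal, ∀ t ∈ Icc T T', LipschitzOnWith K (F t) S
  continuousOn : ∀ x ∈ S, ContinuousOn (fun t => F t x) (Ici T)

section Rect

variable {F : ℝ → ℝ × ℝ → ℝ × ℝ} {a₁ b₁ a₂ b₂ T : ℝ}

theorem clampRect_mem (h₁ : a₁ ≤ b₁) (h₂ : a₂ ≤ b₂) (z : ℝ × ℝ) :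
    clampRect a₁ b₁ a₂ b₂ z ∈ Icc a₁ b₁ ×ˢ Icc a₂ b₂ := ⟨clamp_mem h₁ _, clamp_mem h₂ _⟩

theorem RegularField.clamp_lipschitz (hF : RegularField F (Icc a₁ b₁ ×ˢ Icc a₂ b₂) T)
    (h₁ : a₁ ≤ b₁) (h₂ : a₂ ≤ b₂) (T' : ℝ) : ∃ K : NNReal, ∀ t ∈ Icc T T',
      LipschitzWith K (fun z => F t (clampRect a₁ b₁ a₂ b₂ z)) := by
  obtain ⟨K, hK⟩ := hF.lipschitz T'
  refine ⟨K, fun t ht => ?_⟩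
  have := (hK t ht).comp ((lipschitzWith_clampRect a₁ b₁ a₂ b₂).lipschitzOnWith (s := univ))
    (fun z _ => clampRect_mem h₁ h₂ z)
  simpa [lipschitzOnWith_univ, Function.comp_def] using this

/-- Composition with the nearest-point map makes the field globally bounded and Lipschitz, so
solutions live forever. A clamped solution that never leaves the rectangle solves the original
equation. -/
theorem RegularField.exists_clamped_solution (hF : RegularField F (Icc a₁ b₁ ×ˢ Icc a₂ b₂) T)
    (h₁ : a₁ ≤ b₁) (h₂ : a₂ ≤ b₂) (x₀ : ℝ × ℝ) :
    ∃ z : ℝ → ℝ × ℝ, z T = x₀ ∧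
      ∀ t, T ≤ t → HasDerivWithinAt z (F t (clampRect a₁ b₁ a₂ b₂ (z t))) (Ici T) t := by
  refine exists_global_solution (F := fun t z => F t (clampRect a₁ b₁ a₂ b₂ z))
    (hF.clamp_lipschitz h₁ h₂) (fun x => hF.continuousOn _ (clampRect_mem h₁ h₂ x)) ?_ x₀
  intro T'
  obtain ⟨K, hK⟩ := hF.lipschitz T'
  have hmem : ((a₁, a₂) : ℝ × ℝ) ∈ Icc a₁ b₁ ×ˢ Icc a₂ b₂ :=
    ⟨left_mem_Icc.2 h₁, left_mem_Icc.2 h₂⟩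
  have hbd : Bornology.IsBounded (Icc a₁ b₁ ×ˢ Icc a₂ b₂) :=
    (isCompact_Icc.prod isCompact_Icc).isBounded
  obtain ⟨M, hM⟩ := (isCompact_Icc.image_of_continuousOn
    ((hF.continuousOn _ hmem).mono (Icc_subset_Ici_self : Icc T T' ⊆ Ici T))).isBounded.exists_norm_le
  set D := Metric.diam (Icc a₁ b₁ ×ˢ Icc a₂ b₂)
  refine ⟨(M + K * D).toNNReal, fun t ht x => le_trans ?_ (Real.le_coe_toNNReal _)⟩
  have h3 := (hK t ht).dist_le_mul _ (clampRect_mem h₁ h₂ x) _ hmem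
  have h4 : dist (clampRect a₁ b₁ a₂ b₂ x) (a₁, a₂) ≤ D :=
    Metric.dist_le_diam_of_mem hbd (clampRect_mem h₁ h₂ x) hmem
  have h5 := hM _ ⟨t, ht, rfl⟩
  have h6 : ‖F t (clampRect a₁ b₁ a₂ b₂ x)‖ ≤ ‖F t (a₁, a₂)‖ +
      dist (F t (clampRect a₁ b₁ a₂ b₂ x)) (F t (a₁, a₂)) := by
    rw [dist_eq_norm]
    calc _ = ‖F t (a₁, a₂) + (F t (clampRect a₁ b₁ a₂ b₂ x) - F t (a₁, a₂))‖ := by congr 1; abel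
      _ ≤ _ := norm_add_le _ _
  have h7 : (K : ℝ) * dist (clampRect a₁ b₁ a₂ b₂ x) (a₁, a₂) ≤ K * D := by gcongr
  linarith

end Rect

/-- A function that does not increase above the level `b` and starts below it stays below it. -/
theorem le_of_deriv_nonpos_above {y y' : ℝ → ℝ} {T b : ℝ}
    (hy : ∀ t, T ≤ t → HasDerivWithinAt y (y' t) (Ici T) t) (h0 : y T ≤ b)
    (hpos : ∀ t, T ≤ t → b ≤ y t → y' t ≤ 0) : ∀ t, T ≤ t → y t ≤ b := by
  intro t ht
  refine le_of_forall_pos_le_add fun ε hε => ?_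
  have hT : 0 < t - T + 1 := by linarith
  -- A barrier of small positive slope η turns the weak inequality for the derivative into the
  -- strict one required by the comparison theorem; it rises by at most ε up to time t.
  set η := ε / (t - T + 1) with hη
  have hηpos : 0 < η := by positivity
  have key := image_le_of_deriv_right_lt_deriv_boundary' (f := y)
    (f' := y') (a := T) (b := t) (B := fun s => b + η * (s - T)) (B' := fun _ => η)
    (fun s hs => ((hy s hs.1).continuousWithinAt.mono Icc_subset_Ici_self))
    (fun s hs => ((hy s hs.1).mono (Ici_subset_Ici.2 hs.1)))
    (by simpa using h0) (by fun_prop)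
    (fun s _ => by
      have := (((hasDerivAt_id s).sub_const T).const_mul η).const_add b
      simpa using this.hasDerivWithinAt)
    (fun s hs h => by
      have h1 : 0 ≤ η * (s - T) := mul_nonneg hηpos.le (by linarith [hs.1])
      have := hpos s hs.1 (by rw [h]; linarith)
      linarith)
  have h2 := key ⟨ht, le_rfl⟩
  have h3 : η * (t - T) ≤ ε := by
    rw [hη, div_mul_eq_mul_div, div_le_iff₀ hT]
    nlinarith
  linarith

theorem ge_of_deriv_nonneg_below {y y' : ℝ → ℝ} {T b : ℝ}
    (hy : ∀ t, T ≤ t → HasDerivWithinAt y (y' t) (Ici T) t) (h0 : b ≤ y T)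
    (hpos : ∀ t, T ≤ t → y t ≤ b → 0 ≤ y' t) : ∀ t, T ≤ t → b ≤ y t := by
  intro t ht
  have := le_of_deriv_nonpos_above (y := fun s => -y s) (y' := fun s => -y' s) (b := -b) (T := T)
    (fun s hs => (hy s hs).neg) (by simpa using h0)
    (fun s hs h => by have := hpos s hs (by simpa using h); simpa using this) t ht
  simpa using this

section Rect

variable {F : ℝ → ℝ × ℝ → ℝ × ℝ} {a₁ b₁ a₂ b₂ T : ℝ}

theorem hasDerivWithinAt_fst {z : ℝ → ℝ × ℝ} {z' : ℝ × ℝ} {s : Set ℝ} {t : ℝ}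
    (h : HasDerivWithinAt z z' s t) : HasDerivWithinAt (fun s => (z s).1) z'.1 s t := by
  have := (hasFDerivAt_fst (𝕜 := ℝ) (p := z t)).comp_hasDerivWithinAt t h
  simpa [Function.comp_def] using this

theorem hasDerivWithinAt_snd {z : ℝ → ℝ × ℝ} {z' : ℝ × ℝ} {s : Set ℝ} {t : ℝ}
    (h : HasDerivWithinAt z z' s t) : HasDerivWithinAt (fun s => (z s).2) z'.2 s t := by
  have := (hasFDerivAt_snd (𝕜 := ℝ) (p := z t)).comp_hasDerivWithinAt t h
  simpa [Function.comp_def] using this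

/-- A clamped solution whose first coordinate is pushed inwards stays in the strip. -/
theorem fst_mem_of_clamped {z : ℝ → ℝ × ℝ} (h₁ : a₁ ≤ b₁) (h₂ : a₂ ≤ b₂)
    (hz : ∀ t, T ≤ t → HasDerivWithinAt z (F t (clampRect a₁ b₁ a₂ b₂ (z t))) (Ici T) t)
    (h0 : (z T).1 ∈ Icc a₁ b₁)
    (ha : ∀ t, T ≤ t → ∀ y ∈ Icc a₂ b₂, 0 ≤ (F t (a₁, y)).1)
    (hb : ∀ t, T ≤ t → ∀ y ∈ Icc a₂ b₂, (F t (b₁, y)).1 ≤ 0) :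
    ∀ t, T ≤ t → (z t).1 ∈ Icc a₁ b₁ := by
  intro t ht
  refine ⟨ge_of_deriv_nonneg_below (fun s hs => hasDerivWithinAt_fst (hz s hs)) h0.1 ?_ t ht,
    le_of_deriv_nonpos_above (fun s hs => hasDerivWithinAt_fst (hz s hs)) h0.2 ?_ t ht⟩
  · intro s hs h
    rw [clampRect, clamp_of_le h₁ h]; exact ha s hs _ (clamp_mem h₂ _)
  · intro s hs h
    rw [clampRect, clamp_of_ge h₁ h]; exact hb s hs _ (clamp_mem h₂ _)

theorem snd_mem_of_clamped {z : ℝ → ℝ × ℝ} (h₁ : a₁ ≤ b₁) (h₂ : a₂ ≤ b₂)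
    (hz : ∀ t, T ≤ t → HasDerivWithinAt z (F t (clampRect a₁ b₁ a₂ b₂ (z t))) (Ici T) t)
    (h0 : (z T).2 ∈ Icc a₂ b₂)
    (ha : ∀ t, T ≤ t → ∀ x ∈ Icc a₁ b₁, 0 ≤ (F t (x, a₂)).2)
    (hb : ∀ t, T ≤ t → ∀ x ∈ Icc a₁ b₁, (F t (x, b₂)).2 ≤ 0) :
    ∀ t, T ≤ t → (z t).2 ∈ Icc a₂ b₂ := by
  intro t ht
  refine ⟨ge_of_deriv_nonneg_below (fun s hs => hasDerivWithinAt_snd (hz s hs)) h0.1 ?_ t ht,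
    le_of_deriv_nonpos_above (fun s hs => hasDerivWithinAt_snd (hz s hs)) h0.2 ?_ t ht⟩
  · intro s hs h
    rw [clampRect, clamp_of_le h₂ h]; exact ha s hs _ (clamp_mem h₁ _)
  · intro s hs h
    rw [clampRect, clamp_of_ge h₂ h]; exact hb s hs _ (clamp_mem h₁ _)

/-- A rectangle all of whose sides push inwards is forward invariant. -/
theorem RegularField.exists_solution_of_inward (hF : RegularField F (Icc a₁ b₁ ×ˢ Icc a₂ b₂) T)
    (ha₁ : ∀ t, T ≤ t → ∀ y ∈ Icc a₂ b₂, 0 ≤ (F t (a₁, y)).1)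
    (hb₁ : ∀ t, T ≤ t → ∀ y ∈ Icc a₂ b₂, (F t (b₁, y)).1 ≤ 0)
    (ha₂ : ∀ t, T ≤ t → ∀ x ∈ Icc a₁ b₁, 0 ≤ (F t (x, a₂)).2)
    (hb₂ : ∀ t, T ≤ t → ∀ x ∈ Icc a₁ b₁, (F t (x, b₂)).2 ≤ 0)
    {x₀ : ℝ × ℝ} (hx₀ : x₀ ∈ Icc a₁ b₁ ×ˢ Icc a₂ b₂) :
    ∃ z : ℝ → ℝ × ℝ, z T = x₀ ∧ (∀ t, T ≤ t → z t ∈ Icc a₁ b₁ ×ˢ Icc a₂ b₂) ∧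
      ∀ t, T ≤ t → HasDerivWithinAt z (F t (z t)) (Ici T) t := by
  have h₁ : a₁ ≤ b₁ := hx₀.1.1.trans hx₀.1.2
  have h₂ : a₂ ≤ b₂ := hx₀.2.1.trans hx₀.2.2
  obtain ⟨z, hz0, hz⟩ := hF.exists_clamped_solution h₁ h₂ x₀
  have hmem : ∀ t, T ≤ t → z t ∈ Icc a₁ b₁ ×ˢ Icc a₂ b₂ := fun t ht =>
    ⟨fst_mem_of_clamped h₁ h₂ hz (by rw [hz0]; exact hx₀.1) ha₁ hb₁ t ht,
      snd_mem_of_clamped h₁ h₂ hz (by rw [hz0]; exact hx₀.2) ha₂ hb₂ t ht⟩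
  refine ⟨z, hz0, hmem, fun t ht => ?_⟩
  have := hz t ht
  rwa [clampRect, clamp_of_mem (hmem t ht).1, clamp_of_mem (hmem t ht).2] at this

/-- Shooting: if the first coordinate is pushed inwards and the second one outwards, then for every
initial value of the first coordinate some solution remains in the rectangle. -/
theorem RegularField.exists_solution_of_saddle (hF : RegularField F (Icc a₁ b₁ ×ˢ Icc a₂ b₂) T)
    (h₂ : a₂ ≤ b₂)
    (ha₁ : ∀ t, T ≤ t → ∀ y ∈ Icc a₂ b₂, 0 ≤ (F t (a₁, y)).1)
    (hb₁ : ∀ t, T ≤ t → ∀ y ∈ Icc a₂ b₂, (F t (b₁, y)).1 ≤ 0)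
    (ha₂ : ∀ t, T ≤ t → ∀ x ∈ Icc a₁ b₁, (F t (x, a₂)).2 < 0)
    (hb₂ : ∀ t, T ≤ t → ∀ x ∈ Icc a₁ b₁, 0 < (F t (x, b₂)).2)
    {x₀ : ℝ} (hx₀ : x₀ ∈ Icc a₁ b₁) :
    ∃ z : ℝ → ℝ × ℝ, (z T).1 = x₀ ∧ (∀ t, T ≤ t → z t ∈ Icc a₁ b₁ ×ˢ Icc a₂ b₂) ∧
      ∀ t, T ≤ t → HasDerivWithinAt z (F t (z t)) (Ici T) t := by
  have h₁ : a₁ ≤ b₁ := hx₀.1.trans hx₀.2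
  choose ζ hζ0 hζ using fun y : ℝ => hF.exists_clamped_solution h₁ h₂ (x₀, y)
  -- once out, always out
  have hup : ∀ y t₁, T ≤ t₁ → b₂ < (ζ y t₁).2 → ∀ t, t₁ ≤ t → b₂ < (ζ y t).2 := by
    intro y t₁ ht₁ h t ht
    refine lt_of_lt_of_le h (le_of_deriv_pos_at_level (T := t₁)
      (y := fun s => (ζ y s).2) (fun s hs => hasDerivWithinAt_snd
        ((hζ y s (ht₁.trans hs)).mono (Ici_subset_Ici.2 ht₁))) le_rfl ?_ t ht)
    intro s hs hs'
    rw [clampRect, clamp_of_ge h₂ (by rw [hs']; exact h.le)]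
    exact hb₂ s (ht₁.trans hs) _ (clamp_mem h₁ _)
  have hdown : ∀ y t₁, T ≤ t₁ → (ζ y t₁).2 < a₂ → ∀ t, t₁ ≤ t → (ζ y t).2 < a₂ := by
    intro y t₁ ht₁ h t ht
    refine lt_of_le_of_lt (neg_le_neg_iff.1 (le_of_deriv_pos_at_level (T := t₁)
      (y := fun s => -(ζ y s).2) (fun s hs => (hasDerivWithinAt_snd
        ((hζ y s (ht₁.trans hs)).mono (Ici_subset_Ici.2 ht₁))).neg) le_rfl ?_ t ht)) h
    intro s hs hs'
    have hs'' : (ζ y s).2 ≤ a₂ := by rw [neg_inj.1 hs']; exact h.le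
    rw [clampRect, clamp_of_le h₂ hs'', neg_pos]
    exact ha₂ s (ht₁.trans hs) _ (clamp_mem h₁ _)
  have hcont : ∀ t, T ≤ t → Continuous fun y => (ζ y t).2 := by
    intro t ht
    obtain ⟨C, hC0, hC⟩ := dist_le_of_global_solutions (hF.clamp_lipschitz h₁ h₂) t ht
    have : LipschitzWith C.toNNReal fun y => (ζ y t).2 := by
      refine LipschitzWith.of_dist_le_mul fun y y' => ?_
      have h3 := hC (ζ y) (ζ y') (hζ y) (hζ y')
      rw [hζ0, hζ0, Prod.dist_eq (x := (x₀, y)), dist_self, max_eq_right dist_nonneg, mul_comm] at h3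
      rw [Real.coe_toNNReal _ hC0]
      refine le_trans ?_ h3
      rw [Prod.dist_eq]
      exact le_max_right _ _
    exact this.continuous
  set U : Set ℝ := {y | ∃ t, T ≤ t ∧ b₂ < (ζ y t).2} with hU
  set D : Set ℝ := {y | ∃ t, T ≤ t ∧ (ζ y t).2 < a₂} with hD
  have hUo : IsOpen U := by
    have : U = ⋃ t ∈ Ici T, {y | b₂ < (ζ y t).2} := by ext; simp [hU]
    rw [this]
    exact isOpen_biUnion fun t ht => isOpen_lt continuous_const (hcont t ht)
  have hDo : IsOpen D := by
    have : D = ⋃ t ∈ Ici T, {y | (ζ y t).2 < a₂} := by ext; simp [hD]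
    rw [this]
    exact isOpen_biUnion fun t ht => isOpen_lt (hcont t ht) continuous_const
  -- The initial values that exit above and those that exit below form open, nonempty, disjoint
  -- sets. They cannot cover the connected line.
  have hex : ∃ y, y ∉ U ∧ y ∉ D := by
    by_contra! hcon
    obtain ⟨y, -, ⟨t, ht, hyt⟩, ⟨t', ht', hyt'⟩⟩ := isPreconnected_univ U D hUo hDo
      (fun y _ => by
        by_cases hy : y ∈ U
        · exact Or.inl hy
        · exact Or.inr (hcon y hy))
      ⟨b₂ + 1, trivial, T, le_rfl, by rw [hζ0]; simp⟩ ⟨a₂ - 1, trivial, T, le_rfl, by rw [hζ0]; simp⟩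
    have h3 := hup y t ht hyt (max t t') (le_max_left _ _)
    have h4 := hdown y t' ht' hyt' (max t t') (le_max_right _ _)
    linarith
  obtain ⟨y, hyU, hyD⟩ := hex
  have hmem : ∀ t, T ≤ t → ζ y t ∈ Icc a₁ b₁ ×ˢ Icc a₂ b₂ := fun t ht =>
    ⟨fst_mem_of_clamped h₁ h₂ (hζ y) (by rw [hζ0]; exact hx₀) ha₁ hb₁ t ht,
      not_lt.1 fun h => hyD ⟨t, ht, h⟩, not_lt.1 fun h => hyU ⟨t, ht, h⟩⟩
  refine ⟨ζ y, by rw [hζ0], hmem, fun t ht => ?_⟩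
  have := hζ y t ht
  rwa [clampRect, clamp_of_mem (hmem t ht).1, clamp_of_mem (hmem t ht).2] at this

end Rect
end Collapse
end

noncomputable section
namespace Collapse

/-! ### The limiting autonomous system -/

/-- `h = 1 + ω v³`. -/
def hLim (ω v : ℝ) : ℝ := 1 + ω * v ^ 3

/-- First component of the limiting system. -/
def fLim (ω v q : ℝ) : ℝ := v / 2 * (hLim ω v - hLim ω v * v * q - 3)

/-- Second component of the limiting system. -/
def gLim (ω v q : ℝ) : ℝ := (q ^ 2 - 1) * (q * hLim ω v - 3 / 2 * ω * v ^ 4)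

/-- Radial equilibria are the zeros of `radialPoly`. -/
def radialPoly (ω v : ℝ) : ℝ := ω * v ^ 3 * (1 - v) - v - 2

/-- Nonradial equilibria are zeros of `nonradialPoly`. -/
def nonradialPoly (ω v : ℝ) : ℝ := ω * v ^ 3 * (2 - 3 * v ^ 2) - 4

/-- The critical value of `v`. -/
def vCrit : ℝ := √3 - 1

theorem vCrit_sq : vCrit ^ 2 + 2 * vCrit - 2 = 0 := by
  have : √3 ^ 2 = 3 := Real.sq_sqrt (by norm_num)
  unfold vCrit; nlinarith

theorem vCrit_bounds : 73 / 100 < vCrit ∧ vCrit < 74 / 100 := by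
  have h1 : √3 < 174 / 100 := by
    rw [Real.sqrt_lt' (by norm_num)]; norm_num
  have h2 : 173 / 100 < √3 := by
    rw [Real.lt_sqrt (by norm_num)]; norm_num
  unfold vCrit; constructor <;> linarith

/-- At ω = `omegaCrit` the polynomial vanishes at `vCrit`; this is checked by reducing powers modulo
v² + 2v - 2. The coefficient of ω is positive, so a larger ω gives a positive value. -/
theorem radialPoly_vCrit {ω : ℝ} (hω : omegaCrit < ω) : 0 < radialPoly ω vCrit := by
  have h := vCrit_sq
  obtain ⟨h1, h2⟩ := vCrit_bounds
  have h3 : vCrit ^ 3 = 6 * vCrit - 4 := by linear_combination (vCrit - 2) * h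
  have h4 : vCrit ^ 4 = 12 - 16 * vCrit := by
    linear_combination (vCrit ^ 2 - 2 * vCrit + 6) * h
  have h5 : omegaCrit * (vCrit ^ 3 * (1 - vCrit)) = vCrit + 2 := by
    have hs : √3 = vCrit + 1 := by simp [vCrit]
    have : vCrit ^ 3 * (1 - vCrit) = 22 * vCrit - 16 := by linear_combination h3 - h4
    rw [this, omegaCrit, hs]
    linear_combination (165 : ℝ) * h
  have h6 : 0 < vCrit ^ 3 * (1 - vCrit) := by
    have : 0 < vCrit := by linarith
    have : 0 < 1 - vCrit := by linarith
    positivity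
  have h7 := mul_lt_mul_of_pos_right hω h6
  unfold radialPoly
  nlinarith

theorem omegaCrit_gt : 25 < omegaCrit := by
  have h2 : 173 / 100 < √3 := by
    rw [Real.lt_sqrt (by norm_num)]; norm_num
  unfold omegaCrit; linarith

/-- Elimination of ω by the nonradial equation leaves 3v (v² + 2v - 2), whose sign is decided by
comparing v with `vCrit`. The result places u₂ between uc and u₁. -/
theorem radialPoly_pos_of_nonradial {ω v : ℝ} (hω : 0 < ω) (hv0 : vCrit < v)
    (h : nonradialPoly ω v = 0) : 0 < 2 - 3 * v ^ 2 ∧ 0 < radialPoly ω v := by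
  obtain ⟨h1, h2⟩ := vCrit_bounds
  have h3 := vCrit_sq
  have hv : 0 < v := by linarith
  have h4 : 0 < v ^ 2 + 2 * v - 2 := by nlinarith
  unfold nonradialPoly at h
  unfold radialPoly
  have hden : ω * v ^ 3 * (2 - 3 * v ^ 2) = 4 := by linarith
  have hd : 0 < 2 - 3 * v ^ 2 := by
    by_contra hneg
    have : ω * v ^ 3 * (2 - 3 * v ^ 2) ≤ 0 :=
      mul_nonpos_of_nonneg_of_nonpos (by positivity) (not_lt.1 hneg)
    linarith
  refine ⟨hd, (mul_pos_iff_of_pos_right hd).1 ?_⟩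
  have : (ω * v ^ 3 * (1 - v) - v - 2) * (2 - 3 * v ^ 2) = 3 * v * (v ^ 2 + 2 * v - 2) := by
    linear_combination (1 - v) * hden
  rw [this]
  positivity

/-- `radialPoly ω v = (v + 2) (ω χ - 1)`, with `χ` first increasing, then decreasing. -/
def radialRatio (v : ℝ) : ℝ := v ^ 3 * (1 - v) / (v + 2)

theorem radialPoly_eq {v : ℝ} (hv : 0 ≤ v) (ω : ℝ) :
    radialPoly ω v = (v + 2) * (ω * radialRatio v - 1) := by
  unfold radialPoly radialRatio
  field_simp
  ring

theorem hasDerivAt_radialRatio {v : ℝ} (hv : 0 ≤ v) :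
    HasDerivAt radialRatio (-3 * v ^ 2 * (v ^ 2 + 2 * v - 2) / (v + 2) ^ 2) v := by
  have h := (((hasDerivAt_id v).pow 3).mul ((hasDerivAt_id v).const_sub 1)).div
    ((hasDerivAt_id v).add_const 2) (by simp; linarith)
  refine h.congr_deriv ?_
  have : v + 2 ≠ 0 := by linarith
  simp
  field_simp
  ring

theorem radialRatio_strictMonoOn : StrictMonoOn radialRatio (Icc 0 vCrit) := by
  refine strictMonoOn_of_deriv_pos (convex_Icc _ _)
    (fun v hv => (hasDerivAt_radialRatio hv.1).continuousAt.continuousWithinAt) fun v hv => ?_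
  rw [interior_Icc] at hv
  rw [(hasDerivAt_radialRatio hv.1.le).deriv]
  have h3 := vCrit_sq
  have : v ^ 2 + 2 * v - 2 < 0 := by nlinarith [hv.1, hv.2]
  have h0 : 0 < v := hv.1
  refine div_pos ?_ (by positivity)
  nlinarith [pow_pos h0 2]

theorem radialRatio_strictAntiOn : StrictAntiOn radialRatio (Ici vCrit) := by
  have h0 := vCrit_bounds.1
  refine strictAntiOn_of_deriv_neg (convex_Ici _)
    (fun v hv => (hasDerivAt_radialRatio (by linarith [mem_Ici.1 hv])).continuousAt.continuousWithinAt)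
    fun v hv => ?_
  rw [interior_Ici] at hv
  have hv' : vCrit < v := hv
  rw [(hasDerivAt_radialRatio (by linarith)).deriv]
  have h3 := vCrit_sq
  have : 0 < v ^ 2 + 2 * v - 2 := by nlinarith
  have h0 : 0 < v := by linarith
  refine div_neg_of_neg_of_pos ?_ (by positivity)
  nlinarith [pow_pos h0 2]

theorem nonradialPoly_strictAntiOn {ω : ℝ} (hω : 0 < ω) :
    StrictAntiOn (nonradialPoly ω) (Ici vCrit) := by
  have h0 := vCrit_bounds.1
  have hd : ∀ v, HasDerivAt (nonradialPoly ω) (ω * (6 * v ^ 2 - 15 * v ^ 4)) v := by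
    intro v
    have h := ((((hasDerivAt_id v).pow 3).const_mul ω).mul
      (((hasDerivAt_id v).pow 2).const_mul 3 |>.const_sub 2)).sub_const 4
    refine h.congr_deriv ?_
    simp
    ring
  refine strictAntiOn_of_deriv_neg (convex_Ici _)
    (fun v hv => (hd v).continuousAt.continuousWithinAt) fun v hv => ?_
  rw [interior_Ici] at hv
  have hv' : vCrit < v := hv
  rw [(hd v).deriv]
  have h1 : 1 / 2 < v ^ 2 := by nlinarith
  refine mul_neg_of_pos_of_neg hω ?_
  nlinarith

/-- The three equilibria. -/
structure Equilibria (ω u₁ u₂ uc : ℝ) : Prop where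
  omega_pos : 0 < ω
  uc_pos : 0 < uc
  uc_lt : uc < vCrit
  lt_u₂ : vCrit < u₂
  u₂_lt : u₂ < u₁
  u₁_lt : u₁ < 1
  radial_c : radialPoly ω uc = 0
  radial_1 : radialPoly ω u₁ = 0
  nonradial_2 : nonradialPoly ω u₂ = 0

theorem continuous_radialPoly (ω : ℝ) : Continuous (radialPoly ω) := by
  unfold radialPoly; fun_prop

theorem continuous_nonradialPoly (ω : ℝ) : Continuous (nonradialPoly ω) := by
  unfold nonradialPoly; fun_prop

/-- Three intermediate value arguments. The point u₂ is found before u₁, since the positivity of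
`radialPoly` at u₂ puts u₁ in (u₂, 1). -/
theorem exists_equilibria {ω : ℝ} (hω : omegaCrit < ω) : ∃ u₁ u₂ uc, Equilibria ω u₁ u₂ uc := by
  have hω0 : 0 < ω := by linarith [omegaCrit_gt]
  obtain ⟨hc1, hc2⟩ := vCrit_bounds
  have hcrit := radialPoly_vCrit hω
  have hsq := vCrit_sq
  obtain ⟨uc, ⟨huc0, huc1⟩, huc⟩ := intermediate_value_Ioo (by linarith : (0 : ℝ) ≤ vCrit)
    (continuous_radialPoly ω).continuousOn
    (show (0 : ℝ) ∈ Ioo (radialPoly ω 0) (radialPoly ω vCrit) from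
      ⟨by norm_num [radialPoly], hcrit⟩)
  -- At `vCrit` the two polynomials are positive multiples of each other, because (v + 2)(2 - 3v²) =
  -- 4(1 - v) there.
  have hnc : 0 < nonradialPoly ω vCrit := by
    have h3 : vCrit ^ 3 = 6 * vCrit - 4 := by linear_combination (vCrit - 2) * hsq
    have h6 : (2 - 3 * vCrit ^ 2) = 6 * vCrit - 4 := by linear_combination -3 * hsq
    unfold radialPoly at hcrit
    unfold nonradialPoly
    have h7 : (vCrit + 2) * (2 - 3 * vCrit ^ 2) = 4 * (1 - vCrit) := by
      linear_combination (-3 * vCrit) * hsq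
    have h8 : 0 < (ω * vCrit ^ 3 * (2 - 3 * vCrit ^ 2) - 4) * (1 - vCrit) := by
      have : (ω * vCrit ^ 3 * (2 - 3 * vCrit ^ 2) - 4) * (1 - vCrit) =
        (ω * vCrit ^ 3 * (1 - vCrit) - vCrit - 2) * (2 - 3 * vCrit ^ 2) := by
        linear_combination h7
      rw [this]
      exact mul_pos hcrit (by rw [h6]; linarith)
    exact (mul_pos_iff_of_pos_right (by linarith)).1 h8
  have hn1 : nonradialPoly ω 1 < 0 := by unfold nonradialPoly; nlinarith
  obtain ⟨u₂, ⟨hu20, hu21⟩, hu2⟩ := intermediate_value_Ioo' (by linarith : vCrit ≤ 1)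
    (continuous_nonradialPoly ω).continuousOn
    (show (0 : ℝ) ∈ Ioo (nonradialPoly ω 1) (nonradialPoly ω vCrit) from ⟨hn1, hnc⟩)
  have hr2 := (radialPoly_pos_of_nonradial hω0 hu20 hu2).2
  obtain ⟨u₁, ⟨hu10, hu11⟩, hu1⟩ := intermediate_value_Ioo' hu21.le
    (continuous_radialPoly ω).continuousOn
    (show (0 : ℝ) ∈ Ioo (radialPoly ω 1) (radialPoly ω u₂) from ⟨by norm_num [radialPoly], hr2⟩)
  exact ⟨u₁, u₂, uc, hω0, huc0, huc1, hu20, hu10, hu11, huc, hu1, hu2⟩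

theorem fLim_one (ω v : ℝ) : fLim ω v 1 = v / 2 * radialPoly ω v := by
  unfold fLim hLim radialPoly; ring

theorem hLim_pos {ω v : ℝ} (hω : 0 < ω) (hv : 0 < v) : 0 < hLim ω v := by
  unfold hLim; positivity

namespace Equilibria

variable {ω u₁ u₂ uc : ℝ}

theorem radial_iff (E : Equilibria ω u₁ u₂ uc) {v : ℝ} (hv : 0 < v) (h : radialPoly ω v = 0) :
    v = uc ∨ v = u₁ := by
  have hc := vCrit_bounds.1
  have key : ∀ {x : ℝ}, 0 < x → radialPoly ω x = 0 → ω * radialRatio x = 1 := by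
    intro x hx h
    rw [radialPoly_eq hx.le] at h
    rcases mul_eq_zero.1 h with h | h <;> linarith
  have inj : ∀ {x y : ℝ}, 0 < x → 0 < y → radialPoly ω x = 0 → radialPoly ω y = 0 →
      radialRatio x = radialRatio y := fun hx hy h1 h2 =>
    mul_left_cancel₀ E.omega_pos.ne' ((key hx h1).trans (key hy h2).symm)
  have h1 : vCrit < u₁ := E.lt_u₂.trans E.u₂_lt
  rcases le_total v vCrit with hle | hle
  · exact Or.inl (radialRatio_strictMonoOn.injOn ⟨hv.le, hle⟩ ⟨E.uc_pos.le, E.uc_lt.le⟩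
      (inj hv E.uc_pos h E.radial_c))
  · exact Or.inr (radialRatio_strictAntiOn.injOn hle h1.le
      (inj hv (by linarith) h E.radial_1))

theorem radialPoly_pos (E : Equilibria ω u₁ u₂ uc) {v : ℝ} (h1 : uc < v) (h2 : v < u₁) :
    0 < radialPoly ω v := by
  have hv : 0 < v := E.uc_pos.trans h1
  have hc := vCrit_bounds.1
  have hω := E.omega_pos
  have hlt : vCrit < u₁ := E.lt_u₂.trans E.u₂_lt
  have e1 := E.radial_c
  have e2 := E.radial_1
  rw [radialPoly_eq E.uc_pos.le] at e1
  rw [radialPoly_eq (by linarith)] at e2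
  have e1' := (mul_eq_zero.1 e1).resolve_left (by linarith [E.uc_pos])
  have e2' := (mul_eq_zero.1 e2).resolve_left (by linarith)
  rw [radialPoly_eq hv.le]
  refine mul_pos (by linarith) ?_
  rcases le_total v vCrit with hle | hle
  · have := radialRatio_strictMonoOn ⟨E.uc_pos.le, E.uc_lt.le⟩ ⟨hv.le, hle⟩ h1
    nlinarith
  · have := radialRatio_strictAntiOn (mem_Ici.2 hle) (mem_Ici.2 hlt.le) h2
    nlinarith

theorem radialPoly_neg_left (E : Equilibria ω u₁ u₂ uc) {v : ℝ} (h1 : 0 < v) (h2 : v < uc) :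
    radialPoly ω v < 0 := by
  have hω := E.omega_pos
  have e1 := E.radial_c
  rw [radialPoly_eq E.uc_pos.le] at e1
  have e1' := (mul_eq_zero.1 e1).resolve_left (by linarith [E.uc_pos])
  rw [radialPoly_eq h1.le]
  refine mul_neg_of_pos_of_neg (by linarith) ?_
  have := radialRatio_strictMonoOn ⟨h1.le, (h2.trans E.uc_lt).le⟩ ⟨E.uc_pos.le, E.uc_lt.le⟩ h2
  nlinarith

theorem radialPoly_neg_right (E : Equilibria ω u₁ u₂ uc) {v : ℝ} (h2 : u₁ < v) :
    radialPoly ω v < 0 := by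
  have hω := E.omega_pos
  have hc := vCrit_bounds.1
  have hlt : vCrit < u₁ := E.lt_u₂.trans E.u₂_lt
  have e1 := E.radial_1
  rw [radialPoly_eq (by linarith)] at e1
  have e1' := (mul_eq_zero.1 e1).resolve_left (by linarith)
  rw [radialPoly_eq (by linarith)]
  refine mul_neg_of_pos_of_neg (by linarith) ?_
  have := radialRatio_strictAntiOn (mem_Ici.2 hlt.le) (mem_Ici.2 (hlt.trans h2).le) h2
  nlinarith

/-- The value of `q` at the nonradial equilibrium. -/
theorem q₂_gt (E : Equilibria ω u₁ u₂ uc) : 1 < 2 * u₂ / (2 - u₂ ^ 2) := by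
  have hc := vCrit_bounds.1
  have h1 := E.lt_u₂
  have h2 := E.u₂_lt.trans E.u₁_lt
  have hsq := vCrit_sq
  rw [lt_div_iff₀ (by nlinarith)]
  nlinarith

theorem u₂_pos (E : Equilibria ω u₁ u₂ uc) : 0 < u₂ := by linarith [vCrit_bounds.1, E.lt_u₂]

theorem u₁_pos (E : Equilibria ω u₁ u₂ uc) : 0 < u₁ := by linarith [E.u₂_pos, E.u₂_lt]

theorem omega_u₂ (E : Equilibria ω u₁ u₂ uc) : ω * u₂ ^ 3 * (2 - 3 * u₂ ^ 2) = 4 := by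
  have := E.nonradial_2; unfold nonradialPoly at this; linarith

theorem q₂_mul_h (E : Equilibria ω u₁ u₂ uc) :
    2 * u₂ / (2 - u₂ ^ 2) * hLim ω u₂ = 3 / 2 * ω * u₂ ^ 4 := by
  have h2 := E.u₂_lt.trans E.u₁_lt
  have h0 := E.u₂_pos
  have hd : 0 < 2 - u₂ ^ 2 := by nlinarith
  have := E.omega_u₂
  unfold hLim
  field_simp
  linear_combination -(1 : ℝ) * this

theorem fLim_u₂ (E : Equilibria ω u₁ u₂ uc) : fLim ω u₂ (2 * u₂ / (2 - u₂ ^ 2)) = 0 := by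
  have h := E.q₂_mul_h
  have := E.omega_u₂
  unfold fLim
  have h2 : hLim ω u₂ * u₂ * (2 * u₂ / (2 - u₂ ^ 2)) = u₂ * (3 / 2 * ω * u₂ ^ 4) := by
    rw [← h]; ring
  rw [h2]
  unfold hLim
  linear_combination u₂ / 4 * this

theorem gLim_u₂ (E : Equilibria ω u₁ u₂ uc) : gLim ω u₂ (2 * u₂ / (2 - u₂ ^ 2)) = 0 := by
  unfold gLim
  rw [E.q₂_mul_h]; ring

/-- Either q = 1, and v is a root of `radialPoly`, or q h = (3/2) ω v⁴, and substitution in the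
first equation gives `nonradialPoly` = 0. In the second case q ≥ 1 forces v ≥ `vCrit`, where the
root u₂ is unique by monotonicity. -/
theorem zeros (E : Equilibria ω u₁ u₂ uc) {v q : ℝ} (hv : 0 < v) (hq : 1 ≤ q)
    (hf : fLim ω v q = 0) (hg : gLim ω v q = 0) :
    (v, q) = (uc, 1) ∨ (v, q) = (u₁, 1) ∨ (v, q) = (u₂, 2 * u₂ / (2 - u₂ ^ 2)) := by
  have hω := E.omega_pos
  have hh := hLim_pos hω hv
  unfold gLim at hg
  rcases mul_eq_zero.1 hg with h | h
  · have hq1 : q = 1 := by nlinarith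
    subst hq1
    rw [fLim_one] at hf
    rcases mul_eq_zero.1 hf with h' | h'
    · linarith
    · rcases E.radial_iff hv h' with h | h <;> simp [h]
  · right; right
    unfold fLim at hf
    have hf' : hLim ω v - hLim ω v * v * q - 3 = 0 := by
      rcases mul_eq_zero.1 hf with h' | h'
      · linarith
      · exact h'
    have hn : ω * v ^ 3 * (2 - 3 * v ^ 2) = 4 := by
      have : hLim ω v = 1 + ω * v ^ 3 := rfl
      have e : hLim ω v * v * q = v * (3 / 2 * ω * v ^ 4) := by linear_combination v * h
      rw [e, this] at hf'
      linear_combination 2 * hf'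
    have hρ : 0 ≤ radialPoly ω v := by
      have : radialPoly ω v = hLim ω v * v * (q - 1) := by
        unfold radialPoly
        have : hLim ω v = 1 + ω * v ^ 3 := rfl
        linear_combination hf' - (1 - v) * this
      rw [this]
      exact mul_nonneg (by positivity) (by linarith)
    have hd : 0 < 2 - 3 * v ^ 2 := by
      by_contra hneg
      have : ω * v ^ 3 * (2 - 3 * v ^ 2) ≤ 0 :=
        mul_nonpos_of_nonneg_of_nonpos (by positivity) (not_lt.1 hneg)
      linarith
    have hge : vCrit ≤ v := by
      have h5 : radialPoly ω v * (2 - 3 * v ^ 2) = 3 * v * (v ^ 2 + 2 * v - 2) := by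
        unfold radialPoly
        linear_combination (1 - v) * hn
      have h6 : 0 ≤ 3 * v * (v ^ 2 + 2 * v - 2) := h5 ▸ mul_nonneg hρ hd.le
      have h7 : 0 ≤ v ^ 2 + 2 * v - 2 := nonneg_of_mul_nonneg_right h6 (by positivity)
      have := vCrit_sq
      have := vCrit_bounds.1
      nlinarith
    have hv2 : v = u₂ := (nonradialPoly_strictAntiOn hω).injOn (mem_Ici.2 hge)
      (mem_Ici.2 E.lt_u₂.le) (by rw [E.nonradial_2]; unfold nonradialPoly; linarith)
    subst hv2
    have := E.q₂_mul_h
    have hq : q = 2 * v / (2 - v ^ 2) :=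
      mul_right_cancel₀ hh.ne' (by rw [this]; linarith)
    rw [← hq]

/-- The factor that governs the growth of `q - 1` near radial rays. -/
theorem transverse_u₁ (E : Equilibria ω u₁ u₂ uc) : hLim ω u₁ - 3 / 2 * ω * u₁ ^ 4 < 0 := by
  have h := E.radial_1
  have h1 := E.u₁_lt
  have hlt : vCrit < u₁ := E.lt_u₂.trans E.u₂_lt
  have hc := vCrit_bounds.1
  have hsq := vCrit_sq
  unfold radialPoly at h
  -- The radial equation eliminates ω; what remains changes sign exactly at `vCrit`.
  have h3 : (hLim ω u₁ - 3 / 2 * ω * u₁ ^ 4) * (1 - u₁) = -(3 / 2) * (u₁ ^ 2 + 2 * u₁ - 2) := by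
    unfold hLim
    linear_combination (1 - 3 / 2 * u₁) * h
  have h4 : 0 < u₁ ^ 2 + 2 * u₁ - 2 := by nlinarith
  by_contra hneg
  have : 0 ≤ (hLim ω u₁ - 3 / 2 * ω * u₁ ^ 4) * (1 - u₁) :=
    mul_nonneg (not_lt.1 hneg) (by linarith)
  linarith

/-- The same elimination as at u₁, with the opposite sign because uc < `vCrit`: q - 1 grows near
(uc, 1), so nonradial rays cannot tend to this equilibrium. -/
theorem transverse_uc (E : Equilibria ω u₁ u₂ uc) : 0 < hLim ω uc - 3 / 2 * ω * uc ^ 4 := by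
  have h := E.radial_c
  have h1 := E.uc_lt
  have h0 := E.uc_pos
  have hc := vCrit_bounds.2
  have hsq := vCrit_sq
  unfold radialPoly at h
  have h3 : (hLim ω uc - 3 / 2 * ω * uc ^ 4) * (1 - uc) = -(3 / 2) * (uc ^ 2 + 2 * uc - 2) := by
    unfold hLim
    linear_combination (1 - 3 / 2 * uc) * h
  have h4 : uc ^ 2 + 2 * uc - 2 < 0 := by nlinarith
  by_contra hneg
  have : (hLim ω uc - 3 / 2 * ω * uc ^ 4) * (1 - uc) ≤ 0 :=
    mul_nonpos_of_nonpos_of_nonneg (not_lt.1 hneg) (by linarith)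
  linarith

end Equilibria

end Collapse
end

/-! ### Lyapunov function and asymptotically autonomous systems -/

noncomputable section
namespace Collapse

/-- The limiting vector field. -/
def fieldLim (ω : ℝ) (z : ℝ × ℝ) : ℝ × ℝ := (fLim ω z.1 z.2, gLim ω z.1 z.2)

/-- The phase space. -/
def phase : Set (ℝ × ℝ) := {z | 0 < z.1 ∧ 1 ≤ z.2}

theorem continuous_fieldLim (ω : ℝ) : Continuous (fieldLim ω) := by
  unfold fieldLim fLim gLim hLim; fun_prop

/-- A Lyapunov function of the limiting system. -/
def lyap (ω : ℝ) (z : ℝ × ℝ) : ℝ :=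
  z.2 ^ 2 / 2 - z.2 * (3 / 2 * ω * z.1 ^ 4 / hLim ω z.1) + Real.log (hLim ω z.1) / 2
    + 9 / (4 * hLim ω z.1 ^ 2)

/-- The partial derivative of `lyap` in the first variable. -/
def lyapV (ω : ℝ) (z : ℝ × ℝ) : ℝ :=
  3 / 2 * ω * z.1 ^ 3 * (hLim ω z.1 + 3) / hLim ω z.1 ^ 2 *
    ((hLim ω z.1 - 3) / (hLim ω z.1 * z.1) - z.2)

/-- The partial derivative of `lyap` in the second variable. -/
def lyapQ (ω : ℝ) (z : ℝ × ℝ) : ℝ := z.2 - 3 / 2 * ω * z.1 ^ 4 / hLim ω z.1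

theorem hasDerivAt_lyap {ω : ℝ} (hω : 0 < ω) {v q : ℝ → ℝ} {v' q' t : ℝ} (hv : HasDerivAt v v' t)
    (hq : HasDerivAt q q' t) (hpos : 0 < v t) :
    HasDerivAt (fun s => lyap ω (v s, q s))
      (lyapV ω (v t, q t) * v' + lyapQ ω (v t, q t) * q') t := by
  have hh := hLim_pos hω hpos
  have h1 : HasDerivAt (fun s => hLim ω (v s)) (3 * ω * v t ^ 2 * v') t := by
    have := ((hv.pow 3).const_mul ω).const_add 1
    refine this.congr_deriv ?_
    simp; ring
  have h2 := ((((hq.pow 2).div_const 2).sub (hq.mul (((hv.pow 4).const_mul (3 / 2 * ω)).div h1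
    hh.ne'))).add ((h1.log hh.ne').div_const 2)).add
    ((hasDerivAt_const t (9 : ℝ)).div ((h1.pow 2).const_mul 4) (by show (4 : ℝ) * hLim ω (v t) ^ 2 ≠ 0; positivity))
  refine h2.congr_deriv ?_
  simp only [lyapV, lyapQ]
  have e : hLim ω (v t) = 1 + ω * v t ^ 3 := rfl
  simp
  field_simp
  rw [e]
  ring

/-- The derivative of `lyap` along the limiting flow. -/
def lyapDot (ω : ℝ) (z : ℝ × ℝ) : ℝ := lyapV ω z * fLim ω z.1 z.2 + lyapQ ω z * gLim ω z.1 z.2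

/-- Up to positive factors `lyapV` is `fLim`, and `gLim` is (q² - 1) h times `lyapQ`. The derivative
along the flow is therefore a sum of squares with nonnegative weights. -/
theorem lyapDot_eq {ω : ℝ} (hω : 0 < ω) {z : ℝ × ℝ} (hz : z ∈ phase) : lyapDot ω z =
    3 / 4 * ω * z.1 ^ 5 * (hLim ω z.1 + 3) / hLim ω z.1 *
      ((hLim ω z.1 - 3) / (hLim ω z.1 * z.1) - z.2) ^ 2 +
    (z.2 ^ 2 - 1) * hLim ω z.1 * lyapQ ω z ^ 2 := by
  have hv : 0 < z.1 := hz.1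
  have hh := hLim_pos hω hv
  simp only [lyapDot, lyapV, lyapQ, fLim, gLim]
  field_simp
  ring

theorem lyapDot_nonneg {ω : ℝ} (hω : 0 < ω) {z : ℝ × ℝ} (hz : z ∈ phase) : 0 ≤ lyapDot ω z := by
  have hv : 0 < z.1 := hz.1
  have hh := hLim_pos hω hv
  have hq : 0 ≤ z.2 ^ 2 - 1 := by nlinarith [hz.2]
  rw [lyapDot_eq hω hz]
  positivity

theorem fieldLim_eq_zero_of_lyapDot {ω : ℝ} (hω : 0 < ω) {z : ℝ × ℝ} (hz : z ∈ phase)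
    (h : lyapDot ω z = 0) : fLim ω z.1 z.2 = 0 ∧ gLim ω z.1 z.2 = 0 := by
  have hv : 0 < z.1 := hz.1
  have hh := hLim_pos hω hv
  have hq : 0 ≤ z.2 ^ 2 - 1 := by nlinarith [hz.2]
  rw [lyapDot_eq hω hz, add_eq_zero_iff_of_nonneg (by positivity) (by positivity)] at h
  obtain ⟨h1, h2⟩ := h
  constructor
  · have : (hLim ω z.1 - 3) / (hLim ω z.1 * z.1) - z.2 = 0 := by
      rcases mul_eq_zero.1 h1 with h | h
      · have : 0 < 3 / 4 * ω * z.1 ^ 5 * (hLim ω z.1 + 3) / hLim ω z.1 := by positivity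
        linarith
      · exact pow_eq_zero_iff (two_ne_zero) |>.1 h
    have e : fLim ω z.1 z.2 = z.1 / 2 * (hLim ω z.1 * z.1) *
        ((hLim ω z.1 - 3) / (hLim ω z.1 * z.1) - z.2) := by
      unfold fLim; field_simp; ring
    rw [e, this, mul_zero]
  · have e : gLim ω z.1 z.2 = (z.2 ^ 2 - 1) * hLim ω z.1 * lyapQ ω z := by
      unfold gLim lyapQ; field_simp
    rw [e]
    rcases mul_eq_zero.1 h2 with h | h
    · rw [h, zero_mul]
    · rw [pow_eq_zero_iff two_ne_zero] at h
      rw [h, mul_zero]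

theorem continuousOn_lyap {ω : ℝ} (hω : 0 < ω) : ContinuousOn (lyap ω) phase := by
  intro z hz
  have hh := (hLim_pos hω hz.1).ne'
  have hc : Continuous fun z : ℝ × ℝ => hLim ω z.1 := by unfold hLim; fun_prop
  refine ContinuousAt.continuousWithinAt ?_
  have h3 : ContinuousAt (fun z : ℝ × ℝ => hLim ω z.1) z := hc.continuousAt
  unfold lyap
  have := h3.log hh
  fun_prop (disch := positivity)

theorem continuousOn_lyapV {ω : ℝ} (hω : 0 < ω) : ContinuousOn (lyapV ω) phase := by
  intro z hz
  have hh := (hLim_pos hω hz.1).ne'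
  have hv : z.1 ≠ 0 := hz.1.ne'
  have hc : Continuous fun z : ℝ × ℝ => hLim ω z.1 := by unfold hLim; fun_prop
  refine ContinuousAt.continuousWithinAt ?_
  have h3 : ContinuousAt (fun z : ℝ × ℝ => hLim ω z.1) z := hc.continuousAt
  unfold lyapV
  fun_prop (disch := positivity)

theorem continuousOn_lyapQ {ω : ℝ} (hω : 0 < ω) : ContinuousOn (lyapQ ω) phase := by
  intro z hz
  have hh := (hLim_pos hω hz.1).ne'
  have hc : Continuous fun z : ℝ × ℝ => hLim ω z.1 := by unfold hLim; fun_prop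
  refine ContinuousAt.continuousWithinAt ?_
  have h3 : ContinuousAt (fun z : ℝ × ℝ => hLim ω z.1) z := hc.continuousAt
  unfold lyapQ
  fun_prop (disch := positivity)

theorem continuousOn_lyapDot {ω : ℝ} (hω : 0 < ω) : ContinuousOn (lyapDot ω) phase :=
  ((continuousOn_lyapV hω).mul (continuous_fst.comp (continuous_fieldLim ω)).continuousOn).add
    ((continuousOn_lyapQ hω).mul (continuous_snd.comp (continuous_fieldLim ω)).continuousOn)

/-- Planar systems that are asymptotic to the limiting system. -/
structure Asymptotic (ω : ℝ) (F : ℝ → ℝ × ℝ → ℝ × ℝ) : Prop where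
  tendsto : ∀ S ⊆ phase, IsCompact S → TendstoUniformlyOn F (fieldLim ω) atTop S
  regular : ∀ S ⊆ phase, IsCompact S → ∃ T, RegularField F S T
  -- The velocity of v determines q. So the function R(r) alone, without q, identifies a trajectory.
  injective : ∀ S ⊆ phase, IsCompact S → ∀ᶠ t in atTop, ∀ v q q', (v, q) ∈ S → (v, q') ∈ S →
    (F t (v, q)).1 = (F t (v, q')).1 → q = q'
  -- The line q = 1 is invariant exactly, not only in the limit, and Φ controls the exponential rate
  -- of approach or departure.
  transverse : ∃ Φ : ℝ → ℝ × ℝ → ℝ, (∀ t z, (F t z).2 = (z.2 ^ 2 - 1) * Φ t z) ∧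
    ∀ S ⊆ phase, IsCompact S → TendstoUniformlyOn Φ
      (fun z => z.2 * hLim ω z.1 - 3 / 2 * ω * z.1 ^ 4) atTop S

variable {ω u₁ u₂ uc : ℝ} {F : ℝ → ℝ × ℝ → ℝ × ℝ}

theorem Asymptotic.eventually_close (hF : Asymptotic ω F) {S : Set (ℝ × ℝ)} (hS : S ⊆ phase)
    (hSc : IsCompact S) {ε : ℝ} (hε : 0 < ε) : ∀ᶠ t in atTop, ∀ z ∈ S,
      |(F t z).1 - fLim ω z.1 z.2| < ε ∧ |(F t z).2 - gLim ω z.1 z.2| < ε := by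
  filter_upwards [Metric.tendstoUniformlyOn_iff.1 (hF.tendsto S hS hSc) ε hε] with t ht z hz
  have := ht z hz
  rw [dist_comm, Prod.dist_eq, max_lt_iff, Real.dist_eq, Real.dist_eq] at this
  exact this

/-- Bounded trajectories converge to an equilibrium. -/
theorem Asymptotic.tendsto_equilibrium (hF : Asymptotic ω F) (E : Equilibria ω u₁ u₂ uc)
    {S : Set (ℝ × ℝ)} (hS : S ⊆ phase) (hSc : IsCompact S) {z : ℝ → ℝ × ℝ} {T : ℝ}
    (hz : ∀ t, T ≤ t → HasDerivAt z (F t (z t)) t) (hzS : ∀ t, T ≤ t → z t ∈ S) :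
    ∃ e ∈ S, (e = (uc, 1) ∨ e = (u₁, 1) ∨ e = (u₂, 2 * u₂ / (2 - u₂ ^ 2))) ∧
      Tendsto z atTop (𝓝 e) := by
  have hω := E.omega_pos
  have hzero : ∀ x ∈ S, lyapDot ω x = 0 →
      x = (uc, 1) ∨ x = (u₁, 1) ∨ x = (u₂, 2 * u₂ / (2 - u₂ ^ 2)) := by
    intro x hx h
    obtain ⟨h1, h2⟩ := fieldLim_eq_zero_of_lyapDot hω (hS hx) h
    exact E.zeros (hS hx).1 (hS hx).2 h1 h2
  have hfin : {x ∈ S | lyapDot ω x = 0}.Finite := by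
    refine Set.Finite.subset (s := {(uc, 1), (u₁, 1), (u₂, 2 * u₂ / (2 - u₂ ^ 2))})
      (by simp) fun x hx => ?_
    simpa using hzero x hx.1 hx.2
  obtain ⟨M, hM⟩ := (hSc.image (continuous_fieldLim ω)).isBounded.exists_norm_le
  obtain ⟨t0, ht0⟩ := eventually_atTop.1
    ((hF.eventually_close hS hSc one_pos).and (eventually_ge_atTop T))
  have hbd : ∀ t ∈ Ici t0, ‖F t (z t)‖₊ ≤ (M + 1).toNNReal := by
    intro t ht
    have h1 := (ht0 t ht).1 (z t) (hzS t (ht0 t ht).2)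
    have h2 := hM _ ⟨z t, hzS t (ht0 t ht).2, rfl⟩
    rw [← NNReal.coe_le_coe, coe_nnnorm]
    refine le_trans ?_ (Real.le_coe_toNNReal _)
    rw [fieldLim, Prod.norm_def, max_le_iff, Real.norm_eq_abs, Real.norm_eq_abs] at h2
    rw [Prod.norm_def, max_le_iff, Real.norm_eq_abs, Real.norm_eq_abs]
    constructor
    · have := abs_add_le ((F t (z t)).1 - fLim ω (z t).1 (z t).2) (fLim ω (z t).1 (z t).2)
      rw [sub_add_cancel] at this
      linarith [h1.1, h2.1]
    · have := abs_add_le ((F t (z t)).2 - gLim ω (z t).1 (z t).2) (gLim ω (z t).1 (z t).2)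
      rw [sub_add_cancel] at this
      linarith [h1.2, h2.2]
  have hlip : LipschitzOnWith (M + 1).toNNReal z (Ici t0) :=
    (convex_Ici t0).lipschitzOnWith_of_nnnorm_hasDerivWithin_le
      (fun t ht => (hz t (ht0 t ht).2).hasDerivWithinAt) hbd
  -- On the compact set the gradient of `lyap` is bounded, so the uniform error of the field gives a
  -- vanishing error in the growth rate.
  have hlim : Tendsto (fun t => lyapV ω (z t) * (F t (z t)).1 + lyapQ ω (z t) * (F t (z t)).2 -
      lyapDot ω (z t)) atTop (𝓝 0) := by
    obtain ⟨A, hA⟩ := (hSc.image_of_continuousOn ((continuousOn_lyapV hω).mono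
      hS)).isBounded.exists_norm_le
    obtain ⟨B, hB⟩ := (hSc.image_of_continuousOn ((continuousOn_lyapQ hω).mono
      hS)).isBounded.exists_norm_le
    rw [Metric.tendsto_nhds]
    intro ε hε
    have hAB : 0 < |A| + |B| + 1 := by positivity
    filter_upwards [hF.eventually_close hS hSc (ε := ε / (|A| + |B| + 1)) (by positivity),
      eventually_ge_atTop T] with t ht htT
    obtain ⟨h1, h2⟩ := ht (z t) (hzS t htT)
    have hA' : |lyapV ω (z t)| ≤ |A| := (hA _ ⟨z t, hzS t htT, rfl⟩).trans (le_abs_self _)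
    have hB' : |lyapQ ω (z t)| ≤ |B| := (hB _ ⟨z t, hzS t htT, rfl⟩).trans (le_abs_self _)
    rw [Real.dist_eq, sub_zero, lyapDot]
    have e1 : lyapV ω (z t) * (F t (z t)).1 + lyapQ ω (z t) * (F t (z t)).2 -
        (lyapV ω (z t) * fLim ω (z t).1 (z t).2 + lyapQ ω (z t) * gLim ω (z t).1 (z t).2) =
        lyapV ω (z t) * ((F t (z t)).1 - fLim ω (z t).1 (z t).2) +
        lyapQ ω (z t) * ((F t (z t)).2 - gLim ω (z t).1 (z t).2) := by ring
    rw [e1]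
    set η := ε / (|A| + |B| + 1) with hη
    have hη0 : 0 < η := by positivity
    calc _ ≤ |A| * η + |B| * η := by
          refine (abs_add_le _ _).trans (add_le_add ?_ ?_)
          · rw [abs_mul]; gcongr
          · rw [abs_mul]; gcongr
      _ < (|A| + |B| + 1) * η := by linarith
      _ = ε := by rw [hη]; field_simp
  obtain ⟨e, heS, he0, he⟩ := tendsto_of_lyapunov hSc (T := t0)
    ((continuousOn_lyapDot hω).mono hS) (fun x hx => lyapDot_nonneg hω (hS hx)) hfin
    ((continuousOn_lyap hω).mono hS) (fun t ht => hzS t (ht0 t ht).2) hlip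
    (ν := fun t => lyapV ω (z t) * (F t (z t)).1 + lyapQ ω (z t) * (F t (z t)).2)
    (fun t ht => hasDerivAt_lyap hω (hasDerivWithinAt_univ.1 (hasDerivWithinAt_fst
        (hz t (ht0 t ht).2).hasDerivWithinAt))
      (hasDerivWithinAt_univ.1 (hasDerivWithinAt_snd
        (hz t (ht0 t ht).2).hasDerivWithinAt)) (hS (hzS t (ht0 t ht).2)).1) hlim
  exact ⟨e, heS, hzero e heS he0, he⟩

end Collapse
end

/-! ### Trajectories: identification by v, behaviour transverse to the radial line -/

noncomputable section
namespace Collapse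

variable {ω u₁ u₂ uc : ℝ} {F : ℝ → ℝ × ℝ → ℝ × ℝ}

theorem exists_pos_le_of_isCompact {X : Type*} [TopologicalSpace X] {S : Set X} (hS : IsCompact S)
    {f : X → ℝ} (hf : ContinuousOn f S) (hpos : ∀ x ∈ S, 0 < f x) : ∃ c > 0, ∀ x ∈ S, c ≤ f x := by
  rcases S.eq_empty_or_nonempty with h | h
  · exact ⟨1, one_pos, by simp [h]⟩
  · obtain ⟨x, hx, hmin⟩ := hS.exists_isMinOn h hf
    exact ⟨f x, hpos x hx, fun y hy => hmin hy⟩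

/-- Strict inequalities for the limiting field on a compact set persist. -/
theorem Asymptotic.eventually_pos (hF : Asymptotic ω F) {S : Set (ℝ × ℝ)} (hS : S ⊆ phase)
    (hSc : IsCompact S) (a b : ℝ) (h : ∀ z ∈ S, 0 < a * fLim ω z.1 z.2 + b * gLim ω z.1 z.2) :
    ∀ᶠ t in atTop, ∀ z ∈ S, 0 < a * (F t z).1 + b * (F t z).2 := by
  have hcont : Continuous fun z : ℝ × ℝ => a * fLim ω z.1 z.2 + b * gLim ω z.1 z.2 :=
    ((continuous_fst.comp (continuous_fieldLim ω)).const_mul a).add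
      ((continuous_snd.comp (continuous_fieldLim ω)).const_mul b)
  obtain ⟨c, hc, hcS⟩ := exists_pos_le_of_isCompact hSc hcont.continuousOn h
  have hab : 0 < |a| + |b| + 1 := by positivity
  filter_upwards [hF.eventually_close hS hSc (ε := c / (|a| + |b| + 1)) (by positivity)]
    with t ht z hz
  obtain ⟨h1, h2⟩ := ht z hz
  have h3 := hcS z hz
  set η := c / (|a| + |b| + 1) with hη
  have e : (|a| + |b| + 1) * η = c := by rw [hη]; field_simp
  have hη0 : 0 < η := by positivity
  have h4 : |a * ((F t z).1 - fLim ω z.1 z.2)| ≤ |a| * η := by rw [abs_mul]; gcongr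
  have h5 : |b * ((F t z).2 - gLim ω z.1 z.2)| ≤ |b| * η := by rw [abs_mul]; gcongr
  have h6 := (abs_le.1 h4).1
  have h7 := (abs_le.1 h5).1
  nlinarith

/-- A solution on `[T, ∞)` that stays in `S`. -/
structure IsTrajectory (F : ℝ → ℝ × ℝ → ℝ × ℝ) (S : Set (ℝ × ℝ)) (T : ℝ) (z : ℝ → ℝ × ℝ) :
    Prop where
  mem : ∀ t, T ≤ t → z t ∈ S
  deriv : ∀ t, T ≤ t → HasDerivWithinAt z (F t (z t)) (Ici T) t

theorem IsTrajectory.hasDerivAt {S : Set (ℝ × ℝ)} {T : ℝ} {z : ℝ → ℝ × ℝ}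
    (hz : IsTrajectory F S T z) {t : ℝ} (ht : T < t) : HasDerivAt z (F t (z t)) t :=
  (hz.deriv t ht.le).hasDerivAt (Ici_mem_nhds ht)

theorem IsTrajectory.tendsto_equilibrium (hF : Asymptotic ω F) (E : Equilibria ω u₁ u₂ uc)
    {S : Set (ℝ × ℝ)} (hS : S ⊆ phase) (hSc : IsCompact S) {z : ℝ → ℝ × ℝ} {T : ℝ}
    (hz : IsTrajectory F S T z) :
    ∃ e ∈ S, (e = (uc, 1) ∨ e = (u₁, 1) ∨ e = (u₂, 2 * u₂ / (2 - u₂ ^ 2))) ∧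
      Tendsto z atTop (𝓝 e) :=
  hF.tendsto_equilibrium E hS hSc (T := T + 1) (fun t ht => hz.hasDerivAt (by linarith))
    (fun t ht => hz.mem t (by linarith))

/-- Trajectories whose first components agree for large times coincide. -/
theorem IsTrajectory.eq_of_eventuallyEq (hF : Asymptotic ω F) {S : Set (ℝ × ℝ)} (hS : S ⊆ phase)
    (hSc : IsCompact S) {z z' : ℝ → ℝ × ℝ} {T : ℝ} (hreg : RegularField F S T)
    (hz : IsTrajectory F S T z) (hz' : IsTrajectory F S T z')
    (h : ∀ᶠ t in atTop, (z t).1 = (z' t).1) : z T = z' T := by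
  obtain ⟨t0, ht0⟩ := eventually_atTop.1 (h.and ((hF.injective S hS hSc).and
    (eventually_gt_atTop T)))
  have ht : t0 < t0 + 1 := by linarith
  obtain ⟨h1, hinj, hT⟩ := ht0 (t0 + 1) ht.le
  -- Equality of v on a neighbourhood gives equality of v', hence of q. The solutions then agree at
  -- time t0 + 1 and, by uniqueness backwards in time, at T.
  have e : (fun s => (z s).1) =ᶠ[𝓝 (t0 + 1)] fun s => (z' s).1 := by
    filter_upwards [Ioi_mem_nhds ht] with s hs using (ht0 s (mem_Ioi.1 hs).le).1
  have d1 := hasDerivWithinAt_univ.1 (hasDerivWithinAt_fst (hz.hasDerivAt hT).hasDerivWithinAt)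
  have d2 := hasDerivWithinAt_univ.1 (hasDerivWithinAt_fst (hz'.hasDerivAt hT).hasDerivWithinAt)
  have h2 := d1.unique (d2.congr_of_eventuallyEq e)
  have m1 := hz.mem _ hT.le
  have m2 := hz'.mem _ hT.le
  have hq : (z (t0 + 1)).2 = (z' (t0 + 1)).2 :=
    hinj (z (t0 + 1)).1 _ _ m1 (by rw [h1]; exact m2) (by
      refine h2.trans ?_
      rw [h1])
  obtain ⟨K, hK⟩ := hreg.lipschitz (t0 + 1)
  exact ODE_solution_unique_of_mem_Icc_left (K := K) (v := F) (s := fun _ => S)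
    (fun t ht => hK t ⟨ht.1.le, ht.2⟩)
    (fun t ht => (hz.deriv t ht.1).continuousWithinAt.mono Icc_subset_Ici_self)
    (fun t ht => (hz.hasDerivAt ht.1).hasDerivWithinAt) (fun t ht => hz.mem t ht.1.le)
    (fun t ht => (hz'.deriv t ht.1).continuousWithinAt.mono Icc_subset_Ici_self)
    (fun t ht => (hz'.hasDerivAt ht.1).hasDerivWithinAt) (fun t ht => hz'.mem t ht.1.le)
    (Prod.ext h1 hq) ⟨le_rfl, hT.le⟩

theorem RegularField.mono {S S' : Set (ℝ × ℝ)} {T T' : ℝ} (h : RegularField F S T) (hS : S' ⊆ S)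
    (hT : T ≤ T') : RegularField F S' T' where
  lipschitz T'' := by
    obtain ⟨K, hK⟩ := h.lipschitz T''
    exact ⟨K, fun t ht => (hK t ⟨hT.trans ht.1, ht.2⟩).mono hS⟩
  continuousOn x hx := (h.continuousOn x (hS hx)).mono (Ici_subset_Ici.2 hT)

/-- Trajectories with `q > 1` do not converge to an equilibrium that repels them from the radial
rays. -/
theorem IsTrajectory.not_tendsto_of_transverse (hF : Asymptotic ω F) {S : Set (ℝ × ℝ)}
    (hS : S ⊆ phase) (hSc : IsCompact S) {z : ℝ → ℝ × ℝ} {T v₀ : ℝ}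
    (hz : IsTrajectory F S T z) (hq : ∀ t, T ≤ t → 1 < (z t).2)
    (hv₀ : 0 < hLim ω v₀ - 3 / 2 * ω * v₀ ^ 4) : ¬ Tendsto z atTop (𝓝 (v₀, 1)) := by
  intro hlim
  obtain ⟨Φ, hΦ, hΦlim⟩ := hF.transverse
  set G : ℝ × ℝ → ℝ := fun z => z.2 * hLim ω z.1 - 3 / 2 * ω * z.1 ^ 4 with hG
  have hGc : Continuous G := by simp only [hG, hLim]; fun_prop
  have hG0 : G (v₀, 1) = hLim ω v₀ - 3 / 2 * ω * v₀ ^ 4 := by simp [hG]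
  set c := hLim ω v₀ - 3 / 2 * ω * v₀ ^ 4 with hc
  have h1 : ∀ᶠ t in atTop, c / 2 < G (z t) :=
    ((hGc.tendsto _).comp hlim).eventually (lt_mem_nhds (by rw [hG0]; linarith))
  obtain ⟨t0, ht0⟩ := eventually_atTop.1 (h1.and
    ((Metric.tendstoUniformlyOn_iff.1 (hΦlim S hS hSc) (c / 2) (by linarith)).and
      (eventually_gt_atTop T)))
  have hd : ∀ t, t0 ≤ t → HasDerivAt (fun s => (z s).2) (((z t).2 ^ 2 - 1) * Φ t (z t)) t := by
    intro t ht
    have := hasDerivWithinAt_univ.1 (hasDerivWithinAt_snd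
      (hz.hasDerivAt (ht0 t ht).2.2).hasDerivWithinAt)
    rwa [hΦ] at this
  -- Near the equilibrium Φ is positive, so q increases from a value above 1 and cannot tend to 1.
  have hmono : MonotoneOn (fun s => (z s).2) (Ici t0) := by
    refine monotoneOn_of_hasDerivWithinAt_nonneg (convex_Ici t0)
      (fun t ht => (hd t ht).continuousAt.continuousWithinAt)
      (f' := fun t => ((z t).2 ^ 2 - 1) * Φ t (z t)) (fun t ht => ?_) (fun t ht => ?_)
    · rw [interior_Ici] at ht; exact (hd t ht.le).hasDerivWithinAt
    · rw [interior_Ici] at ht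
      have ht' := mem_Ioi.1 ht
      obtain ⟨a1, a2, a3⟩ := ht0 t ht'.le
      have a4 := a2 (z t) (hz.mem t a3.le)
      rw [Real.dist_eq, abs_lt] at a4
      have a5 := hq t a3.le
      have a6 : c / 2 < (z t).2 * hLim ω (z t).1 - 3 / 2 * ω * (z t).1 ^ 4 := a1
      exact mul_nonneg (by nlinarith) (by linarith)
  have hlim2 : Tendsto (fun s => (z s).2) atTop (𝓝 1) :=
    (continuous_snd.tendsto (v₀, (1 : ℝ))).comp hlim
  have h3 : (z t0).2 ≤ 1 := ge_of_tendsto hlim2 (by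
    filter_upwards [eventually_ge_atTop t0] with t ht using hmono (mem_Ici.2 le_rfl) ht ht)
  exact absurd (hq t0 (ht0 t0 le_rfl).2.2.le) (not_lt.2 h3)

/-- Trajectories approaching an equilibrium that attracts in the transverse direction become
radial exponentially fast. -/
theorem IsTrajectory.exists_exp_bound (hF : Asymptotic ω F) {S : Set (ℝ × ℝ)}
    (hS : S ⊆ phase) (hSc : IsCompact S) {z : ℝ → ℝ × ℝ} {T v₀ : ℝ}
    (hz : IsTrajectory F S T z)
    (hv₀ : hLim ω v₀ - 3 / 2 * ω * v₀ ^ 4 < 0) (hlim : Tendsto z atTop (𝓝 (v₀, 1))) :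
    ∃ c > 0, ∃ C, ∀ᶠ t in atTop, (z t).2 ^ 2 - 1 ≤ C * Real.exp (-c * t) := by
  obtain ⟨Φ, hΦ, hΦlim⟩ := hF.transverse
  set G : ℝ × ℝ → ℝ := fun z => z.2 * hLim ω z.1 - 3 / 2 * ω * z.1 ^ 4 with hG
  have hGc : Continuous G := by simp only [hG, hLim]; fun_prop
  have hG0 : G (v₀, 1) = hLim ω v₀ - 3 / 2 * ω * v₀ ^ 4 := by simp [hG]
  set c := -(hLim ω v₀ - 3 / 2 * ω * v₀ ^ 4) with hc
  have hc0 : 0 < c := by linarith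
  have h1 : ∀ᶠ t in atTop, G (z t) < -(c / 2) :=
    ((hGc.tendsto _).comp hlim).eventually (gt_mem_nhds (by rw [hG0]; linarith))
  obtain ⟨t0, ht0⟩ := eventually_atTop.1 (h1.and
    ((Metric.tendstoUniformlyOn_iff.1 (hΦlim S hS hSc) (c / 4) (by linarith)).and
      (eventually_gt_atTop T)))
  -- The logarithmic derivative of q² - 1 is 2qΦ. Eventually Φ ≤ -c/4 and q ≥ 1, so it is at most
  -- -c/2, and y does not increase.
  set y : ℝ → ℝ := fun s => ((z s).2 ^ 2 - 1) * Real.exp (c / 2 * s) with hy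
  have hd : ∀ t, t0 ≤ t → HasDerivAt y ((2 * (z t).2 * (((z t).2 ^ 2 - 1) * Φ t (z t)) +
      ((z t).2 ^ 2 - 1) * (c / 2)) * Real.exp (c / 2 * t)) t := by
    intro t ht
    have := hasDerivWithinAt_univ.1 (hasDerivWithinAt_snd
      (hz.hasDerivAt (ht0 t ht).2.2).hasDerivWithinAt)
    rw [hΦ] at this
    have h2 := ((this.pow 2).sub_const 1).mul (((hasDerivAt_id t).const_mul (c / 2)).exp)
    refine h2.congr_deriv ?_
    simp
    ring
  have hanti : AntitoneOn y (Ici t0) := by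
    refine antitoneOn_of_hasDerivWithinAt_nonpos (convex_Ici t0)
      (fun t ht => (hd t ht).continuousAt.continuousWithinAt)
      (fun t ht => (hd t (interior_subset ht)).hasDerivWithinAt) (fun t ht => ?_)
    obtain ⟨a1, a2, a3⟩ := ht0 t (interior_subset ht)
    have a7 := hz.mem t a3.le
    have a4 := a2 (z t) a7
    rw [Real.dist_eq, abs_lt] at a4
    have a5 := (hS a7).2
    have a6 : (z t).2 * hLim ω (z t).1 - 3 / 2 * ω * (z t).1 ^ 4 < -(c / 2) := a1
    refine mul_nonpos_of_nonpos_of_nonneg ?_ (Real.exp_pos _).le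
    have a8 : Φ t (z t) ≤ -(c / 4) := by linarith
    have a9 : (z t).2 * Φ t (z t) ≤ -(c / 4) := by nlinarith
    have a10 : 0 ≤ (z t).2 ^ 2 - 1 := by nlinarith
    have : (2 * (z t).2 * (((z t).2 ^ 2 - 1) * Φ t (z t)) + ((z t).2 ^ 2 - 1) * (c / 2)) =
      ((z t).2 ^ 2 - 1) * (2 * ((z t).2 * Φ t (z t)) + c / 2) := by ring
    rw [this]
    exact mul_nonpos_of_nonneg_of_nonpos a10 (by linarith)
  refine ⟨c / 2, by positivity, y t0, ?_⟩
  filter_upwards [eventually_ge_atTop t0] with t ht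
  have h3 := hanti (mem_Ici.2 le_rfl) (mem_Ici.2 ht) ht
  have h4 : (z t).2 ^ 2 - 1 = y t * Real.exp (-(c / 2) * t) := by
    simp only [hy]
    rw [mul_assoc, ← Real.exp_add]
    simp
  rw [h4]
  gcongr

/-! ### Families of trajectories -/

theorem fLim_antitone {v q q' : ℝ} (hω : 0 < ω) (hv : 0 < v) (h : q ≤ q') :
    fLim ω v q' ≤ fLim ω v q := by
  have hh := hLim_pos hω hv
  unfold fLim
  have : hLim ω v * v * q ≤ hLim ω v * v * q' := by gcongr
  have : 0 < v / 2 := by positivity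
  nlinarith

/-- Trajectories with `q > 1` at the initial time have `q > 1` for all times. -/
theorem IsTrajectory.one_lt_snd (hF : Asymptotic ω F) {S : Set (ℝ × ℝ)} {T : ℝ} (hS : S ⊆ phase)
    (hreg : RegularField F S T) (hS1 : ∀ x ∈ S, (x.1, (1 : ℝ)) ∈ S) {z : ℝ → ℝ × ℝ}
    (hz : IsTrajectory F S T z) (h : 1 < (z T).2) : ∀ t, T ≤ t → 1 < (z t).2 := by
  intro t ht
  obtain ⟨K, hK⟩ := hreg.lipschitz t
  obtain ⟨Φ, hΦ, -⟩ := hF.transverse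
  -- The second component of F vanishes at q = 1, so its absolute value is at most K (q - 1). The
  -- integrating factor exp(K s) thus makes q - 1 nondecreasing, which excludes its vanishing.
  have hd : ∀ s, T ≤ s → HasDerivWithinAt (fun s => ((z s).2 - 1) * Real.exp (K * s))
      ((F s (z s)).2 * Real.exp (K * s) + ((z s).2 - 1) * (Real.exp (K * s) * K)) (Ici T) s := by
    intro s hs
    refine ((hasDerivWithinAt_snd (hz.deriv s hs)).sub_const 1).mul ?_
    have := ((hasDerivAt_id s).const_mul (K : ℝ)).exp
    simp only [id, mul_one] at this
    exact this.hasDerivWithinAt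
  have hmono : MonotoneOn (fun s => ((z s).2 - 1) * Real.exp (K * s)) (Icc T t) := by
    refine monotoneOn_of_hasDerivWithinAt_nonneg (convex_Icc T t)
      (fun s hs => (hd s hs.1).continuousWithinAt.mono Icc_subset_Ici_self)
      (fun s hs => (hd s (interior_subset hs).1).mono
        (interior_subset.trans Icc_subset_Ici_self)) fun s hs => ?_
    have hs' := interior_subset hs
    have hzs := hz.mem s hs'.1
    have h1 := (hK s hs').dist_le_mul _ hzs _ (hS1 _ hzs)
    have h2 : |(F s (z s)).2 - (F s ((z s).1, 1)).2| ≤ K * |(z s).2 - 1| := by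
      refine le_trans ?_ (h1.trans (le_of_eq ?_))
      · rw [Prod.dist_eq, Real.dist_eq, Real.dist_eq]
        exact le_max_right _ _
      · rw [Prod.dist_eq, Real.dist_eq, Real.dist_eq]
        simp
    have h3 : 1 ≤ (z s).2 := (hS hzs).2
    rw [hΦ s ((z s).1, 1)] at h2
    simp only [one_pow, sub_self, zero_mul, sub_zero] at h2
    rw [abs_of_nonneg (show 0 ≤ (z s).2 - 1 by linarith)] at h2
    have h4 := (abs_le.1 h2).1
    have h5 := Real.exp_pos (K * s)
    have : 0 ≤ Real.exp (K * s) * ((F s (z s)).2 + K * ((z s).2 - 1)) :=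
      mul_nonneg h5.le (by linarith)
    linarith
  have h6 := hmono (left_mem_Icc.2 ht) (right_mem_Icc.2 ht) ht
  have h7 : 0 < ((z T).2 - 1) * Real.exp (K * T) :=
    mul_pos (by linarith) (Real.exp_pos _)
  have h8 := pos_of_mul_pos_left (h7.trans_le h6) (Real.exp_pos _).le
  linarith

/-- Near the sink `(u₁, 1)`: nonradial trajectories with prescribed initial data. -/
theorem Asymptotic.exists_sink_family (hF : Asymptotic ω F) (E : Equilibria ω u₁ u₂ uc)
    (T₀ : ℝ) : ∃ T ≥ T₀, ∃ S ⊆ phase, IsCompact S ∧ RegularField F S T ∧ ∃ ρ > 0, ∃ σ > 0,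
      ∀ v ∈ Icc (u₁ - ρ) (u₁ + ρ), ∀ q ∈ Icc 1 (1 + σ), ∃ z : ℝ → ℝ × ℝ, z T = (v, q) ∧
        IsTrajectory F S T z ∧ (q = 1 → ∀ t, T ≤ t → (z t).2 = 1) ∧
        (1 < q → ∀ t, T ≤ t → 1 < (z t).2) ∧ Tendsto z atTop (𝓝 (u₁, 1)) := by
  have hω := E.omega_pos
  have hu₁ := E.u₁_pos
  set G : ℝ × ℝ → ℝ := fun z => z.2 * hLim ω z.1 - 3 / 2 * ω * z.1 ^ 4 with hG
  have hGc : Continuous G := by simp only [hG, hLim]; fun_prop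
  have hG0 : G (u₁, 1) < 0 := by simpa [hG] using E.transverse_u₁
  obtain ⟨ε, hε, hεG⟩ := Metric.mem_nhds_iff.1 ((hGc.tendsto _).eventually (gt_mem_nhds hG0))
  -- The first bound keeps the transverse rate negative on the rectangle; the second keeps the other
  -- two equilibria outside it.
  set ρ := min (ε / 2) ((u₁ - u₂) / 2) with hρ
  have hρ0 : 0 < ρ := lt_min (by linarith) (by linarith [E.u₂_lt])
  have hρε : ρ ≤ ε / 2 := min_le_left _ _
  have hρu : ρ ≤ (u₁ - u₂) / 2 := min_le_right _ _
  have hu₂ := E.u₂_pos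
  have hleft : 0 < fLim ω (u₁ - ρ) 1 := by
    rw [fLim_one]
    refine mul_pos (by linarith) (E.radialPoly_pos ?_ (by linarith))
    linarith [E.uc_lt, E.lt_u₂]
  have hright : fLim ω (u₁ + ρ) 1 < 0 := by
    rw [fLim_one]
    exact mul_neg_of_pos_of_neg (by linarith) (E.radialPoly_neg_right (by linarith))
  -- Since `fLim` decreases in q, the right edge points inwards for every q ≥ 1, whereas the left
  -- edge does so only for q close to 1.
  obtain ⟨σ₁, hσ₁, hσf⟩ : ∃ σ > 0, 0 < fLim ω (u₁ - ρ) (1 + σ) := by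
    have hc : Continuous fun s => fLim ω (u₁ - ρ) (1 + s) := by unfold fLim; fun_prop
    have : ∀ᶠ s in 𝓝[>] (0 : ℝ), 0 < fLim ω (u₁ - ρ) (1 + s) :=
      ((hc.tendsto 0).eventually (lt_mem_nhds (by simpa using hleft))).filter_mono
        nhdsWithin_le_nhds
    obtain ⟨s, hs1, hs2⟩ := (this.and self_mem_nhdsWithin).exists
    exact ⟨s, hs2, hs1⟩
  set σ := min (ε / 2) σ₁ with hσ
  have hσ0 : 0 < σ := lt_min (by linarith) hσ₁
  have hσε : σ ≤ ε / 2 := min_le_left _ _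
  have hσle : σ ≤ σ₁ := min_le_right _ _
  set S : Set (ℝ × ℝ) := Icc (u₁ - ρ) (u₁ + ρ) ×ˢ Icc 1 (1 + σ) with hSdef
  have hS : S ⊆ phase := fun z hz => ⟨by linarith [hz.1.1], hz.2.1⟩
  have hSc : IsCompact S := isCompact_Icc.prod isCompact_Icc
  have hface : ∀ {S' : Set (ℝ × ℝ)} , S' ⊆ S → IsClosed S' → IsCompact S' :=
    fun h h' => hSc.of_isClosed_subset h' h
  obtain ⟨T₁, hreg⟩ := hF.regular S hS hSc
  have ev1 := hF.eventually_pos (S := {u₁ - ρ} ×ˢ Icc 1 (1 + σ))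
    (fun z hz => hS ⟨by rw [hz.1]; constructor <;> linarith, hz.2⟩)
    (isCompact_singleton.prod isCompact_Icc) 1 0 (by
      rintro ⟨v, q⟩ ⟨hv, hq⟩
      obtain rfl : v = u₁ - ρ := hv
      have := fLim_antitone hω (v := u₁ - ρ) (by linarith) (show q ≤ 1 + σ₁ by linarith [hq.2])
      simp only [one_mul, zero_mul, add_zero]
      linarith)
  have ev2 := hF.eventually_pos (S := {u₁ + ρ} ×ˢ Icc 1 (1 + σ))
    (fun z hz => hS ⟨by rw [hz.1]; constructor <;> linarith, hz.2⟩)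
    (isCompact_singleton.prod isCompact_Icc) (-1) 0 (by
      rintro ⟨v, q⟩ ⟨hv, hq⟩
      obtain rfl : v = u₁ + ρ := hv
      have := fLim_antitone hω (v := u₁ + ρ) (by linarith) hq.1
      simp only [zero_mul, add_zero]
      linarith)
  have ev3 := hF.eventually_pos (S := Icc (u₁ - ρ) (u₁ + ρ) ×ˢ {1 + σ})
    (fun z hz => hS ⟨hz.1, by rw [hz.2]; constructor <;> linarith⟩)
    (isCompact_Icc.prod isCompact_singleton) 0 (-1) (by
      rintro ⟨v, q⟩ ⟨hv, hq⟩
      obtain rfl : q = 1 + σ := hq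
      have h1 : G (v, 1 + σ) < 0 := hεG (by
        rw [Metric.mem_ball, Prod.dist_eq, Real.dist_eq, Real.dist_eq, max_lt_iff, abs_lt, abs_lt]
        simp only at hv ⊢
        refine ⟨⟨?_, ?_⟩, ?_, ?_⟩ <;> linarith [hv.1, hv.2])
      simp only [zero_mul, zero_add, gLim]
      have h2 : 0 < (1 + σ) ^ 2 - 1 := by nlinarith
      have := mul_neg_of_pos_of_neg h2 h1
      simp only [hG] at this
      linarith)
  obtain ⟨Φ, hΦ, -⟩ := hF.transverse
  obtain ⟨T₂, hT₂⟩ := eventually_atTop.1 (ev1.and (ev2.and ev3))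
  set T := max T₀ (max T₁ T₂) with hT
  have hTT₁ : T₁ ≤ T := (le_max_left _ _).trans (le_max_right _ _)
  have hTT₂ : T₂ ≤ T := (le_max_right _ _).trans (le_max_right _ _)
  refine ⟨T, le_max_left _ _, S, hS, hSc, hreg.mono subset_rfl hTT₁, ρ, hρ0, σ, hσ0, ?_⟩
  intro v hv q hq
  have hleft' : ∀ t, T ≤ t → ∀ y ∈ Icc 1 (1 + σ), 0 ≤ (F t (u₁ - ρ, y)).1 := fun t ht y hy => by
    have := (hT₂ t (hTT₂.trans ht)).1 (u₁ - ρ, y) ⟨rfl, hy⟩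
    simp at this; exact this.le
  have hright' : ∀ t, T ≤ t → ∀ y ∈ Icc 1 (1 + σ), (F t (u₁ + ρ, y)).1 ≤ 0 := fun t ht y hy => by
    have := (hT₂ t (hTT₂.trans ht)).2.1 (u₁ + ρ, y) ⟨rfl, hy⟩
    simp at this; exact this.le
  obtain ⟨z, hzT, hz, hz1⟩ : ∃ z : ℝ → ℝ × ℝ, z T = (v, q) ∧ IsTrajectory F S T z ∧
      (q = 1 → ∀ t, T ≤ t → (z t).2 = 1) := by
    -- For q = 1 the rectangle degenerates to height zero, so the solution is radial by
    -- construction.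
    by_cases hq1 : q = 1
    · have hsub : Icc (1 : ℝ) 1 ⊆ Icc 1 (1 + σ) := Icc_subset_Icc_right (by linarith)
      have hsub' : Icc (u₁ - ρ) (u₁ + ρ) ×ˢ Icc (1 : ℝ) 1 ⊆ S := prod_mono subset_rfl hsub
      obtain ⟨z, hzT, hzm, hzd⟩ := (hreg.mono hsub' hTT₁).exists_solution_of_inward
        (x₀ := (v, q)) (fun t ht y hy => hleft' t ht y (hsub hy))
        (fun t ht y hy => hright' t ht y (hsub hy))
        (fun t ht x hx => by rw [hΦ]; simp) (fun t ht x hx => by rw [hΦ]; simp)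
        ⟨hv, by rw [hq1]; simp⟩
      exact ⟨z, hzT, ⟨fun t ht => hsub' (hzm t ht), hzd⟩, fun _ t ht =>
        le_antisymm (hzm t ht).2.2 (hzm t ht).2.1⟩
    · obtain ⟨z, hzT, hzm, hzd⟩ := (hreg.mono subset_rfl hTT₁).exists_solution_of_inward
        (x₀ := (v, q)) hleft' hright' (fun t ht x hx => by rw [hΦ]; simp)
        (fun t ht x hx => by
          have := (hT₂ t (hTT₂.trans ht)).2.2 (x, 1 + σ) ⟨hx, rfl⟩
          simp at this; exact this.le)
        ⟨hv, hq⟩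
      exact ⟨z, hzT, ⟨hzm, hzd⟩, fun h => absurd h hq1⟩
  refine ⟨z, hzT, hz, hz1, fun hq1 => hz.one_lt_snd hF hS (hreg.mono subset_rfl hTT₁)
    (fun x hx => ⟨hx.1, le_rfl, by linarith⟩) (by rw [hzT]; exact hq1), ?_⟩
  obtain ⟨e, heS, he, hlim⟩ := hz.tendsto_equilibrium hF E hS hSc
  rcases he with rfl | rfl | rfl
  · exact absurd heS.1.1 (by simp only; linarith [E.uc_lt, E.lt_u₂])
  · exact hlim
  · exact absurd heS.1.1 (by simp only; linarith)

/-- Shooting in affine coordinates. -/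
theorem RegularField.exists_trajectory_of_saddle {T a₁ b₁ a₂ b₂ : ℝ} {S : Set (ℝ × ℝ)}
    (hF : RegularField F S T) (A : (ℝ × ℝ) ≃L[ℝ] (ℝ × ℝ)) (z₀ : ℝ × ℝ)
    (hS : MapsTo (fun y => z₀ + A y) (Icc a₁ b₁ ×ˢ Icc a₂ b₂) S) (h₂ : a₂ ≤ b₂)
    (ha₁ : ∀ t, T ≤ t → ∀ y ∈ Icc a₂ b₂, 0 ≤ (A.symm (F t (z₀ + A (a₁, y)))).1)
    (hb₁ : ∀ t, T ≤ t → ∀ y ∈ Icc a₂ b₂, (A.symm (F t (z₀ + A (b₁, y)))).1 ≤ 0)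
    (ha₂ : ∀ t, T ≤ t → ∀ x ∈ Icc a₁ b₁, (A.symm (F t (z₀ + A (x, a₂)))).2 < 0)
    (hb₂ : ∀ t, T ≤ t → ∀ x ∈ Icc a₁ b₁, 0 < (A.symm (F t (z₀ + A (x, b₂)))).2)
    {x₀ : ℝ} (hx₀ : x₀ ∈ Icc a₁ b₁) :
    ∃ z : ℝ → ℝ × ℝ, (A.symm (z T - z₀)).1 = x₀ ∧
      IsTrajectory F ((fun y => z₀ + A y) '' (Icc a₁ b₁ ×ˢ Icc a₂ b₂)) T z := by
  have hreg : RegularField (fun t y => A.symm (F t (z₀ + A y))) (Icc a₁ b₁ ×ˢ Icc a₂ b₂) T :=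
    { lipschitz := fun T' => by
        obtain ⟨K, hK⟩ := hF.lipschitz T'
        refine ⟨‖(A.symm : (ℝ × ℝ) →L[ℝ] (ℝ × ℝ))‖₊ * (K * ‖(A : (ℝ × ℝ) →L[ℝ] (ℝ × ℝ))‖₊),
          fun t ht => ?_⟩
        have h1 : LipschitzWith ‖(A : (ℝ × ℝ) →L[ℝ] (ℝ × ℝ))‖₊ fun y => z₀ + A y := by
          have := (A : (ℝ × ℝ) →L[ℝ] (ℝ × ℝ)).lipschitz
          refine LipschitzWith.of_dist_le_mul fun x y => ?_
          rw [dist_add_left]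
          exact this.dist_le_mul x y
        exact (A.symm : (ℝ × ℝ) →L[ℝ] (ℝ × ℝ)).lipschitz.comp_lipschitzOnWith
          ((hK t ht).comp (h1.lipschitzOnWith (s := Icc a₁ b₁ ×ˢ Icc a₂ b₂)) hS)
      continuousOn := fun x hx => A.symm.continuous.comp_continuousOn
        (hF.continuousOn _ (hS hx)) }
  obtain ⟨y, hy0, hym, hyd⟩ := hreg.exists_solution_of_saddle h₂ ha₁ hb₁ ha₂ hb₂ hx₀
  refine ⟨fun t => z₀ + A (y t), by simp [hy0], fun t ht => ⟨y t, hym t ht, rfl⟩, fun t ht => ?_⟩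
  have := (A : (ℝ × ℝ) →L[ℝ] (ℝ × ℝ)).hasFDerivAt.comp_hasDerivWithinAt t (hyd t ht)
  have := this.const_add z₀
  simpa [Function.comp_def] using this

theorem IsTrajectory.mono_set {S S' : Set (ℝ × ℝ)} {T : ℝ} {z : ℝ → ℝ × ℝ}
    (h : IsTrajectory F S T z) (hS : S ⊆ S') : IsTrajectory F S' T z :=
  ⟨fun t ht => hS (h.mem t ht), h.deriv⟩

/-- The exceptional radial trajectory. -/
theorem Asymptotic.exists_radial_saddle (hF : Asymptotic ω F) (E : Equilibria ω u₁ u₂ uc)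
    (T₀ : ℝ) : ∃ T ≥ T₀, ∃ S ⊆ phase, IsCompact S ∧ ∃ z : ℝ → ℝ × ℝ,
      IsTrajectory F S T z ∧ (∀ t, T ≤ t → (z t).2 = 1) ∧ Tendsto z atTop (𝓝 (uc, 1)) := by
  have huc := E.uc_pos
  have hc := vCrit_bounds
  have h12 := E.u₂_lt
  have h2 := E.lt_u₂
  have huc' := E.uc_lt
  set ρ := min (uc / 2) ((vCrit - uc) / 2) with hρ
  have hρ0 : 0 < ρ := lt_min (by linarith) (by linarith)
  have hρ1 : ρ ≤ uc / 2 := min_le_left _ _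
  have hρ2 : ρ ≤ (vCrit - uc) / 2 := min_le_right _ _
  set S : Set (ℝ × ℝ) := Icc (uc - ρ) (uc + ρ) ×ˢ {1} with hSdef
  have hS : S ⊆ phase := fun z hz => ⟨by linarith [hz.1.1], by rw [hz.2]⟩
  have hSc : IsCompact S := isCompact_Icc.prod isCompact_singleton
  have ev1 := hF.eventually_pos (S := {(uc - ρ, 1)})
    (fun z hz => by rw [hz]; exact ⟨by simp only; linarith, le_rfl⟩) isCompact_singleton (-1) 0 (by
      rintro z rfl
      have := E.radialPoly_neg_left (v := uc - ρ) (by linarith) (by linarith)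
      simp only [zero_mul, add_zero, fLim_one]
      nlinarith)
  have ev2 := hF.eventually_pos (S := {(uc + ρ, 1)})
    (fun z hz => by rw [hz]; exact ⟨by simp only; linarith, le_rfl⟩) isCompact_singleton 1 0 (by
      rintro z rfl
      have := E.radialPoly_pos (v := uc + ρ) (by linarith) (by linarith)
      simp only [zero_mul, add_zero, fLim_one, one_mul]
      exact mul_pos (by linarith) this)
  obtain ⟨Φ, hΦ, -⟩ := hF.transverse
  obtain ⟨T₁, hreg⟩ := hF.regular S hS hSc
  obtain ⟨T₂, hT₂⟩ := eventually_atTop.1 (ev1.and ev2)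
  set T := max T₀ (max T₁ T₂) with hT
  have hTT₁ : T₁ ≤ T := (le_max_left _ _).trans (le_max_right _ _)
  have hTT₂ : T₂ ≤ T := (le_max_right _ _).trans (le_max_right _ _)
  -- The coordinates are swapped so that the repelling variable v takes the outward slot of the
  -- shooting lemma. The other slot has width zero, which keeps q = 1.
  have hmaps : MapsTo (fun y => ((uc, 1) : ℝ × ℝ) + ContinuousLinearEquiv.prodComm ℝ ℝ ℝ y)
      (Icc 0 0 ×ˢ Icc (-ρ) ρ) S := by
    rintro ⟨x, y⟩ ⟨hx, hy⟩
    rw [Icc_self] at hx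
    obtain rfl : x = 0 := hx
    simp only at hy
    refine ⟨?_, ?_⟩
    · simp; constructor <;> linarith [hy.1, hy.2]
    · simp
  obtain ⟨z, -, hz⟩ := (hreg.mono subset_rfl hTT₁).exists_trajectory_of_saddle
    (ContinuousLinearEquiv.prodComm ℝ ℝ ℝ) (uc, 1) hmaps (by linarith)
    (fun t ht y hy => by simp [hΦ]) (fun t ht y hy => by simp [hΦ])
    (fun t ht x hx => by
      rw [Icc_self] at hx
      obtain rfl : x = 0 := hx
      have := (hT₂ t (hTT₂.trans ht)).1 _ rfl
      simp at this ⊢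
      simpa [sub_eq_add_neg] using this)
    (fun t ht x hx => by
      rw [Icc_self] at hx
      obtain rfl : x = 0 := hx
      have := (hT₂ t (hTT₂.trans ht)).2 _ rfl
      simp at this ⊢
      exact this) (x₀ := 0) (by simp)
  replace hz := hz.mono_set hmaps.image_subset
  refine ⟨T, le_max_left _ _, S, hS, hSc, z, hz, fun t ht => (hz.mem t ht).2, ?_⟩
  obtain ⟨e, heS, he, hlim⟩ := hz.tendsto_equilibrium hF E hS hSc
  rcases he with rfl | rfl | rfl
  · exact hlim
  · exact absurd heS.1.2 (by simp only; linarith)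
  · exact absurd heS.1.2 (by simp only; linarith)

/-- Real eigenvalues of opposite sign. -/
theorem exists_eigenvalues_of_det_neg {a b c d : ℝ} (h : a * d - b * c < 0) :
    ∃ l m : ℝ, l < 0 ∧ 0 < m ∧ (l - a) * (l - d) = b * c ∧ (m - a) * (m - d) = b * c := by
  set Δ := (a + d) ^ 2 - 4 * (a * d - b * c) with hΔ
  have hs : √Δ ^ 2 = Δ := Real.sq_sqrt (by nlinarith [sq_nonneg (a + d)])
  have h1 : |a + d| < √Δ := by
    rw [← Real.sqrt_sq_eq_abs]
    exact Real.sqrt_lt_sqrt (sq_nonneg _) (by linarith)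
  rw [abs_lt] at h1
  refine ⟨(a + d - √Δ) / 2, (a + d + √Δ) / 2, by linarith, by linarith, ?_, ?_⟩
  · linear_combination hs / 4 + hΔ / 4
  · linear_combination hs / 4 + hΔ / 4

/-- The inverse of the coordinates given by the left eigenvectors `(c, l - a)`, `(c, m - a)`. -/
def eigenCoord (a c l m : ℝ) (hc : c ≠ 0) (hlm : l < m) : (ℝ × ℝ) ≃L[ℝ] (ℝ × ℝ) :=
  (ContinuousLinearEquiv.equivOfInverse
    ((c • ContinuousLinearMap.fst ℝ ℝ ℝ + (l - a) • ContinuousLinearMap.snd ℝ ℝ ℝ).prod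
      (c • ContinuousLinearMap.fst ℝ ℝ ℝ + (m - a) • ContinuousLinearMap.snd ℝ ℝ ℝ))
    ((((m - a) / (c * (m - l))) • ContinuousLinearMap.fst ℝ ℝ ℝ -
        ((l - a) / (c * (m - l))) • ContinuousLinearMap.snd ℝ ℝ ℝ).prod
      ((-1 / (m - l)) • ContinuousLinearMap.fst ℝ ℝ ℝ +
        (1 / (m - l)) • ContinuousLinearMap.snd ℝ ℝ ℝ))
    (fun x => by
      have : m - l ≠ 0 := by linarith
      ext <;> simp <;> field_simp <;> ring)
    (fun x => by
      have : m - l ≠ 0 := by linarith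
      ext <;> simp <;> field_simp <;> ring)).symm

theorem eigenCoord_symm_apply (a c l m : ℝ) (hc : c ≠ 0) (hlm : l < m) (x : ℝ × ℝ) :
    (eigenCoord a c l m hc hlm).symm x = (c * x.1 + (l - a) * x.2, c * x.1 + (m - a) * x.2) := by
  simp [eigenCoord]

/-- By the equilibrium equations the determinant is a positive multiple of 1 - (5/2) u₂², negative
since u₂ > `vCrit`: the equilibrium is a saddle. The entry c, a positive multiple of q₂ - 2u₂, is
nonzero, so the left eigenvectors can be taken with first entry c. -/
theorem hasFDerivAt_fieldLim_u₂ (E : Equilibria ω u₁ u₂ uc) : ∃ a b c d : ℝ, c ≠ 0 ∧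
    a * d - b * c < 0 ∧ HasFDerivAt (fieldLim ω)
      ((a • ContinuousLinearMap.fst ℝ ℝ ℝ + b • ContinuousLinearMap.snd ℝ ℝ ℝ).prod
        (c • ContinuousLinearMap.fst ℝ ℝ ℝ + d • ContinuousLinearMap.snd ℝ ℝ ℝ))
      (u₂, 2 * u₂ / (2 - u₂ ^ 2)) := by
  have hω := E.omega_pos
  have hv := E.u₂_pos
  have hv1 := E.u₂_lt.trans E.u₁_lt
  have hq := E.q₂_gt
  have hqh := E.q₂_mul_h
  have hf := E.fLim_u₂
  have hh := hLim_pos hω hv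
  have hc := vCrit_bounds.1
  have hd2 : 0 < 2 - u₂ ^ 2 := by nlinarith
  have hq2 : 2 * u₂ / (2 - u₂ ^ 2) < 2 * u₂ := by
    rw [div_lt_iff₀ hd2]; nlinarith
  set q := 2 * u₂ / (2 - u₂ ^ 2) with hqdef
  refine ⟨u₂ / 2 * (3 * ω * u₂ ^ 2 - (hLim ω u₂ + 3 * ω * u₂ ^ 3) * q), -(u₂ ^ 2 * hLim ω u₂ / 2),
    (q ^ 2 - 1) * (3 * ω * u₂ ^ 2 * (q - 2 * u₂)), (q ^ 2 - 1) * hLim ω u₂, ?_, ?_, ?_⟩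
  · have h1 : 0 < q ^ 2 - 1 := by nlinarith
    have h2 : q - 2 * u₂ < 0 := by linarith
    exact (mul_neg_of_pos_of_neg h1 (mul_neg_of_pos_of_neg (by positivity) h2)).ne
  · have h1 : 0 < q ^ 2 - 1 := by nlinarith
    have e : u₂ / 2 * (3 * ω * u₂ ^ 2 - (hLim ω u₂ + 3 * ω * u₂ ^ 3) * q) *
        ((q ^ 2 - 1) * hLim ω u₂) - -(u₂ ^ 2 * hLim ω u₂ / 2) *
        ((q ^ 2 - 1) * (3 * ω * u₂ ^ 2 * (q - 2 * u₂))) =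
        (q ^ 2 - 1) * (u₂ * hLim ω u₂ / 2) * (3 * ω * u₂ ^ 2 * (1 - 5 / 2 * u₂ ^ 2)) := by
      linear_combination -((q ^ 2 - 1) * (u₂ * hLim ω u₂ / 2)) * hqh
    rw [e]
    have h3 : 1 - 5 / 2 * u₂ ^ 2 < 0 := by nlinarith [E.lt_u₂]
    exact mul_neg_of_pos_of_neg (by positivity) (mul_neg_of_pos_of_neg (by positivity) h3)
  · have hfst := hasFDerivAt_fst (𝕜 := ℝ) (E := ℝ) (F := ℝ) (p := (u₂, q))
    have hsnd := hasFDerivAt_snd (𝕜 := ℝ) (E := ℝ) (F := ℝ) (p := (u₂, q))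
    have hhd : HasFDerivAt (fun z : ℝ × ℝ => hLim ω z.1)
        ((3 * ω * u₂ ^ 2) • ContinuousLinearMap.fst ℝ ℝ ℝ) (u₂, q) := by
      refine (((hfst.pow 3).const_mul ω).const_add 1).congr_fderiv ?_
      ext <;> simp
      ring
    have hhalf : HasFDerivAt (fun z : ℝ × ℝ => z.1 / 2)
        ((2⁻¹ : ℝ) • ContinuousLinearMap.fst ℝ ℝ ℝ) (u₂, q) := by
      simpa [div_eq_mul_inv] using hfst.mul_const (2⁻¹ : ℝ)
    have hfd := hhalf.mul (((hhd.sub ((hhd.mul hfst).mul hsnd))).sub_const 3)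
    have hgd := ((hsnd.pow 2).sub_const 1).mul
      ((hsnd.mul hhd).sub ((hfst.pow 4).const_mul (3 / 2 * ω)))
    have hb : hLim ω u₂ - hLim ω u₂ * u₂ * q - 3 = 0 :=
      (mul_eq_zero.1 hf).resolve_left (by positivity)
    refine (hfd.prodMk hgd).congr_fderiv ?_
    ext
    · simp
      linear_combination 2⁻¹ * hb
    · simp
      left
      ring
    · simp
      ring
    · simp
      left
      linear_combination hqh

/-- The stable manifold (backwards in `r`) of the nonradial equilibrium. -/
theorem Asymptotic.exists_saddle_family (hF : Asymptotic ω F) (E : Equilibria ω u₁ u₂ uc)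
    (T₀ : ℝ) : ∃ T ≥ T₀, ∃ S ⊆ phase, IsCompact S ∧ RegularField F S T ∧ ∃ ρ > 0,
      ∃ ζ : ℝ → ℝ → ℝ × ℝ, InjOn (fun s => ζ s T) (Icc (-ρ) ρ) ∧ ∀ s ∈ Icc (-ρ) ρ,
        IsTrajectory F S T (ζ s) ∧ (∀ t, T ≤ t → 1 < (ζ s t).2) ∧
        Tendsto (ζ s) atTop (𝓝 (u₂, 2 * u₂ / (2 - u₂ ^ 2))) := by
  have hcrit := vCrit_bounds.1
  obtain ⟨a, b, c, d, hc, hdet, hder⟩ := hasFDerivAt_fieldLim_u₂ E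
  obtain ⟨l, m, hl, hm, hle, hme⟩ := exists_eigenvalues_of_det_neg hdet
  set z₀ : ℝ × ℝ := (u₂, 2 * u₂ / (2 - u₂ ^ 2)) with hz₀
  have hF0 : fieldLim ω z₀ = 0 := by
    rw [fieldLim, E.fLim_u₂, E.gLim_u₂]; rfl
  set A := eigenCoord a c l m hc (hl.trans hm) with hA
  have hAs : ∀ x, A.symm x = (c * x.1 + (l - a) * x.2, c * x.1 + (m - a) * x.2) :=
    eigenCoord_symm_apply a c l m hc (hl.trans hm)
  set D : ℝ × ℝ →L[ℝ] ℝ × ℝ := (l • ContinuousLinearMap.fst ℝ ℝ ℝ).prod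
    (m • ContinuousLinearMap.snd ℝ ℝ ℝ) with hD
  set H : ℝ × ℝ → ℝ × ℝ := fun y => A.symm (fieldLim ω (z₀ + A y)) with hH
  have hH0 : H 0 = 0 := by simp [hH, hF0]
  have hHd : HasFDerivAt H D 0 := by
    have h1 : HasFDerivAt (fun y => z₀ + A y) (A : (ℝ × ℝ) →L[ℝ] (ℝ × ℝ)) 0 :=
      A.hasFDerivAt.const_add z₀
    have e0 : (fun y : ℝ × ℝ => z₀ + A y) 0 = z₀ := by simp
    have h2 := hder
    rw [← e0] at h2
    have h3 := (A.symm : (ℝ × ℝ) →L[ℝ] (ℝ × ℝ)).hasFDerivAt.comp (0 : ℝ × ℝ)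
      (h2.comp (0 : ℝ × ℝ) h1)
    refine h3.congr_fderiv ?_
    refine ContinuousLinearMap.ext fun y => ?_
    obtain ⟨x, rfl⟩ := A.symm.surjective y
    simp only [ContinuousLinearMap.comp_apply, ContinuousLinearEquiv.coe_coe,
      ContinuousLinearEquiv.apply_symm_apply]
    simp only [hAs, hD]
    ext
    · simp
      linear_combination x.2 * (- hle)
    · simp
      linear_combination x.2 * (- hme)
  -- In eigencoordinates the linear part has size at least κ ρ on each face of the square, while the
  -- nonlinear remainder is at most κ ρ / 2. The faces thus keep the directions of the linear
  -- saddle.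
  set κ := min (-l) m with hκ
  have hκ0 : 0 < κ := lt_min (by linarith) hm
  have hκl : κ ≤ -l := min_le_left _ _
  have hκm : κ ≤ m := min_le_right _ _
  have hlin := (hasFDerivAt_iff_isLittleO_nhds_zero.1 hHd).def (c := κ / 2) (by linarith)
  have hU : ∀ᶠ y in 𝓝 (0 : ℝ × ℝ), vCrit < (z₀ + A y).1 ∧ 1 < (z₀ + A y).2 := by
    have hcont : Continuous fun y => z₀ + A y := by fun_prop
    have h1 := ((continuous_fst.comp hcont).tendsto 0).eventually
      (lt_mem_nhds (a := vCrit) (by simpa [hz₀] using E.lt_u₂))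
    have h2 := ((continuous_snd.comp hcont).tendsto 0).eventually
      (lt_mem_nhds (a := (1 : ℝ)) (by simpa [hz₀] using E.q₂_gt))
    exact h1.and h2
  obtain ⟨ε, hε, hball⟩ := Metric.eventually_nhds_iff.1 (hlin.and hU)
  set ρ := ε / 2 with hρ
  have hρ0 : 0 < ρ := by positivity
  have hnorm : ∀ y ∈ Icc (-ρ) ρ ×ˢ Icc (-ρ) ρ, ‖y‖ ≤ ρ := by
    rintro ⟨x, y⟩ ⟨hx, hy⟩
    rw [Prod.norm_def, max_le_iff, Real.norm_eq_abs, Real.norm_eq_abs, abs_le, abs_le]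
    exact ⟨hx, hy⟩
  have hbox : ∀ y ∈ Icc (-ρ) ρ ×ˢ Icc (-ρ) ρ, |(H y).1 - l * y.1| ≤ κ / 2 * ρ ∧
      |(H y).2 - m * y.2| ≤ κ / 2 * ρ ∧ vCrit < (z₀ + A y).1 ∧ 1 < (z₀ + A y).2 := by
    intro y hy
    have h1 := hnorm y hy
    obtain ⟨h2, h3⟩ := hball (y := y) (by rw [dist_zero_right]; linarith)
    have h4 : ‖H y - D y‖ ≤ κ / 2 * ρ := by
      rw [zero_add, hH0, sub_zero] at h2
      exact h2.trans (by gcongr)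
    rw [Prod.norm_def, max_le_iff, Real.norm_eq_abs, Real.norm_eq_abs] at h4
    exact ⟨by simpa [hD] using h4.1, by simpa [hD] using h4.2, h3⟩
  set Q : Set (ℝ × ℝ) := Icc (-ρ) ρ ×ˢ Icc (-ρ) ρ with hQ
  have hcontA : Continuous fun y => z₀ + A y := by fun_prop
  have hQc : IsCompact Q := isCompact_Icc.prod isCompact_Icc
  set S : Set (ℝ × ℝ) := (fun y => z₀ + A y) '' Q with hSdef
  have hS : S ⊆ phase := by
    rintro _ ⟨y, hy, rfl⟩
    obtain ⟨-, -, h3, h4⟩ := hbox y hy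
    exact ⟨by linarith, h4.le⟩
  have hSc : IsCompact S := hQc.image hcontA
  have hface : ∀ (Q' : Set (ℝ × ℝ)), Q' ⊆ Q → IsCompact Q' → ∀ a' b' : ℝ,
      (∀ y ∈ Q', 0 < a' * (H y).1 + b' * (H y).2) → ∀ᶠ t in atTop, ∀ y ∈ Q',
        0 < a' * (A.symm (F t (z₀ + A y))).1 + b' * (A.symm (F t (z₀ + A y))).2 := by
    intro Q' hQ' hQc' a' b' hpos
    have := hF.eventually_pos (S := (fun y => z₀ + A y) '' Q') ((image_mono hQ').trans hS)
      (hQc'.image hcontA) (a' * c + b' * c) (a' * (l - a) + b' * (m - a)) (by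
        rintro _ ⟨y, hy, rfl⟩
        have := hpos y hy
        simp only [hH, hAs, fieldLim] at this
        linarith)
    filter_upwards [this] with t ht y hy
    have := ht _ ⟨y, hy, rfl⟩
    simp only [hAs]
    linarith
  have hsingle : ∀ x ∈ Icc (-ρ) ρ, ({x} : Set ℝ) ×ˢ Icc (-ρ) ρ ⊆ Q :=
    fun x hx => prod_mono (by simpa using hx) subset_rfl
  have hsingle' : ∀ x ∈ Icc (-ρ) ρ, Icc (-ρ) ρ ×ˢ ({x} : Set ℝ) ⊆ Q :=
    fun x hx => prod_mono subset_rfl (by simpa using hx)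
  have hρm : ρ ∈ Icc (-ρ) ρ := ⟨by linarith, le_rfl⟩
  have hρm' : -ρ ∈ Icc (-ρ) ρ := ⟨le_rfl, by linarith⟩
  have hκρ : κ / 2 * ρ < κ * ρ := by nlinarith
  have hκlρ : κ * ρ ≤ -l * ρ := by gcongr
  have hκmρ : κ * ρ ≤ m * ρ := by gcongr
  have ev1 := hface _ (hsingle (-ρ) hρm') (isCompact_singleton.prod isCompact_Icc) 1 0 (by
    rintro ⟨x, y⟩ hy
    have h1 := (abs_le.1 (hbox _ (hsingle _ hρm' hy)).1).1
    obtain rfl : x = -ρ := hy.1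
    simp only at h1
    linarith)
  have ev2 := hface _ (hsingle ρ hρm) (isCompact_singleton.prod isCompact_Icc) (-1) 0 (by
    rintro ⟨x, y⟩ hy
    have h1 := (abs_le.1 (hbox _ (hsingle _ hρm hy)).1).2
    obtain rfl : x = ρ := hy.1
    simp only at h1
    linarith)
  have ev3 := hface _ (hsingle' (-ρ) hρm') (isCompact_Icc.prod isCompact_singleton) 0 (-1) (by
    rintro ⟨x, y⟩ hy
    have h1 := (abs_le.1 (hbox _ (hsingle' _ hρm' hy)).2.1).2
    obtain rfl : y = -ρ := hy.2
    simp only at h1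
    linarith)
  have ev4 := hface _ (hsingle' ρ hρm) (isCompact_Icc.prod isCompact_singleton) 0 1 (by
    rintro ⟨x, y⟩ hy
    have h1 := (abs_le.1 (hbox _ (hsingle' _ hρm hy)).2.1).1
    obtain rfl : y = ρ := hy.2
    simp only at h1
    linarith)
  obtain ⟨T₁, hreg⟩ := hF.regular S hS hSc
  obtain ⟨T₂, hT₂⟩ := eventually_atTop.1 (ev1.and (ev2.and (ev3.and ev4)))
  set T := max T₀ (max T₁ T₂) with hT
  have hTT₁ : T₁ ≤ T := (le_max_left _ _).trans (le_max_right _ _)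
  have hTT₂ : T₂ ≤ T := (le_max_right _ _).trans (le_max_right _ _)
  have hreg' := hreg.mono subset_rfl hTT₁
  refine ⟨T, le_max_left _ _, S, hS, hSc, hreg', ρ, hρ0, ?_⟩
  -- The family is total in s; outside [-ρ, ρ] it takes an irrelevant constant value. The attracting
  -- coordinate s at time T makes the family injective.
  have hex : ∀ s : ℝ, ∃ z : ℝ → ℝ × ℝ, s ∈ Icc (-ρ) ρ → (A.symm (z T - z₀)).1 = s ∧
      IsTrajectory F S T z := by
    intro s
    by_cases hs : s ∈ Icc (-ρ) ρ
    · obtain ⟨z, h1, h2⟩ := hreg'.exists_trajectory_of_saddle A z₀ (mapsTo_image _ _) (by linarith)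
        (fun t ht y hy => by
          have := (hT₂ t (hTT₂.trans ht)).1 (-ρ, y) ⟨rfl, hy⟩
          linarith)
        (fun t ht y hy => by
          have := (hT₂ t (hTT₂.trans ht)).2.1 (ρ, y) ⟨rfl, hy⟩
          linarith)
        (fun t ht x hx => by
          have := (hT₂ t (hTT₂.trans ht)).2.2.1 (x, -ρ) ⟨hx, rfl⟩
          linarith)
        (fun t ht x hx => by
          have := (hT₂ t (hTT₂.trans ht)).2.2.2 (x, ρ) ⟨hx, rfl⟩
          linarith) hs
      exact ⟨z, fun _ => ⟨h1, h2⟩⟩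
    · exact ⟨fun _ => 0, fun h => absurd h hs⟩
  choose ζ hζ using hex
  refine ⟨ζ, fun s hs s' hs' h => ?_, fun s hs => ?_⟩
  · rw [← (hζ s hs).1, ← (hζ s' hs').1]
    simp only at h
    rw [h]
  · have hz := (hζ s hs).2
    have hq : ∀ t, T ≤ t → vCrit < (ζ s t).1 ∧ 1 < (ζ s t).2 := by
      intro t ht
      obtain ⟨y, hy, hyz⟩ := hz.mem t ht
      rw [← hyz]
      exact (hbox y hy).2.2
    have hSq : ∀ e ∈ S, 1 < e.2 := by
      rintro _ ⟨y, hy, rfl⟩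
      exact (hbox y hy).2.2.2
    refine ⟨hz, fun t ht => (hq t ht).2, ?_⟩
    obtain ⟨e, heS, he, hlim⟩ := hz.tendsto_equilibrium hF E hS hSc
    rcases he with rfl | rfl | rfl
    · exact absurd (hSq _ heS) (by simp)
    · exact absurd (hSq _ heS) (by simp)
    · exact hlim

end Collapse
end

/-! ### Parametric integrals, and derivative bounds in a cone -/

noncomputable section
namespace Collapse

open MeasureTheory in
/-- Parametric integrals of `C¹` functions are `C¹`. -/
theorem contDiffAt_integral_param {E : Type*} [NormedAddCommGroup E] [NormedSpace ℝ E]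
    [ProperSpace E] {k : E × ℝ → ℝ} {w : ℝ → ℝ} {a b : ℝ} {x₀ : E} (hab : a ≤ b)
    (hw : ContinuousOn w (Icc a b)) (hk : ∀ s ∈ Icc a b, ContDiffAt ℝ 1 k (x₀, s)) :
    ContDiffAt ℝ 1 (fun x => ∫ s in a..b, w s * k (x, s)) x₀ ∧
    HasFDerivAt (fun x => ∫ s in a..b, w s * k (x, s))
      (∫ s in a..b, w s • (fderiv ℝ k (x₀, s)).comp (ContinuousLinearMap.inl ℝ E ℝ)) x₀ := by
  set O : Set (E × ℝ) := {p | ContDiffAt ℝ 1 k p} with hO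
  have hOo : IsOpen O := by
    rw [isOpen_iff_eventually]
    intro p hp
    exact (show ContDiffAt ℝ 1 k p from hp).eventually (by simp)
  -- The points of C¹ regularity form an open set containing the segment over x₀, hence a whole tube
  -- around it; compactness of a closed subtube gives the dominating constant.
  obtain ⟨U, V, hU, -, hxU, hV, hUV⟩ := generalized_tube_lemma (s := {x₀}) isCompact_singleton
    (t := Icc a b) isCompact_Icc hOo (by rintro ⟨x, s⟩ ⟨hx, hs⟩; obtain rfl : x = x₀ := hx
                                         exact hk s hs)
  obtain ⟨ε, hε, hball⟩ := Metric.nhds_basis_closedBall.mem_iff.1 (hU.mem_nhds (hxU rfl))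
  set B := Metric.closedBall x₀ ε
  have hBO : ∀ x ∈ B, ∀ s ∈ Icc a b, ContDiffAt ℝ 1 k (x, s) :=
    fun x hx s hs => hUV ⟨hball hx, hV hs⟩
  set D : E × ℝ → E →L[ℝ] ℝ := fun p =>
    w p.2 • (fderiv ℝ k p).comp (ContinuousLinearMap.inl ℝ E ℝ) with hD
  have hfd : ContinuousOn (fderiv ℝ k) (B ×ˢ Icc a b) := fun p hp =>
    ((hBO p.1 hp.1 p.2 hp.2).fderiv_right (m := 0) (by simp)).continuousAt.continuousWithinAt
  have hDc : ContinuousOn D (B ×ˢ Icc a b) := by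
    refine (hw.comp continuousOn_snd fun p hp => hp.2).smul ?_
    exact hfd.clm_comp continuousOn_const
  have hkc : ContinuousOn k (B ×ˢ Icc a b) := fun p hp =>
    (hBO p.1 hp.1 p.2 hp.2).continuousAt.continuousWithinAt
  have hcomp : IsCompact (B ×ˢ Icc a b) := (isCompact_closedBall x₀ ε).prod isCompact_Icc
  obtain ⟨M, hM⟩ := (hcomp.image_of_continuousOn hDc).isBounded.exists_norm_le
  have hsec : ∀ x ∈ B, ContinuousOn (fun s => w s * k (x, s)) (Icc a b) := fun x hx =>
    hw.mul (hkc.comp (by fun_prop) fun s hs => ⟨hx, hs⟩)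
  have hsecD : ∀ x ∈ B, ContinuousOn (fun s => D (x, s)) (Icc a b) := fun x hx =>
    hDc.comp (by fun_prop) fun s hs => ⟨hx, hs⟩
  have hI : Set.uIoc a b ⊆ Icc a b := by rw [uIoc_of_le hab]; exact Ioc_subset_Icc_self
  have hder : ∀ x ∈ Metric.ball x₀ ε, HasFDerivAt (fun x => ∫ s in a..b, w s * k (x, s))
      (∫ s in a..b, D (x, s)) x := by
    intro x hx
    have hnhds : Metric.ball x₀ ε ∈ 𝓝 x := Metric.isOpen_ball.mem_nhds hx
    refine intervalIntegral.hasFDerivAt_integral_of_dominated_of_fderiv_le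
      (F' := fun x s => D (x, s)) (bound := fun _ => M) hnhds ?_ ?_ ?_ ?_ ?_ ?_
    · filter_upwards [hnhds] with y hy
      exact ((hsec y (Metric.ball_subset_closedBall hy)).mono hI).aestronglyMeasurable
        measurableSet_uIoc
    · exact (hsec x (Metric.ball_subset_closedBall hx)).intervalIntegrable_of_Icc hab
    · exact ((hsecD x (Metric.ball_subset_closedBall hx)).mono hI).aestronglyMeasurable
        measurableSet_uIoc
    · exact Eventually.of_forall fun s hs y hy =>
        hM _ ⟨(y, s), ⟨Metric.ball_subset_closedBall hy, hI hs⟩, rfl⟩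
    · exact intervalIntegrable_const
    · refine Eventually.of_forall fun s hs y hy => ?_
      have h1 := ((hBO y (Metric.ball_subset_closedBall hy) s (hI hs)).differentiableAt
        (by simp)).hasFDerivAt
      have h2 : HasFDerivAt (fun y : E => (y, s)) (ContinuousLinearMap.inl ℝ E ℝ) y :=
        hasFDerivAt_prodMk_left y s
      exact (h1.comp y h2).const_mul (w s)
  refine ⟨contDiffAt_one_iff.2 ⟨fun x => ∫ s in a..b, D (x, s), Metric.ball x₀ ε,
    Metric.ball_mem_nhds _ hε, ?_, hder⟩, hder x₀ (Metric.mem_ball_self hε)⟩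
  intro x hx
  refine ContinuousAt.continuousWithinAt ?_
  have hnhds : Metric.ball x₀ ε ∈ 𝓝 x := Metric.isOpen_ball.mem_nhds hx
  refine intervalIntegral.continuousAt_of_dominated_interval (bound := fun _ => M) ?_ ?_
    intervalIntegrable_const ?_
  · filter_upwards [hnhds] with y hy
    exact ((hsecD y (Metric.ball_subset_closedBall hy)).mono hI).aestronglyMeasurable
      measurableSet_uIoc
  · filter_upwards [hnhds] with y hy
    exact Eventually.of_forall fun s hs =>
      hM _ ⟨(y, s), ⟨Metric.ball_subset_closedBall hy, hI hs⟩, rfl⟩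
  · refine Eventually.of_forall fun s hs => ?_
    have h1 : ContinuousWithinAt D (B ×ˢ Icc a b) (x, s) :=
      hDc (x, s) ⟨Metric.ball_subset_closedBall hx, hI hs⟩
    have h2 : ContinuousWithinAt (fun y => D (y, s)) (Metric.ball x₀ ε) x :=
      ContinuousWithinAt.comp (t := B ×ˢ Icc a b) (f := fun y : E => (y, s)) h1 (by fun_prop)
        (fun y hy => ⟨Metric.ball_subset_closedBall hy, hI hs⟩)
    exact h2.continuousAt hnhds

/-- A growth bound from a bound on the derivative. -/
theorem abs_le_of_abs_deriv_le {f f' b b' : ℝ → ℝ} {a : ℝ}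
    (hf : ∀ s ∈ Icc 0 a, HasDerivAt f (f' s) s) (hb : ∀ s, HasDerivAt b (b' s) s) (h0 : f 0 = 0)
    (hb0 : b 0 = 0) (h : ∀ s ∈ Icc 0 a, |f' s| ≤ b' s) : ∀ s ∈ Icc 0 a, |f s| ≤ b s := by
  intro s hs
  exact image_norm_le_of_norm_deriv_right_le_deriv_boundary
    (fun s hs => (hf s hs).continuousAt.continuousWithinAt)
    (fun s hs => (hf s ⟨hs.1, hs.2.le⟩).hasDerivWithinAt) (by simp [h0, hb0]) hb
    (fun s hs => h s ⟨hs.1, hs.2.le⟩) hs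

/-- A Landau-type inequality: a small function with almost constant third derivative has a small
first derivative. -/
theorem abs_deriv_le_of_third {g g₁ g₂ g₃ : ℝ → ℝ} {h δ c : ℝ} (hh : 0 < h)
    (h₁ : ∀ s ∈ Icc 0 (3 * h), HasDerivAt g (g₁ s) s)
    (h₂ : ∀ s ∈ Icc 0 (3 * h), HasDerivAt g₁ (g₂ s) s)
    (h₃ : ∀ s ∈ Icc 0 (3 * h), HasDerivAt g₂ (g₃ s) s)
    (hc : ∀ s ∈ Icc 0 (3 * h), |g₃ s - c| ≤ δ)
    (hg : ∀ s ∈ Icc 0 (3 * h), |g s| ≤ δ * h ^ 3) : |g₁ 0| ≤ 11 * δ * h ^ 2 := by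
  have e₂ : ∀ s ∈ Icc 0 (3 * h), |g₂ s - g₂ 0 - c * s| ≤ δ * s :=
    abs_le_of_abs_deriv_le (f' := fun s => g₃ s - c) (b' := fun _ => δ)
      (fun s hs => by
        refine ((h₃ s hs).sub_const (g₂ 0)).sub ((hasDerivAt_id s).const_mul c) |>.congr_deriv ?_
        simp)
      (fun s => by simpa using (hasDerivAt_id s).const_mul δ) (by simp) (by simp) hc
  have e₁ : ∀ s ∈ Icc 0 (3 * h), |g₁ s - g₁ 0 - g₂ 0 * s - c * s ^ 2 / 2| ≤ δ * s ^ 2 / 2 :=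
    abs_le_of_abs_deriv_le (f' := fun s => g₂ s - g₂ 0 - c * s) (b' := fun s => δ * s)
      (fun s hs => by
        refine ((((h₂ s hs).sub_const (g₁ 0)).sub ((hasDerivAt_id s).const_mul (g₂ 0))).sub
          ((((hasDerivAt_id s).pow 2).const_mul c).div_const 2)).congr_deriv ?_
        simp; ring)
      (fun s => by
        refine ((((hasDerivAt_id s).pow 2).const_mul δ).div_const 2).congr_deriv ?_
        simp; ring) (by simp) (by simp) e₂
  have e₀ : ∀ s ∈ Icc 0 (3 * h), |g s - g 0 - g₁ 0 * s - g₂ 0 * s ^ 2 / 2 - c * s ^ 3 / 6|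
      ≤ δ * s ^ 3 / 6 :=
    abs_le_of_abs_deriv_le (f' := fun s => g₁ s - g₁ 0 - g₂ 0 * s - c * s ^ 2 / 2)
      (b' := fun s => δ * s ^ 2 / 2)
      (fun s hs => by
        refine (((((h₁ s hs).sub_const (g 0)).sub ((hasDerivAt_id s).const_mul (g₁ 0))).sub
          ((((hasDerivAt_id s).pow 2).const_mul (g₂ 0)).div_const 2)).sub
          ((((hasDerivAt_id s).pow 3).const_mul c).div_const 6)).congr_deriv ?_
        simp; ring)
      (fun s => by
        refine ((((hasDerivAt_id s).pow 3).const_mul δ).div_const 6).congr_deriv ?_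
        simp; ring) (by simp) (by simp) e₁
  have m1 : h ∈ Icc 0 (3 * h) := ⟨by linarith, by linarith⟩
  have m2 : 2 * h ∈ Icc 0 (3 * h) := ⟨by linarith, by linarith⟩
  have m3 : 3 * h ∈ Icc 0 (3 * h) := ⟨by linarith, by linarith⟩
  have a0 := abs_le.1 (hg 0 ⟨le_rfl, by linarith⟩)
  have a1 := abs_le.1 (hg _ m1)
  have a2 := abs_le.1 (hg _ m2)
  have a3 := abs_le.1 (hg _ m3)
  have b1 := abs_le.1 (e₀ _ m1)
  have b2 := abs_le.1 (e₀ _ m2)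
  have b3 := abs_le.1 (e₀ _ m3)
  -- The difference formula 6h g'(0) = -11 g(0) + 18 g(h) - 9 g(2h) + 2 g(3h) is exact for cubics.
  -- The values of g contribute at most 40/6 and the Taylor remainders at most 4, in units of δ h³;
  -- the sum is below 11.
  have key : |g₁ 0 * h| ≤ 11 * δ * h ^ 2 * h := by
    rw [abs_le]
    constructor
    · linarith [a0.1, a0.2, a1.1, a1.2, a2.1, a2.2, a3.1, a3.2, b1.1, b1.2, b2.1, b2.2, b3.1, b3.2]
    · linarith [a0.1, a0.2, a1.1, a1.2, a2.1, a2.2, a3.1, a3.2, b1.1, b1.2, b2.1, b2.2, b3.1, b3.2]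
  rw [abs_mul, abs_of_pos hh] at key
  exact le_of_mul_le_mul_right key hh

/-- A `C³` function on the plane that is `o(r³)` in the cone `0 < R ≤ r` has partial derivatives
that are `o(r²)` in a smaller cone. -/
theorem fderiv_small_of_cone {D : ℝ × ℝ → ℝ} (hD : ContDiffAt ℝ 3 D 0)
    (hsmall : ∀ ε > 0, ∃ η > 0, ∀ r R, 0 < R → R ≤ r → r < η → |D (r, R)| ≤ ε * r ^ 3)
    {ε : ℝ} (hε : 0 < ε) : ∃ η > 0, ∀ r R, 0 < R → R ≤ r / 4 → r < η →
      |fderiv ℝ D (r, R) (1, 0)| ≤ ε * r ^ 2 ∧ |fderiv ℝ D (r, R) (0, 1)| ≤ ε * r ^ 2 := by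
  -- The third derivative in a fixed direction is continuous at the origin, so it is almost a
  -- constant c nearby; this is all the Landau inequality asks of it.
  have key : ∀ v : ℝ × ℝ, ∃ c : ℝ, ∀ δ > 0, ∃ η > 0, ∀ x : ℝ × ℝ, ‖x‖ < η → 
      ContDiffAt ℝ 3 D x ∧ ContDiffAt ℝ 2 (fun x => fderiv ℝ D x v) x ∧
      ContDiffAt ℝ 1 (fun x => fderiv ℝ (fun x => fderiv ℝ D x v) x v) x ∧
      |fderiv ℝ (fun x => fderiv ℝ (fun x => fderiv ℝ D x v) x v) x v - c| ≤ δ := by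
    intro v
    have d1 : ContDiffAt ℝ 2 (fun x => fderiv ℝ D x v) 0 :=
      (hD.fderiv_right (m := 2) (by norm_num)).clm_apply contDiffAt_const
    have d2 : ContDiffAt ℝ 1 (fun x => fderiv ℝ (fun x => fderiv ℝ D x v) x v) 0 :=
      (d1.fderiv_right (m := 1) (by norm_num)).clm_apply contDiffAt_const
    have d3 : ContDiffAt ℝ 0 (fun x =>
        fderiv ℝ (fun x => fderiv ℝ (fun x => fderiv ℝ D x v) x v) x v) 0 :=
      (d2.fderiv_right (m := 0) (by norm_num)).clm_apply contDiffAt_const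
    refine ⟨fderiv ℝ (fun x => fderiv ℝ (fun x => fderiv ℝ D x v) x v) 0 v, fun δ hδ => ?_⟩
    have h3 := d3.continuousAt.eventually (Metric.closedBall_mem_nhds _ hδ)
    obtain ⟨η, hη, hball⟩ := Metric.eventually_nhds_iff.1 ((hD.eventually (by simp)).and
      ((d1.eventually (by simp)).and ((d2.eventually (by simp)).and h3)))
    exact ⟨η, hη, fun x hx => by
      have := hball (y := x) (by simpa using hx)
      exact ⟨this.1, this.2.1, this.2.2.1, by simpa [Real.dist_eq] using this.2.2.2⟩⟩
  have main : ∀ v : ℝ × ℝ, (v = (1, 0) ∨ v = (0, 1)) → ∃ η > 0, ∀ r R, 0 < R → R ≤ r / 4 → r < η →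
      |fderiv ℝ D (r, R) v| ≤ ε * r ^ 2 := by
    intro v hv
    obtain ⟨c, hc⟩ := key v
    obtain ⟨η₁, hη₁, H₁⟩ := hc ε hε
    -- The inequality is applied with step r/4 on a segment where the first coordinate stays below
    -- 2r, and (ε/512)(2r)³ = ε (r/4)³. The condition R ≤ r/4 leaves room for a vertical segment of
    -- length 3r/4 inside the cone.
    obtain ⟨η₂, hη₂, H₂⟩ := hsmall (ε / 512) (by positivity)
    refine ⟨min (η₁ / 2) (η₂ / 2), by positivity, fun r R hR hRr hr => ?_⟩
    have hr1 : r < η₁ / 2 := hr.trans_le (min_le_left _ _)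
    have hr2 : r < η₂ / 2 := hr.trans_le (min_le_right _ _)
    have hr0 : 0 < r := by linarith
    have hpt : ∀ s ∈ Icc 0 (3 * (r / 4)), ‖(r, R) + s • v‖ < η₁ ∧
        |D ((r, R) + s • v)| ≤ ε * (r / 4) ^ 3 := by
      intro s hs
      rcases hv with rfl | rfl
      · have h1 := H₂ (r + s) R hR (by linarith [hs.1]) (by linarith [hs.2])
        have h2 : (r + s) ^ 3 ≤ (2 * r) ^ 3 :=
          pow_le_pow_left₀ (by linarith [hs.1]) (by linarith [hs.2]) 3
        refine ⟨?_, ?_⟩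
        · simp only [Prod.smul_mk, Prod.mk_add_mk, smul_eq_mul, mul_one, mul_zero, add_zero]
          rw [Prod.norm_def, max_lt_iff, Real.norm_eq_abs, Real.norm_eq_abs, abs_lt, abs_lt]
          refine ⟨⟨?_, ?_⟩, ?_, ?_⟩ <;> simp only <;> linarith [hs.1, hs.2]
        · simp only [Prod.smul_mk, Prod.mk_add_mk, smul_eq_mul, mul_one, mul_zero, add_zero]
          have : ε / 512 * (r + s) ^ 3 ≤ ε / 512 * (2 * r) ^ 3 := by gcongr
          refine h1.trans (this.trans (le_of_eq ?_))
          ring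
      · have h1 := H₂ r (R + s) (by linarith [hs.1]) (by linarith [hs.2]) (by linarith)
        refine ⟨?_, ?_⟩
        · simp only [Prod.smul_mk, Prod.mk_add_mk, smul_eq_mul, mul_one, mul_zero, add_zero]
          rw [Prod.norm_def, max_lt_iff, Real.norm_eq_abs, Real.norm_eq_abs, abs_lt, abs_lt]
          refine ⟨⟨?_, ?_⟩, ?_, ?_⟩ <;> simp only <;> linarith [hs.1, hs.2]
        · simp only [Prod.smul_mk, Prod.mk_add_mk, smul_eq_mul, mul_one, mul_zero, add_zero]
          refine h1.trans ?_
          have : 0 < ε * r ^ 3 := by positivity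
          nlinarith
    have hline : ∀ {f : ℝ × ℝ → ℝ} {s : ℝ}, DifferentiableAt ℝ f ((r, R) + s • v) →
        HasDerivAt (fun s : ℝ => f ((r, R) + s • v)) (fderiv ℝ f ((r, R) + s • v) v) s := by
      intro f s hf
      have h1 : HasDerivAt (fun s : ℝ => (r, R) + s • v) v s := by
        simpa using ((hasDerivAt_id s).smul_const v).const_add (r, R)
      exact hf.hasFDerivAt.comp_hasDerivAt s h1
    have := abs_deriv_le_of_third (h := r / 4) (δ := ε) (c := c)
      (g := fun s => D ((r, R) + s • v)) (by linarith)
      (fun s hs => hline ((H₁ _ (hpt s hs).1).1.differentiableAt (by simp)))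
      (fun s hs => hline ((H₁ _ (hpt s hs).1).2.1.differentiableAt (by simp)))
      (fun s hs => hline ((H₁ _ (hpt s hs).1).2.2.1.differentiableAt (by simp)))
      (fun s hs => (H₁ _ (hpt s hs).1).2.2.2) (fun s hs => (hpt s hs).2)
    simp only [zero_smul, add_zero] at this
    refine this.trans ?_
    have : 0 < ε * r ^ 2 := by positivity
    nlinarith
  obtain ⟨η₁, h1, H1⟩ := main (1, 0) (Or.inl rfl)
  obtain ⟨η₂, h2, H2⟩ := main (0, 1) (Or.inr rfl)
  exact ⟨min η₁ η₂, by positivity, fun r R a b c => ⟨H1 r R a b (c.trans_le (min_le_left _ _)),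
    H2 r R a b (c.trans_le (min_le_right _ _))⟩⟩

end Collapse
end

/-! ### Regularity of u and G away from and up to the singularity -/

noncomputable section
namespace Collapse

/-- Partial derivative in the first variable. -/
def dr (f : ℝ × ℝ → ℝ) (x : ℝ × ℝ) : ℝ := fderiv ℝ f x (1, 0)

/-- Partial derivative in the second variable. -/
def dR (f : ℝ × ℝ → ℝ) (x : ℝ × ℝ) : ℝ := fderiv ℝ f x (0, 1)

theorem hasDerivAt_dr {f : ℝ × ℝ → ℝ} {r R : ℝ} (h : DifferentiableAt ℝ f (r, R)) :
    HasDerivAt (fun s => f (s, R)) (dr f (r, R)) r :=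
  h.hasFDerivAt.comp_hasDerivAt r ((hasDerivAt_id r).prodMk (hasDerivAt_const r R))

theorem hasDerivAt_dR {f : ℝ × ℝ → ℝ} {r R : ℝ} (h : DifferentiableAt ℝ f (r, R)) :
    HasDerivAt (fun s => f (r, s)) (dR f (r, R)) R :=
  h.hasFDerivAt.comp_hasDerivAt R ((hasDerivAt_const R r).prodMk (hasDerivAt_id R))

theorem hasDerivAt_comp_curve {f : ℝ × ℝ → ℝ} {a b : ℝ → ℝ} {a' b' s : ℝ}
    (h : DifferentiableAt ℝ f (a s, b s)) (ha : HasDerivAt a a' s) (hb : HasDerivAt b b' s) :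
    HasDerivAt (fun s => f (a s, b s)) (dr f (a s, b s) * a' + dR f (a s, b s) * b') s := by
  have := h.hasFDerivAt.comp_hasDerivAt s (ha.prodMk hb)
  refine this.congr_deriv ?_
  have e : (a', b') = a' • ((1 : ℝ), (0 : ℝ)) + b' • ((0 : ℝ), (1 : ℝ)) := by simp
  rw [e, map_add, map_smul, map_smul, dr, dR]
  simp [mul_comm]

theorem contDiffAt_dr {f : ℝ × ℝ → ℝ} {x : ℝ × ℝ} {n m : WithTop ℕ∞} (h : ContDiffAt ℝ n f x)
    (hm : m + 1 ≤ n) : ContDiffAt ℝ m (dr f) x :=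
  (h.fderiv_right hm).clm_apply contDiffAt_const

theorem contDiffAt_dR {f : ℝ × ℝ → ℝ} {x : ℝ × ℝ} {n m : WithTop ℕ∞} (h : ContDiffAt ℝ n f x)
    (hm : m + 1 ≤ n) : ContDiffAt ℝ m (dR f) x :=
  (h.fderiv_right hm).clm_apply contDiffAt_const

/-- `∫₀^R √σ f(r,σ) dσ`. -/
def sqrtInt (f : ℝ × ℝ → ℝ) (x : ℝ × ℝ) : ℝ := ∫ σ in (0 : ℝ)..x.2, √σ * f (x.1, σ)

/-- The substitution σ = R s fixes the interval of integration, so differentiability in both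
variables reduces to parametric integrals. -/
theorem sqrtInt_eq {f : ℝ × ℝ → ℝ} {x : ℝ × ℝ} (hx : 0 < x.2) :
    sqrtInt f x = x.2 * √x.2 * ∫ s in (0 : ℝ)..1, √s * f (x.1, x.2 * s) := by
  have h := intervalIntegral.smul_integral_comp_mul_left
    (fun σ => √σ * f (x.1, σ)) (a := 0) (b := 1) x.2
  simp only [mul_zero, mul_one, smul_eq_mul] at h
  rw [sqrtInt, ← h, mul_assoc, ← intervalIntegral.integral_const_mul (√x.2)]
  congr 1
  refine intervalIntegral.integral_congr fun s hs => ?_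
  simp only [Real.sqrt_mul hx.le]
  ring

theorem contDiffAt_sqrtInt {f : ℝ × ℝ → ℝ} {r R : ℝ} (hR : 0 < R)
    (hf : ∀ σ ∈ Icc 0 R, ContDiffAt ℝ 1 f (r, σ)) : ContDiffAt ℝ 1 (sqrtInt f) (r, R) := by
  have h1 := (contDiffAt_integral_param (E := ℝ × ℝ) (k := fun p => f (p.1.1, p.1.2 * p.2))
    (w := fun s => √s) (a := 0) (b := 1) (x₀ := (r, R)) zero_le_one (by fun_prop)
    (fun s hs => by
      have h := hf (R * s) ⟨mul_nonneg hR.le hs.1, mul_le_of_le_one_right hR.le hs.2⟩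
      exact ContDiffAt.comp (g := f) (f := fun p : (ℝ × ℝ) × ℝ => (p.1.1, p.1.2 * p.2)) _ h
        (by fun_prop))).1
  have h2 : ContDiffAt ℝ 1 (fun x : ℝ × ℝ => x.2 * √x.2) (r, R) :=
    contDiffAt_snd.mul (contDiffAt_snd.sqrt hR.ne')
  refine (h2.mul h1).congr_of_eventuallyEq ?_
  filter_upwards [(continuous_snd.isOpen_preimage _ isOpen_Ioi).mem_nhds
    (show ((r, R) : ℝ × ℝ) ∈ Prod.snd ⁻¹' Ioi (0 : ℝ) from hR)] with x hx
  exact sqrtInt_eq hx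

theorem dr_sqrtInt {f : ℝ × ℝ → ℝ} {r R : ℝ} (hR : 0 < R)
    (hf : ∀ σ ∈ Icc 0 R, ContDiffAt ℝ 1 f (r, σ)) :
    dr (sqrtInt f) (r, R) = sqrtInt (dr f) (r, R) := by
  have h1 := hasDerivAt_dr ((contDiffAt_sqrtInt hR hf).differentiableAt (by simp))
  have h2 := (contDiffAt_integral_param (E := ℝ) (k := f) (w := fun s => √s) hR.le
    (by fun_prop) hf).2.hasDerivAt
  refine h1.unique (h2.congr_deriv ?_)
  have hfd : ContinuousOn (fun s => √s • (fderiv ℝ f (r, s)).comp (ContinuousLinearMap.inl ℝ ℝ ℝ))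
      (Icc 0 R) := by
    have : ContinuousOn (fun s => fderiv ℝ f (r, s)) (Icc 0 R) := fun s hs =>
      (ContinuousAt.comp (g := fderiv ℝ f) (f := fun s : ℝ => (r, s))
        ((hf s hs).fderiv_right (m := 0) (by simp)).continuousAt
        (by fun_prop)).continuousWithinAt
    exact (by fun_prop : ContinuousOn (fun s : ℝ => √s) _).smul
      (this.clm_comp continuousOn_const)
  rw [ContinuousLinearMap.intervalIntegral_apply (hfd.intervalIntegrable_of_Icc hR.le)]
  simp [sqrtInt, dr]

theorem dR_sqrtInt {f : ℝ × ℝ → ℝ} {r R : ℝ} (hR : 0 < R)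
    (hf : ∀ σ ∈ Icc 0 R, ContDiffAt ℝ 1 f (r, σ)) :
    dR (sqrtInt f) (r, R) = √R * f (r, R) := by
  have h1 := hasDerivAt_dR ((contDiffAt_sqrtInt hR hf).differentiableAt (by simp))
  refine h1.unique ?_
  have hc : ∀ σ ∈ Icc 0 R, ContinuousAt (fun σ => √σ * f (r, σ)) σ := fun σ hσ =>
    (Real.continuous_sqrt.continuousAt).mul (ContinuousAt.comp (g := f) (f := fun s : ℝ => (r, s))
      (hf σ hσ).continuousAt (by fun_prop))
  have hcR : ∀ᶠ σ in 𝓝 R, ContinuousAt (fun σ => √σ * f (r, σ)) σ := by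
    have h3 := (hf R ⟨hR.le, le_rfl⟩).eventually (by simp)
    have h4 : Tendsto (fun s : ℝ => (r, s)) (𝓝 R) (𝓝 (r, R)) := Continuous.tendsto (by fun_prop) R
    filter_upwards [h4.eventually h3] with σ hσ
    exact (Real.continuous_sqrt.continuousAt).mul
      (ContinuousAt.comp (g := f) (f := fun s : ℝ => (r, s)) hσ.continuousAt (by fun_prop))
  refine intervalIntegral.integral_hasDerivAt_right
    (ContinuousOn.intervalIntegrable_of_Icc hR.le fun σ hσ => (hc σ hσ).continuousWithinAt) ?_
    (hc R ⟨hR.le, le_rfl⟩)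
  obtain ⟨U, hU, hUo, hRU⟩ := eventually_nhds_iff.1 hcR
  exact ContinuousOn.stronglyMeasurableAtFilter hUo
    (fun σ hσ => (hU σ hσ).continuousWithinAt) R hRU

/-- `R u²`, which is regular up to the singularity. -/
def rUSq (Ψ Y : ℝ → ℝ → ℝ) (x : ℝ × ℝ) : ℝ := x.2 * (Y x.1 x.2 ^ 2 - 1) + 2 * Ψ x.1 x.2

/-- The function with `∂G/∂R = √R · gDens`, which is regular up to the singularity. -/
def gDens (Ψ Y : ℝ → ℝ → ℝ) (x : ℝ × ℝ) : ℝ :=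
  dr (rUSq Ψ Y) x / (2 * Y x.1 x.2 * (rUSq Ψ Y x * √(rUSq Ψ Y x)))

variable {Ψ Y : ℝ → ℝ → ℝ} {rb α ξ r R : ℝ}

theorem u_eq (hR : 0 < R) : u Ψ Y r R = √(rUSq Ψ Y (r, R) / R) := by
  rw [u, uSq, rUSq]
  congr 1
  field_simp
  ring

theorem mul_uSq (hR : 0 < R) : R * uSq Ψ Y r R = rUSq Ψ Y (r, R) := by
  rw [uSq, rUSq]; field_simp; ring

theorem eventually_region (h0 : 0 < R) (h1 : R < r) (h2 : r < rb) :
    ∀ᶠ x : ℝ × ℝ in 𝓝 (r, R), 0 < x.2 ∧ x.2 < x.1 ∧ x.1 < rb := by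
  have : IsOpen {x : ℝ × ℝ | 0 < x.2 ∧ x.2 < x.1 ∧ x.1 < rb} :=
    (isOpen_lt continuous_const continuous_snd).inter
      ((isOpen_lt continuous_snd continuous_fst).inter (isOpen_lt continuous_fst continuous_const))
  exact this.mem_nhds ⟨h0, h1, h2⟩

theorem sqrt_rUSq (h0 : 0 < R) :
    √(rUSq Ψ Y (r, R)) = √R * u Ψ Y r R := by
  rw [u_eq h0, ← Real.sqrt_mul h0.le]
  congr 1
  field_simp

namespace IsCollapse

variable (H : IsCollapse Ψ Y rb α ξ)
include H

theorem contDiffAt_rUSq (h0 : 0 ≤ R) (h1 : R ≤ r) (h2 : r < rb) :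
    ContDiffAt ℝ 3 (rUSq Ψ Y) (r, R) := by
  have hY := H.contDiff_Y r R h0 h1 h2
  have hΨ := H.contDiff_Psi r R h0 h1 h2
  exact (contDiffAt_snd.mul ((hY.pow 2).sub contDiffAt_const)).add (contDiffAt_const.mul hΨ)

theorem rUSq_pos (h0 : 0 ≤ R) (h1 : R ≤ r) (hr : 0 < r) (h2 : r < rb) :
    0 < rUSq Ψ Y (r, R) := by
  rcases h0.eq_or_lt with rfl | h0
  · have := H.Psi_pos r 0 le_rfl h1 hr h2
    simp only [rUSq, zero_mul, zero_add]
    positivity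
  · rw [← mul_uSq h0]
    exact mul_pos h0 (H.uSq_pos r R h0 h1 h2)

theorem u_pos (h0 : 0 < R) (h1 : R ≤ r) (h2 : r < rb) : 0 < u Ψ Y r R :=
  Real.sqrt_pos.2 (H.uSq_pos r R h0 h1 h2)

theorem u_sq (h0 : 0 < R) (h1 : R ≤ r) (h2 : r < rb) :
    u Ψ Y r R ^ 2 = Y r R ^ 2 + 2 * Ψ r R / R - 1 :=
  Real.sq_sqrt (H.uSq_pos r R h0 h1 h2).le

theorem contDiffAt_gDens (h0 : 0 ≤ R) (h1 : R ≤ r) (hr : 0 < r) (h2 : r < rb) :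
    ContDiffAt ℝ 1 (gDens Ψ Y) (r, R) := by
  have hP := H.contDiffAt_rUSq h0 h1 h2
  have hp := H.rUSq_pos h0 h1 hr h2
  have hY0 := H.Y_pos r R h0 h1 h2
  have hY := (H.contDiff_Y r R h0 h1 h2).of_le (m := 1) (by norm_num)
  have hP1 := hP.of_le (m := 1) (by norm_num)
  exact (contDiffAt_dr hP (by norm_num)).div
    ((contDiffAt_const.mul hY).mul (hP1.mul (hP1.sqrt hp.ne')))
    (by positivity)

theorem contDiffAt_u (h0 : 0 < R) (h1 : R ≤ r) (h2 : r < rb) :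
    ContDiffAt ℝ 3 (fun x : ℝ × ℝ => u Ψ Y x.1 x.2) (r, R) := by
  have hP := H.contDiffAt_rUSq h0.le h1 h2
  have hp := H.rUSq_pos h0.le h1 (h0.trans_le h1) h2
  refine ((hP.div contDiffAt_snd h0.ne').sqrt (div_pos hp h0 |>.ne')).congr_of_eventuallyEq ?_
  filter_upwards [(continuous_snd.isOpen_preimage _ isOpen_Ioi).mem_nhds
    (show ((r, R) : ℝ × ℝ) ∈ Prod.snd ⁻¹' Ioi (0 : ℝ) from h0)] with x hx
  exact u_eq hx

theorem hasDerivAt_u_sq (h0 : 0 < R) (h1 : R ≤ r) (h2 : r < rb) :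
    2 * u Ψ Y r R * dr (fun x : ℝ × ℝ => u Ψ Y x.1 x.2) (r, R) * R = dr (rUSq Ψ Y) (r, R) := by
  have h := hasDerivAt_dr ((H.contDiffAt_u h0 h1 h2).differentiableAt (by simp))
  have h' := hasDerivAt_dr ((H.contDiffAt_rUSq h0.le h1 h2).differentiableAt (by simp))
  refine (((h.pow 2).mul_const R).congr_deriv (by simp)).unique (h'.congr_of_eventuallyEq ?_)
  have hev : ∀ᶠ x : ℝ × ℝ in 𝓝 (r, R), 0 < uSq Ψ Y x.1 x.2 := by
    have hc := (H.contDiffAt_rUSq h0.le h1 h2).continuousAt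
    have hp := H.rUSq_pos h0.le h1 (h0.trans_le h1) h2
    have hs : Tendsto Prod.snd (𝓝 (r, R)) (𝓝 R) := continuous_snd.tendsto (r, R)
    filter_upwards [hc.eventually (lt_mem_nhds hp), hs.eventually (lt_mem_nhds h0)] with x hx hx2
    have e : x.2 * uSq Ψ Y x.1 x.2 = rUSq Ψ Y x := mul_uSq hx2
    rw [← e] at hx
    exact pos_of_mul_pos_right hx hx2.le
  have hc : Tendsto (fun s : ℝ => (s, R)) (𝓝 r) (𝓝 (r, R)) := Continuous.tendsto (by fun_prop) r
  filter_upwards [hc.eventually hev] with s hs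
  simp only [Pi.pow_apply] at hs ⊢
  rw [u, Real.sq_sqrt hs.le, ← mul_uSq h0]
  ring

theorem dr_u (h0 : 0 < R) (h1 : R ≤ r) (h2 : r < rb) :
    dr (fun x : ℝ × ℝ => u Ψ Y x.1 x.2) (r, R) =
      u Ψ Y r R * (u Ψ Y r R * Y r R * (√R * gDens Ψ Y (r, R))) := by
  have hu := H.u_pos h0 h1 h2
  have hY := H.Y_pos r R h0.le h1 h2
  have hP : rUSq Ψ Y (r, R) = R * u Ψ Y r R ^ 2 := by
    rw [u, Real.sq_sqrt (H.uSq_pos r R h0 h1 h2).le, mul_uSq h0]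
  rw [gDens, ← H.hasDerivAt_u_sq h0 h1 h2, sqrt_rUSq h0, hP]
  have := Real.sqrt_pos.2 h0
  simp only
  field_simp

/-- The integrand of `G` is -√R times a function that is C¹ up to R = 0 for r > 0; the square root
carries the whole singular behaviour of u. -/
theorem deriv_inv_u (h0 : 0 < R) (h1 : R ≤ r) (h2 : r < rb) :
    1 / Y r R * deriv (fun ρ => 1 / u Ψ Y ρ R) r = -(√R * gDens Ψ Y (r, R)) := by
  have hu := H.u_pos h0 h1 h2
  have hY := H.Y_pos r R h0.le h1 h2
  have h := hasDerivAt_dr ((H.contDiffAt_u h0 h1 h2).differentiableAt (by simp))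
  have h' : HasDerivAt (fun ρ => 1 / u Ψ Y ρ R)
      (-(dr (fun x : ℝ × ℝ => u Ψ Y x.1 x.2) (r, R)) / u Ψ Y r R ^ 2) r := by
    simp only [one_div]
    exact h.inv hu.ne'
  rw [h'.deriv, H.dr_u h0 h1 h2]
  field_simp

theorem continuousOn_sqrt_gDens (hr : 0 < r) (h2 : r < rb) :
    ContinuousOn (fun σ => √σ * gDens Ψ Y (r, σ)) (Icc 0 r) := fun σ hσ =>
  (Real.continuous_sqrt.continuousAt.mul (ContinuousAt.comp (g := gDens Ψ Y)
    (f := fun s : ℝ => (r, s)) (H.contDiffAt_gDens hσ.1 hσ.2 hr h2).continuousAt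
    (by fun_prop))).continuousWithinAt

theorem G_eq (h0 : 0 ≤ R) (h1 : R ≤ r) (hr : 0 < r) (h2 : r < rb) :
    G Ψ Y r R = 1 / (Y r r * u Ψ Y r r) - sqrtInt (gDens Ψ Y) (r, r)
      + sqrtInt (gDens Ψ Y) (r, R) := by
  have e1 : (∫ σ in R..r, 1 / Y r σ * deriv (fun ρ => 1 / u Ψ Y ρ σ) r) =
      ∫ σ in R..r, -(√σ * gDens Ψ Y (r, σ)) := by
    -- Equality on the open interval suffices, which avoids σ = 0, where u has no geometric meaning.
    refine intervalIntegral.integral_congr_uIoo ?_ |>.trans rfl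
    intro σ hσ
    rw [uIoo_of_le h1] at hσ
    exact H.deriv_inv_u (h0.trans_lt hσ.1) hσ.2.le h2
  have hc := H.continuousOn_sqrt_gDens hr h2
  have e2 := intervalIntegral.integral_add_adjacent_intervals
    ((hc.mono (Icc_subset_Icc_right h1)).intervalIntegrable_of_Icc (μ := MeasureTheory.volume) h0)
    ((hc.mono (Icc_subset_Icc_left h0)).intervalIntegrable_of_Icc (μ := MeasureTheory.volume) h1)
  rw [G, e1, intervalIntegral.integral_neg]
  simp only [sqrtInt]
  linarith

theorem G_eq_G_zero (h0 : 0 ≤ R) (h1 : R ≤ r) (hr : 0 < r) (h2 : r < rb) :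
    G Ψ Y r R = G Ψ Y r 0 + sqrtInt (gDens Ψ Y) (r, R) := by
  rw [H.G_eq h0 h1 hr h2, H.G_eq le_rfl hr.le hr h2]
  simp [sqrtInt]

theorem contDiffAt_G (h0 : 0 < R) (h1 : R < r) (h2 : r < rb) :
    ContDiffAt ℝ 1 (fun x : ℝ × ℝ => G Ψ Y x.1 x.2) (r, R) := by
  have hr := h0.trans h1
  have hdiag : ContDiffAt ℝ 1 (fun x : ℝ × ℝ => (x.1, x.1)) (r, R) := by fun_prop
  have hY := (H.contDiff_Y r r hr.le le_rfl h2).of_le (m := 1) (by norm_num)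
  have hu := (H.contDiffAt_u hr le_rfl h2).of_le (m := 1) (by norm_num)
  have hI := contDiffAt_sqrtInt (f := gDens Ψ Y) hr
    fun σ hσ => H.contDiffAt_gDens hσ.1 hσ.2 hr h2
  have hI' := contDiffAt_sqrtInt (f := gDens Ψ Y) h0
    fun σ hσ => H.contDiffAt_gDens hσ.1 (hσ.2.trans h1.le) hr h2
  have hY' : ContDiffAt ℝ 1 (fun x : ℝ × ℝ => Y x.1 x.1) (r, R) :=
    ContDiffAt.comp (g := fun x : ℝ × ℝ => Y x.1 x.2) (f := fun x : ℝ × ℝ => (x.1, x.1)) _ hY hdiag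
  have hu' : ContDiffAt ℝ 1 (fun x : ℝ × ℝ => u Ψ Y x.1 x.1) (r, R) :=
    ContDiffAt.comp (g := fun x : ℝ × ℝ => u Ψ Y x.1 x.2) (f := fun x : ℝ × ℝ => (x.1, x.1)) _
      hu hdiag
  have hI2 : ContDiffAt ℝ 1 (fun x : ℝ × ℝ => sqrtInt (gDens Ψ Y) (x.1, x.1)) (r, R) :=
    ContDiffAt.comp (g := sqrtInt (gDens Ψ Y)) (f := fun x : ℝ × ℝ => (x.1, x.1)) _ hI hdiag
  have h3 := H.Y_pos r r hr.le le_rfl h2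
  have h4 := H.u_pos hr le_rfl h2
  refine ((((contDiffAt_const (c := (1 : ℝ))).div (hY'.mul hu') (by positivity)).sub hI2).add
    hI').congr_of_eventuallyEq ?_
  filter_upwards [eventually_region h0 h1 h2] with x hx
  exact H.G_eq hx.1.le hx.2.1.le (hx.1.trans hx.2.1) hx.2.2

theorem dR_G (h0 : 0 < R) (h1 : R < r) (h2 : r < rb) :
    dR (fun x : ℝ × ℝ => G Ψ Y x.1 x.2) (r, R) = √R * gDens Ψ Y (r, R) := by
  have hr := h0.trans h1
  have h := hasDerivAt_dR ((H.contDiffAt_G h0 h1 h2).differentiableAt (by simp))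
  have hg : ∀ σ ∈ Icc 0 R, ContDiffAt ℝ 1 (gDens Ψ Y) (r, σ) :=
    fun σ hσ => H.contDiffAt_gDens hσ.1 (hσ.2.trans h1.le) hr h2
  have h' := hasDerivAt_dR ((contDiffAt_sqrtInt h0 hg).differentiableAt (by simp))
  rw [dR_sqrtInt h0 hg] at h'
  refine h.unique ((h'.const_add (G Ψ Y r 0)).congr_of_eventuallyEq ?_)
  filter_upwards [Ioo_mem_nhds h0 h1] with s hs
  exact H.G_eq_G_zero hs.1.le hs.2.le hr h2

theorem dR_u (h0 : 0 < R) (h1 : R ≤ r) (h2 : r < rb) :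
    dR (fun x : ℝ × ℝ => u Ψ Y x.1 x.2) (r, R) =
      u Ψ Y r R / 2 * (dR (rUSq Ψ Y) (r, R) / rUSq Ψ Y (r, R) - 1 / R) := by
  have h := hasDerivAt_dR ((H.contDiffAt_u h0 h1 h2).differentiableAt (by simp))
  have h' := hasDerivAt_dR ((H.contDiffAt_rUSq h0.le h1 h2).differentiableAt (by simp))
  have hp := H.rUSq_pos h0.le h1 (h0.trans_le h1) h2
  have h3 := (h'.div (hasDerivAt_id R) h0.ne').sqrt (div_pos hp h0).ne'
  refine h.unique ((h3.congr_deriv ?_).congr_of_eventuallyEq ?_)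
  · have hu := H.u_pos h0 h1 h2
    simp only [id, Pi.div_apply]
    rw [← u_eq h0]
    have hP : rUSq Ψ Y (r, R) = R * u Ψ Y r R ^ 2 := by
      rw [u, Real.sq_sqrt (H.uSq_pos r R h0 h1 h2).le, mul_uSq h0]
    rw [hP]
    field_simp
  · filter_upwards [Ioi_mem_nhds h0] with s hs
    exact u_eq hs

end IsCollapse

end Collapse
end

/-! ### Expansions of the data as r → 0 and R/r → 0 -/

noncomputable section
namespace Collapse

/-- The approach `r → 0`, `R / r → 0` to the central singularity. -/
def cone : Filter (ℝ × ℝ) :=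
  comap Prod.fst (𝓝[>] 0) ⊓ comap (fun x => x.2 / x.1) (𝓝[>] 0)

theorem eventually_cone {p : ℝ × ℝ → Prop} : (∀ᶠ x in cone, p x) ↔
    ∃ η > 0, ∀ r R, 0 < r → r < η → 0 < R → R < η * r → p (r, R) := by
  have hb : (𝓝[>] (0 : ℝ)).HasBasis (fun η : ℝ => 0 < η) (fun η => Ioo 0 η) :=
    nhdsGT_basis 0
  rw [cone, ((hb.comap Prod.fst).inf (hb.comap (fun x : ℝ × ℝ => x.2 / x.1))).eventually_iff]
  constructor
  · rintro ⟨⟨a, b⟩, ⟨ha, hb⟩, h⟩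
    simp only at ha hb
    refine ⟨min a b, by positivity, fun r R hr hra hR hRb => h ⟨⟨hr, hra.trans_le (min_le_left _ _)⟩,
      show 0 < R / r by positivity, ?_⟩⟩
    rw [div_lt_iff₀ hr]
    exact hRb.trans_le (mul_le_mul_of_nonneg_right (min_le_right _ _) hr.le)
  · rintro ⟨η, hη, h⟩
    refine ⟨⟨η, η⟩, ⟨hη, hη⟩, ?_⟩
    rintro ⟨r, R⟩ ⟨⟨h1, h2⟩, h3, h4⟩
    simp only at h1 h2 h3 h4
    have hR : 0 < R := by
      have := mul_pos h3 h1
      rwa [div_mul_cancel₀ _ h1.ne'] at this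
    exact h r R h1 h2 hR ((div_lt_iff₀ h1).1 h4)

theorem tendsto_cone {ι : Type*} {l : Filter ι} {f : ι → ℝ × ℝ} : Tendsto f l cone ↔
    Tendsto (fun i => (f i).1) l (𝓝[>] 0) ∧ Tendsto (fun i => (f i).2 / (f i).1) l (𝓝[>] 0) := by
  rw [cone, tendsto_inf, tendsto_comap_iff, tendsto_comap_iff]
  rfl

theorem tendsto_fst_cone : Tendsto Prod.fst cone (𝓝[>] (0 : ℝ)) := (tendsto_cone.1 tendsto_id).1

theorem tendsto_ratio_cone : Tendsto (fun x : ℝ × ℝ => x.2 / x.1) cone (𝓝 0) :=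
  (tendsto_cone.1 tendsto_id).2.mono_right nhdsWithin_le_nhds

theorem eventually_cone_region {b : ℝ} (hb : 0 < b) :
    ∀ᶠ x : ℝ × ℝ in cone, 0 < x.2 ∧ x.2 < x.1 ∧ x.1 < b := by
  refine eventually_cone.2 ⟨min 1 b, by positivity, fun r R hr h1 hR h2 => ⟨hR, ?_, ?_⟩⟩
  · exact h2.trans_le (mul_le_of_le_one_left hr.le (min_le_left _ _))
  · exact h1.trans_le (min_le_right _ _)

theorem cone_le_nhds : cone ≤ 𝓝 (0 : ℝ × ℝ) := by
  have h1 : Tendsto Prod.fst cone (𝓝 (0 : ℝ)) :=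
    tendsto_fst_cone.mono_right nhdsWithin_le_nhds
  have h2 : Tendsto Prod.snd cone (𝓝 (0 : ℝ)) := by
    have := h1.mul tendsto_ratio_cone
    rw [mul_zero] at this
    refine this.congr' ?_
    filter_upwards [eventually_cone_region one_pos] with x hx
    have : x.1 ≠ 0 := (hx.1.trans hx.2.1).ne'
    field_simp
  exact (h1.prodMk_nhds h2)

theorem tendsto_cone_zero_of_small {D w : ℝ × ℝ → ℝ} (hw : ∀ᶠ x in cone, 0 < w x)
    (h : ∀ ε > 0, ∀ᶠ x in cone, |D x| ≤ ε * w x) :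
    Tendsto (fun x => D x / w x) cone (𝓝 0) := by
  rw [Metric.tendsto_nhds]
  intro ε hε
  filter_upwards [hw, h (ε / 2) (by positivity)] with x h1 h2
  rw [Real.dist_eq, sub_zero, abs_div, abs_of_pos h1, div_lt_iff₀ h1]
  have := mul_pos hε h1
  linarith

theorem integral_sqrt : ∫ s in (0 : ℝ)..1, √s = 2 / 3 := by
  simp_rw [Real.sqrt_eq_rpow]
  rw [integral_rpow (Or.inl (by norm_num))]
  norm_num

/-- Asymptotics of `∫₀^R √σ f(r,σ) dσ` near the central singularity. -/
theorem tendsto_sqrtInt {f : ℝ × ℝ → ℝ} {w : ℝ → ℝ} {c b : ℝ} (hb : 0 < b)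
    (hf : ∀ r σ, 0 ≤ σ → σ ≤ r → 0 < r → r < b → ContinuousAt f (r, σ))
    (h : Tendsto (fun x => f x * w x.1) cone (𝓝 c)) :
    Tendsto (fun x => sqrtInt f x * w x.1 / (x.2 * √x.2)) cone (𝓝 (2 / 3 * c)) := by
  rw [Metric.tendsto_nhds] at h ⊢
  intro ε hε
  obtain ⟨η, hη, H⟩ := eventually_cone.1 (h (ε / 2) (by positivity))
  refine eventually_cone.2 ⟨min η (min 1 b), by positivity, fun r R hr h1 hR h2 => ?_⟩
  have hRη : R < η * r := h2.trans_le (mul_le_mul_of_nonneg_right (min_le_left _ _) hr.le)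
  have hRr : R < r := h2.trans_le (mul_le_of_le_one_left hr.le
    ((min_le_right _ _).trans (min_le_left _ _)))
  have hrη : r < η := h1.trans_le (min_le_left _ _)
  have hrb : r < b := h1.trans_le ((min_le_right _ _).trans (min_le_right _ _))
  have hRs := Real.sqrt_pos.2 hR
  have hc : ContinuousOn (fun s => √s * f (r, R * s)) (Icc 0 1) := fun s hs =>
    (Real.continuous_sqrt.continuousAt.mul (ContinuousAt.comp (g := f)
      (f := fun s : ℝ => (r, R * s)) (hf r (R * s) (mul_nonneg hR.le hs.1)
      ((mul_le_of_le_one_right hR.le hs.2).trans hRr.le) hr hrb) (by fun_prop))).continuousWithinAt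
  have hi := hc.intervalIntegrable_of_Icc (μ := MeasureTheory.volume) zero_le_one
  have hs : IntervalIntegrable (fun s => √s) MeasureTheory.volume 0 1 :=
    Real.continuous_sqrt.intervalIntegrable 0 1
  have e : sqrtInt f (r, R) * w r / (R * √R) - 2 / 3 * c =
      ∫ s in (0 : ℝ)..1, (√s * f (r, R * s) * w r - √s * c) := by
    rw [intervalIntegral.integral_sub (hi.mul_const _) (hs.mul_const _),
      intervalIntegral.integral_mul_const, intervalIntegral.integral_mul_const, integral_sqrt,
      sqrtInt_eq (x := (r, R)) hR]
    field_simp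
  rw [Real.dist_eq]
  simp only
  rw [e, ← Real.norm_eq_abs]
  have : ‖∫ s in (0 : ℝ)..1, (√s * f (r, R * s) * w r - √s * c)‖ ≤ ε / 2 * |1 - 0| := by
    refine intervalIntegral.norm_integral_le_of_norm_le_const fun s hs => ?_
    rw [uIoc_of_le zero_le_one] at hs
    have hRs : R * s ≤ R := mul_le_of_le_one_right hR.le hs.2
    have := H r (R * s) hr hrη (mul_pos hR hs.1) (hRs.trans_lt hRη)
    rw [Real.dist_eq] at this
    have h1 : √s ≤ 1 := Real.sqrt_le_one.2 hs.2
    rw [mul_assoc, ← mul_sub, norm_mul, Real.norm_eq_abs, Real.norm_eq_abs,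
      abs_of_nonneg (Real.sqrt_nonneg s)]
    calc _ ≤ 1 * (ε / 2) := mul_le_mul h1 this.le (abs_nonneg _) zero_le_one
      _ = _ := one_mul _
  refine this.trans_lt ?_
  norm_num
  exact hε

namespace IsCollapse

variable {Ψ Y : ℝ → ℝ → ℝ} {rb α ξ r R : ℝ} (H : IsCollapse Ψ Y rb α ξ)
include H

/-- The expansions of `R u²` and of its partial derivatives at the central singularity. -/
theorem tendsto_rUSq : Tendsto (fun x => rUSq Ψ Y x / x.1 ^ 3) cone (𝓝 α) ∧
    Tendsto (fun x => dr (rUSq Ψ Y) x / x.1 ^ 2) cone (𝓝 (3 * α)) ∧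
    ∃ β, Tendsto (fun x => dR (rUSq Ψ Y) x / x.1 ^ 2) cone (𝓝 β) := by
  obtain ⟨β, γ, δ, h⟩ := H.taylor
  set c : ℝ × ℝ → ℝ := fun x =>
    α * x.1 ^ 3 + β * x.1 ^ 2 * x.2 + γ * x.1 * x.2 ^ 2 + δ * x.2 ^ 3 with hc
  have hcs : ContDiff ℝ 3 c := by fun_prop
  have hP0 : ContDiffAt ℝ 3 (rUSq Ψ Y) 0 := H.contDiffAt_rUSq le_rfl le_rfl H.rb_pos
  -- The remainder is C³ and o(r³) in the cone, so `fderiv_small_of_cone` turns the expansion of the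
  -- function into expansions of its first derivatives.
  set D : ℝ × ℝ → ℝ := fun x => rUSq Ψ Y x - c x with hD
  have hD0 : ContDiffAt ℝ 3 D 0 := hP0.sub hcs.contDiffAt
  have hsmall : ∀ ε > 0, ∃ η > 0, ∀ r R, 0 < R → R ≤ r → r < η → |D (r, R)| ≤ ε * r ^ 3 := by
    intro ε hε
    have h1 := (Asymptotics.isLittleO_iff.1 h) (show 0 < ε / 8 by positivity)
    rw [eventually_nhdsWithin_iff] at h1
    obtain ⟨η, hη, h2⟩ := Metric.eventually_nhds_iff.1 h1
    refine ⟨η, hη, fun r R hR hRr hr => ?_⟩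
    have hr0 : 0 < r := hR.trans_le hRr
    have h3 := h2 (y := (r, R)) (by
      rw [Prod.dist_eq, max_lt_iff]
      simp only [Real.dist_eq, sub_zero]
      rw [abs_of_pos hr0, abs_of_pos hR]
      exact ⟨hr, hRr.trans_lt hr⟩) ⟨hR, hRr⟩
    simp only [Real.norm_eq_abs] at h3
    rw [mul_uSq hR] at h3
    have h4 : (r ^ 2 + R ^ 2) ^ (3 / 2 : ℝ) ≤ 8 * r ^ 3 := by
      calc (r ^ 2 + R ^ 2) ^ (3 / 2 : ℝ) ≤ ((2 * r) ^ 2) ^ (3 / 2 : ℝ) := by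
            refine Real.rpow_le_rpow (by positivity) ?_ (by norm_num)
            nlinarith
        _ = (2 * r) ^ 3 := by
            rw [← Real.rpow_natCast, ← Real.rpow_mul (by positivity), ← Real.rpow_natCast]
            norm_num
        _ = _ := by ring
    rw [abs_of_nonneg (show 0 ≤ (r ^ 2 + R ^ 2) ^ (3 / 2 : ℝ) by positivity)] at h3
    refine h3.trans ?_
    calc ε / 8 * (r ^ 2 + R ^ 2) ^ (3 / 2 : ℝ) ≤ ε / 8 * (8 * r ^ 3) := by gcongr
      _ = _ := by ring
  have hρ := tendsto_ratio_cone
  have hreg := eventually_cone_region (b := 1) one_pos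
  have hdiff : ∀ᶠ x in cone, DifferentiableAt ℝ (rUSq Ψ Y) x :=
    cone_le_nhds ((hP0.eventually (by simp)).mono fun x hx => hx.differentiableAt (by simp))
  have hdrD : ∀ᶠ x in cone, dr (rUSq Ψ Y) x = dr D x + dr c x ∧
      dR (rUSq Ψ Y) x = dR D x + dR c x := by
    filter_upwards [hdiff] with x hx
    have : fderiv ℝ D x = fderiv ℝ (rUSq Ψ Y) x - fderiv ℝ c x :=
      fderiv_sub hx (hcs.differentiable (by simp) x)
    simp [dr, dR, this]
  have hdrc : ∀ x, dr c x = 3 * α * x.1 ^ 2 + 2 * β * x.1 * x.2 + γ * x.2 ^ 2 := by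
    rintro ⟨r, R⟩
    have h1 := hasDerivAt_dr (hcs.differentiable (by simp) (r, R))
    have h2 := ((((hasDerivAt_id r).pow 3).const_mul α).add
      ((((hasDerivAt_id r).pow 2).const_mul β).mul_const R)).add
      (((hasDerivAt_id r).const_mul γ).mul_const (R ^ 2)) |>.add_const (δ * R ^ 3)
    refine h1.unique (h2.congr_deriv ?_)
    simp; ring
  have hdRc : ∀ x, dR c x = β * x.1 ^ 2 + 2 * γ * x.1 * x.2 + 3 * δ * x.2 ^ 2 := by
    rintro ⟨r, R⟩
    have h1 := hasDerivAt_dR (hcs.differentiable (by simp) (r, R))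
    have h2 := ((((hasDerivAt_id R).const_mul (β * r ^ 2)).const_add (α * r ^ 3)).add
      (((hasDerivAt_id R).pow 2).const_mul (γ * r))).add (((hasDerivAt_id R).pow 3).const_mul δ)
    refine h1.unique (h2.congr_deriv ?_)
    simp; ring
  have hDr : ∀ ε > 0, ∀ᶠ x : ℝ × ℝ in cone, |dr D x| ≤ ε * x.1 ^ 2 ∧ |dR D x| ≤ ε * x.1 ^ 2 := by
    intro ε hε
    obtain ⟨η, hη, h⟩ := fderiv_small_of_cone hD0 hsmall hε
    refine eventually_cone.2 ⟨min η (1 / 4), by positivity, fun r R hr h1 hR h2 =>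
      h r R hR ?_ (h1.trans_le (min_le_left _ _))⟩
    have := mul_le_mul_of_nonneg_right (min_le_right η (1 / 4)) hr.le
    linarith
  refine ⟨?_, ?_, β, ?_⟩
  · have h1 : Tendsto (fun x => D x / x.1 ^ 3) cone (𝓝 0) := by
      refine tendsto_cone_zero_of_small ?_ fun ε hε => ?_
      · filter_upwards [hreg] with x hx
        have := hx.1.trans hx.2.1
        positivity
      · obtain ⟨η, hη, h⟩ := hsmall ε hε
        refine eventually_cone.2 ⟨min η 1, by positivity, fun r R hr h1 hR h2 =>
          h r R hR ?_ (h1.trans_le (min_le_left _ _))⟩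
        exact h2.le.trans (mul_le_of_le_one_left hr.le (min_le_right _ _))
    have h2 := ((h1.add_const α).add (hρ.const_mul β)).add
      ((hρ.pow 2).const_mul γ) |>.add ((hρ.pow 3).const_mul δ)
    simp only [mul_zero, add_zero, zero_add, ne_eq, OfNat.ofNat_ne_zero, not_false_eq_true,
      zero_pow] at h2
    refine h2.congr' ?_
    filter_upwards [hreg] with x hx
    have := hx.1.trans hx.2.1
    simp only [hD, hc]
    field_simp
    ring
  · have h1 : Tendsto (fun x => dr D x / x.1 ^ 2) cone (𝓝 0) := by
      refine tendsto_cone_zero_of_small ?_ fun ε hε => (hDr ε hε).mono fun x hx => hx.1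
      filter_upwards [hreg] with x hx
      have := hx.1.trans hx.2.1
      positivity
    have h2 := ((h1.add_const (3 * α)).add (hρ.const_mul (2 * β))).add ((hρ.pow 2).const_mul γ)
    simp only [mul_zero, add_zero, zero_add, ne_eq, OfNat.ofNat_ne_zero, not_false_eq_true,
      zero_pow] at h2
    refine h2.congr' ?_
    filter_upwards [hreg, hdrD] with x hx hx'
    have := hx.1.trans hx.2.1
    rw [hx'.1, hdrc]
    field_simp
    ring
  · have h1 : Tendsto (fun x => dR D x / x.1 ^ 2) cone (𝓝 0) := by
      refine tendsto_cone_zero_of_small ?_ fun ε hε => (hDr ε hε).mono fun x hx => hx.2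
      filter_upwards [hreg] with x hx
      have := hx.1.trans hx.2.1
      positivity
    have h2 := ((h1.add_const β).add (hρ.const_mul (2 * γ))).add ((hρ.pow 2).const_mul (3 * δ))
    simp only [mul_zero, add_zero, zero_add, ne_eq, OfNat.ofNat_ne_zero, not_false_eq_true,
      zero_pow] at h2
    refine h2.congr' ?_
    filter_upwards [hreg, hdrD] with x hx hx'
    have := hx.1.trans hx.2.1
    rw [hx'.2, hdRc]
    field_simp
    ring

theorem tendsto_Y : Tendsto (fun x : ℝ × ℝ => Y x.1 x.2) cone (𝓝 1) := by
  have := (H.contDiff_Y 0 0 le_rfl le_rfl H.rb_pos).continuousAt.tendsto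
  rw [H.Y_centre] at this
  exact this.mono_left cone_le_nhds

/-- From R u² ~ α r³ and ∂_r(R u²) ~ 3α r² with Y → 1, the density behaves like 3α r² / (2 (α
r³)^{3/2}). -/
theorem tendsto_gDens : Tendsto (fun x : ℝ × ℝ => gDens Ψ Y x * (x.1 ^ 2 * √x.1)) cone
    (𝓝 (3 / (2 * √α))) := by
  obtain ⟨h1, h2, -⟩ := H.tendsto_rUSq
  have hα := H.alpha_pos
  have hs := Real.sqrt_pos.2 hα
  have h3 := h2.div ((H.tendsto_Y.const_mul 2).mul (h1.mul h1.sqrt)) (by positivity)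
  have e : 3 * α / (2 * 1 * (α * √α)) = 3 / (2 * √α) := by field_simp
  rw [e] at h3
  refine h3.congr' ?_
  filter_upwards [eventually_cone_region H.rb_pos] with ⟨r, R⟩ ⟨hx0, hx1, hx2⟩
  simp only at hx0 hx1 hx2 ⊢
  have hr := hx0.trans hx1
  have hp := H.rUSq_pos hx0.le hx1.le hr hx2
  have hY := H.Y_pos r R hx0.le hx1.le hx2
  have hps := Real.sqrt_pos.2 hp
  have hrs := Real.sqrt_pos.2 hr
  have e1 : √(r ^ 3) = r * √r := by
    rw [show r ^ 3 = r ^ 2 * r by ring, Real.sqrt_mul (by positivity), Real.sqrt_sq hr.le]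
  simp only [Pi.div_apply, gDens]
  rw [Real.sqrt_div hp.le, e1]
  field_simp

theorem tendsto_G_zero : Tendsto (fun r => G Ψ Y r 0 / r ^ 2) (𝓝[>] 0) (𝓝 ξ) := by
  have h := H.G_zero.tendsto_div_nhds_zero.add_const ξ
  rw [zero_add] at h
  refine h.congr' ?_
  filter_upwards [self_mem_nhdsWithin] with r hr
  have : (0 : ℝ) < r := hr
  field_simp
  ring

theorem tendsto_sqrtInt_gDens : Tendsto (fun x : ℝ × ℝ =>
    sqrtInt (gDens Ψ Y) x * (x.1 ^ 2 * √x.1) / (x.2 * √x.2)) cone (𝓝 (1 / √α)) := by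
  have h := tendsto_sqrtInt (w := fun r => r ^ 2 * √r) H.rb_pos
    (fun r σ h0 h1 hr h2 => (H.contDiffAt_gDens h0 h1 hr h2).continuousAt) H.tendsto_gDens
  have hs := Real.sqrt_pos.2 H.alpha_pos
  convert h using 2
  field_simp

end IsCollapse

end Collapse
end

/-! ### Limits in the cubic scaling, and the planar field of light rays -/

noncomputable section
namespace Collapse

/-- The approach `R ~ (α / v²) r³` to the central singularity. -/
def scaling (α v : ℝ) : Filter (ℝ × ℝ) :=
  cone ⊓ comap (fun x => x.2 / x.1 ^ 3) (𝓝 (α / v ^ 2))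

theorem scaling_le_cone (α v : ℝ) : scaling α v ≤ cone := inf_le_left

theorem tendsto_scaling {ι : Type*} {l : Filter ι} {f : ι → ℝ × ℝ} {α v : ℝ} (hα : 0 < α)
    (hv : 0 < v) : Tendsto f l (scaling α v) ↔ Tendsto (fun i => (f i).1) l (𝓝[>] 0) ∧
      Tendsto (fun i => (f i).2 / (f i).1 ^ 3) l (𝓝 (α / v ^ 2)) := by
  rw [scaling, tendsto_inf, tendsto_comap_iff, tendsto_cone]
  refine ⟨fun h => ⟨h.1.1, h.2⟩, fun h => ⟨⟨h.1, ?_⟩, h.2⟩⟩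
  have h1 : Tendsto (fun i => (f i).1) l (𝓝 0) := h.1.mono_right nhdsWithin_le_nhds
  have h2 := h.2.mul (h1.pow 2)
  have hp : ∀ᶠ i in l, 0 < (f i).1 := h.1 self_mem_nhdsWithin
  have hp2 := h.2.eventually (lt_mem_nhds (show 0 < α / v ^ 2 by positivity))
  refine tendsto_nhdsWithin_iff.2 ⟨?_, ?_⟩
  · simp only [ne_eq, OfNat.ofNat_ne_zero, not_false_eq_true, zero_pow, mul_zero] at h2
    refine h2.congr' ?_
    filter_upwards [hp] with i hi
    field_simp
  · filter_upwards [hp, hp2] with i hi hi2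
    have := mul_pos hi2 (pow_pos hi 2)
    have e : (f i).2 / (f i).1 ^ 3 * (f i).1 ^ 2 = (f i).2 / (f i).1 := by field_simp
    rwa [e] at this

/-- The speed `dR/dr = kSpeed · (Y - u q)` of light rays involves `u G`. -/
def kSpeed (Ψ Y : ℝ → ℝ → ℝ) (x : ℝ × ℝ) : ℝ := u Ψ Y x.1 x.2 * G Ψ Y x.1 x.2

/-- The partial derivative `∂_R (u G)`. -/
def kSpeedR (Ψ Y : ℝ → ℝ → ℝ) (x : ℝ × ℝ) : ℝ :=
  dR (fun x => u Ψ Y x.1 x.2) x * G Ψ Y x.1 x.2 + u Ψ Y x.1 x.2 * (√x.2 * gDens Ψ Y x)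

namespace IsCollapse

variable {Ψ Y : ℝ → ℝ → ℝ} {rb α ξ r R v : ℝ} (H : IsCollapse Ψ Y rb α ξ)
include H

theorem dR_kSpeed (h0 : 0 < R) (h1 : R < r) (h2 : r < rb) :
    dR (kSpeed Ψ Y) (r, R) = kSpeedR Ψ Y (r, R) := by
  have hu := (H.contDiffAt_u h0 h1.le h2).of_le (m := 1) (by norm_num)
  have hG := H.contDiffAt_G h0 h1 h2
  have h := hasDerivAt_dR ((hu.mul hG).differentiableAt (by simp))
  have h' := (hasDerivAt_dR (hu.differentiableAt (by simp))).mul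
    (hasDerivAt_dR (hG.differentiableAt (by simp)))
  rw [H.dR_G h0 h1 h2] at h'
  exact h.unique h'

theorem contDiffAt_kSpeed (h0 : 0 < R) (h1 : R < r) (h2 : r < rb) :
    ContDiffAt ℝ 1 (kSpeed Ψ Y) (r, R) :=
  ((H.contDiffAt_u h0 h1.le h2).of_le (m := 1) (by norm_num)).mul (H.contDiffAt_G h0 h1 h2)

theorem contDiffAt_kSpeedR (h0 : 0 < R) (h1 : R < r) (h2 : r < rb) :
    ContDiffAt ℝ 1 (kSpeedR Ψ Y) (r, R) := by
  have hu := H.contDiffAt_u h0 h1.le h2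
  exact ((contDiffAt_dR hu (by norm_num)).mul (H.contDiffAt_G h0 h1 h2)).add
    ((hu.of_le (m := 1) (by norm_num)).mul ((contDiffAt_snd.sqrt h0.ne').mul
      (H.contDiffAt_gDens h0.le h1.le (h0.trans h1) h2)))

theorem kSpeed_pos (h0 : 0 < R) (h1 : R < r) (h2 : r < rb) : 0 < kSpeed Ψ Y (r, R) :=
  mul_pos (H.u_pos h0 h1.le h2) (H.G_pos r R h0 h1.le h2)

/-- Divide R u² ~ α r³ by R ~ (α/v²) r³. The phase variable v is thus the limit of u, and R < 2Ψ or
R > 2Ψ is decided by v against 1. -/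
theorem tendsto_u (hv : 0 < v) :
    Tendsto (fun x : ℝ × ℝ => u Ψ Y x.1 x.2) (scaling α v) (𝓝 v) := by
  have hα := H.alpha_pos
  have h1 := H.tendsto_rUSq.1.mono_left (scaling_le_cone α v)
  have h2 : Tendsto (fun x : ℝ × ℝ => x.2 / x.1 ^ 3) (scaling α v) (𝓝 (α / v ^ 2)) :=
    ((tendsto_scaling hα hv).1 tendsto_id).2
  have h3 := (h1.div h2 (by positivity)).sqrt
  have e : α / (α / v ^ 2) = v ^ 2 := by field_simp
  rw [e, Real.sqrt_sq hv.le] at h3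
  refine h3.congr' ?_
  filter_upwards [scaling_le_cone α v (eventually_cone_region H.rb_pos)] with ⟨r, R⟩ ⟨h0, h1, h2⟩
  simp only at h0 h1 ⊢
  have := h0.trans h1
  rw [u_eq h0, Pi.div_apply]
  congr 1
  field_simp

/-- The two terms are `G` on the singularity and ∫₀^R √σ `gDens` ~ α^{-1/2} R^{3/2} r^{-5/2}. They
are both of order r² exactly when R is of order r³. -/
theorem tendsto_G (hv : 0 < v) :
    Tendsto (fun x : ℝ × ℝ => G Ψ Y x.1 x.2 / x.1 ^ 2) (scaling α v) (𝓝 (ξ + α / v ^ 3)) := by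
  have hα := H.alpha_pos
  have hs := Real.sqrt_pos.2 hα
  have h1 := H.tendsto_sqrtInt_gDens.mono_left (scaling_le_cone α v)
  have h2 : Tendsto (fun x : ℝ × ℝ => x.2 / x.1 ^ 3) (scaling α v) (𝓝 (α / v ^ 2)) :=
    ((tendsto_scaling hα hv).1 tendsto_id).2
  have h0 : Tendsto (fun x : ℝ × ℝ => G Ψ Y x.1 0 / x.1 ^ 2) (scaling α v) (𝓝 ξ) :=
    H.tendsto_G_zero.comp (tendsto_fst_cone.mono_left (scaling_le_cone α v))
  have h3 := h0.add (h1.mul (h2.mul h2.sqrt))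
  have e : ξ + 1 / √α * (α / v ^ 2 * √(α / v ^ 2)) = ξ + α / v ^ 3 := by
    rw [Real.sqrt_div hα.le, Real.sqrt_sq hv.le]
    field_simp
  rw [e] at h3
  refine h3.congr' ?_
  filter_upwards [scaling_le_cone α v (eventually_cone_region H.rb_pos)] with ⟨r, R⟩ ⟨h0, h1, h2⟩
  simp only at h0 h1 h2 ⊢
  have hr := h0.trans h1
  have hrs := Real.sqrt_pos.2 hr
  have hRs := Real.sqrt_pos.2 h0
  have e1 : √(r ^ 3) = r * √r := by
    rw [show r ^ 3 = r ^ 2 * r by ring, Real.sqrt_mul (by positivity), Real.sqrt_sq hr.le]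
  rw [H.G_eq_G_zero h0.le h1.le hr h2, Real.sqrt_div h0.le, e1]
  field_simp

theorem tendsto_r_G (hv : 0 < v) : Tendsto (fun x : ℝ × ℝ => x.1 * G Ψ Y x.1 x.2 / x.2)
    (scaling α v) (𝓝 (hLim (ξ / α) v / v)) := by
  have hα := H.alpha_pos
  have h2 : Tendsto (fun x : ℝ × ℝ => x.2 / x.1 ^ 3) (scaling α v) (𝓝 (α / v ^ 2)) :=
    ((tendsto_scaling hα hv).1 tendsto_id).2
  have h := (H.tendsto_G hv).div h2 (by positivity)
  have e : (ξ + α / v ^ 3) / (α / v ^ 2) = hLim (ξ / α) v / v := by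
    unfold hLim; field_simp; ring
  rw [e] at h
  refine h.congr' ?_
  filter_upwards [scaling_le_cone α v (eventually_cone_region H.rb_pos)] with ⟨r, R⟩ ⟨h0, h1, h2⟩
  simp only at h0 h1 h2 ⊢
  have hr := h0.trans h1
  simp only [Pi.div_apply]
  field_simp

theorem tendsto_kSpeed (hv : 0 < v) : Tendsto (fun x : ℝ × ℝ => x.1 * kSpeed Ψ Y x / x.2)
    (scaling α v) (𝓝 (hLim (ξ / α) v)) := by
  have h := (H.tendsto_u hv).mul (H.tendsto_r_G hv)
  have e : v * (hLim (ξ / α) v / v) = hLim (ξ / α) v := by field_simp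
  rw [e] at h
  refine h.congr fun x => ?_
  unfold kSpeed; ring

theorem tendsto_dR_Y : Tendsto (fun x : ℝ × ℝ => x.2 * dR (fun x => Y x.1 x.2) x) cone (𝓝 0) := by
  have h1 : Tendsto (fun x : ℝ × ℝ => x.2) cone (𝓝 0) :=
    (continuous_snd.tendsto (0 : ℝ × ℝ)).mono_left cone_le_nhds
  have h2 := (contDiffAt_dR (m := 0) (H.contDiff_Y 0 0 le_rfl le_rfl H.rb_pos)
    (by norm_num)).continuousAt.tendsto.mono_left cone_le_nhds
  simpa using h1.mul h2

/-- To leading order u is proportional to R^{-1/2} at fixed r, whence the factor -1/2. -/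
theorem tendsto_mul_dR_u (hv : 0 < v) :
    Tendsto (fun x : ℝ × ℝ => x.2 * dR (fun x => u Ψ Y x.1 x.2) x) (scaling α v) (𝓝 (-v / 2)) := by
  obtain ⟨h1, -, β, h2⟩ := H.tendsto_rUSq
  have hα := H.alpha_pos
  have h3 := ((tendsto_ratio_cone.mul (h2.div h1 hα.ne')).sub_const 1).mono_left
    (scaling_le_cone α v)
  have h4 := ((H.tendsto_u hv).div_const 2).mul h3
  have e : v / 2 * (0 * (β / α) - 1) = -v / 2 := by ring
  rw [e] at h4
  refine h4.congr' ?_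
  filter_upwards [scaling_le_cone α v (eventually_cone_region H.rb_pos)] with ⟨r, R⟩ ⟨h0, h1, h2⟩
  simp only at h0 h1 h2 ⊢
  have hr := h0.trans h1
  have hp := H.rUSq_pos h0.le h1.le hr h2
  rw [H.dR_u h0 h1.le h2]
  simp only [Pi.div_apply]
  field_simp

/-- The product rule gives -h/2 from ∂_R u and, from ∂_R G = √R `gDens`, the constant 3/2: there the
powers of v and α cancel. -/
theorem tendsto_kSpeedR (hv : 0 < v) : Tendsto (fun x : ℝ × ℝ => x.1 * kSpeedR Ψ Y x)
    (scaling α v) (𝓝 (3 / 2 - hLim (ξ / α) v / 2)) := by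
  have hα := H.alpha_pos
  have hs := Real.sqrt_pos.2 hα
  have h2 : Tendsto (fun x : ℝ × ℝ => x.2 / x.1 ^ 3) (scaling α v) (𝓝 (α / v ^ 2)) :=
    ((tendsto_scaling hα hv).1 tendsto_id).2
  have h3 := ((H.tendsto_mul_dR_u hv).mul (H.tendsto_r_G hv)).add ((H.tendsto_u hv).mul
    (h2.sqrt.mul (H.tendsto_gDens.mono_left (scaling_le_cone α v))))
  have e : -v / 2 * (hLim (ξ / α) v / v) + v * (√(α / v ^ 2) * (3 / (2 * √α))) =
      3 / 2 - hLim (ξ / α) v / 2 := by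
    rw [Real.sqrt_div hα.le, Real.sqrt_sq hv.le]
    field_simp
    ring
  rw [e] at h3
  refine h3.congr' ?_
  filter_upwards [scaling_le_cone α v (eventually_cone_region H.rb_pos)] with ⟨r, R⟩ ⟨h0, h1, h2⟩
  simp only at h0 h1 h2 ⊢
  have hr := h0.trans h1
  have hrs := Real.sqrt_pos.2 hr
  have e1 : √(r ^ 3) = r * √r := by
    rw [show r ^ 3 = r ^ 2 * r by ring, Real.sqrt_mul (by positivity), Real.sqrt_sq hr.le]
  rw [Real.sqrt_div h0.le, e1, kSpeedR]
  field_simp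

end IsCollapse

/-- The slope `dR/dr` of a light ray. -/
def raySlope (Ψ Y : ℝ → ℝ → ℝ) (x : ℝ × ℝ) (q : ℝ) : ℝ :=
  kSpeed Ψ Y x * (Y x.1 x.2 - u Ψ Y x.1 x.2 * q)

/-- The factor in `dq/dr = (q² - 1) · rayTurn` along a light ray. -/
def rayTurn (Ψ Y : ℝ → ℝ → ℝ) (x : ℝ × ℝ) (q : ℝ) : ℝ :=
  -q * kSpeed Ψ Y x * (Y x.1 x.2 / x.2 - dR (fun x => Y x.1 x.2) x)
    + u Ψ Y x.1 x.2 * kSpeed Ψ Y x / x.2 - u Ψ Y x.1 x.2 * kSpeedR Ψ Y x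

/-- The point `(r, R)` in terms of the variables `t = -log r` and `v = √(α r³ / R)`. -/
def position (α t v : ℝ) : ℝ × ℝ := (Real.exp (-t), α * Real.exp (-t) ^ 3 / v ^ 2)

/-- The system of light rays in the variables `t`, `(v, q)`. -/
def rayField (Ψ Y : ℝ → ℝ → ℝ) (α t : ℝ) (z : ℝ × ℝ) : ℝ × ℝ :=
  (z.1 / 2 * (Real.exp (-t) * raySlope Ψ Y (position α t z.1) z.2 / (position α t z.1).2 - 3),
    (z.2 ^ 2 - 1) * (-Real.exp (-t) * rayTurn Ψ Y (position α t z.1) z.2))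

theorem tendsto_exp_neg_atTop : Tendsto (fun t : ℝ => Real.exp (-t)) atTop (𝓝[>] 0) :=
  tendsto_nhdsWithin_iff.2 ⟨Real.tendsto_exp_neg_atTop_nhds_zero,
    Eventually.of_forall fun _ => Real.exp_pos _⟩

theorem tendsto_position {α : ℝ} (hα : 0 < α) {z : ℝ × ℝ} (hz : 0 < z.1) :
    Tendsto (fun p : ℝ × (ℝ × ℝ) => position α p.1 p.2.1) (atTop ×ˢ 𝓝 z) (scaling α z.1) := by
  refine (tendsto_scaling hα hz).2 ⟨tendsto_exp_neg_atTop.comp tendsto_fst, ?_⟩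
  have h : Tendsto (fun p : ℝ × (ℝ × ℝ) => p.2.1) (atTop ×ˢ 𝓝 z) (𝓝 z.1) :=
    (continuous_fst.tendsto z).comp tendsto_snd
  have h2 : Tendsto (fun p : ℝ × (ℝ × ℝ) => α / p.2.1 ^ 2) (atTop ×ˢ 𝓝 z) (𝓝 (α / z.1 ^ 2)) :=
    tendsto_const_nhds.div (h.pow 2) (by positivity)
  refine h2.congr fun p => ?_
  have := Real.exp_pos (-p.1)
  simp only [position]
  field_simp

/-- A joint limit in time and position at each point is locally uniform convergence, and compactness
makes it uniform. Only filter limits along `scaling` have to be computed. -/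
theorem tendstoUniformlyOn_of_forall_tendsto {β : Type*} [UniformSpace β] {X : Type*}
    [TopologicalSpace X] {F : ℝ → X → β} {f : X → β} {S : Set X} (hS : IsCompact S)
    (hf : Continuous f)
    (h : ∀ z ∈ S, Tendsto (fun p : ℝ × X => F p.1 p.2) (atTop ×ˢ 𝓝 z) (𝓝 (f z))) :
    TendstoUniformlyOn F f atTop S := by
  rw [← tendstoLocallyUniformlyOn_iff_tendstoUniformlyOn_of_compact hS,
    tendstoLocallyUniformlyOn_iff_forall_tendsto]
  intro z hz
  have h1 : Tendsto (fun p : ℝ × X => f p.2) (atTop ×ˢ 𝓝[S] z) (𝓝 (f z)) :=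
    (hf.tendsto z).comp (tendsto_snd.mono_right nhdsWithin_le_nhds)
  have h2 := (h z hz).mono_left (Filter.prod_mono le_rfl (nhdsWithin_le_nhds (a := z) (s := S)))
  exact (h1.prodMk_nhds h2).mono_right (nhds_le_uniformity (f z))

namespace IsCollapse

variable {Ψ Y : ℝ → ℝ → ℝ} {rb α ξ r R v : ℝ} (H : IsCollapse Ψ Y rb α ξ)
include H

theorem tendsto_rayField_fst {z : ℝ × ℝ} (hz : 0 < z.1) :
    Tendsto (fun p : ℝ × (ℝ × ℝ) => (rayField Ψ Y α p.1 p.2).1) (atTop ×ˢ 𝓝 z)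
      (𝓝 (fLim (ξ / α) z.1 z.2)) := by
  have hpos := tendsto_position H.alpha_pos hz
  have h1 := (H.tendsto_kSpeed hz).comp hpos
  have h2 := (H.tendsto_Y.mono_left (scaling_le_cone α z.1)).comp hpos
  have h3 := (H.tendsto_u hz).comp hpos
  have hv : Tendsto (fun p : ℝ × (ℝ × ℝ) => p.2.1) (atTop ×ˢ 𝓝 z) (𝓝 z.1) :=
    (continuous_fst.tendsto z).comp tendsto_snd
  have hq : Tendsto (fun p : ℝ × (ℝ × ℝ) => p.2.2) (atTop ×ˢ 𝓝 z) (𝓝 z.2) :=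
    (continuous_snd.tendsto z).comp tendsto_snd
  have h := (hv.div_const 2).mul ((h1.mul (h2.sub (h3.mul hq))).sub_const 3)
  have e : fLim (ξ / α) z.1 z.2 = z.1 / 2 * (hLim (ξ / α) z.1 * (1 - z.1 * z.2) - 3) := by
    unfold fLim; ring
  rw [e]
  refine h.congr fun p => ?_
  simp only [Function.comp, rayField, raySlope, position]
  ring

/-- The three terms of -r · `rayTurn` tend to q h, -v h and v (3/2 - h/2), and h - 1 = ω v³ combines
the last two to -(3/2) ω v⁴. -/
theorem tendsto_rayTurn {z : ℝ × ℝ} (hz : 0 < z.1) :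
    Tendsto (fun p : ℝ × (ℝ × ℝ) => -Real.exp (-p.1) * rayTurn Ψ Y (position α p.1 p.2.1) p.2.2)
      (atTop ×ˢ 𝓝 z) (𝓝 (z.2 * hLim (ξ / α) z.1 - 3 / 2 * (ξ / α) * z.1 ^ 4)) := by
  have hpos := tendsto_position H.alpha_pos hz
  have h1 := (H.tendsto_kSpeed hz).comp hpos
  have h2 := (H.tendsto_Y.mono_left (scaling_le_cone α z.1)).comp hpos
  have h3 := (H.tendsto_u hz).comp hpos
  have h4 := (H.tendsto_dR_Y.mono_left (scaling_le_cone α z.1)).comp hpos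
  have h5 := (H.tendsto_kSpeedR hz).comp hpos
  have hq : Tendsto (fun p : ℝ × (ℝ × ℝ) => p.2.2) (atTop ×ˢ 𝓝 z) (𝓝 z.2) :=
    (continuous_snd.tendsto z).comp tendsto_snd
  have h := (((hq.mul h1).mul (h2.sub h4)).sub (h3.mul h1)).add (h3.mul h5)
  have e : z.2 * hLim (ξ / α) z.1 * (1 - 0) - z.1 * hLim (ξ / α) z.1 +
      z.1 * (3 / 2 - hLim (ξ / α) z.1 / 2) =
      z.2 * hLim (ξ / α) z.1 - 3 / 2 * (ξ / α) * z.1 ^ 4 := by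
    unfold hLim; ring
  rw [e] at h
  have hreg := hpos.eventually (scaling_le_cone α z.1 (eventually_cone_region H.rb_pos))
  refine h.congr' ?_
  filter_upwards [hreg] with p hp
  have hR := hp.1
  simp only [Function.comp, rayTurn]
  have e2 : (position α p.1 p.2.1).1 = Real.exp (-p.1) := rfl
  rw [← e2]
  field_simp
  ring

theorem contDiffAt_raySlope (h0 : 0 < R) (h1 : R < r) (h2 : r < rb) (q : ℝ) :
    ContDiffAt ℝ 1 (fun p : (ℝ × ℝ) × ℝ => raySlope Ψ Y p.1 p.2) ((r, R), q) := by
  have hK := ContDiffAt.fst' (x := (r, R)) (y := q) (H.contDiffAt_kSpeed h0 h1 h2)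
  have hY := ContDiffAt.fst' (x := (r, R)) (y := q)
    ((H.contDiff_Y r R h0.le h1.le h2).of_le (m := 1) (by norm_num))
  have hu := ContDiffAt.fst' (x := (r, R)) (y := q)
    ((H.contDiffAt_u h0 h1.le h2).of_le (m := 1) (by norm_num))
  exact hK.mul (hY.sub (hu.mul contDiffAt_snd))

theorem contDiffAt_rayTurn (h0 : 0 < R) (h1 : R < r) (h2 : r < rb) (q : ℝ) :
    ContDiffAt ℝ 1 (fun p : (ℝ × ℝ) × ℝ => rayTurn Ψ Y p.1 p.2) ((r, R), q) := by
  have hK := ContDiffAt.fst' (x := (r, R)) (y := q) (H.contDiffAt_kSpeed h0 h1 h2)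
  have hKR := ContDiffAt.fst' (x := (r, R)) (y := q) (H.contDiffAt_kSpeedR h0 h1 h2)
  have hY := ContDiffAt.fst' (x := (r, R)) (y := q)
    ((H.contDiff_Y r R h0.le h1.le h2).of_le (m := 1) (by norm_num))
  have hYR := ContDiffAt.fst' (x := (r, R)) (y := q)
    (contDiffAt_dR (m := 1) (H.contDiff_Y r R h0.le h1.le h2) (by norm_num))
  have hu := ContDiffAt.fst' (x := (r, R)) (y := q)
    ((H.contDiffAt_u h0 h1.le h2).of_le (m := 1) (by norm_num))
  have hq : ContDiffAt ℝ 1 (fun p : (ℝ × ℝ) × ℝ => p.2) ((r, R), q) := contDiffAt_snd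
  have hR : ContDiffAt ℝ 1 (fun p : (ℝ × ℝ) × ℝ => p.1.2) ((r, R), q) := by fun_prop
  exact (((hq.neg.mul hK).mul ((hY.div hR h0.ne').sub hYR)).add
    ((hu.mul hK).div hR h0.ne')).sub (hu.mul hKR)

theorem contDiffAt_rayField {t : ℝ} {z : ℝ × ℝ} (hz : 0 < z.1)
    (h1 : (position α t z.1).2 < (position α t z.1).1) (h2 : (position α t z.1).1 < rb) :
    ContDiffAt ℝ 1 (fun p : ℝ × (ℝ × ℝ) => rayField Ψ Y α p.1 p.2) (t, z) := by
  have hα := H.alpha_pos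
  have hpos : ContDiffAt ℝ 1 (fun p : ℝ × (ℝ × ℝ) => (position α p.1 p.2.1, p.2.2)) (t, z) := by
    have h3 : ContDiffAt ℝ 1 (fun p : ℝ × (ℝ × ℝ) => α * Real.exp (-p.1) ^ 3 / p.2.1 ^ 2) (t, z) :=
      ContDiffAt.div (by fun_prop) (by fun_prop) (by positivity)
    exact (ContDiffAt.prodMk (by fun_prop) h3).prodMk (by fun_prop)
  have h0 : 0 < (position α t z.1).2 := by
    have := Real.exp_pos (-t)
    simp only [position]
    positivity
  have hs := ContDiffAt.comp (t, z) (H.contDiffAt_raySlope h0 h1 h2 z.2) hpos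
  have ht := ContDiffAt.comp (t, z) (H.contDiffAt_rayTurn h0 h1 h2 z.2) hpos
  have hR : ContDiffAt ℝ 1 (fun p : ℝ × (ℝ × ℝ) => (position α p.1 p.2.1).2) (t, z) :=
    contDiffAt_snd.comp (t, z) (contDiffAt_fst.comp (t, z) hpos)
  have e1 : ContDiffAt ℝ 1 (fun p : ℝ × (ℝ × ℝ) => p.2.1 / 2) (t, z) := by fun_prop
  have e2 : ContDiffAt ℝ 1 (fun p : ℝ × (ℝ × ℝ) => Real.exp (-p.1)) (t, z) := by fun_prop
  have e3 : ContDiffAt ℝ 1 (fun p : ℝ × (ℝ × ℝ) => p.2.2 ^ 2 - 1) (t, z) := by fun_prop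
  exact (e1.mul (((e2.mul hs).div hR h0.ne').sub contDiffAt_const)).prodMk
    (e3.mul (e2.neg.mul ht))

end IsCollapse

/-- A `C¹` function is Lipschitz on compact sets. -/
theorem exists_lipschitzOnWith_of_contDiffAt {E E' : Type*} [NormedAddCommGroup E]
    [NormedSpace ℝ E] [NormedAddCommGroup E'] [NormedSpace ℝ E'] {f : E → E'} {S : Set E}
    (hS : IsCompact S) (hf : ∀ x ∈ S, ContDiffAt ℝ 1 f x) : ∃ L, LipschitzOnWith L f S := by
  refine LocallyLipschitzOn.exists_lipschitzOnWith_of_compact hS fun x hx => ?_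
  obtain ⟨L, U, hU, h⟩ := (hf x hx).exists_lipschitzOnWith
  exact ⟨L, U, mem_nhdsWithin_of_mem_nhds hU, h⟩

theorem eventually_position {α b v₀ : ℝ} (hα : 0 < α) (hb : 0 < b) (hv : 0 < v₀) :
    ∀ᶠ t in atTop, ∀ v, v₀ ≤ v → 0 < (position α t v).2 ∧
      (position α t v).2 < (position α t v).1 ∧ (position α t v).1 < b := by
  have h := Real.tendsto_exp_neg_atTop_nhds_zero
  have h2 : Tendsto (fun t => α * Real.exp (-t) ^ 2) atTop (𝓝 0) := by simpa using (h.pow 2).const_mul α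
  filter_upwards [h.eventually (gt_mem_nhds hb), h2.eventually (gt_mem_nhds (pow_pos hv 2))]
    with t h1 h2 v h3
  have he := Real.exp_pos (-t)
  have hv' : 0 < v := hv.trans_le h3
  simp only [position]
  refine ⟨by positivity, ?_, h1⟩
  rw [div_lt_iff₀ (by positivity)]
  have : v₀ ^ 2 ≤ v ^ 2 := by gcongr
  nlinarith

namespace IsCollapse

variable {Ψ Y : ℝ → ℝ → ℝ} {rb α ξ r R v : ℝ} (H : IsCollapse Ψ Y rb α ξ)
include H

theorem tendstoUniformlyOn_rayTurn {S : Set (ℝ × ℝ)} (hS : S ⊆ phase) (hSc : IsCompact S) :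
    TendstoUniformlyOn (fun t z => -Real.exp (-t) * rayTurn Ψ Y (position α t z.1) z.2)
      (fun z => z.2 * hLim (ξ / α) z.1 - 3 / 2 * (ξ / α) * z.1 ^ 4) atTop S := by
  refine tendstoUniformlyOn_of_forall_tendsto hSc ?_ fun z hz => H.tendsto_rayTurn (hS hz).1
  unfold hLim
  fun_prop

/-- On a compact set v is bounded below, so for late times all positions lie in the region where the
field is C¹. The slope is affine in q with nonzero coefficient -K u, which gives injectivity. -/
theorem asymptotic : Asymptotic (ξ / α) (rayField Ψ Y α) := by
  have hbd : ∀ S ⊆ phase, IsCompact S → ∀ᶠ t in atTop, ∀ z ∈ S, 0 < (position α t z.1).2 ∧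
      (position α t z.1).2 < (position α t z.1).1 ∧ (position α t z.1).1 < rb := by
    intro S hS hSc
    obtain ⟨v₀, hv₀, h⟩ := exists_pos_le_of_isCompact hSc (f := Prod.fst)
      continuous_fst.continuousOn fun z hz => (hS hz).1
    filter_upwards [eventually_position H.alpha_pos H.rb_pos hv₀] with t ht z hz
    exact ht z.1 (h z hz)
  refine ⟨fun S hS hSc => ?_, fun S hS hSc => ?_, fun S hS hSc => ?_,
    fun t z => -Real.exp (-t) * rayTurn Ψ Y (position α t z.1) z.2, fun t z => rfl,
    fun S hS hSc => H.tendstoUniformlyOn_rayTurn hS hSc⟩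
  · refine tendstoUniformlyOn_of_forall_tendsto hSc (continuous_fieldLim _) fun z hz => ?_
    have hq : Tendsto (fun p : ℝ × (ℝ × ℝ) => p.2.2) (atTop ×ˢ 𝓝 z) (𝓝 z.2) :=
      (continuous_snd.tendsto z).comp tendsto_snd
    exact (H.tendsto_rayField_fst (hS hz).1).prodMk_nhds
      (((hq.pow 2).sub_const 1).mul (H.tendsto_rayTurn (hS hz).1))
  · obtain ⟨T, hT⟩ := eventually_atTop.1 (hbd S hS hSc)
    refine ⟨T, fun T' => ?_, fun z hz t ht => ?_⟩
    · obtain ⟨L, hL⟩ := exists_lipschitzOnWith_of_contDiffAt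
        (isCompact_Icc (a := T) (b := T').prod hSc)
        (f := fun p : ℝ × (ℝ × ℝ) => rayField Ψ Y α p.1 p.2) (by
          rintro ⟨t, z⟩ ⟨ht, hz⟩
          obtain ⟨-, h1, h2⟩ := hT t ht.1 z hz
          exact H.contDiffAt_rayField (hS hz).1 h1 h2)
      refine ⟨L, fun t ht => ?_⟩
      intro z hz z' hz'
      have := hL (show ((t, z) : ℝ × (ℝ × ℝ)) ∈ _ from ⟨ht, hz⟩)
        (show ((t, z') : ℝ × (ℝ × ℝ)) ∈ _ from ⟨ht, hz'⟩)
      simpa [Prod.edist_eq] using this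
    · obtain ⟨-, h1, h2⟩ := hT t ht z hz
      have := (H.contDiffAt_rayField (t := t) (hS hz).1 h1 h2).continuousAt
      exact (ContinuousAt.comp (f := fun t : ℝ => (t, z)) this
        (by fun_prop)).continuousWithinAt
  · filter_upwards [hbd S hS hSc] with t ht v q q' hq hq' heq
    obtain ⟨h0, h1, h2⟩ := ht _ hq
    simp only at h0 h1 h2
    have hv : 0 < v := (hS hq).1
    have hK := H.kSpeed_pos h0 h1 h2
    have hu := H.u_pos h0 h1.le h2
    have he := Real.exp_pos (-t)
    rw [Prod.mk.eta] at hK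
    simp only [rayField, raySlope] at heq
    have e1 := mul_left_cancel₀ (by positivity) heq
    have e2 := (div_left_inj' h0.ne').1 (sub_left_injective e1)
    have e3 := mul_left_cancel₀ hK.ne' (mul_left_cancel₀ he.ne' e2)
    exact mul_left_cancel₀ hu.ne' (sub_right_injective e3)

end IsCollapse

end Collapse
end

/-! ### Metric coefficients and their derivatives -/

noncomputable section
namespace Collapse

variable {Ψ Y : ℝ → ℝ → ℝ} {rb α ξ r R : ℝ}

/-- The component `A` of the metric as a function on the plane. -/
def coeffA (Ψ Y : ℝ → ℝ → ℝ) (x : ℝ × ℝ) : ℝ := A Ψ Y x.1 x.2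

/-- The component `B` of the metric as a function on the plane. -/
def coeffB (Ψ Y : ℝ → ℝ → ℝ) (x : ℝ × ℝ) : ℝ := B Ψ Y x.1 x.2

/-- The component `C` of the metric as a function on the plane. -/
def coeffC (Ψ Y : ℝ → ℝ → ℝ) (x : ℝ × ℝ) : ℝ := C Ψ Y x.1 x.2

namespace IsCollapse

variable (H : IsCollapse Ψ Y rb α ξ)
include H

/-- In this form the quadratic form A + 2Bw + Cw² can be completed to a square: at w = K (Y - u q)
it equals K² (q² - 1). -/
theorem A_eq (h0 : 0 < R) (h1 : R ≤ r) (h2 : r < rb) :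
    A Ψ Y r R = (Y r R ^ 2 - u Ψ Y r R ^ 2) * G Ψ Y r R ^ 2 := by
  rw [A, H.u_sq h0 h1 h2]; ring

theorem differentiableAt_coeff (h0 : 0 < R) (h1 : R < r) (h2 : r < rb) :
    DifferentiableAt ℝ (coeffA Ψ Y) (r, R) ∧ DifferentiableAt ℝ (coeffB Ψ Y) (r, R) ∧
      DifferentiableAt ℝ (coeffC Ψ Y) (r, R) := by
  have hY := (H.contDiff_Y r R h0.le h1.le h2).of_le (m := 1) (by norm_num)
  have hΨ := (H.contDiff_Psi r R h0.le h1.le h2).of_le (m := 1) (by norm_num)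
  have hu := (H.contDiffAt_u h0 h1.le h2).of_le (m := 1) (by norm_num)
  have hG := H.contDiffAt_G h0 h1 h2
  have hu0 := H.u_pos h0 h1.le h2
  have c1 : ContDiffAt ℝ 1 (coeffA Ψ Y) (r, R) := (contDiffAt_const.sub
    ((contDiffAt_const.mul hΨ).div contDiffAt_snd h0.ne')).mul (hG.pow 2)
  have c2 : ContDiffAt ℝ 1 (coeffB Ψ Y) (r, R) := (hG.mul (hY.div hu hu0.ne')).neg
  have c3 : ContDiffAt ℝ 1 (coeffC Ψ Y) (r, R) :=
    contDiffAt_const.div (hu.pow 2) (by positivity)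
  exact ⟨c1.differentiableAt (by simp), c2.differentiableAt (by simp),
    c3.differentiableAt (by simp)⟩

/-- The `R`-derivative of `A + 2 B w + C w²` for a null slope `w`. -/
theorem dR_coeff (h0 : 0 < R) (h1 : R < r) (h2 : r < rb) (q : ℝ) :
    dR (coeffA Ψ Y) (r, R) + 2 * dR (coeffB Ψ Y) (r, R) * raySlope Ψ Y (r, R) q
      + dR (coeffC Ψ Y) (r, R) * raySlope Ψ Y (r, R) q ^ 2 =
    2 * (kSpeed Ψ Y (r, R) * q * (√R * gDens Ψ Y (r, R) * Y r R
      + G Ψ Y r R * dR (fun x => Y x.1 x.2) (r, R) + G Ψ Y r R * (Y r R - u Ψ Y r R * q) *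
        dR (fun x => u Ψ Y x.1 x.2) (r, R) / u Ψ Y r R)
      - kSpeed Ψ Y (r, R) * kSpeedR Ψ Y (r, R)) := by
  have hY := hasDerivAt_dR ((H.contDiff_Y r R h0.le h1.le h2).differentiableAt (by simp))
  have hu := hasDerivAt_dR ((H.contDiffAt_u h0 h1.le h2).differentiableAt (by simp))
  have hG := hasDerivAt_dR ((H.contDiffAt_G h0 h1 h2).differentiableAt (by simp))
  rw [H.dR_G h0 h1 h2] at hG
  have hu0 := H.u_pos h0 h1.le h2
  obtain ⟨dA, dB, dC⟩ := H.differentiableAt_coeff h0 h1 h2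
  have eA := (hasDerivAt_dR dA).unique ((((hY.pow 2).sub (hu.pow 2)).mul
    (hG.pow 2)).congr_of_eventuallyEq (by
      filter_upwards [Ioo_mem_nhds h0 h1] with s hs
      exact H.A_eq hs.1 hs.2.le h2))
  have eB := (hasDerivAt_dR dB).unique (hG.mul (hY.div hu hu0.ne')).neg
  have eC := (hasDerivAt_dR dC).unique
    ((hasDerivAt_const R (1 : ℝ)).div (hu.pow 2) (by show u Ψ Y r R ^ 2 ≠ 0; positivity))
  rw [eA, eB, eC]
  simp only [Pi.pow_apply, Pi.sub_apply, Pi.div_apply, kSpeed, kSpeedR, raySlope]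
  push_cast
  field_simp
  ring

end IsCollapse

/-- The partial derivatives of the metric with respect to `r`. -/
def metricDr (Ψ Y : ℝ → ℝ → ℝ) (x : ℝ × ℝ) : Matrix (Fin 4) (Fin 4) ℝ :=
  !![-dr (coeffA Ψ Y) x, -dr (coeffB Ψ Y) x, 0, 0;
     -dr (coeffB Ψ Y) x, -dr (coeffC Ψ Y) x, 0, 0;
     0, 0, 0, 0;
     0, 0, 0, 0]

/-- The partial derivatives of the metric with respect to `R`. -/
def metricDR (Ψ Y : ℝ → ℝ → ℝ) (x : ℝ × ℝ) : Matrix (Fin 4) (Fin 4) ℝ :=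
  !![-dR (coeffA Ψ Y) x, -dR (coeffB Ψ Y) x, 0, 0;
     -dR (coeffB Ψ Y) x, -dR (coeffC Ψ Y) x, 0, 0;
     0, 0, 2 * x.2, 0;
     0, 0, 0, 2 * x.2]

theorem metric_apply (φ : ℝ) : metric Ψ Y ![r, R, Real.pi / 2, φ] =
    !![-coeffA Ψ Y (r, R), -coeffB Ψ Y (r, R), 0, 0;
       -coeffB Ψ Y (r, R), -coeffC Ψ Y (r, R), 0, 0;
       0, 0, R ^ 2, 0;
       0, 0, 0, R ^ 2] := by
  simp [metric, coeffA, coeffB, coeffC]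

/-- The only dependence on θ is through sin²θ, which is stationary at π/2; so the equatorial plane
is totally geodesic. -/
theorem partialDeriv_metric_two (φ : ℝ) (μ ν : Fin 4) :
    partialDeriv (fun y => metric Ψ Y y μ ν) 2 ![r, R, Real.pi / 2, φ] = 0 := by
  fin_cases μ <;> fin_cases ν <;>
    simp [partialDeriv, metric, Function.update]

theorem partialDeriv_metric_three (φ : ℝ) (μ ν : Fin 4) :
    partialDeriv (fun y => metric Ψ Y y μ ν) 3 ![r, R, Real.pi / 2, φ] = 0 := by
  fin_cases μ <;> fin_cases ν <;>
    simp [partialDeriv, metric, Function.update]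

namespace IsCollapse

theorem partialDeriv_metric_zero (H : IsCollapse Ψ Y rb α ξ) (h0 : 0 < R) (h1 : R < r) (h2 : r < rb) (φ : ℝ) (μ ν : Fin 4) :
    partialDeriv (fun y => metric Ψ Y y μ ν) 0 ![r, R, Real.pi / 2, φ] =
      metricDr Ψ Y (r, R) μ ν := by
  obtain ⟨dA, dB, dC⟩ := H.differentiableAt_coeff h0 h1 h2
  have eA : deriv (fun s => A Ψ Y s R) r = dr (coeffA Ψ Y) (r, R) := (hasDerivAt_dr dA).deriv
  have eB : deriv (fun s => B Ψ Y s R) r = dr (coeffB Ψ Y) (r, R) := (hasDerivAt_dr dB).deriv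
  have eC : deriv (fun s => C Ψ Y s R) r = dr (coeffC Ψ Y) (r, R) := (hasDerivAt_dr dC).deriv
  fin_cases μ <;> fin_cases ν <;>
    simp [partialDeriv, metric, metricDr, Function.update, eA, eB, eC]

theorem partialDeriv_metric_one (H : IsCollapse Ψ Y rb α ξ) (h0 : 0 < R) (h1 : R < r) (h2 : r < rb) (φ : ℝ) (μ ν : Fin 4) :
    partialDeriv (fun y => metric Ψ Y y μ ν) 1 ![r, R, Real.pi / 2, φ] =
      metricDR Ψ Y (r, R) μ ν := by
  obtain ⟨dA, dB, dC⟩ := H.differentiableAt_coeff h0 h1 h2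
  have eA : deriv (fun s => A Ψ Y r s) R = dR (coeffA Ψ Y) (r, R) := (hasDerivAt_dR dA).deriv
  have eB : deriv (fun s => B Ψ Y r s) R = dR (coeffB Ψ Y) (r, R) := (hasDerivAt_dR dB).deriv
  have eC : deriv (fun s => C Ψ Y r s) R = dR (coeffC Ψ Y) (r, R) := (hasDerivAt_dR dC).deriv
  fin_cases μ <;> fin_cases ν <;>
    simp [partialDeriv, metric, metricDR, Function.update, eA, eB, eC]

end IsCollapse

end Collapse
end

/-! ### The geodesic equation in components -/

noncomputable section
namespace Collapse

variable {Ψ Y : ℝ → ℝ → ℝ} {rb α ξ r R : ℝ}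

/-- The left hand side of the geodesic equation for a tangent vector `K` with derivative `d`. -/
def geodesicSum (Ψ Y : ℝ → ℝ → ℝ) (x K d : Fin 4 → ℝ) (μ : Fin 4) : ℝ :=
  ∑ ν, metric Ψ Y x μ ν * (K 0 * d ν)
    + ∑ ν, ∑ l, christoffel (metric Ψ Y) μ ν l x * K ν * K l

theorem metric_sum (φ : ℝ) (K : Fin 4 → ℝ) (hK : K 2 = 0) :
    ∑ μ, ∑ ν, metric Ψ Y ![r, R, Real.pi / 2, φ] μ ν * K μ * K ν =
      -(coeffA Ψ Y (r, R) * K 0 ^ 2 + 2 * coeffB Ψ Y (r, R) * K 0 * K 1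
        + coeffC Ψ Y (r, R) * K 1 ^ 2) + R ^ 2 * K 3 ^ 2 := by
  rw [metric_apply]
  simp [Fin.sum_univ_four, hK]
  ring

theorem metric_sum_one (φ : ℝ) (K : Fin 4 → ℝ) :
    ∑ μ, metric Ψ Y ![r, R, Real.pi / 2, φ] μ 1 * K μ =
      -coeffB Ψ Y (r, R) * K 0 - coeffC Ψ Y (r, R) * K 1 := by
  rw [metric_apply]
  simp [Fin.sum_univ_four]
  ring

namespace IsCollapse

variable (H : IsCollapse Ψ Y rb α ξ)
include H

theorem geodesicSum_eq (h0 : 0 < R) (h1 : R < r) (h2 : r < rb) (φ : ℝ) (K d : Fin 4 → ℝ)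
    (hK : K 2 = 0) (hd : d 2 = 0) :
    geodesicSum Ψ Y ![r, R, Real.pi / 2, φ] K d 0 =
      -coeffA Ψ Y (r, R) * K 0 * d 0 - coeffB Ψ Y (r, R) * K 0 * d 1
        - (dr (coeffA Ψ Y) (r, R) * K 0 + dR (coeffA Ψ Y) (r, R) * K 1) * K 0
        - (dr (coeffB Ψ Y) (r, R) * K 0 + dR (coeffB Ψ Y) (r, R) * K 1) * K 1
        + (dr (coeffA Ψ Y) (r, R) * K 0 ^ 2 + 2 * dr (coeffB Ψ Y) (r, R) * K 0 * K 1
          + dr (coeffC Ψ Y) (r, R) * K 1 ^ 2) / 2 ∧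
    geodesicSum Ψ Y ![r, R, Real.pi / 2, φ] K d 1 =
      -coeffB Ψ Y (r, R) * K 0 * d 0 - coeffC Ψ Y (r, R) * K 0 * d 1
        - (dr (coeffB Ψ Y) (r, R) * K 0 + dR (coeffB Ψ Y) (r, R) * K 1) * K 0
        - (dr (coeffC Ψ Y) (r, R) * K 0 + dR (coeffC Ψ Y) (r, R) * K 1) * K 1
        + (dR (coeffA Ψ Y) (r, R) * K 0 ^ 2 + 2 * dR (coeffB Ψ Y) (r, R) * K 0 * K 1
          + dR (coeffC Ψ Y) (r, R) * K 1 ^ 2) / 2 - R * K 3 ^ 2 ∧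
    geodesicSum Ψ Y ![r, R, Real.pi / 2, φ] K d 2 = 0 ∧
    geodesicSum Ψ Y ![r, R, Real.pi / 2, φ] K d 3 =
      R ^ 2 * K 0 * d 3 + 2 * R * K 1 * K 3 := by
  have e0 := H.partialDeriv_metric_zero h0 h1 h2 φ
  have e1 := H.partialDeriv_metric_one h0 h1 h2 φ
  have e2 := partialDeriv_metric_two (Ψ := Ψ) (Y := Y) (r := r) (R := R) φ
  have e3 := partialDeriv_metric_three (Ψ := Ψ) (Y := Y) (r := r) (R := R) φ
  refine ⟨?_, ?_, ?_, ?_⟩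
  all_goals
    simp only [geodesicSum, christoffel, Fin.sum_univ_four, e0, e1, e2, e3, hK, hd, mul_zero,
      zero_mul, add_zero]
    rw [metric_apply]
    simp [metricDr, metricDR]
    try ring

end IsCollapse

/-- The null geodesics with slope angle `q`: `R' = K (Y - u q)`, `q' = (q² - 1) · rayTurn`. -/
structure IsLightRay (Ψ Y : ℝ → ℝ → ℝ) (b : ℝ) (R q : ℝ → ℝ) : Prop where
  pos : ∀ r ∈ Ioo 0 b, 0 < R r
  lt : ∀ r ∈ Ioo 0 b, R r < r
  one_le : ∀ r ∈ Ioo 0 b, 1 ≤ q r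
  deriv_R : ∀ r ∈ Ioo 0 b, HasDerivAt R (raySlope Ψ Y (r, R r) (q r)) r
  deriv_q : ∀ r ∈ Ioo 0 b, HasDerivAt q ((q r ^ 2 - 1) * rayTurn Ψ Y (r, R r) (q r)) r

/-- The logarithmic derivative of the momentum `K_R = k G q` along a light ray. -/
def rayForce (Ψ Y : ℝ → ℝ → ℝ) (x : ℝ × ℝ) (q : ℝ) : ℝ :=
  -u Ψ Y x.1 x.2 * (√x.2 * gDens Ψ Y x * Y x.1 x.2 + G Ψ Y x.1 x.2 * dR (fun x => Y x.1 x.2) x)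
    - G Ψ Y x.1 x.2 * (Y x.1 x.2 - u Ψ Y x.1 x.2 * q) * dR (fun x => u Ψ Y x.1 x.2) x
    + u Ψ Y x.1 x.2 * kSpeedR Ψ Y x / q
    + G Ψ Y x.1 x.2 * u Ψ Y x.1 x.2 ^ 2 * (q ^ 2 - 1) / (q * x.2)

namespace IsCollapse

variable (H : IsCollapse Ψ Y rb α ξ)
include H

/-- On the left is the logarithmic derivative of R p u along a ray, where p = k G q. The squared
angular momentum is (R p u)² (1 - 1/q²), so this identity expresses its conservation as an equation
for q. -/
theorem rayTurn_eq (h0 : 0 < R) (h1 : R < r) (h2 : r < rb) {q : ℝ} (hq : 0 < q) :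
    raySlope Ψ Y (r, R) q / R + rayForce Ψ Y (r, R) q
      + (dr (fun x => u Ψ Y x.1 x.2) (r, R) + dR (fun x => u Ψ Y x.1 x.2) (r, R) *
        raySlope Ψ Y (r, R) q) / u Ψ Y r R = -rayTurn Ψ Y (r, R) q / q := by
  have hu := H.u_pos h0 h1.le h2
  rw [H.dr_u h0 h1.le h2]
  simp only [rayForce, rayTurn, raySlope, kSpeed]
  field_simp
  ring

/-- `A + 2 B w + C w²` and `B + C w` in terms of `q`. -/
theorem coeff_raySlope (h0 : 0 < R) (h1 : R < r) (h2 : r < rb) (q : ℝ) :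
    coeffA Ψ Y (r, R) + 2 * coeffB Ψ Y (r, R) * raySlope Ψ Y (r, R) q
      + coeffC Ψ Y (r, R) * raySlope Ψ Y (r, R) q ^ 2 = kSpeed Ψ Y (r, R) ^ 2 * (q ^ 2 - 1) ∧
    -coeffB Ψ Y (r, R) - coeffC Ψ Y (r, R) * raySlope Ψ Y (r, R) q = G Ψ Y r R * q := by
  have hu := H.u_pos h0 h1.le h2
  constructor
  · simp only [coeffA, coeffB, coeffC, H.A_eq h0 h1.le h2, B, C, raySlope, kSpeed]
    field_simp
    ring
  · simp only [coeffB, coeffC, B, C, raySlope, kSpeed]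
    field_simp
    ring

/-- This is the R-component of the geodesic equation, divided by k², with the centrifugal term
rewritten by the null condition. -/
theorem rayForce_mul (h0 : 0 < R) (h1 : R < r) (h2 : r < rb) {q : ℝ} (hq : 0 < q) :
    G Ψ Y r R * q * rayForce Ψ Y (r, R) q =
      -(dR (coeffA Ψ Y) (r, R) + 2 * dR (coeffB Ψ Y) (r, R) * raySlope Ψ Y (r, R) q
        + dR (coeffC Ψ Y) (r, R) * raySlope Ψ Y (r, R) q ^ 2) / 2
        + kSpeed Ψ Y (r, R) ^ 2 * (q ^ 2 - 1) / R := by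
  have hu := H.u_pos h0 h1.le h2
  rw [H.dR_coeff h0 h1 h2]
  simp only [rayForce, kSpeed]
  field_simp
  ring

end IsCollapse

end Collapse
end

/-! ### From null geodesics to light rays -/

noncomputable section
namespace Collapse

variable {Ψ Y : ℝ → ℝ → ℝ} {rb α ξ r R : ℝ}

/-- A function with vanishing derivative on an interval is constant. -/
theorem eq_of_hasDerivAt_zero {f : ℝ → ℝ} {b : ℝ} (hf : ∀ r ∈ Ioo 0 b, HasDerivAt f 0 r) :
    ∀ r ∈ Ioo 0 b, ∀ s ∈ Ioo 0 b, f r = f s := by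
  intro r hr s hs
  exact isOpen_Ioo.is_const_of_deriv_eq_zero isPreconnected_Ioo
    (fun x hx => (hf x hx).differentiableAt.differentiableWithinAt)
    (fun x hx => (hf x hx).deriv) hr hs

/-- The derivative of `q`, from the conservation of the angular momentum. -/
theorem deriv_q_of_conservation {l R R' p f u u' q q' τ : ℝ} (hR : 0 < R) (hp : 0 < p) (hu : 0 < u)
    (hq : 0 < q) (h : l ^ 2 * q ^ 2 = R ^ 2 * p ^ 2 * u ^ 2 * (q ^ 2 - 1))
    (h' : l ^ 2 * (2 * q * q') = (2 * R * R' * p ^ 2 * u ^ 2 + R ^ 2 * (2 * p * (p * f)) * u ^ 2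
      + R ^ 2 * p ^ 2 * (2 * u * u')) * (q ^ 2 - 1) + R ^ 2 * p ^ 2 * u ^ 2 * (2 * q * q'))
    (hτ : R' / R + f + u' / u = -τ / q) : q' = (q ^ 2 - 1) * τ := by
  have e1 : l ^ 2 = R ^ 2 * p ^ 2 * u ^ 2 * (q ^ 2 - 1) / q ^ 2 := by field_simp; linarith
  have e2 : 2 * R * R' * p ^ 2 * u ^ 2 + R ^ 2 * (2 * p * (p * f)) * u ^ 2
      + R ^ 2 * p ^ 2 * (2 * u * u') = 2 * R ^ 2 * p ^ 2 * u ^ 2 * (-τ / q) := by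
    rw [← hτ]; field_simp
  rw [e1, e2] at h'
  field_simp at h'
  linear_combination -h'

/-- The φ-component conserves ℓ, the R-component gives the derivative of the momentum p, and the
null condition relates the two through q. Differentiating that relation yields q'. -/
theorem Ray.IsNullGeodesic.exists_isLightRay {c : Ray} (H : IsCollapse Ψ Y rb α ξ)
    (hc : c.IsNullGeodesic Ψ Y rb) : ∃ (q : ℝ → ℝ) (ℓ : ℝ), 0 ≤ ℓ ∧
      IsLightRay Ψ Y c.rmax c.R q ∧ c.HasAngularMomentum ℓ ∧
      (∀ r ∈ Ioo 0 c.rmax, HasDerivAt c.φ (kSpeed Ψ Y (r, c.R r) / c.R r * √(q r ^ 2 - 1)) r) ∧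
      (ℓ = 0 → ∀ r ∈ Ioo 0 c.rmax, q r = 1) ∧ (0 < ℓ → ∀ r ∈ Ioo 0 c.rmax, 1 < q r) := by
  set I := Ioo 0 c.rmax with hI
  have h0 : ∀ r ∈ I, 0 < c.R r := fun r hr => (hc.mem_region r hr).1
  have h1 : ∀ r ∈ I, c.R r < r := fun r hr => (hc.mem_region r hr).2
  have h2 : ∀ r ∈ I, r < rb := fun r hr => hr.2.trans_le hc.rmax_le
  have hK : ∀ r ∈ I, 0 < kSpeed Ψ Y (r, c.R r) := fun r hr =>
    H.kSpeed_pos (h0 r hr) (h1 r hr) (h2 r hr)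
  have hu : ∀ r ∈ I, 0 < u Ψ Y r (c.R r) := fun r hr => H.u_pos (h0 r hr) (h1 r hr).le (h2 r hr)
  have hG : ∀ r ∈ I, 0 < G Ψ Y r (c.R r) := fun r hr =>
    H.G_pos r _ (h0 r hr) (h1 r hr).le (h2 r hr)
  set q : ℝ → ℝ := fun r =>
    (Y r (c.R r) - deriv c.R r / kSpeed Ψ Y (r, c.R r)) / u Ψ Y r (c.R r) with hq
  have hslope : ∀ r ∈ I, deriv c.R r = raySlope Ψ Y (r, c.R r) (q r) := by
    intro r hr
    have a1 := hK r hr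
    have a2 := hu r hr
    simp only [hq, raySlope]
    field_simp
    ring
  have hR : ∀ r ∈ I, HasDerivAt c.R (raySlope Ψ Y (r, c.R r) (q r)) r := fun r hr => by
    rw [← hslope r hr]
    exact (hc.differentiable_R r hr).hasDerivAt
  have hcurve : ∀ r ∈ I, ∀ f : ℝ × ℝ → ℝ, DifferentiableAt ℝ f (r, c.R r) →
      HasDerivAt (fun s => f (s, c.R s)) (dr f (r, c.R r) + dR f (r, c.R r) *
        raySlope Ψ Y (r, c.R r) (q r)) r := by
    intro r hr f hf
    have := hasDerivAt_comp_curve (a := fun s => s) hf (hasDerivAt_id r) (hR r hr)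
    rwa [mul_one] at this
  have hT : ∀ r ∈ I, ∀ ν, HasDerivAt (fun s => c.tangent s ν) (deriv (fun s => c.tangent s ν) r) r :=
    fun r hr ν => (differentiableAt_pi.1 (hc.differentiable_tangent r hr) ν).hasDerivAt
  have hT0 : ∀ r, c.tangent r 0 = c.k r := fun r => rfl
  have hT1 : ∀ r, c.tangent r 1 = c.k r * deriv c.R r := fun r => rfl
  have hT2 : ∀ r, c.tangent r 2 = 0 := fun r => rfl
  have hT3 : ∀ r, c.tangent r 3 = c.k r * deriv c.φ r := fun r => rfl
  have hYd : ∀ r ∈ I, DifferentiableAt ℝ (fun x : ℝ × ℝ => Y x.1 x.2) (r, c.R r) := fun r hr =>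
    (H.contDiff_Y r _ (h0 r hr).le (h1 r hr).le (h2 r hr)).differentiableAt (by simp)
  have hud : ∀ r ∈ I, DifferentiableAt ℝ (fun x : ℝ × ℝ => u Ψ Y x.1 x.2) (r, c.R r) := fun r hr =>
    (H.contDiffAt_u (h0 r hr) (h1 r hr).le (h2 r hr)).differentiableAt (by simp)
  have hKd : ∀ r ∈ I, DifferentiableAt ℝ (kSpeed Ψ Y) (r, c.R r) := fun r hr =>
    (H.contDiffAt_kSpeed (h0 r hr) (h1 r hr) (h2 r hr)).differentiableAt (by simp)
  have hnhds : ∀ r ∈ I, I ∈ 𝓝 r := fun r hr => Ioo_mem_nhds hr.1 hr.2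
  have hqd : ∀ r ∈ I, DifferentiableAt ℝ q r := by
    intro r hr
    -- R is assumed only once differentiable; the second derivative comes from the differentiability
    -- of the affine tangent vector.
    have e : deriv c.R =ᶠ[𝓝 r] fun s => c.tangent s 1 / c.tangent s 0 := by
      filter_upwards [hnhds r hr] with s hs
      have := hc.k_pos s hs
      rw [hT0, hT1]
      field_simp
    have d1 : DifferentiableAt ℝ (deriv c.R) r :=
      ((hT r hr 1).differentiableAt.div (hT r hr 0).differentiableAt
        (hc.k_pos r hr).ne').congr_of_eventuallyEq e
    exact ((hcurve r hr _ (hYd r hr)).differentiableAt.sub (d1.div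
      (hcurve r hr _ (hKd r hr)).differentiableAt (hK r hr).ne')).div
      (hcurve r hr _ (hud r hr)).differentiableAt (hu r hr).ne'
  -- The covariant R-component of the tangent. Future orientation makes it positive, hence q > 0,
  -- and the null condition then gives q ≥ 1.
  set p : ℝ → ℝ := fun s => c.k s * (G Ψ Y s (c.R s) * q s) with hp
  have hp' : ∀ s ∈ I, p s = -coeffB Ψ Y (s, c.R s) * c.tangent s 0
      - coeffC Ψ Y (s, c.R s) * c.tangent s 1 := by
    intro s hs
    simp only [hp]
    rw [hT1, hT0, hslope s hs,
      ← (H.coeff_raySlope (h0 s hs) (h1 s hs) (h2 s hs) (q s)).2]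
    ring
  have hqpos : ∀ r ∈ I, 0 < q r := by
    intro r hr
    have h := hc.future r hr
    rw [← Finset.sum_mul, Ray.point, metric_sum_one, ← hp' r hr] at h
    have a1 := hu r hr
    have a2 := hG r hr
    have a3 := hc.k_pos r hr
    have h4 : 0 < p r * u Ψ Y r (c.R r) := by linarith
    have h5 : 0 < p r := pos_of_mul_pos_left h4 a1.le
    exact pos_of_mul_pos_right (pos_of_mul_pos_right h5 a3.le) a2.le
  have hnull : ∀ r ∈ I, c.R r ^ 2 * c.tangent r 3 ^ 2 =
      c.k r ^ 2 * (kSpeed Ψ Y (r, c.R r) ^ 2 * (q r ^ 2 - 1)) := by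
    intro r hr
    have h := hc.null r hr
    rw [Ray.point, metric_sum _ _ (hT2 r), hT0, hT1, hslope r hr] at h
    rw [← (H.coeff_raySlope (h0 r hr) (h1 r hr) (h2 r hr) (q r)).1]
    linear_combination h
  have hqone : ∀ r ∈ I, 1 ≤ q r := by
    intro r hr
    have h := hnull r hr
    have a1 := hK r hr
    have a2 := hc.k_pos r hr
    have h3 : 0 ≤ c.k r ^ 2 * (kSpeed Ψ Y (r, c.R r) ^ 2 * (q r ^ 2 - 1)) := by
      rw [← h]; positivity
    have h4 : 0 ≤ q r ^ 2 - 1 := by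
      by_contra hlt
      have : 0 < c.k r ^ 2 * (kSpeed Ψ Y (r, c.R r) ^ 2 * (1 - q r ^ 2)) := by
        have : 0 < 1 - q r ^ 2 := by linarith
        positivity
      nlinarith
    nlinarith [hqpos r hr]
  have hgeo : ∀ r ∈ I, ∀ μ, geodesicSum Ψ Y ![r, c.R r, Real.pi / 2, c.φ r] (c.tangent r)
      (fun ν => deriv (fun s => c.tangent s ν) r) μ = 0 := fun r hr μ => hc.geodesic r hr μ
  have hd2 : ∀ r, deriv (fun s => c.tangent s 2) r = 0 := fun r => by
    simp only [hT2, deriv_const]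
  have hsum := fun r (hr : r ∈ I) => H.geodesicSum_eq (h0 r hr) (h1 r hr) (h2 r hr) (c.φ r)
    (c.tangent r) (fun ν => deriv (fun s => c.tangent s ν) r) (hT2 r) (hd2 r)
  have hL : ∀ r ∈ I, HasDerivAt (fun s => c.R s ^ 2 * c.tangent s 3) 0 r := by
    intro r hr
    have h := (hsum r hr).2.2.2
    rw [hgeo r hr, hT0, hT1, hslope r hr] at h
    refine (((hR r hr).pow 2).mul (hT r hr 3)).congr_deriv ?_
    have hk := hc.k_pos r hr
    refine mul_left_cancel₀ hk.ne' ?_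
    simp only [Pi.pow_apply]
    push_cast
    linear_combination -h
  have hconst := eq_of_hasDerivAt_zero hL
  have hmid : c.rmax / 2 ∈ I := ⟨by linarith [hc.rmax_pos], by linarith [hc.rmax_pos]⟩
  set ℓ := c.R (c.rmax / 2) ^ 2 * c.tangent (c.rmax / 2) 3 with hℓ
  have hℓ0 : 0 ≤ ℓ := mul_nonneg (sq_nonneg _) (hc.oriented _ hmid)
  have hLr : ∀ r ∈ I, c.R r ^ 2 * c.tangent r 3 = ℓ := fun r hr => hconst r hr _ hmid
  have hcons : ∀ r ∈ I, ℓ ^ 2 * q r ^ 2 =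
      c.R r ^ 2 * p r ^ 2 * u Ψ Y r (c.R r) ^ 2 * (q r ^ 2 - 1) := by
    intro r hr
    have h := hnull r hr
    rw [← hLr r hr]
    simp only [hp, kSpeed] at h ⊢
    linear_combination c.R r ^ 2 * q r ^ 2 * h
  have hpd : ∀ r ∈ I, HasDerivAt p (p r * rayForce Ψ Y (r, c.R r) (q r)) r := by
    intro r hr
    obtain ⟨-, dB, dC⟩ := H.differentiableAt_coeff (h0 r hr) (h1 r hr) (h2 r hr)
    have d := (((hcurve r hr _ dB).neg.mul (hT r hr 0)).sub
      ((hcurve r hr _ dC).mul (hT r hr 1)))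
    have e : p =ᶠ[𝓝 r] fun s => -coeffB Ψ Y (s, c.R s) * c.tangent s 0
      - coeffC Ψ Y (s, c.R s) * c.tangent s 1 := by
      filter_upwards [hnhds r hr] with s hs using hp' s hs
    refine (d.congr_of_eventuallyEq e).congr_deriv ?_
    have h := (hsum r hr).2.1
    have hF := H.rayForce_mul (h0 r hr) (h1 r hr) (h2 r hr) (hqpos r hr)
    have hn := hnull r hr
    have hk := hc.k_pos r hr
    have hRr := h0 r hr
    have hn' : c.R r * c.tangent r 3 ^ 2 =
        c.k r ^ 2 * (kSpeed Ψ Y (r, c.R r) ^ 2 * (q r ^ 2 - 1) / c.R r) := by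
      field_simp
      linear_combination hn
    rw [hgeo r hr, hn', hT0, hT1, hslope r hr] at h
    refine mul_left_cancel₀ hk.ne' ?_
    simp only [hp, Pi.neg_apply]
    rw [hT0 r, hT1 r, hslope r hr]
    linear_combination -h - c.k r ^ 2 * hF
  refine ⟨q, ℓ, hℓ0, ⟨h0, h1, hqone, hR, ?_⟩, hLr, ?_, ?_, ?_⟩
  · intro r hr
    have hqr := (hqd r hr).hasDerivAt
    have hud' := hcurve r hr _ (hud r hr)
    have d1 := (hqr.pow 2).const_mul (ℓ ^ 2)
    have d2 := ((((hR r hr).pow 2).mul ((hpd r hr).pow 2)).mul (hud'.pow 2)).mul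
      ((hqr.pow 2).sub_const 1)
    have e : (fun s => ℓ ^ 2 * q s ^ 2) =ᶠ[𝓝 r] fun s =>
        c.R s ^ 2 * p s ^ 2 * u Ψ Y s (c.R s) ^ 2 * (q s ^ 2 - 1) := by
      filter_upwards [hnhds r hr] with s hs using hcons s hs
    have h' := d1.unique (d2.congr_of_eventuallyEq e)
    have hpr : 0 < p r := mul_pos (hc.k_pos r hr) (mul_pos (hG r hr) (hqpos r hr))
    have key := deriv_q_of_conservation (h0 r hr) hpr (hu r hr) (hqpos r hr) (hcons r hr)
      (q' := deriv q r) (by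
        simp only [Pi.pow_apply, Pi.mul_apply] at h'
        push_cast at h'
        linear_combination h')
      (H.rayTurn_eq (h0 r hr) (h1 r hr) (h2 r hr) (hqpos r hr))
    rw [← key]
    exact hqr
  · intro r hr
    refine (hc.differentiable_φ r hr).hasDerivAt.congr_deriv ?_
    have h := hnull r hr
    have ho := hc.oriented r hr
    have hk := hc.k_pos r hr
    have hRr := h0 r hr
    rw [hT3] at h ho
    have hφ : 0 ≤ deriv c.φ r := nonneg_of_mul_nonneg_right ho hk
    have h3 : (c.R r * deriv c.φ r / kSpeed Ψ Y (r, c.R r)) ^ 2 = q r ^ 2 - 1 := by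
      have := hK r hr
      field_simp
      have h5 : c.k r ^ 2 * (c.R r ^ 2 * deriv c.φ r ^ 2) =
          c.k r ^ 2 * (kSpeed Ψ Y (r, c.R r) ^ 2 * (q r ^ 2 - 1)) := by linear_combination h
      exact mul_left_cancel₀ (by positivity) h5
    have := hK r hr
    rw [← h3, Real.sqrt_sq (by positivity)]
    field_simp
  · intro h r hr
    have h3 := hcons r hr
    have hpr : 0 < p r := mul_pos (hc.k_pos r hr) (mul_pos (hG r hr) (hqpos r hr))
    have hRr := h0 r hr
    have hur := hu r hr
    rw [h] at h3
    have h4 : c.R r ^ 2 * p r ^ 2 * u Ψ Y r (c.R r) ^ 2 * (q r ^ 2 - 1) = 0 := by rw [← h3]; ring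
    have h5 := (mul_eq_zero.1 h4).resolve_left (by positivity)
    nlinarith [hqpos r hr]
  · intro h r hr
    have h3 := hcons r hr
    refine lt_of_le_of_ne (hqone r hr) fun h6 => ?_
    rw [← h6] at h3
    have : 0 < ℓ ^ 2 := by positivity
    norm_num at h3
    linarith

end Collapse
end

/-! ### From light rays to null geodesics -/

noncomputable section
namespace Collapse

variable {Ψ Y : ℝ → ℝ → ℝ} {rb α ξ : ℝ}

/-- Continuous functions on an interval have primitives. -/
theorem exists_primitive {f : ℝ → ℝ} {b : ℝ} (hb : 0 < b) (hf : ∀ r ∈ Ioo 0 b, ContinuousAt f r) :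
    ∃ F : ℝ → ℝ, ∀ r ∈ Ioo 0 b, HasDerivAt F (f r) r := by
  refine ⟨fun r => ∫ s in (b / 2)..r, f s, fun r hr => ?_⟩
  have hsub : uIcc (b / 2) r ⊆ Ioo 0 b :=
    (ordConnected_Ioo (a := (0 : ℝ)) (b := b)).uIcc_subset ⟨by linarith, by linarith⟩ hr
  have hcont : ContinuousOn f (Ioo 0 b) := fun s hs => (hf s hs).continuousWithinAt
  exact intervalIntegral.integral_hasDerivAt_right
    (ContinuousOn.intervalIntegrable fun s hs => (hf s (hsub hs)).continuousWithinAt)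
    (ContinuousOn.stronglyMeasurableAtFilter isOpen_Ioo hcont r hr) (hf r hr)

theorem IsCollapse.continuousAt_rayForce (H : IsCollapse Ψ Y rb α ξ) {r R : ℝ} (h0 : 0 < R)
    (h1 : R < r) (h2 : r < rb) {q : ℝ} (hq : q ≠ 0) :
    ContinuousAt (fun p : (ℝ × ℝ) × ℝ => rayForce Ψ Y p.1 p.2) ((r, R), q) := by
  have aux : ∀ f : ℝ × ℝ → ℝ, ContinuousAt f (r, R) →
      ContinuousAt (fun p : (ℝ × ℝ) × ℝ => f p.1) ((r, R), q) := fun f hf =>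
    ContinuousAt.comp (g := f) (f := fun p : (ℝ × ℝ) × ℝ => p.1) hf continuousAt_fst
  have hY := aux _ (H.contDiff_Y r R h0.le h1.le h2).continuousAt
  have hYR := aux _ (contDiffAt_dR (m := 0) (H.contDiff_Y r R h0.le h1.le h2)
    (by norm_num)).continuousAt
  have hu := aux _ (H.contDiffAt_u h0 h1.le h2).continuousAt
  have huR := aux _ (contDiffAt_dR (m := 0) (H.contDiffAt_u h0 h1.le h2)
    (by norm_num)).continuousAt
  have hG := aux _ (H.contDiffAt_G h0 h1 h2).continuousAt
  have hg := aux _ (H.contDiffAt_gDens h0.le h1.le (h0.trans h1) h2).continuousAt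
  have hKR := aux _ (H.contDiffAt_kSpeedR h0 h1 h2).continuousAt
  have hq' : ContinuousAt (fun p : (ℝ × ℝ) × ℝ => p.2) ((r, R), q) := continuousAt_snd
  have hR : ContinuousAt (fun p : (ℝ × ℝ) × ℝ => p.1.2) ((r, R), q) := by fun_prop
  have hs : ContinuousAt (fun p : (ℝ × ℝ) × ℝ => √p.1.2) ((r, R), q) := by fun_prop
  exact (((hu.neg.mul (((hs.mul hg).mul hY).add (hG.mul hYR))).sub
    ((hG.mul (hY.sub (hu.mul hq'))).mul huR)).add ((hu.mul hKR).div hq' hq)).add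
    (((hG.mul (hu.pow 2)).mul ((hq'.pow 2).sub continuousAt_const)).div (hq'.mul hR)
      (mul_ne_zero hq h0.ne'))

/-- The affine parameter and the angle are recovered by quadratures: p = exp ∫ `rayForce` fixes k =
p / (G q), and then φ' = ℓ / (R² k). -/
theorem IsLightRay.exists_ray (H : IsCollapse Ψ Y rb α ξ) {b : ℝ} (hb : 0 < b) (hbr : b ≤ rb)
    {R q : ℝ → ℝ} (h : IsLightRay Ψ Y b R q) : ∃ (c : Ray) (ℓ : ℝ), c.rmax = b ∧ c.R = R ∧
      c.IsNullGeodesic Ψ Y rb ∧ c.HasAngularMomentum ℓ ∧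
      ((∃ r ∈ Ioo 0 b, q r = 1) → ℓ = 0) ∧ ((∃ r ∈ Ioo 0 b, 1 < q r) → 0 < ℓ) := by
  set I := Ioo 0 b with hI
  have h0 := h.pos
  have h1 := h.lt
  have h2 : ∀ r ∈ I, r < rb := fun r hr => hr.2.trans_le hbr
  have hqpos : ∀ r ∈ I, 0 < q r := fun r hr => one_pos.trans_le (h.one_le r hr)
  have hu : ∀ r ∈ I, 0 < u Ψ Y r (R r) := fun r hr => H.u_pos (h0 r hr) (h1 r hr).le (h2 r hr)
  have hG : ∀ r ∈ I, 0 < G Ψ Y r (R r) := fun r hr => H.G_pos r _ (h0 r hr) (h1 r hr).le (h2 r hr)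
  have hnhds : ∀ r ∈ I, I ∈ 𝓝 r := fun r hr => Ioo_mem_nhds hr.1 hr.2
  have hcurve : ∀ r ∈ I, ∀ f : ℝ × ℝ → ℝ, DifferentiableAt ℝ f (r, R r) →
      HasDerivAt (fun s => f (s, R s)) (dr f (r, R r) + dR f (r, R r) *
        raySlope Ψ Y (r, R r) (q r)) r := by
    intro r hr f hf
    have := hasDerivAt_comp_curve (a := fun s => s) hf (hasDerivAt_id r) (h.deriv_R r hr)
    rwa [mul_one] at this
  have hud : ∀ r ∈ I, DifferentiableAt ℝ (fun x : ℝ × ℝ => u Ψ Y x.1 x.2) (r, R r) := fun r hr =>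
    (H.contDiffAt_u (h0 r hr) (h1 r hr).le (h2 r hr)).differentiableAt (by simp)
  have hGd : ∀ r ∈ I, DifferentiableAt ℝ (fun x : ℝ × ℝ => G Ψ Y x.1 x.2) (r, R r) := fun r hr =>
    (H.contDiffAt_G (h0 r hr) (h1 r hr) (h2 r hr)).differentiableAt (by simp)
  have hpt : ∀ r ∈ I, DifferentiableAt ℝ (fun s => (((s, R s), q s) : (ℝ × ℝ) × ℝ)) r :=
    fun r hr => (differentiableAt_id.prodMk (h.deriv_R r hr).differentiableAt).prodMk
      (h.deriv_q r hr).differentiableAt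
  obtain ⟨F, hF⟩ := exists_primitive (f := fun r => rayForce Ψ Y (r, R r) (q r)) hb fun r hr =>
    ContinuousAt.comp (g := fun p : (ℝ × ℝ) × ℝ => rayForce Ψ Y p.1 p.2)
      (f := fun s => (((s, R s), q s) : (ℝ × ℝ) × ℝ))
      (H.continuousAt_rayForce (h0 r hr) (h1 r hr) (h2 r hr) (hqpos r hr).ne')
      (hpt r hr).continuousAt
  set p : ℝ → ℝ := fun r => Real.exp (F r) with hp
  have hppos : ∀ r, 0 < p r := fun r => Real.exp_pos _
  have hpd : ∀ r ∈ I, HasDerivAt p (p r * rayForce Ψ Y (r, R r) (q r)) r := fun r hr => (hF r hr).exp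
  set k : ℝ → ℝ := fun r => p r / (G Ψ Y r (R r) * q r) with hk
  have hkpos : ∀ r ∈ I, 0 < k r := fun r hr =>
    div_pos (hppos r) (mul_pos (hG r hr) (hqpos r hr))
  have hkd : ∀ r ∈ I, DifferentiableAt ℝ k r := fun r hr =>
    (hpd r hr).differentiableAt.div ((hcurve r hr _ (hGd r hr)).differentiableAt.mul
      (h.deriv_q r hr).differentiableAt) (mul_pos (hG r hr) (hqpos r hr)).ne'
  -- The candidate for ℓ²; its constancy is `rayTurn_eq` combined with the equation for q.
  set W : ℝ → ℝ := fun r => (R r * p r * u Ψ Y r (R r)) ^ 2 * (1 - (q r ^ 2)⁻¹) with hW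
  have hWd : ∀ r ∈ I, HasDerivAt W 0 r := by
    intro r hr
    have d := ((((h.deriv_R r hr).mul (hpd r hr)).mul (hcurve r hr _ (hud r hr))).pow 2).mul
      ((((h.deriv_q r hr).pow 2).inv (by have := hqpos r hr; simp only [Pi.pow_apply]; positivity)).const_sub 1)
    refine d.congr_deriv ?_
    have e := H.rayTurn_eq (h0 r hr) (h1 r hr) (h2 r hr) (hqpos r hr)
    have a0 := h0 r hr
    have a1 := hqpos r hr
    have a2 := hu r hr
    have a3 := hppos r
    set R' := raySlope Ψ Y (r, R r) (q r)
    set f := rayForce Ψ Y (r, R r) (q r)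
    set u' := dr (fun x => u Ψ Y x.1 x.2) (r, R r) + dR (fun x => u Ψ Y x.1 x.2) (r, R r) * R'
    set τ := rayTurn Ψ Y (r, R r) (q r)
    have e2 : (R' * p r + R r * (p r * f)) * u Ψ Y r (R r) + R r * p r * u' =
        R r * p r * u Ψ Y r (R r) * (-τ / q r) := by
      rw [← e]; field_simp
    simp only [Pi.pow_apply, Pi.mul_apply, Pi.inv_apply]
    push_cast
    rw [e2]
    field_simp
    ring
  have hmid : b / 2 ∈ I := ⟨by linarith, by linarith⟩
  have hWnonneg : 0 ≤ W (b / 2) := by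
    have : (q (b / 2) ^ 2)⁻¹ ≤ 1 := inv_le_one_of_one_le₀ (one_le_pow₀ (h.one_le _ hmid))
    exact mul_nonneg (sq_nonneg _) (by linarith)
  set ℓ := √(W (b / 2)) with hℓ
  have hℓ0 : 0 ≤ ℓ := Real.sqrt_nonneg _
  have hℓW : ∀ r ∈ I, ℓ ^ 2 = W r := fun r hr => by
    rw [hℓ, Real.sq_sqrt hWnonneg]
    exact eq_of_hasDerivAt_zero hWd _ hmid r hr
  have hR2 : ∀ r ∈ I, 0 < R r ^ 2 * k r := fun r hr => by
    have := h0 r hr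
    have := hkpos r hr
    positivity
  obtain ⟨φ, hφ⟩ := exists_primitive (f := fun r => ℓ / (R r ^ 2 * k r)) hb fun r hr =>
    continuousAt_const.div (((h.deriv_R r hr).continuousAt.pow 2).mul (hkd r hr).continuousAt)
      (hR2 r hr).ne'
  set c : Ray := ⟨b, R, φ, k⟩ with hc
  have hT0 : ∀ r, c.tangent r 0 = k r := fun r => rfl
  have hT1 : ∀ r ∈ I, c.tangent r 1 = k r * raySlope Ψ Y (r, R r) (q r) := fun r hr => by
    show k r * deriv R r = _
    rw [(h.deriv_R r hr).deriv]
  have hT2 : ∀ r, c.tangent r 2 = 0 := fun r => rfl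
  have hT3 : ∀ r ∈ I, c.tangent r 3 = ℓ / R r ^ 2 := fun r hr => by
    show k r * deriv φ r = _
    rw [(hφ r hr).deriv]
    have := hkpos r hr
    have := h0 r hr
    field_simp
  have hTd : ∀ r ∈ I, ∀ ν, DifferentiableAt ℝ (fun s => c.tangent s ν) r := by
    intro r hr ν
    have hs : DifferentiableAt ℝ (fun s => raySlope Ψ Y (s, R s) (q s)) r :=
      DifferentiableAt.comp (g := fun p : (ℝ × ℝ) × ℝ => raySlope Ψ Y p.1 p.2) r
        ((H.contDiffAt_raySlope (h0 r hr) (h1 r hr) (h2 r hr) (q r)).differentiableAt (by simp))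
        (hpt r hr)
    fin_cases ν
    · exact hkd r hr
    · refine ((hkd r hr).mul hs).congr_of_eventuallyEq ?_
      filter_upwards [hnhds r hr] with s hsI using hT1 s hsI
    · exact differentiableAt_const 0
    · refine ((differentiableAt_const ℓ).div ((h.deriv_R r hr).differentiableAt.pow 2)
        (pow_pos (h0 r hr) 2).ne').congr_of_eventuallyEq ?_
      filter_upwards [hnhds r hr] with s hsI using hT3 s hsI
  have hTd' : ∀ r ∈ I, ∀ ν, HasDerivAt (fun s => c.tangent s ν)
    (deriv (fun s => c.tangent s ν) r) r := fun r hr ν => (hTd r hr ν).hasDerivAt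
  have hp' : ∀ s ∈ I, p s = -coeffB Ψ Y (s, R s) * c.tangent s 0
      - coeffC Ψ Y (s, R s) * c.tangent s 1 := by
    intro s hs
    have e := (H.coeff_raySlope (h0 s hs) (h1 s hs) (h2 s hs) (q s)).2
    have hgq := mul_pos (hG s hs) (hqpos s hs)
    have : p s = k s * (G Ψ Y s (R s) * q s) := by
      simp only [hk]
      rw [div_mul_cancel₀ _ hgq.ne']
    rw [this, hT1 s hs, hT0, ← e]
    ring
  have hnull : ∀ r ∈ I, coeffA Ψ Y (r, R r) * c.tangent r 0 ^ 2
      + 2 * coeffB Ψ Y (r, R r) * c.tangent r 0 * c.tangent r 1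
      + coeffC Ψ Y (r, R r) * c.tangent r 1 ^ 2 - R r ^ 2 * c.tangent r 3 ^ 2 = 0 := by
    intro r hr
    have e := (H.coeff_raySlope (h0 r hr) (h1 r hr) (h2 r hr) (q r)).1
    have e2 := hℓW r hr
    have a0 := h0 r hr
    have a1 := hqpos r hr
    have a2 := hG r hr
    have e3 : R r ^ 2 * (ℓ / R r ^ 2) ^ 2 = k r ^ 2 * (kSpeed Ψ Y (r, R r) ^ 2 * (q r ^ 2 - 1)) := by
      have : R r ^ 2 * (ℓ / R r ^ 2) ^ 2 = ℓ ^ 2 / R r ^ 2 := by field_simp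
      rw [this, e2]
      simp only [hW, hk, kSpeed]
      field_simp
    rw [hT3 r hr, e3, hT1 r hr, hT0]
    linear_combination k r ^ 2 * e
  refine ⟨c, ℓ, rfl, rfl, ⟨hb, hbr, fun r hr => ⟨h0 r hr, h1 r hr⟩,
    fun r hr => (h.deriv_R r hr).differentiableAt, fun r hr => (hφ r hr).differentiableAt,
    fun r hr => differentiableAt_pi.2 (hTd r hr), hkpos, ?_, ?_, ?_, ?_⟩, ?_, ?_, ?_⟩
  · intro r hr
    have := hnull r hr
    rw [Ray.point, metric_sum _ _ (hT2 r)]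
    show -(coeffA Ψ Y (r, R r) * _ + _ + _) + R r ^ 2 * _ = 0
    linear_combination -this
  · intro r hr
    rw [← Finset.sum_mul, Ray.point, metric_sum_one]
    show (-coeffB Ψ Y (r, R r) * _ - coeffC Ψ Y (r, R r) * _) * -u Ψ Y r (R r) < 0
    rw [← hp' r hr]
    have := mul_pos (hppos r) (hu r hr)
    linarith
  · intro r hr μ
    have hd2 : deriv (fun s => c.tangent s 2) r = 0 := by simp only [hT2, deriv_const]
    obtain ⟨s0, s1, s2, s3⟩ := H.geodesicSum_eq (h0 r hr) (h1 r hr) (h2 r hr) (c.φ r)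
      (c.tangent r) (fun ν => deriv (fun s => c.tangent s ν) r) (hT2 r) hd2
    obtain ⟨dA, dB, dC⟩ := H.differentiableAt_coeff (h0 r hr) (h1 r hr) (h2 r hr)
    have hkr := hkpos r hr
    have hRr := h0 r hr
    have d3 : deriv (fun s => c.tangent s 3) r =
        -(2 * R r * raySlope Ψ Y (r, R r) (q r)) * ℓ / R r ^ 4 := by
      have e : (fun s => c.tangent s 3) =ᶠ[𝓝 r] fun s => ℓ / R s ^ 2 := by
        filter_upwards [hnhds r hr] with s hsI using hT3 s hsI
      rw [e.deriv_eq]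
      refine (((hasDerivAt_const r ℓ).div ((h.deriv_R r hr).pow 2)
        (pow_pos hRr 2).ne').congr_deriv ?_).deriv
      simp only [Pi.pow_apply]
      push_cast
      field_simp
      ring
    have z3 : geodesicSum Ψ Y ![r, R r, Real.pi / 2, φ r] (c.tangent r)
        (fun ν => deriv (fun s => c.tangent s ν) r) 3 = 0 := by
      refine s3.trans ?_
      rw [d3, hT3 r hr, hT1 r hr, hT0]
      field_simp
      ring
    have z1 : geodesicSum Ψ Y ![r, R r, Real.pi / 2, φ r] (c.tangent r)
        (fun ν => deriv (fun s => c.tangent s ν) r) 1 = 0 := by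
      refine s1.trans ?_
      have d := (((hcurve r hr _ dB).neg.mul (hTd' r hr 0)).sub
        ((hcurve r hr _ dC).mul (hTd' r hr 1)))
      have e : p =ᶠ[𝓝 r] fun s => -coeffB Ψ Y (s, R s) * c.tangent s 0
        - coeffC Ψ Y (s, R s) * c.tangent s 1 := by
        filter_upwards [hnhds r hr] with s hs using hp' s hs
      have eq := (hpd r hr).unique (d.congr_of_eventuallyEq e)
      have hF := H.rayForce_mul (h0 r hr) (h1 r hr) (h2 r hr) (hqpos r hr)
      have hn := hnull r hr
      have e' := (H.coeff_raySlope (h0 r hr) (h1 r hr) (h2 r hr) (q r)).1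
      have hn' : R r * c.tangent r 3 ^ 2 =
          k r ^ 2 * (kSpeed Ψ Y (r, R r) ^ 2 * (q r ^ 2 - 1) / R r) := by
        rw [hT0, hT1 r hr] at hn
        field_simp
        linear_combination k r ^ 2 * e' - hn
      have hgq := mul_pos (hG r hr) (hqpos r hr)
      have hpk : p r = k r * (G Ψ Y r (R r) * q r) := by
        simp only [hk]
        rw [div_mul_cancel₀ _ hgq.ne']
      rw [hpk] at eq
      simp only [Pi.neg_apply] at eq ⊢
      show _ - R r * c.tangent r 3 ^ 2 = 0
      rw [hn']
      rw [hT1 r hr, hT0 r] at eq ⊢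
      linear_combination (-k r) * eq + k r ^ 2 * hF
    -- Differentiating the null constraint gives the contraction of the geodesic equation with the
    -- tangent. Since k > 0, the r-component follows from the others.
    have z0 : geodesicSum Ψ Y ![r, R r, Real.pi / 2, φ r] (c.tangent r)
        (fun ν => deriv (fun s => c.tangent s ν) r) 0 = 0 := by
      have d := ((((hcurve r hr _ dA).mul ((hTd' r hr 0).pow 2)).add
        ((((hcurve r hr _ dB).const_mul 2).mul (hTd' r hr 0)).mul (hTd' r hr 1))).add
        ((hcurve r hr _ dC).mul ((hTd' r hr 1).pow 2))).sub
        (((h.deriv_R r hr).pow 2).mul ((hTd' r hr 3).pow 2))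
      have e : (fun _ => (0 : ℝ)) =ᶠ[𝓝 r] fun s => coeffA Ψ Y (s, R s) * c.tangent s 0 ^ 2
          + 2 * coeffB Ψ Y (s, R s) * c.tangent s 0 * c.tangent s 1
          + coeffC Ψ Y (s, R s) * c.tangent s 1 ^ 2 - R s ^ 2 * c.tangent s 3 ^ 2 := by
        filter_upwards [hnhds r hr] with s hs using (hnull s hs).symm
      have eq := (hasDerivAt_const r (0 : ℝ)).unique (d.congr_of_eventuallyEq e)
      have y1 := s1.symm.trans z1
      have y3 := s3.symm.trans z3
      refine s0.trans ?_
      simp only [Pi.pow_apply, Pi.mul_apply] at eq y1 y3 ⊢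
      push_cast at eq
      change _ - R r * c.tangent r 3 ^ 2 = 0 at y1
      change R r ^ 2 * _ * _ + 2 * R r * _ * _ = 0 at y3
      refine mul_left_cancel₀ hkr.ne' ?_
      rw [hT1 r hr, hT0 r] at eq y1 y3 ⊢
      linear_combination (k r / 2) * eq - (k r * raySlope Ψ Y (r, R r) (q r)) * y1 - c.tangent r 3 * y3
    fin_cases μ
    · exact z0
    · exact z1
    · exact s2
    · exact z3
  · intro r hr
    rw [hT3 r hr]
    have := h0 r hr
    positivity
  · intro r hr
    rw [hT3 r hr]
    have : 0 < R r := h0 r hr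
    show R r ^ 2 * _ = _
    field_simp
  · rintro ⟨r, hr, hq⟩
    have := hℓW r hr
    simp only [hW, hq] at this
    norm_num at this
    exact this
  · rintro ⟨r, hr, hq⟩
    have h3 := hℓW r hr
    have a0 := h0 r hr
    have a1 := hppos r
    have a2 := hu r hr
    have : (q r ^ 2)⁻¹ < 1 := inv_lt_one_of_one_lt₀ (one_lt_pow₀ hq two_ne_zero)
    have h4 : 0 < W r := mul_pos (by positivity) (by linarith)
    rw [← h3] at h4
    exact hℓ0.lt_of_ne' (pow_ne_zero_iff two_ne_zero |>.1 h4.ne')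

end Collapse
end

/-! ### Change of variables between light rays and trajectories -/

noncomputable section
namespace Collapse

variable {Ψ Y : ℝ → ℝ → ℝ} {rb α ξ b : ℝ} {R q : ℝ → ℝ}

/-- The function `R(r)` of a trajectory of `rayField`. -/
def radiusOf (α : ℝ) (z : ℝ → ℝ × ℝ) (r : ℝ) : ℝ := α * r ^ 3 / (z (-Real.log r)).1 ^ 2

theorem position_neg_log {z : ℝ → ℝ × ℝ} {r : ℝ} (hr : 0 < r) :
    position α (-Real.log r) (z (-Real.log r)).1 = (r, radiusOf α z r) := by
  simp [position, radiusOf, Real.exp_log hr]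

/-- Compactness bounds v below, so R = α r³/v² lies below r once r is small. The bound b ≤ exp(-T)
ensures that only times after T occur. -/
theorem IsTrajectory.exists_isLightRay (H : IsCollapse Ψ Y rb α ξ) {S : Set (ℝ × ℝ)}
    (hS : S ⊆ phase) (hSc : IsCompact S) {T : ℝ} {z : ℝ → ℝ × ℝ}
    (hz : IsTrajectory (rayField Ψ Y α) S T z) : ∃ b, 0 < b ∧ b ≤ rb ∧ b ≤ Real.exp (-T) ∧
      IsLightRay Ψ Y b (radiusOf α z) (fun r => (z (-Real.log r)).2) := by
  obtain ⟨v₀, hv₀, hv⟩ := exists_pos_le_of_isCompact hSc (f := Prod.fst)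
    continuous_fst.continuousOn fun z hz => (hS hz).1
  obtain ⟨T₁, hT₁⟩ := eventually_atTop.1 (eventually_position H.alpha_pos H.rb_pos hv₀)
  have hlog : ∀ {r}, r ∈ Ioo 0 (min rb (Real.exp (-(max T T₁)))) → 0 < r ∧ T < -Real.log r ∧
      T₁ < -Real.log r := by
    intro r hr
    have h1 := (Real.log_lt_iff_lt_exp hr.1).2 (hr.2.trans_le (min_le_right _ _))
    have h2 := le_max_left T T₁
    have h3 := le_max_right T T₁
    exact ⟨hr.1, by linarith, by linarith⟩
  have hpos : ∀ r ∈ Ioo 0 (min rb (Real.exp (-(max T T₁)))), 0 < radiusOf α z r ∧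
      radiusOf α z r < r := by
    intro r hr
    obtain ⟨h0, h1, h2⟩ := hlog hr
    have := hT₁ _ h2.le _ (hv _ (hz.mem _ h1.le))
    rw [position_neg_log h0] at this
    exact ⟨this.1, this.2.1⟩
  refine ⟨min rb (Real.exp (-(max T T₁))), lt_min H.rb_pos (Real.exp_pos _), min_le_left _ _,
    (min_le_right _ _).trans (Real.exp_le_exp.2 (neg_le_neg (le_max_left _ _))),
    fun r hr => (hpos r hr).1, fun r hr => (hpos r hr).2,
    fun r hr => (hS (hz.mem _ (hlog hr).2.1.le)).2, fun r hr => ?_, fun r hr => ?_⟩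
  · obtain ⟨h0, h1, h2⟩ := hlog hr
    have hzv := (hS (hz.mem _ h1.le)).1
    have hd := (hasDerivWithinAt_univ.1 (hasDerivWithinAt_fst
      (hz.hasDerivAt h1).hasDerivWithinAt)).comp r (Real.hasDerivAt_log h0.ne').neg
    have hR := (hpos r hr).1
    have := (((hasDerivAt_id r).pow 3).const_mul α).div (hd.pow 2) (pow_pos hzv 2).ne'
    refine this.congr_deriv ?_
    simp only [rayField, position_neg_log h0, neg_neg, Real.exp_log h0, Pi.pow_apply, id,
      Function.comp, Pi.neg_apply]
    push_cast
    generalize raySlope Ψ Y (r, radiusOf α z r) (z (-Real.log r)).2 = s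
    have hR' : radiusOf α z r = α * r ^ 3 / (z (-Real.log r)).1 ^ 2 := rfl
    rw [hR']
    have hα := H.alpha_pos
    field_simp
    ring
  · obtain ⟨h0, h1, h2⟩ := hlog hr
    have hd := (hasDerivWithinAt_univ.1 (hasDerivWithinAt_snd
      (hz.hasDerivAt h1).hasDerivWithinAt)).comp r (Real.hasDerivAt_log h0.ne').neg
    refine hd.congr_deriv ?_
    simp only [rayField, position_neg_log h0, neg_neg, Real.exp_log h0]
    field_simp

/-- The trajectory of `rayField` of a light ray. -/
def phaseOf (α : ℝ) (R q : ℝ → ℝ) (t : ℝ) : ℝ × ℝ :=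
  (√(α * Real.exp (-t) ^ 3 / R (Real.exp (-t))), q (Real.exp (-t)))

namespace IsLightRay

theorem exp_mem {t : ℝ} (hb : 0 < b) (ht : -Real.log b < t) : Real.exp (-t) ∈ Ioo 0 b := by
  refine ⟨Real.exp_pos _, ?_⟩
  rw [← Real.lt_log_iff_exp_lt hb]
  linarith

theorem phaseOf_pos (h : IsLightRay Ψ Y b R q) (hα : 0 < α) (hb : 0 < b) {t : ℝ}
    (ht : -Real.log b < t) : 0 < (phaseOf α R q t).1 := by
  have h0 := h.pos _ (exp_mem hb ht)
  have := Real.exp_pos (-t)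
  exact Real.sqrt_pos.2 (by positivity)

theorem position_phaseOf (h : IsLightRay Ψ Y b R q) (hα : 0 < α) (hb : 0 < b) {t : ℝ}
    (ht : -Real.log b < t) :
    position α t (phaseOf α R q t).1 = (Real.exp (-t), R (Real.exp (-t))) := by
  have h0 := h.pos _ (exp_mem hb ht)
  have := Real.exp_pos (-t)
  simp only [position, phaseOf]
  rw [Real.sq_sqrt (by positivity)]
  congr 1
  field_simp

theorem hasDerivAt_phaseOf (h : IsLightRay Ψ Y b R q) (hα : 0 < α) (hb : 0 < b) {t : ℝ}
    (ht : -Real.log b < t) : HasDerivAt (phaseOf α R q)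
      (rayField Ψ Y α t (phaseOf α R q t)) t := by
  have hm := exp_mem hb ht
  have h0 := h.pos _ hm
  have he := Real.exp_pos (-t)
  have dexp : HasDerivAt (fun t : ℝ => Real.exp (-t)) (-Real.exp (-t)) t := by
    simpa using (hasDerivAt_neg t).exp
  have dR := (h.deriv_R _ hm).comp t dexp
  have dq := (h.deriv_q _ hm).comp t dexp
  have d1 := (((dexp.pow 3).const_mul α).div dR h0.ne').sqrt
    (by show α * Real.exp (-t) ^ 3 / R (Real.exp (-t)) ≠ 0; positivity)
  refine (d1.prodMk dq).congr_deriv ?_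
  have hv := h.phaseOf_pos hα hb ht
  simp only [rayField, h.position_phaseOf hα hb ht]
  refine Prod.ext ?_ ?_
  · simp only [Pi.div_apply, Function.comp, Pi.pow_apply]
    have e1 : (phaseOf α R q t).1 = √(α * Real.exp (-t) ^ 3 / R (Real.exp (-t))) := rfl
    have e2 : (phaseOf α R q t).2 = q (Real.exp (-t)) := rfl
    rw [← e1, ← e2]
    have e3 : α = (phaseOf α R q t).1 ^ 2 * R (Real.exp (-t)) / Real.exp (-t) ^ 3 := by
      rw [e1, Real.sq_sqrt (by positivity)]
      field_simp
    generalize raySlope Ψ Y (Real.exp (-t), R (Real.exp (-t))) (phaseOf α R q t).2 = s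
    generalize (phaseOf α R q t).1 = v at hv e3
    rw [e3]
    push_cast
    field_simp
    ring
  · simp only [phaseOf]
    ring

end IsLightRay

end Collapse
end

/-! ### A priori bounds: R is of the order of r³ -/

noncomputable section
namespace Collapse

variable {Ψ Y : ℝ → ℝ → ℝ} {rb α ξ b r : ℝ} {R q : ℝ → ℝ}

theorem nonpos_of_deriv_nonpos {f f' : ℝ → ℝ} {b : ℝ} (hf : ∀ r ∈ Ioo 0 b, HasDerivAt f (f' r) r)
    (hf' : ∀ r ∈ Ioo 0 b, f' r ≤ 0) (h0 : Tendsto f (𝓝[>] 0) (𝓝 0)) : ∀ r ∈ Ioo 0 b, f r ≤ 0 := by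
  have hanti : AntitoneOn f (Ioo 0 b) := by
    refine antitoneOn_of_hasDerivWithinAt_nonpos (convex_Ioo 0 b)
      (fun r hr => (hf r hr).continuousAt.continuousWithinAt) (f' := f') ?_ ?_
    · rw [interior_Ioo]; exact fun r hr => (hf r hr).hasDerivWithinAt
    · rw [interior_Ioo]; exact hf'
  intro r hr
  refine ge_of_tendsto h0 ?_
  filter_upwards [Ioo_mem_nhdsGT hr.1] with s hs
  exact hanti ⟨hs.1, hs.2.trans hr.2⟩ hr hs.2.le

/-- The integrand of `∫₀^R dσ / (u Y)`, divided by `√σ`. -/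
def travelDens (Ψ Y : ℝ → ℝ → ℝ) (x : ℝ × ℝ) : ℝ := 1 / (√(rUSq Ψ Y x) * Y x.1 x.2)

namespace IsCollapse

variable (H : IsCollapse Ψ Y rb α ξ)
include H

theorem contDiffAt_travelDens {R : ℝ} (h0 : 0 ≤ R) (h1 : R ≤ r) (hr : 0 < r) (h2 : r < rb) :
    ContDiffAt ℝ 1 (travelDens Ψ Y) (r, R) := by
  have hp := H.rUSq_pos h0 h1 hr h2
  have hY0 := H.Y_pos r R h0 h1 h2
  have hY := (H.contDiff_Y r R h0 h1 h2).of_le (m := 1) (by norm_num)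
  have hP := (H.contDiffAt_rUSq h0 h1 h2).of_le (m := 1) (by norm_num)
  exact contDiffAt_const.div ((hP.sqrt hp.ne').mul hY) (by positivity)

/-- The term -`gDens` is minus the density of ∂_R G. This is why ∫₀^R dσ/(uY) is a good quantity
along rays: the R-dependence of G cancels in its derivative. -/
theorem dr_travelDens {R : ℝ} (h0 : 0 ≤ R) (h1 : R ≤ r) (hr : 0 < r) (h2 : r < rb) :
    dr (travelDens Ψ Y) (r, R) = -gDens Ψ Y (r, R)
      - dr (fun x => Y x.1 x.2) (r, R) / Y r R * travelDens Ψ Y (r, R) := by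
  have hp := H.rUSq_pos h0 h1 hr h2
  have hY0 := H.Y_pos r R h0 h1 h2
  have hs := Real.sqrt_pos.2 hp
  have d := hasDerivAt_dr ((H.contDiffAt_travelDens h0 h1 hr h2).differentiableAt (by simp))
  have dY := hasDerivAt_dr ((H.contDiff_Y r R h0 h1 h2).differentiableAt (by simp))
  have dP := hasDerivAt_dr ((H.contDiffAt_rUSq h0 h1 h2).differentiableAt (by simp))
  have d' := (hasDerivAt_const r (1 : ℝ)).div ((dP.sqrt hp.ne').mul dY)
    (by show √(rUSq Ψ Y (r, R)) * Y r R ≠ 0; positivity)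
  refine d.unique (d'.congr_deriv ?_)
  simp only [gDens, travelDens, Pi.mul_apply]
  have e : rUSq Ψ Y (r, R) = √(rUSq Ψ Y (r, R)) ^ 2 := (Real.sq_sqrt hp.le).symm
  generalize √(rUSq Ψ Y (r, R)) = s at hs e
  rw [e]
  field_simp
  ring

theorem tendsto_travelDens : Tendsto (fun x : ℝ × ℝ => travelDens Ψ Y x * (x.1 * √x.1)) cone
    (𝓝 (1 / √α)) := by
  have hs := Real.sqrt_pos.2 H.alpha_pos
  have h := (H.tendsto_rUSq.1.sqrt.mul H.tendsto_Y).inv₀ (by positivity)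
  rw [mul_one, ← one_div] at h
  refine h.congr' ?_
  filter_upwards [eventually_cone_region H.rb_pos] with ⟨r, R⟩ ⟨hx0, hx1, hx2⟩
  simp only at hx0 hx1 hx2 ⊢
  have hr := hx0.trans hx1
  have hp := H.rUSq_pos hx0.le hx1.le hr hx2
  have hY := H.Y_pos r R hx0.le hx1.le hx2
  have hps := Real.sqrt_pos.2 hp
  have hrs := Real.sqrt_pos.2 hr
  have e1 : √(r ^ 3) = r * √r := by
    rw [show r ^ 3 = r ^ 2 * r by ring, Real.sqrt_mul (by positivity), Real.sqrt_sq hr.le]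
  simp only [travelDens]
  rw [Real.sqrt_div hp.le, e1]
  field_simp

theorem tendsto_sqrtInt_travelDens : Tendsto (fun x : ℝ × ℝ =>
    sqrtInt (travelDens Ψ Y) x * (x.1 * √x.1) / (x.2 * √x.2)) cone (𝓝 (2 / 3 * (1 / √α))) :=
  tendsto_sqrtInt (w := fun r => r * √r) H.rb_pos
    (fun _ _ h0 h1 hr h2 => (H.contDiffAt_travelDens h0 h1 hr h2).continuousAt)
    H.tendsto_travelDens

/-- A bound for the derivative of `∫₀^R dσ / (u Y)` along light rays. -/
theorem exists_travel_bound : ∃ C, 0 ≤ C ∧ ∃ η > 0, ∀ r R q, 0 < R → R < r → r < η → r < rb →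
    1 ≤ q → dr (sqrtInt (travelDens Ψ Y)) (r, R)
      + dR (sqrtInt (travelDens Ψ Y)) (r, R) * raySlope Ψ Y (r, R) q
      ≤ G Ψ Y r 0 + C * sqrtInt (travelDens Ψ Y) (r, R) := by
  have hc : ContinuousAt (fun x : ℝ × ℝ => -(dr (fun x => Y x.1 x.2) x / Y x.1 x.2)) (0, 0) :=
    (((contDiffAt_dr (m := 0) (H.contDiff_Y 0 0 le_rfl le_rfl H.rb_pos)
      (by norm_num)).continuousAt).div (H.contDiff_Y 0 0 le_rfl le_rfl H.rb_pos).continuousAt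
      (by rw [H.Y_centre]; exact one_ne_zero)).neg
  set c := -(dr (fun x => Y x.1 x.2) ((0 : ℝ), (0 : ℝ)) / Y 0 0) with hcdef
  obtain ⟨η, hη, hball⟩ := Metric.eventually_nhds_iff.1
    (hc.tendsto.eventually (gt_mem_nhds (show c < |c| + 1 by linarith [le_abs_self c])))
  refine ⟨|c| + 1, by positivity, η, hη, fun r R q h0 h1 hrη h2 hq => ?_⟩
  have hr := h0.trans h1
  have hT : ∀ σ ∈ Icc 0 R, ContDiffAt ℝ 1 (travelDens Ψ Y) (r, σ) := fun σ hσ =>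
    H.contDiffAt_travelDens hσ.1 (hσ.2.trans h1.le) hr h2
  have hg : ∀ σ ∈ Icc 0 R, ContDiffAt ℝ 1 (gDens Ψ Y) (r, σ) := fun σ hσ =>
    H.contDiffAt_gDens hσ.1 (hσ.2.trans h1.le) hr h2
  have hcont : ∀ f : ℝ × ℝ → ℝ, (∀ σ ∈ Icc 0 R, ContinuousAt f (r, σ)) →
      IntervalIntegrable (fun σ => √σ * f (r, σ)) MeasureTheory.volume 0 R := fun f hf =>
    ContinuousOn.intervalIntegrable_of_Icc h0.le fun σ hσ =>
      (Real.continuous_sqrt.continuousAt.mul (ContinuousAt.comp (g := f)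
        (f := fun s : ℝ => (r, s)) (hf σ hσ) (by fun_prop))).continuousWithinAt
  have i1 := hcont _ fun σ hσ => (contDiffAt_dr (m := 0) (hT σ hσ) (by norm_num)).continuousAt
  have i2 := hcont _ fun σ hσ => (hT σ hσ).continuousAt
  have i3 := hcont _ fun σ hσ => (hg σ hσ).continuousAt
  have i4 : IntervalIntegrable (fun σ => -(√σ * gDens Ψ Y (r, σ))) MeasureTheory.volume 0 R :=
    i3.neg
  have hint : sqrtInt (dr (travelDens Ψ Y)) (r, R) ≤
      -sqrtInt (gDens Ψ Y) (r, R) + (|c| + 1) * sqrtInt (travelDens Ψ Y) (r, R) := by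
    simp only [sqrtInt]
    rw [← intervalIntegral.integral_neg, ← intervalIntegral.integral_const_mul,
      ← intervalIntegral.integral_add i4 (i2.const_mul _)]
    refine intervalIntegral.integral_mono_on h0.le i1 (i4.add (i2.const_mul _)) fun σ hσ => ?_
    have hσr := hσ.2.trans h1.le
    rw [H.dr_travelDens hσ.1 hσr hr h2]
    have hb := hball (y := (r, σ)) (by
      rw [Prod.dist_eq, max_lt_iff]
      simp only [Real.dist_eq, sub_zero]
      rw [abs_of_pos hr, abs_of_nonneg hσ.1]
      exact ⟨hrη, hσr.trans_lt hrη⟩)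
    have hp := H.rUSq_pos hσ.1 hσr hr h2
    have hY := H.Y_pos r σ hσ.1 hσr h2
    have hps := Real.sqrt_pos.2 hp
    have ht : 0 < travelDens Ψ Y (r, σ) := by simp only [travelDens]; positivity
    have hs := Real.sqrt_nonneg σ
    have := mul_le_mul_of_nonneg_right hb.le (mul_nonneg hs ht.le)
    simp only at this
    linarith
  -- The product is G - G u q / Y. Rewriting G(r, R) as G(r, 0) plus the integral of `gDens` then
  -- cancels the integral in the r-derivative.
  have hslope : dR (sqrtInt (travelDens Ψ Y)) (r, R) * raySlope Ψ Y (r, R) q ≤ G Ψ Y r R := by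
    have hu := H.u_pos h0 h1.le h2
    have hY := H.Y_pos r R h0.le h1.le h2
    have hG := H.G_pos r R h0 h1.le h2
    have hR := Real.sqrt_pos.2 h0
    rw [dR_sqrtInt h0 hT, travelDens, sqrt_rUSq h0, raySlope, kSpeed]
    have e : √R * (1 / (√R * u Ψ Y r R * Y r R)) *
        (u Ψ Y r R * G Ψ Y r R * (Y r R - u Ψ Y r R * q)) =
        G Ψ Y r R - G Ψ Y r R * u Ψ Y r R * q / Y r R := by field_simp
    simp only
    rw [e]
    have : 0 < G Ψ Y r R * u Ψ Y r R * q / Y r R := by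
      have : 0 < q := by linarith
      positivity
    linarith
  rw [H.G_eq_G_zero h0.le h1.le hr h2] at hslope
  rw [dr_sqrtInt h0 hT]
  linarith

end IsCollapse

namespace IsLightRay

theorem tendsto_cone (h : IsLightRay Ψ Y b R q) (hb : 0 < b)
    (hem : Tendsto (fun r => R r / r) (𝓝[>] 0) (𝓝 0)) :
    Tendsto (fun r => (r, R r)) (𝓝[>] 0) cone := by
  refine Collapse.tendsto_cone.2 ⟨tendsto_id, tendsto_nhdsWithin_iff.2 ⟨hem, ?_⟩⟩
  filter_upwards [Ioo_mem_nhdsGT hb] with r hr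
  exact div_pos (h.pos r hr) hr.1

/-- A light ray from the central singularity satisfies `R = O(r³)`. -/
theorem exists_le_cube (H : IsCollapse Ψ Y rb α ξ) (h : IsLightRay Ψ Y b R q) (hb : 0 < b)
    (hbr : b ≤ rb) (hem : Tendsto (fun r => R r / r) (𝓝[>] 0) (𝓝 0)) :
    ∃ C > 0, ∀ᶠ r in 𝓝[>] 0, R r ≤ C * r ^ 3 := by
  obtain ⟨C, hC, η, hη, hbound⟩ := H.exists_travel_bound
  have hcone := h.tendsto_cone hb hem
  have hlim := H.tendsto_sqrtInt_travelDens.comp hcone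
  have hsα := Real.sqrt_pos.2 H.alpha_pos
  set M : ℝ → ℝ := fun r => sqrtInt (travelDens Ψ Y) (r, R r) with hM
  -- Here emanation from the singularity enters: M is comparable to (R/r)^{3/2}, which tends to 0.
  have hM0 : Tendsto M (𝓝[>] 0) (𝓝 0) := by
    have h1 := hlim.mul (hem.mul hem.sqrt)
    simp only [mul_zero, Real.sqrt_zero] at h1
    refine h1.congr' ?_
    filter_upwards [Ioo_mem_nhdsGT hb] with r hr
    have h0 := h.pos r hr
    have hr0 : 0 < r := hr.1
    have := Real.sqrt_pos.2 h0
    have := Real.sqrt_pos.2 hr0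
    simp only [Function.comp, hM]
    rw [Real.sqrt_div h0.le]
    field_simp
  set c := |ξ| + 1 with hc
  have hG : ∀ᶠ r in 𝓝[>] (0 : ℝ), G Ψ Y r 0 ≤ c * r ^ 2 := by
    filter_upwards [H.tendsto_G_zero.eventually (gt_mem_nhds (show ξ < c by
      linarith [le_abs_self ξ])), self_mem_nhdsWithin] with r h1 hr
    have hr0 : 0 < r := hr
    exact ((div_lt_iff₀ (by positivity)).1 h1).le
  obtain ⟨δ, hδ, hδG⟩ := mem_nhdsGT_iff_exists_Ioo_subset.1 hG
  have hδ0 : 0 < δ := hδ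
  set b' := min (min b η) (min δ 1) with hb'
  have hb'0 : 0 < b' := by positivity
  have hb'b : b' ≤ b := (min_le_left _ _).trans (min_le_left _ _)
  have hb'η : b' ≤ η := (min_le_left _ _).trans (min_le_right _ _)
  have hb'δ : b' ≤ δ := (min_le_right _ _).trans (min_le_left _ _)
  have hb'1 : b' ≤ 1 := (min_le_right _ _).trans (min_le_right _ _)
  have hMd : ∀ r ∈ Ioo 0 b', HasDerivAt M (dr (sqrtInt (travelDens Ψ Y)) (r, R r)
      + dR (sqrtInt (travelDens Ψ Y)) (r, R r) * raySlope Ψ Y (r, R r) (q r)) r := by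
    intro r hr
    have hrb : r ∈ Ioo 0 b := ⟨hr.1, hr.2.trans_le hb'b⟩
    have hd : DifferentiableAt ℝ (sqrtInt (travelDens Ψ Y)) (r, R r) :=
      (contDiffAt_sqrtInt (h.pos r hrb) fun σ hσ => H.contDiffAt_travelDens hσ.1
        (hσ.2.trans (h.lt r hrb).le) hr.1 (hrb.2.trans_le hbr)).differentiableAt (by simp)
    have := hasDerivAt_comp_curve (a := fun s => s) hd (hasDerivAt_id r) (h.deriv_R r hrb)
    rwa [mul_one] at this
  -- Gronwall from the centre: M' ≤ C M + c r² and M → 0 give M = O(r³).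
  have hN := nonpos_of_deriv_nonpos (f := fun r => M r * Real.exp (-C * r) - c * r ^ 3 / 3)
    (f' := fun r => (dr (sqrtInt (travelDens Ψ Y)) (r, R r)
      + dR (sqrtInt (travelDens Ψ Y)) (r, R r) * raySlope Ψ Y (r, R r) (q r) - C * M r) *
        Real.exp (-C * r) - c * r ^ 2) (b := b')
    (fun r hr => by
      have d1 := ((hasDerivAt_id r).const_mul (-C)).exp
      have d2 := (((hasDerivAt_id r).pow 3).const_mul c).div_const 3
      refine (((hMd r hr).mul d1).sub d2).congr_deriv ?_
      simp only [id]
      push_cast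
      ring)
    (fun r hr => by
      have hrb : r ∈ Ioo 0 b := ⟨hr.1, hr.2.trans_le hb'b⟩
      have h1 := hbound r (R r) (q r) (h.pos r hrb) (h.lt r hrb) (hr.2.trans_le hb'η)
        (hrb.2.trans_le hbr) (h.one_le r hrb)
      have h2 : G Ψ Y r 0 ≤ c * r ^ 2 := hδG ⟨hr.1, hr.2.trans_le hb'δ⟩
      have he : Real.exp (-C * r) ≤ 1 := by
        rw [Real.exp_le_one_iff]
        nlinarith [hr.1]
      have he0 := Real.exp_pos (-C * r)
      have h3 : dr (sqrtInt (travelDens Ψ Y)) (r, R r) + dR (sqrtInt (travelDens Ψ Y)) (r, R r) *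
          raySlope Ψ Y (r, R r) (q r) - C * M r ≤ c * r ^ 2 := by linarith
      have h4 := mul_le_mul_of_nonneg_right h3 he0.le
      have h5 : c * r ^ 2 * Real.exp (-C * r) ≤ c * r ^ 2 * 1 :=
        mul_le_mul_of_nonneg_left he (by positivity)
      linarith)
    (by
      have h1 : Tendsto (fun r : ℝ => Real.exp (-C * r)) (𝓝[>] 0) (𝓝 (Real.exp (-C * 0))) :=
        (Continuous.tendsto (by fun_prop) 0).mono_left nhdsWithin_le_nhds
      have h2 : Tendsto (fun r : ℝ => c * r ^ 3 / 3) (𝓝[>] 0) (𝓝 (c * 0 ^ 3 / 3)) :=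
        (Continuous.tendsto (by fun_prop) 0).mono_left nhdsWithin_le_nhds
      simpa using (hM0.mul h1).sub h2)
  set C₁ := c / 3 * Real.exp C with hC₁
  have hC₁0 : 0 < C₁ := by positivity
  -- Half of the limit of M (r/R)^{3/2}.
  set c₀ := 1 / (3 * √α) with hc₀
  have hc₀0 : 0 < c₀ := by positivity
  have hlow := hlim.eventually (lt_mem_nhds (show c₀ < 2 / 3 * (1 / √α) by
    rw [hc₀, div_lt_iff₀ (by positivity)]
    field_simp
    norm_num))
  -- For y = R/r³ the bounds on M give c₀ y^{3/2} < C₁, and y ≤ y^{3/2} when y ≥ 1.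
  refine ⟨1 + C₁ / c₀, by positivity, ?_⟩
  filter_upwards [hlow, Ioo_mem_nhdsGT hb'0] with r hr1 hr
  have hrb : r ∈ Ioo 0 b := ⟨hr.1, hr.2.trans_le hb'b⟩
  have hr0 : 0 < r := hr.1
  have hR0 := h.pos r hrb
  have hsr := Real.sqrt_pos.2 hr0
  have hsR := Real.sqrt_pos.2 hR0
  have hMr : M r ≤ C₁ * r ^ 3 := by
    have h1 := hN r hr
    have h2 : M r * Real.exp (-C * r) ≤ c * r ^ 3 / 3 := by linarith
    have h3 : Real.exp (-C) ≤ Real.exp (-C * r) := by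
      apply Real.exp_le_exp.2
      nlinarith [hr.2.trans_le hb'1]
    have hMpos : 0 ≤ M r := by
      have : 0 < M r * (r * √r) / (R r * √(R r)) := hc₀0.trans hr1
      have h4 : 0 < M r * (r * √r) := by
        have := mul_pos this (show 0 < R r * √(R r) by positivity)
        rwa [div_mul_cancel₀ _ (by positivity)] at this
      exact (pos_of_mul_pos_left h4 (by positivity)).le
    have h4 : M r * Real.exp (-C) ≤ c * r ^ 3 / 3 :=
      (mul_le_mul_of_nonneg_left h3 hMpos).trans h2
    rw [Real.exp_neg, ← div_eq_mul_inv, div_le_iff₀ (Real.exp_pos _)] at h4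
    refine h4.trans (le_of_eq ?_)
    rw [hC₁]; ring
  have h5 : c₀ * (R r * √(R r)) < C₁ * r ^ 3 * (r * √r) := by
    have h6 := (lt_div_iff₀ (show 0 < R r * √(R r) by positivity)).1 hr1
    exact h6.trans_le (mul_le_mul_of_nonneg_right hMr (by positivity))
  by_contra hlt
  rw [not_le] at hlt
  set y := R r / r ^ 3 with hy
  have hRy : R r = y * r ^ 3 := by rw [hy]; field_simp
  have hy1 : 1 + C₁ / c₀ < y := by
    rw [hRy] at hlt
    exact lt_of_mul_lt_mul_right hlt (by positivity)
  have hquot : 0 < C₁ / c₀ := by positivity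
  have e1 : √(r ^ 3) = r * √r := by
    rw [show r ^ 3 = r ^ 2 * r by ring, Real.sqrt_mul (by positivity), Real.sqrt_sq hr0.le]
  have hys : 1 ≤ √y := Real.one_le_sqrt.2 (by linarith)
  rw [hRy, Real.sqrt_mul (by linarith), e1] at h5
  have h7 : c₀ * (y * √y) < C₁ := by
    have h8 : (c₀ * (y * √y)) * (r ^ 3 * (r * √r)) < C₁ * (r ^ 3 * (r * √r)) := by linarith
    exact lt_of_mul_lt_mul_right h8 (by positivity)
  have h9 : c₀ * (C₁ / c₀) = C₁ := by field_simp
  have h10 : y ≤ y * √y := le_mul_of_one_le_right (by linarith) hys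
  have h11 : c₀ * (C₁ / c₀) < c₀ * (y * √y) := mul_lt_mul_of_pos_left (by linarith) hc₀0
  linarith

/-- A light ray that starts in the untrapped region satisfies `α r³ ≤ 4 R`. -/
theorem eventually_cube_le (H : IsCollapse Ψ Y rb α ξ) (h : IsLightRay Ψ Y b R q) (hb : 0 < b)
    (hem : Tendsto (fun r => R r / r) (𝓝[>] 0) (𝓝 0))
    (hesc : ∀ᶠ r in 𝓝[>] 0, 2 * Ψ r (R r) < R r) : ∀ᶠ r in 𝓝[>] 0, α * r ^ 3 ≤ 4 * R r := by
  have hα := H.alpha_pos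
  have hcone := h.tendsto_cone hb hem
  have h1 := (H.tendsto_rUSq.1.comp hcone).eventually (lt_mem_nhds (half_lt_self hα))
  have h2 := ((H.tendsto_Y.comp hcone).pow 2).eventually
    (gt_mem_nhds (show (1 : ℝ) ^ 2 < 2 by norm_num))
  filter_upwards [h1, h2, hesc, Ioo_mem_nhdsGT hb] with r h1 h2 h3 hr
  have h0 := h.pos r hr
  have hr0 : 0 < r := hr.1
  simp only [Function.comp] at h1 h2
  -- Combine R u² = R (Y² - 1) + 2Ψ > α r³/2 with 2Ψ < R and Y² < 2.
  rw [lt_div_iff₀ (by positivity), rUSq] at h1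
  simp only at h1
  nlinarith

end IsLightRay

end Collapse
end

/-! ### A priori bound on q and compactness of singular trajectories -/

noncomputable section
namespace Collapse

variable {Ψ Y : ℝ → ℝ → ℝ} {rb α ξ b r : ℝ} {R q : ℝ → ℝ}

/-- `rayTurn` is affine in q, so uniform convergence on the compact range 1 ≤ q ≤ 2 controls it for
all q, however large. -/
theorem rayTurn_linear (Ψ Y : ℝ → ℝ → ℝ) (x : ℝ × ℝ) (q : ℝ) :
    rayTurn Ψ Y x q = rayTurn Ψ Y x 1 + (q - 1) * (rayTurn Ψ Y x 2 - rayTurn Ψ Y x 1) := by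
  unfold rayTurn; ring

/-- For steep rays the slope angle grows. -/
theorem IsCollapse.exists_turn_bound (H : IsCollapse Ψ Y rb α ξ) (hξ : 0 < ξ) {v₀ v₁ : ℝ}
    (hv₀ : 0 < v₀) : ∃ Q ≥ 2, ∀ᶠ t in atTop, ∀ v ∈ Icc v₀ v₁, ∀ q, Q ≤ q →
      1 ≤ -Real.exp (-t) * rayTurn Ψ Y (position α t v) q := by
  have hω : 0 < ξ / α := div_pos hξ H.alpha_pos
  have hS : Icc v₀ v₁ ×ˢ Icc 1 2 ⊆ phase := fun z hz => ⟨hv₀.trans_le hz.1.1, hz.2.1⟩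
  have h := Metric.tendstoUniformlyOn_iff.1 (H.tendstoUniformlyOn_rayTurn hS
    (isCompact_Icc.prod isCompact_Icc)) (1 / 4) (by norm_num)
  set B := 3 / 2 * (ξ / α) * |v₁| ^ 4 with hB
  have hB0 : 0 ≤ B := by positivity
  -- The value at q = 1 is at least 3/4 - B and the slope in q at least h - 1/2 ≥ 1/2, so from q =
  -- 2B + 6 on the value exceeds 1.
  refine ⟨2 * B + 6, by linarith, ?_⟩
  filter_upwards [h] with t ht v hv q hq
  have a1 := ht (v, 1) ⟨hv, le_rfl, one_le_two⟩
  have a2 := ht (v, 2) ⟨hv, one_le_two, le_rfl⟩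
  rw [Real.dist_eq, abs_lt] at a1 a2
  simp only at a1 a2
  have hv0 : 0 < v := hv₀.trans_le hv.1
  have hh : 1 ≤ hLim (ξ / α) v := by
    have : 0 < ξ / α * v ^ 3 := by positivity
    unfold hLim; linarith
  have hBv : 3 / 2 * (ξ / α) * v ^ 4 ≤ B := by
    have : v ^ 4 ≤ |v₁| ^ 4 := pow_le_pow_left₀ hv0.le (hv.2.trans (le_abs_self _)) 4
    exact mul_le_mul_of_nonneg_left this (by positivity)
  rw [rayTurn_linear]
  set x := -Real.exp (-t) * rayTurn Ψ Y (position α t v) 1 with hx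
  set y := -Real.exp (-t) * rayTurn Ψ Y (position α t v) 2 with hy
  have e : -Real.exp (-t) * (rayTurn Ψ Y (position α t v) 1 + (q - 1) *
      (rayTurn Ψ Y (position α t v) 2 - rayTurn Ψ Y (position α t v) 1)) =
      x + (q - 1) * (y - x) := by rw [hx, hy]; ring
  rw [e]
  have h1 : 1 / 2 ≤ y - x := by linarith [a1.1, a1.2, a2.1, a2.2]
  have h2 : 3 / 4 - B ≤ x := by linarith [a1.1, a1.2]
  have h3 : (q - 1) * (1 / 2) ≤ (q - 1) * (y - x) := mul_le_mul_of_nonneg_left h1 (by linarith)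
  linarith

/-- A function on a half-line satisfying `q' ≥ q²/2` above a level `Q` stays below this level. -/
theorem le_of_superlinear {q q' : ℝ → ℝ} {T Q : ℝ} (hQ : 0 < Q)
    (hq : ∀ t, T ≤ t → HasDerivAt q (q' t) t)
    (h : ∀ t, T ≤ t → Q ≤ q t → q t ^ 2 / 2 ≤ q' t) : ∀ t, T ≤ t → q t ≤ Q := by
  intro t₁ ht₁
  by_contra hlt
  rw [not_le] at hlt
  have hge : ∀ t, t₁ ≤ t → Q ≤ q t := le_of_deriv_pos_at_level
    (fun t ht => (hq t (ht₁.trans ht)).hasDerivWithinAt) hlt.le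
    (fun t ht hqt => by
      have h1 := h t (ht₁.trans ht) hqt.ge
      have h2 : 0 < q t ^ 2 := by rw [hqt]; positivity
      linarith)
  have hd : ∀ t, t₁ ≤ t → HasDerivAt (fun t => (q t)⁻¹ + t / 2) (-q' t / q t ^ 2 + 1 / 2) t :=
    fun t ht => ((hq t (ht₁.trans ht)).inv (hQ.trans_le (hge t ht)).ne').add
      ((hasDerivAt_id t).div_const 2)
  -- While q ≥ Q, 1/q falls at rate at least 1/2, so it could not be positive after a further time
  -- 2/q(t₁).
  have hanti : AntitoneOn (fun t => (q t)⁻¹ + t / 2) (Ici t₁) := by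
    refine antitoneOn_of_hasDerivWithinAt_nonpos (convex_Ici t₁)
      (fun t ht => (hd t ht).continuousAt.continuousWithinAt)
      (f' := fun t => -q' t / q t ^ 2 + 1 / 2) (fun t ht => ?_) (fun t ht => ?_)
    · exact (hd t (interior_subset ht)).hasDerivWithinAt
    · have ht' : t₁ ≤ t := interior_subset ht
      have h1 := hge t ht'
      have h2 := h t (ht₁.trans ht') h1
      have h3 : 0 < q t ^ 2 := by have := hQ.trans_le h1; positivity
      have : 1 / 2 ≤ q' t / q t ^ 2 := by rw [le_div_iff₀ h3]; linarith
      rw [neg_div]; linarith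
  have h1 := hanti (mem_Ici.2 le_rfl) (mem_Ici.2 (show t₁ ≤ t₁ + 2 * (q t₁)⁻¹ by
    have := hQ.trans hlt; simp; positivity)) (by have := hQ.trans hlt; simp; positivity)
  have h2 : 0 < (q (t₁ + 2 * (q t₁)⁻¹))⁻¹ :=
    inv_pos.2 (hQ.trans_le (hge _ (by have := hQ.trans hlt; simp; positivity)))
  simp only at h1
  linarith

theorem tendsto_exp_neg_mem {p : ℝ → Prop} (h : ∀ᶠ r in 𝓝[>] 0, p r) :
    ∀ᶠ t in atTop, p (Real.exp (-t)) := tendsto_exp_neg_atTop.eventually h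

/-- The trajectory of a light ray that escapes from the central singularity stays in a compact
set. -/
theorem IsLightRay.exists_isTrajectory (H : IsCollapse Ψ Y rb α ξ) (hξ : 0 < ξ)
    (h : IsLightRay Ψ Y b R q) (hb : 0 < b) (hbr : b ≤ rb)
    (hem : Tendsto (fun r => R r / r) (𝓝[>] 0) (𝓝 0))
    (hesc : ∀ᶠ r in 𝓝[>] 0, 2 * Ψ r (R r) < R r) : ∃ T > -Real.log b, ∃ S ⊆ phase, IsCompact S ∧
      IsTrajectory (rayField Ψ Y α) S T (phaseOf α R q) := by
  have hα := H.alpha_pos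
  obtain ⟨C, hC, hRC⟩ := h.exists_le_cube H hb hbr hem
  have hlow := h.eventually_cube_le H hb hem hesc
  set v₀ := √(α / C) with hv₀
  have hv₀0 : 0 < v₀ := Real.sqrt_pos.2 (by positivity)
  -- The range of v is [v₀, 2]: R ≤ C r³ gives the lower end √(α/C), and α r³ ≤ 4R the upper one.
  obtain ⟨Q, hQ, hturn⟩ := H.exists_turn_bound hξ (v₁ := 2) hv₀0
  obtain ⟨T, hT⟩ := eventually_atTop.1 ((tendsto_exp_neg_mem (hRC.and hlow)).and
    (hturn.and (eventually_gt_atTop (-Real.log b))))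
  have hv : ∀ t, T ≤ t → (phaseOf α R q t).1 ∈ Icc v₀ 2 := by
    intro t ht
    obtain ⟨⟨h1, h2⟩, -, h3⟩ := hT t ht
    have h0 := h.pos _ (exp_mem hb h3)
    have he := Real.exp_pos (-t)
    constructor
    · apply Real.sqrt_le_sqrt
      rw [div_le_div_iff₀ hC h0]
      nlinarith
    · have : √(α * Real.exp (-t) ^ 3 / R (Real.exp (-t))) ≤ √(2 ^ 2) := by
        apply Real.sqrt_le_sqrt
        rw [div_le_iff₀ h0]
        linarith
      rwa [Real.sqrt_sq zero_le_two] at this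
  have hd : ∀ t, T ≤ t → HasDerivAt (phaseOf α R q) (rayField Ψ Y α t (phaseOf α R q t)) t :=
    fun t ht => h.hasDerivAt_phaseOf hα hb (hT t ht).2.2
  have hq : ∀ t, T ≤ t → (phaseOf α R q t).2 ≤ Q := by
    refine le_of_superlinear (by linarith) (q' := fun t => (rayField Ψ Y α t (phaseOf α R q t)).2)
      (fun t ht => hasDerivWithinAt_univ.1 (hasDerivWithinAt_snd (hd t ht).hasDerivWithinAt))
      fun t ht hQt => ?_
    have h1 := (hT t ht).2.1 _ (hv t ht) _ hQt
    set q' := (phaseOf α R q t).2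
    have h2 : 0 ≤ q' ^ 2 - 1 := by nlinarith
    have h3 : (q' ^ 2 - 1) * 1 ≤ (rayField Ψ Y α t (phaseOf α R q t)).2 :=
      mul_le_mul_of_nonneg_left h1 h2
    nlinarith
  refine ⟨T, (hT T le_rfl).2.2, Icc v₀ 2 ×ˢ Icc 1 Q, fun z hz => ⟨hv₀0.trans_le hz.1.1, hz.2.1⟩,
    isCompact_Icc.prod isCompact_Icc, fun t ht => ⟨hv t ht, ?_, hq t ht⟩,
    fun t ht => (hd t ht).hasDerivWithinAt⟩
  exact h.one_le _ (exp_mem hb (hT t ht).2.2)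

/-- The direction of a light ray from the limit of its trajectory. -/
theorem tendsto_div_cube {v : ℝ} (hα : 0 < α) (hv : 0 < v) (hb : 0 < b)
    (h : IsLightRay Ψ Y b R q) (hlim : Tendsto (fun t => (phaseOf α R q t).1) atTop (𝓝 v)) :
    Tendsto (fun r => R r / r ^ 3) (𝓝[>] 0) (𝓝 (α / v ^ 2)) := by
  have hlog : Tendsto (fun r => -Real.log r) (𝓝[>] 0) atTop :=
    tendsto_neg_atBot_atTop.comp Real.tendsto_log_nhdsGT_zero
  have h1 := (tendsto_const_nhds (x := α)).div ((hlim.comp hlog).pow 2) (by positivity)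
  refine h1.congr' ?_
  filter_upwards [Ioo_mem_nhdsGT hb] with r hr
  have h0 := h.pos r hr
  have hr0 : 0 < r := hr.1
  simp only [Pi.div_apply, Function.comp, phaseOf, neg_neg, Real.exp_log hr0]
  rw [Real.sq_sqrt (by positivity)]
  field_simp

theorem Ray.hasDirection_iff {c : Ray} {x : ℝ} :
    c.HasDirection x ↔ Tendsto (fun r => c.R r / r ^ 3) (𝓝[>] 0) (𝓝 x) := by
  have hne : ∀ᶠ r in 𝓝[>] (0 : ℝ), r ^ 3 = 0 → c.R r - x * r ^ 3 = 0 := by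
    filter_upwards [self_mem_nhdsWithin] with r hr h
    exact absurd h (pow_pos (show (0 : ℝ) < r from hr) 3).ne'
  rw [Ray.HasDirection, isLittleO_iff_tendsto' hne, ← tendsto_sub_nhds_zero_iff (x := x)]
  refine tendsto_congr' ?_
  filter_upwards [self_mem_nhdsWithin] with r hr
  have : (0 : ℝ) < r := hr
  field_simp

end Collapse
end

/-! ### Limits of singular geodesics, the angle, and geodesics built from trajectories -/

noncomputable section
namespace Collapse

variable {Ψ Y : ℝ → ℝ → ℝ} {rb α ξ b u₁ u₂ uc : ℝ} {R q : ℝ → ℝ}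

theorem tendsto_neg_log : Tendsto (fun r => -Real.log r) (𝓝[>] 0) atTop :=
  tendsto_neg_atBot_atTop.comp Real.tendsto_log_nhdsGT_zero

/-- Every singular geodesic gives a trajectory that converges to one of the three equilibria. -/
theorem Ray.IsSingular.exists_tendsto (H : IsCollapse Ψ Y rb α ξ)
    (E : Equilibria (ξ / α) u₁ u₂ uc) {c : Ray} (hc : c.IsSingular Ψ Y rb) :
    ∃ (q : ℝ → ℝ) (ℓ : ℝ), 0 ≤ ℓ ∧ IsLightRay Ψ Y c.rmax c.R q ∧ c.HasAngularMomentum ℓ ∧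
      (∀ r ∈ Ioo 0 c.rmax, HasDerivAt c.φ (kSpeed Ψ Y (r, c.R r) / c.R r * √(q r ^ 2 - 1)) r) ∧
      (ℓ = 0 → ∀ r ∈ Ioo 0 c.rmax, q r = 1) ∧ (0 < ℓ → ∀ r ∈ Ioo 0 c.rmax, 1 < q r) ∧
      ∃ T > -Real.log c.rmax, ∃ S ⊆ phase, IsCompact S ∧
        IsTrajectory (rayField Ψ Y α) S T (phaseOf α c.R q) ∧
        ((Tendsto (phaseOf α c.R q) atTop (𝓝 (uc, 1)) ∧ c.HasDirection (α / uc ^ 2) ∧ ℓ = 0) ∨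
        (Tendsto (phaseOf α c.R q) atTop (𝓝 (u₁, 1)) ∧ c.HasDirection (α / u₁ ^ 2)) ∨
        (Tendsto (phaseOf α c.R q) atTop (𝓝 (u₂, 2 * u₂ / (2 - u₂ ^ 2))) ∧
          c.HasDirection (α / u₂ ^ 2) ∧ 0 < ℓ)) := by
  have hα := H.alpha_pos
  have hξ : 0 < ξ := by
    have := mul_pos E.omega_pos hα
    rwa [div_mul_cancel₀ _ hα.ne'] at this
  obtain ⟨q, ℓ, hℓ, hray, hL, hφ, hrad, hnon⟩ := hc.isNullGeodesic.exists_isLightRay H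
  have hb := hc.isNullGeodesic.rmax_pos
  obtain ⟨T, hT, S, hS, hSc, hz⟩ := hray.exists_isTrajectory H hξ hb hc.isNullGeodesic.rmax_le
    hc.emanates hc.escapes
  obtain ⟨e, heS, he, hlim⟩ := hz.tendsto_equilibrium H.asymptotic E hS hSc
  refine ⟨q, ℓ, hℓ, hray, hL, hφ, hrad, hnon, T, hT, S, hS, hSc, hz, ?_⟩
  have hdir : c.HasDirection (α / e.1 ^ 2) := Ray.hasDirection_iff.2
    (tendsto_div_cube hα (hS heS).1 hb hray ((continuous_fst.tendsto e).comp hlim))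
  have hmem : ∀ t, T ≤ t → Real.exp (-t) ∈ Ioo 0 c.rmax := fun t ht =>
    IsLightRay.exp_mem hb (by linarith)
  rcases he with rfl | rfl | rfl
  · refine Or.inl ⟨hlim, hdir, ?_⟩
    -- With ℓ > 0 one has q > 1 throughout, and such a trajectory is repelled from the radial line
    -- near (uc, 1).
    by_contra hne
    exact hz.not_tendsto_of_transverse H.asymptotic hS hSc
      (fun t ht => hnon (hℓ.lt_of_ne' hne) _ (hmem t ht)) E.transverse_uc hlim
  · exact Or.inr (Or.inl ⟨hlim, hdir⟩)
  · refine Or.inr (Or.inr ⟨hlim, hdir, ?_⟩)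
    refine hℓ.lt_of_ne' fun h0 => ?_
    have h1 : Tendsto (fun t => (phaseOf α c.R q t).2) atTop (𝓝 (2 * u₂ / (2 - u₂ ^ 2))) :=
      (continuous_snd.tendsto _).comp hlim
    have h2 : Tendsto (fun t => (phaseOf α c.R q t).2) atTop (𝓝 1) := by
      refine tendsto_const_nhds.congr' ?_
      filter_upwards [eventually_ge_atTop T] with t ht
      exact (hrad h0 _ (hmem t ht)).symm
    exact E.q₂_gt.ne' (tendsto_nhds_unique h1 h2)

/-- The derivative of the angle with respect to `t = -log r`. -/
theorem hasDerivAt_angle {φ : ℝ → ℝ} (hb : 0 < b)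
    (hφ : ∀ r ∈ Ioo 0 b, HasDerivAt φ (kSpeed Ψ Y (r, R r) / R r * √(q r ^ 2 - 1)) r) {t : ℝ}
    (ht : -Real.log b < t) : HasDerivAt (fun t => φ (Real.exp (-t)))
      (-(Real.exp (-t) * kSpeed Ψ Y (Real.exp (-t), R (Real.exp (-t))) / R (Real.exp (-t)) *
        √((phaseOf α R q t).2 ^ 2 - 1))) t := by
  have dexp : HasDerivAt (fun t : ℝ => Real.exp (-t)) (-Real.exp (-t)) t := by
    simpa using (hasDerivAt_neg t).exp
  refine ((hφ _ (IsLightRay.exp_mem hb ht)).comp t dexp).congr_deriv ?_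
  simp only [phaseOf]
  ring

/-- This is the coefficient of √(q² - 1) in -dφ/dt. Its limit is positive and finite, so q alone
decides whether the angle converges. -/
theorem IsLightRay.tendsto_kSpeed (H : IsCollapse Ψ Y rb α ξ) (h : IsLightRay Ψ Y b R q)
    (hb : 0 < b) {v : ℝ} (hv : 0 < v)
    (hlim : Tendsto (fun t => (phaseOf α R q t).1) atTop (𝓝 v)) :
    Tendsto (fun t => Real.exp (-t) * kSpeed Ψ Y (Real.exp (-t), R (Real.exp (-t))) /
      R (Real.exp (-t))) atTop (𝓝 (hLim (ξ / α) v)) := by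
  have hsc : Tendsto (fun r => (r, R r)) (𝓝[>] 0) (scaling α v) :=
    (tendsto_scaling H.alpha_pos hv).2 ⟨tendsto_id, tendsto_div_cube H.alpha_pos hv hb h hlim⟩
  exact (H.tendsto_kSpeed hv).comp (hsc.comp tendsto_exp_neg_atTop)

theorem tendsto_atBot_of_deriv_le {f f' : ℝ → ℝ} {T δ : ℝ} (hδ : 0 < δ)
    (hf : ∀ t, T ≤ t → HasDerivAt f (f' t) t) (h : ∀ t, T ≤ t → f' t ≤ -δ) :
    Tendsto f atTop atBot := by
  have hanti : AntitoneOn (fun t => f t + δ * t) (Ici T) := by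
    have hd : ∀ t, T ≤ t → HasDerivAt (fun t => f t + δ * t) (f' t + δ) t := fun t ht => by
      refine ((hf t ht).add ((hasDerivAt_id t).const_mul δ)).congr_deriv ?_
      simp
    refine antitoneOn_of_hasDerivWithinAt_nonpos (convex_Ici T)
      (fun t ht => (hd t ht).continuousAt.continuousWithinAt) (f' := fun t => f' t + δ)
      (fun t ht => (hd t (interior_subset ht)).hasDerivWithinAt) fun t ht => ?_
    linarith [h t (interior_subset ht)]
  refine tendsto_atBot_mono' atTop (f₁ := fun t => (f T + δ * T) + (-δ) * t) ?_ ?_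
  · filter_upwards [eventually_ge_atTop T] with t ht
    have := hanti (mem_Ici.2 le_rfl) (mem_Ici.2 ht) ht
    simp only at this
    linarith
  · exact tendsto_atBot_add_const_left _ _ (tendsto_id.const_mul_atTop_of_neg (by linarith))

/-- A function with nonpositive exponentially decaying derivative converges. -/
theorem exists_tendsto_of_exp_bound {f f' : ℝ → ℝ} {T c D : ℝ} (hc : 0 < c)
    (hf : ∀ t, T ≤ t → HasDerivAt f (f' t) t) (h0 : ∀ t, T ≤ t → f' t ≤ 0)
    (h : ∀ t, T ≤ t → -(D * Real.exp (-c * t)) ≤ f' t) : ∃ a, Tendsto f atTop (𝓝 a) := by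
  have hanti : AntitoneOn f (Ici T) := antitoneOn_of_hasDerivWithinAt_nonpos (convex_Ici T)
    (fun t ht => (hf t ht).continuousAt.continuousWithinAt)
    (fun t ht => (hf t (interior_subset ht)).hasDerivWithinAt)
    fun t ht => h0 t (interior_subset ht)
  have hD : 0 ≤ D := by
    have h1 := (h T le_rfl).trans (h0 T le_rfl)
    exact nonneg_of_mul_nonneg_left (by linarith : 0 ≤ D * Real.exp (-c * T)) (Real.exp_pos _)
  have hmono : MonotoneOn (fun t => f t - D / c * Real.exp (-c * t)) (Ici T) := by
    have hd : ∀ t, T ≤ t → HasDerivAt (fun t => f t - D / c * Real.exp (-c * t))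
        (f' t + D * Real.exp (-c * t)) t := fun t ht => by
      refine ((hf t ht).sub ((((hasDerivAt_id t).const_mul (-c)).exp).const_mul
        (D / c))).congr_deriv ?_
      simp only [id]
      field_simp
      ring
    refine monotoneOn_of_hasDerivWithinAt_nonneg (convex_Ici T)
      (fun t ht => (hd t ht).continuousAt.continuousWithinAt)
      (f' := fun t => f' t + D * Real.exp (-c * t))
      (fun t ht => (hd t (interior_subset ht)).hasDerivWithinAt) fun t ht => ?_
    linarith [h t (interior_subset ht)]
  have hg : Antitone fun t => f (max T t) := fun s t hst =>
    hanti (mem_Ici.2 (le_max_left _ _)) (mem_Ici.2 (le_max_left _ _)) (max_le_max le_rfl hst)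
  have hbdd : BddBelow (range fun t => f (max T t)) := by
    refine ⟨f T - D / c * Real.exp (-c * T), ?_⟩
    rintro - ⟨t, rfl⟩
    have h1 := hmono (mem_Ici.2 le_rfl) (mem_Ici.2 (le_max_left T t)) (le_max_left T t)
    have h2 : 0 ≤ D / c * Real.exp (-c * max T t) := by positivity
    simp only at h1 ⊢
    linarith
  refine ⟨_, (tendsto_atTop_ciInf hg hbdd).congr' ?_⟩
  filter_upwards [eventually_ge_atTop T] with t ht
  rw [max_eq_right ht]

/-- Convergence of the angle along a light ray that becomes radial. -/
theorem IsLightRay.exists_tendsto_angle (H : IsCollapse Ψ Y rb α ξ) (h : IsLightRay Ψ Y b R q)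
    (hb : 0 < b) {φ : ℝ → ℝ}
    (hφ : ∀ r ∈ Ioo 0 b, HasDerivAt φ (kSpeed Ψ Y (r, R r) / R r * √(q r ^ 2 - 1)) r)
    {T v : ℝ} {S : Set (ℝ × ℝ)} (hS : S ⊆ phase) (hSc : IsCompact S) (hv : 0 < v)
    (hω : 0 < ξ / α)
    (hz : IsTrajectory (rayField Ψ Y α) S T (phaseOf α R q))
    (htr : hLim (ξ / α) v - 3 / 2 * (ξ / α) * v ^ 4 < 0)
    (hlim : Tendsto (phaseOf α R q) atTop (𝓝 (v, 1))) :
    ∃ φ₀, Tendsto φ (𝓝[>] 0) (𝓝 φ₀) := by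
  obtain ⟨c, hc, C, hC⟩ := hz.exists_exp_bound H.asymptotic hS hSc htr hlim
  have hK := h.tendsto_kSpeed H hb hv ((continuous_fst.tendsto (v, (1 : ℝ))).comp hlim)
  have hh := hLim_pos hω hv
  obtain ⟨T₁, hT₁⟩ := eventually_atTop.1 (((hK.eventually (gt_mem_nhds (lt_add_one _))).and
    (hK.eventually (lt_mem_nhds hh))).and (hC.and (eventually_gt_atTop (-Real.log b))))
  obtain ⟨a, ha⟩ := exists_tendsto_of_exp_bound (c := c / 2) (T := T₁)
    (D := (hLim (ξ / α) v + 1) * √C) (by linarith)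
    (fun t ht => hasDerivAt_angle (α := α) hb hφ (hT₁ t ht).2.2)
    (fun t ht => by
      have := (hT₁ t ht).1.2
      have := mul_nonneg this.le (Real.sqrt_nonneg ((phaseOf α R q t).2 ^ 2 - 1))
      linarith)
    (fun t ht => by
      obtain ⟨⟨h1, h2⟩, h3, -⟩ := hT₁ t ht
      -- The square root halves the decay rate, which is still enough for integrability.
      have h4 : √((phaseOf α R q t).2 ^ 2 - 1) ≤ √C * Real.exp (-(c / 2) * t) := by
        have e : C * Real.exp (-c * t) = C * Real.exp (-(c / 2) * t) ^ 2 := by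
          rw [← Real.exp_nat_mul]; congr 2; push_cast; ring
        rw [e] at h3
        refine (Real.sqrt_le_sqrt h3).trans (le_of_eq ?_)
        rw [Real.sqrt_mul' _ (sq_nonneg _), Real.sqrt_sq (Real.exp_pos _).le]
      have h5 := mul_le_mul h1.le h4 (Real.sqrt_nonneg _) (by linarith)
      linarith)
  refine ⟨a, (ha.comp tendsto_neg_log).congr' ?_⟩
  filter_upwards [self_mem_nhdsWithin] with r hr
  simp [Real.exp_log (show 0 < r from hr)]

/-- Along a light ray whose slope angle has a limit `q₂ > 1` the angle diverges. -/
theorem IsLightRay.tendsto_angle_atBot (H : IsCollapse Ψ Y rb α ξ) (h : IsLightRay Ψ Y b R q)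
    (hb : 0 < b) {φ : ℝ → ℝ}
    (hφ : ∀ r ∈ Ioo 0 b, HasDerivAt φ (kSpeed Ψ Y (r, R r) / R r * √(q r ^ 2 - 1)) r)
    {v q₂ : ℝ} (hv : 0 < v) (hq₂ : 1 < q₂) (hω : 0 < ξ / α)
    (hlim : Tendsto (phaseOf α R q) atTop (𝓝 (v, q₂))) : Tendsto φ (𝓝[>] 0) atBot := by
  have hK := h.tendsto_kSpeed H hb hv ((continuous_fst.tendsto (v, q₂)).comp hlim)
  have hq := (continuous_snd.tendsto (v, q₂)).comp hlim
  have hh := hLim_pos hω hv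
  have h1 := hK.mul ((hq.pow 2).sub_const 1).sqrt
  set δ := hLim (ξ / α) v * √(q₂ ^ 2 - 1) with hδ
  have hδ0 : 0 < δ := mul_pos hh (Real.sqrt_pos.2 (by nlinarith))
  obtain ⟨T₁, hT₁⟩ := eventually_atTop.1 ((h1.eventually (lt_mem_nhds (half_lt_self hδ0))).and
    (eventually_gt_atTop (-Real.log b)))
  have h2 := tendsto_atBot_of_deriv_le (half_pos hδ0) (T := T₁)
    (fun t ht => hasDerivAt_angle (α := α) hb hφ (hT₁ t ht).2)
    (fun t ht => by
      have := (hT₁ t ht).1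
      simp only [Function.comp] at this
      linarith)
  refine (h2.comp tendsto_neg_log).congr' ?_
  filter_upwards [self_mem_nhdsWithin] with r hr
  simp [Real.exp_log (show 0 < r from hr)]

/-- Trajectories with limit in `0 < v < 1` give singular geodesics. -/
theorem IsTrajectory.exists_isSingular (H : IsCollapse Ψ Y rb α ξ) {S : Set (ℝ × ℝ)}
    (hS : S ⊆ phase) (hSc : IsCompact S) {T : ℝ} {z : ℝ → ℝ × ℝ}
    (hz : IsTrajectory (rayField Ψ Y α) S T z) {v : ℝ} (hv : 0 < v) (hv1 : v < 1)
    (hlim : Tendsto (fun t => (z t).1) atTop (𝓝 v)) : ∃ (c : Ray) (ℓ : ℝ), c.R = radiusOf α z ∧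
      c.IsSingular Ψ Y rb ∧ c.HasDirection (α / v ^ 2) ∧ c.HasAngularMomentum ℓ ∧
      ((∀ t, T ≤ t → (z t).2 = 1) → ℓ = 0) ∧ ((∀ t, T ≤ t → 1 < (z t).2) → 0 < ℓ) := by
  have hα := H.alpha_pos
  obtain ⟨b, hb, hbr, hbT, hray⟩ := hz.exists_isLightRay H hS hSc
  obtain ⟨c, ℓ, hcb, hcR, hc, hL, h0, h1⟩ := hray.exists_ray H hb hbr
  have hlimR : Tendsto (fun r => radiusOf α z r / r ^ 3) (𝓝[>] 0) (𝓝 (α / v ^ 2)) := by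
    have h1 := (tendsto_const_nhds (x := α)).div ((hlim.comp tendsto_neg_log).pow 2)
      (by positivity)
    refine h1.congr' ?_
    filter_upwards [self_mem_nhdsWithin] with r hr
    have : (0 : ℝ) < r := hr
    simp only [Pi.div_apply, Function.comp, radiusOf]
    field_simp
  have hsc : Tendsto (fun r => (r, radiusOf α z r)) (𝓝[>] 0) (scaling α v) :=
    (tendsto_scaling hα hv).2 ⟨tendsto_id, hlimR⟩
  have hcone := hsc.mono_right (scaling_le_cone α v)
  have hmid : b / 2 ∈ Ioo 0 b := ⟨by linarith, by linarith⟩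
  have hlog : T ≤ -Real.log (b / 2) := by
    have h2 := (Real.log_lt_iff_lt_exp hmid.1).2 (hmid.2.trans_le hbT)
    linarith
  refine ⟨c, ℓ, hcR, ⟨hc, ?_, ?_⟩, ?_, hL, fun h => h0 ⟨b / 2, hmid, h _ hlog⟩,
    fun h => h1 ⟨b / 2, hmid, h _ hlog⟩⟩
  · rw [hcR]
    exact (Collapse.tendsto_cone.1 hcone).2.mono_right nhdsWithin_le_nhds
  · rw [hcR]
    have h2 := ((H.tendsto_u hv).comp hsc)
    have h3 := H.tendsto_Y.comp hcone
    -- Since u → v < 1 and Y → 1, eventually u < Y, which is the same as 2Ψ/R < 1.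
    filter_upwards [h2.eventually_lt h3 hv1, Ioo_mem_nhdsGT hb] with r hr hrb
    simp only [Function.comp] at hr
    have hp := hray.pos r hrb
    have hl := hray.lt r hrb
    have hrr := hrb.2.trans_le hbr
    have hu := H.u_pos hp hl.le hrr
    have hs := H.u_sq hp hl.le hrr
    have h4 : 2 * Ψ r (radiusOf α z r) / radiusOf α z r < 1 := by nlinarith
    rwa [div_lt_one hp] at h4
  · rw [Ray.hasDirection_iff, hcR]
    exact hlimR

/-- Trajectories with the same germ of `R(r)` agree. -/
theorem IsTrajectory.eq_of_radiusOf (H : IsCollapse Ψ Y rb α ξ) {S : Set (ℝ × ℝ)}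
    (hS : S ⊆ phase) (hSc : IsCompact S) {T : ℝ} (hreg : RegularField (rayField Ψ Y α) S T)
    {z z' : ℝ → ℝ × ℝ} (hz : IsTrajectory (rayField Ψ Y α) S T z)
    (hz' : IsTrajectory (rayField Ψ Y α) S T z')
    (h : radiusOf α z =ᶠ[𝓝[>] 0] radiusOf α z') : z T = z' T := by
  refine hz.eq_of_eventuallyEq H.asymptotic hS hSc hreg hz' ?_
  filter_upwards [tendsto_exp_neg_mem h, eventually_ge_atTop T] with t ht htT
  have h1 := (hS (hz.mem t htT)).1
  have h2 := (hS (hz'.mem t htT)).1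
  have hα := H.alpha_pos
  have he := Real.exp_pos (-t)
  simp only [radiusOf, Real.log_exp, neg_neg] at ht
  rw [div_eq_div_iff (by positivity) (by positivity)] at ht
  have h3 := mul_left_cancel₀ (by positivity) ht
  exact ((pow_left_inj₀ h2.le h1.le two_ne_zero).1 h3).symm

/-- An injective family of trajectories gives infinitely many rays. -/
theorem infinitelyMany_of_family (H : IsCollapse Ψ Y rb α ξ) {S : Set (ℝ × ℝ)}
    (hS : S ⊆ phase) (hSc : IsCompact S) {T : ℝ} (hreg : RegularField (rayField Ψ Y α) S T)
    {P : Ray → Prop} {I : Set ℝ} (hI : I.Infinite) (ζ : ℝ → ℝ → ℝ × ℝ)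
    (hζ : ∀ s ∈ I, IsTrajectory (rayField Ψ Y α) S T (ζ s)) (hinj : InjOn (fun s => ζ s T) I)
    (hP : ∀ s ∈ I, ∃ c : Ray, P c ∧ c.R = radiusOf α (ζ s)) : InfinitelyMany P := by
  refine Set.infinite_of_injOn_mapsTo
    (f := fun s => ((radiusOf α (ζ s) : ℝ → ℝ) : Germ (𝓝[>] (0 : ℝ)) ℝ)) (s := I) ?_ ?_ hI
  · intro s hs s' hs' h
    exact hinj hs hs' ((hζ s hs).eq_of_radiusOf H hS hSc hreg (hζ s' hs') (Germ.coe_eq.1 h))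
  · intro s hs
    obtain ⟨c, hc, hcR⟩ := hP s hs
    exact ⟨c, hc, by rw [hcR]⟩

end Collapse
end

/-! ### Comparison of rays and uniqueness of the Cauchy horizon -/

noncomputable section
namespace Collapse

variable {Ψ Y : ℝ → ℝ → ℝ} {rb α ξ b b' r u₁ u₂ uc : ℝ} {R R' q q' : ℝ → ℝ}

/-- The condition on κ makes the exponential a strict barrier for either sign of δ: κ > L if δ > 0,
κ < -L if δ < 0. Negative δ preserves strict inequalities between rays; positive δ → 0 preserves
weak ones. -/
theorem le_mul_exp_of_deriv_le {f f' : ℝ → ℝ} {a b L δ κ : ℝ}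
    (hf : ∀ x ∈ Icc a b, HasDerivAt f (f' x) x) (h : ∀ x ∈ Icc a b, f' x ≤ L * |f x|)
    (h0 : f a ≤ δ) (hκ : L * |δ| < κ * δ) : ∀ x ∈ Icc a b, f x ≤ δ * Real.exp (κ * (x - a)) := by
  have hB : ∀ x, HasDerivAt (fun x => δ * Real.exp (κ * (x - a)))
      (κ * δ * Real.exp (κ * (x - a))) x := fun x => by
    refine (((((hasDerivAt_id x).sub_const a).const_mul κ).exp).const_mul δ).congr_deriv ?_
    simp only [id]; ring
  intro x hx
  refine image_le_of_deriv_right_lt_deriv_boundary'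
    (fun y hy => (hf y hy).continuousAt.continuousWithinAt)
    (fun y hy => (hf y ⟨hy.1, hy.2.le⟩).hasDerivWithinAt) (by simpa using h0)
    (fun y _ => (hB y).continuousAt.continuousWithinAt) (fun y _ => (hB y).hasDerivWithinAt)
    (fun y hy hyB => ?_) hx
  have he := Real.exp_pos (κ * (y - a))
  calc f' y ≤ L * |f y| := h y ⟨hy.1, hy.2.le⟩
    _ = L * |δ| * Real.exp (κ * (y - a)) := by rw [hyB, abs_mul, abs_of_pos he]; ring
    _ < κ * δ * Real.exp (κ * (y - a)) := mul_lt_mul_of_pos_right hκ he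

namespace IsLightRay

/-- At a given point the radial ray is the steepest, since the slope decreases in q and q ≥ 1. -/
theorem deriv_le (H : IsCollapse Ψ Y rb α ξ) (h : IsLightRay Ψ Y b R q) (hbr : b ≤ rb)
    (hr : r ∈ Ioo 0 b) : raySlope Ψ Y (r, R r) (q r) ≤ raySlope Ψ Y (r, R r) 1 := by
  have h2 := hr.2.trans_le hbr
  have hK := H.kSpeed_pos (h.pos r hr) (h.lt r hr) h2
  have hu := H.u_pos (h.pos r hr) (h.lt r hr).le h2
  have := mul_le_mul_of_nonneg_left (mul_le_mul_of_nonneg_left (h.one_le r hr) hu.le) hK.le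
  simp only [raySlope]
  linarith

/-- The Lipschitz constant is taken on the union of the two compact arcs; no convex region
containing both is needed. -/
theorem exists_slope_bound (H : IsCollapse Ψ Y rb α ξ) (h : IsLightRay Ψ Y b R q) (hbr : b ≤ rb)
    (h' : IsLightRay Ψ Y b' R' q') (hbr' : b' ≤ rb) {r₀ r₁ : ℝ} (h0 : 0 < r₀)
    (h1 : r₁ < b) (h1' : r₁ < b') : ∃ L : ℝ, 0 ≤ L ∧ ∀ r ∈ Icc r₀ r₁,
      |raySlope Ψ Y (r, R r) 1 - raySlope Ψ Y (r, R' r) 1| ≤ L * |R r - R' r| := by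
  have hm : ∀ r ∈ Icc r₀ r₁, r ∈ Ioo 0 b := fun r hr =>
    ⟨h0.trans_le hr.1, hr.2.trans_lt h1⟩
  have hm' : ∀ r ∈ Icc r₀ r₁, r ∈ Ioo 0 b' := fun r hr =>
    ⟨h0.trans_le hr.1, hr.2.trans_lt h1'⟩
  have hc : ContinuousOn (fun r => (r, R r)) (Icc r₀ r₁) := fun r hr =>
    (continuousAt_id.prodMk (h.deriv_R r (hm r hr)).continuousAt).continuousWithinAt
  have hc' : ContinuousOn (fun r => (r, R' r)) (Icc r₀ r₁) := fun r hr =>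
    (continuousAt_id.prodMk (h'.deriv_R r (hm' r hr)).continuousAt).continuousWithinAt
  have hslope : ∀ r R, 0 < R → R < r → r < rb →
      ContDiffAt ℝ 1 (fun x : ℝ × ℝ => raySlope Ψ Y x 1) (r, R) := fun r R h0 h1 h2 =>
    (H.contDiffAt_raySlope h0 h1 h2 1).comp (r, R)
      (contDiffAt_id.prodMk contDiffAt_const)
  obtain ⟨L, hL⟩ := exists_lipschitzOnWith_of_contDiffAt
    ((isCompact_Icc.image_of_continuousOn hc).union (isCompact_Icc.image_of_continuousOn hc'))
    (f := fun x => raySlope Ψ Y x 1) (by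
      rintro _ (⟨r, hr, rfl⟩ | ⟨r, hr, rfl⟩)
      · exact hslope _ _ (h.pos r (hm r hr)) (h.lt r (hm r hr)) ((hm r hr).2.trans_le hbr)
      · exact hslope _ _ (h'.pos r (hm' r hr)) (h'.lt r (hm' r hr)) ((hm' r hr).2.trans_le hbr'))
  refine ⟨L, L.2, fun r hr => ?_⟩
  have := hL.dist_le_mul _ (Or.inl ⟨r, hr, rfl⟩) _ (Or.inr ⟨r, hr, rfl⟩)
  simpa [Prod.dist_eq, Real.dist_eq] using this

/-- A light ray below a radial one stays below it. -/
theorem sub_le_mul_exp (H : IsCollapse Ψ Y rb α ξ) (h : IsLightRay Ψ Y b R q) (hbr : b ≤ rb)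
    (h' : IsLightRay Ψ Y b' R' q') (hbr' : b' ≤ rb) (hq' : ∀ r ∈ Ioo 0 b', q' r = 1)
    {r₀ r₁ : ℝ} (h0 : 0 < r₀) (h1 : r₁ < b) (h1' : r₁ < b') : ∃ L : ℝ, 0 ≤ L ∧
      ∀ δ κ : ℝ, R r₀ - R' r₀ ≤ δ → L * |δ| < κ * δ →
        ∀ r ∈ Icc r₀ r₁, R r - R' r ≤ δ * Real.exp (κ * (r - r₀)) := by
  obtain ⟨L, hL0, hL⟩ := h.exists_slope_bound H hbr h' hbr' h0 h1 h1'
  refine ⟨L, hL0, fun δ κ hδ hκ => ?_⟩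
  refine le_mul_exp_of_deriv_le (f := fun r => R r - R' r)
    (f' := fun r => raySlope Ψ Y (r, R r) (q r) - raySlope Ψ Y (r, R' r) (q' r))
    (fun r hr => (h.deriv_R r ⟨h0.trans_le hr.1, hr.2.trans_lt h1⟩).sub
      (h'.deriv_R r ⟨h0.trans_le hr.1, hr.2.trans_lt h1'⟩)) (fun r hr => ?_) hδ hκ
  have e1 := h.deriv_le H hbr ⟨h0.trans_le hr.1, hr.2.trans_lt h1⟩
  have e2 := (le_abs_self _).trans (hL r hr)
  simp only [hq' r ⟨h0.trans_le hr.1, hr.2.trans_lt h1'⟩]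
  linarith

theorem lt_of_lt (H : IsCollapse Ψ Y rb α ξ) (h : IsLightRay Ψ Y b R q) (hbr : b ≤ rb)
    (h' : IsLightRay Ψ Y b' R' q') (hbr' : b' ≤ rb) (hq' : ∀ r ∈ Ioo 0 b', q' r = 1)
    {r₀ r₁ : ℝ} (h0 : 0 < r₀) (h01 : r₀ ≤ r₁) (h1 : r₁ < b) (h1' : r₁ < b')
    (hlt : R r₀ < R' r₀) : R r₁ < R' r₁ := by
  obtain ⟨L, hL0, hL⟩ := h.sub_le_mul_exp H hbr h' hbr' hq' h0 h1 h1'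
  have hδ : R r₀ - R' r₀ < 0 := by linarith
  have h2 := hL _ (-(L + 1)) le_rfl (by rw [abs_of_neg hδ]; linarith) r₁ ⟨h01, le_rfl⟩
  have h3 := mul_neg_of_neg_of_pos hδ (Real.exp_pos (-(L + 1) * (r₁ - r₀)))
  linarith

theorem le_of_le (H : IsCollapse Ψ Y rb α ξ) (h : IsLightRay Ψ Y b R q) (hbr : b ≤ rb)
    (h' : IsLightRay Ψ Y b' R' q') (hbr' : b' ≤ rb) (hq' : ∀ r ∈ Ioo 0 b', q' r = 1)
    {r₀ r₁ : ℝ} (h0 : 0 < r₀) (h01 : r₀ ≤ r₁) (h1 : r₁ < b) (h1' : r₁ < b')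
    (hle : R r₀ ≤ R' r₀) : R r₁ ≤ R' r₁ := by
  obtain ⟨L, hL0, hL⟩ := h.sub_le_mul_exp H hbr h' hbr' hq' h0 h1 h1'
  refine sub_nonpos.1 (le_of_forall_pos_le_add fun ε hε => ?_)
  have he := Real.exp_pos ((L + 1) * (r₁ - r₀))
  have hδ : 0 < ε / Real.exp ((L + 1) * (r₁ - r₀)) := div_pos hε he
  have h2 := hL _ (L + 1) (by linarith) (by rw [abs_of_pos hδ]; linarith) r₁ ⟨h01, le_rfl⟩
  rw [div_mul_cancel₀ _ he.ne'] at h2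
  linarith

end IsLightRay

/-- The product `R ∂_R (F / R)` of the slope `F` of the radial rays. -/
def slopeDefect (Ψ Y : ℝ → ℝ → ℝ) (x : ℝ × ℝ) : ℝ :=
  kSpeedR Ψ Y x * (Y x.1 x.2 - u Ψ Y x.1 x.2)
    + kSpeed Ψ Y x * (dR (fun x => Y x.1 x.2) x - dR (fun x => u Ψ Y x.1 x.2) x)
    - raySlope Ψ Y x 1 / x.2

namespace IsCollapse

variable (H : IsCollapse Ψ Y rb α ξ)
include H

theorem hasDerivAt_raySlope_div {R : ℝ} (h0 : 0 < R) (h1 : R < r) (h2 : r < rb) :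
    HasDerivAt (fun s => raySlope Ψ Y (r, s) 1 / s) (slopeDefect Ψ Y (r, R) / R) R := by
  have dK := hasDerivAt_dR ((H.contDiffAt_kSpeed h0 h1 h2).differentiableAt (by simp))
  have dY := hasDerivAt_dR ((H.contDiff_Y r R h0.le h1.le h2).differentiableAt (by simp))
  have du := hasDerivAt_dR ((H.contDiffAt_u h0 h1.le h2).differentiableAt (by simp))
  rw [H.dR_kSpeed h0 h1 h2] at dK
  refine ((dK.mul (dY.sub (du.mul_const 1))).div (hasDerivAt_id R) h0.ne').congr_deriv ?_
  simp only [slopeDefect, raySlope, id, Pi.mul_apply, Pi.sub_apply]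
  field_simp

theorem tendsto_slopeDefect {v : ℝ} (hv : 0 < v) :
    Tendsto (fun x => x.1 * slopeDefect Ψ Y x) (scaling α v)
      (𝓝 ((3 / 2 - hLim (ξ / α) v / 2) * (1 - v) + hLim (ξ / α) v * (v / 2)
        - hLim (ξ / α) v * (1 - v))) := by
  have hY := H.tendsto_Y.mono_left (scaling_le_cone α v)
  have hu := H.tendsto_u hv
  have hK := H.tendsto_kSpeed hv
  have h := (((H.tendsto_kSpeedR hv).mul (hY.sub hu)).add (hK.mul
    ((H.tendsto_dR_Y.mono_left (scaling_le_cone α v)).sub (H.tendsto_mul_dR_u hv)))).sub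
    (hK.mul (hY.sub hu))
  have e : hLim (ξ / α) v * (0 - -v / 2) = hLim (ξ / α) v * (v / 2) := by ring
  rw [e] at h
  refine h.congr' ?_
  filter_upwards [scaling_le_cone α v (eventually_cone_region H.rb_pos)] with x hx
  have := hx.1.ne'
  simp only [slopeDefect, raySlope]
  field_simp

/-- With h (1 - uc) = 3 the limit of r · `slopeDefect` becomes a positive multiple of uc² + 2uc - 2,
negative because uc < `vCrit`. It is the repulsion from uc on the radial line in other variables. -/
theorem eventually_slopeDefect_neg (E : Equilibria (ξ / α) u₁ u₂ uc) :
    ∀ᶠ x in scaling α uc, slopeDefect Ψ Y x < 0 := by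
  have hlt : (3 / 2 - hLim (ξ / α) uc / 2) * (1 - uc) + hLim (ξ / α) uc * (uc / 2)
        - hLim (ξ / α) uc * (1 - uc) < 0 := by
    have h1 : hLim (ξ / α) uc * (1 - uc) = 3 := by
      have := E.radial_c
      simp only [radialPoly] at this
      simp only [hLim]
      linarith
    have hc := E.uc_lt
    have hp := E.uc_pos
    have h2 := vCrit_sq
    have h3 := vCrit_bounds
    have hu1 : uc < 1 := by linarith [h3.1, h3.2]
    have h4 : uc ^ 2 < vCrit ^ 2 := pow_lt_pow_left₀ hc hp.le two_ne_zero
    have h5 : ((3 / 2 - hLim (ξ / α) uc / 2) * (1 - uc) + hLim (ξ / α) uc * (uc / 2)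
        - hLim (ξ / α) uc * (1 - uc)) * (1 - uc) = 3 / 2 * (uc ^ 2 + 2 * uc - 2) := by
      linear_combination (-(3 / 2) * (1 - uc) + uc / 2) * h1
    have h6 : uc ^ 2 + 2 * uc - 2 < 0 := by linarith
    by_contra hcon
    have := mul_nonneg (not_lt.1 hcon) (sub_nonneg.2 hu1.le)
    linarith
  have hpos := scaling_le_cone α uc (eventually_cone_region H.rb_pos)
  filter_upwards [(H.tendsto_slopeDefect E.uc_pos).eventually (gt_mem_nhds hlt), hpos] with x hx hx'
  exact neg_of_mul_neg_right hx (hx'.1.trans hx'.2.1).le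

/-- The sign is needed on the whole segment between two rays at the same r, hence on a neighbourhood
of R/r³ that does not depend on r. -/
theorem exists_slopeDefect_neg (E : Equilibria (ξ / α) u₁ u₂ uc) :
    ∃ ε > 0, ∀ᶠ r in 𝓝[>] 0, r < rb ∧ ∀ s, |s / r ^ 3 - α / uc ^ 2| < ε →
      0 < s ∧ s < r ∧ slopeDefect Ψ Y (r, s) < 0 := by
  have ht : Tendsto (fun p : ℝ × ℝ => (p.1, p.2 * p.1 ^ 3)) (𝓝[>] 0 ×ˢ 𝓝 (α / uc ^ 2))
      (scaling α uc) := by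
    refine (tendsto_scaling H.alpha_pos E.uc_pos).2 ⟨tendsto_fst, ?_⟩
    refine (tendsto_snd (f := 𝓝[>] (0 : ℝ))).congr' ?_
    filter_upwards [tendsto_fst.eventually (self_mem_nhdsWithin (s := Ioi (0 : ℝ)))] with p hp
    have : p.1 ≠ 0 := ne_of_gt hp
    field_simp
  have hev := ht.eventually ((H.eventually_slopeDefect_neg E).and
    (scaling_le_cone α uc (eventually_cone_region H.rb_pos)))
  obtain ⟨pa, ha, pb, hb, hab⟩ := eventually_prod_iff.1 hev
  obtain ⟨ε, hε, hball⟩ := Metric.eventually_nhds_iff.1 hb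
  refine ⟨ε, hε, ?_⟩
  filter_upwards [ha, self_mem_nhdsWithin] with r hr hr0
  have hr0 : 0 < r := hr0
  have hx : α / uc ^ 2 * r ^ 3 / r ^ 3 = α / uc ^ 2 := by field_simp
  refine ⟨(hab hr (hball (y := α / uc ^ 2) (by simpa using hε))).2.2.2, fun s hs => ?_⟩
  have h := hab hr (hball (y := s / r ^ 3) (by rwa [Real.dist_eq]))
  have e : s / r ^ 3 * r ^ 3 = s := by field_simp
  simp only [e] at h
  exact ⟨h.2.1, h.2.2.1, h.1⟩

/-- Two radial rays in the direction of the Cauchy horizon coincide near the centre. -/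
theorem eventuallyEq_of_direction (E : Equilibria (ξ / α) u₁ u₂ uc) (hb : 0 < b)
    (h : IsLightRay Ψ Y b R q) (hq : ∀ r ∈ Ioo 0 b, q r = 1)
    (hd : Tendsto (fun r => R r / r ^ 3) (𝓝[>] 0) (𝓝 (α / uc ^ 2)))
    (hb' : 0 < b') (h' : IsLightRay Ψ Y b' R' q') (hq' : ∀ r ∈ Ioo 0 b', q' r = 1)
    (hd' : Tendsto (fun r => R' r / r ^ 3) (𝓝[>] 0) (𝓝 (α / uc ^ 2))) : R =ᶠ[𝓝[>] 0] R' := by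
  obtain ⟨ε, hε, hev⟩ := H.exists_slopeDefect_neg E
  have hx : 0 < α / uc ^ 2 := div_pos H.alpha_pos (pow_pos E.uc_pos 2)
  have hclose : ∀ {f : ℝ → ℝ}, Tendsto (fun r => f r / r ^ 3) (𝓝[>] 0) (𝓝 (α / uc ^ 2)) →
      ∀ᶠ r in 𝓝[>] 0, |f r / r ^ 3 - α / uc ^ 2| < ε := fun hf =>
    (Metric.tendsto_nhds.1 hf ε hε)
  obtain ⟨b₀, hb₀, hall⟩ := mem_nhdsGT_iff_exists_Ioo_subset.1
    (((hev.and (hclose hd)).and (hclose hd')).and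
      (Ioo_mem_nhdsGT (lt_min hb hb')))
  have hb₀ : 0 < b₀ := hb₀
  have hm : ∀ r ∈ Ioo 0 b₀, r ∈ Ioo 0 b := fun r hr =>
    ⟨hr.1, (hall hr).2.2.trans_le (min_le_left _ _)⟩
  have hm' : ∀ r ∈ Ioo 0 b₀, r ∈ Ioo 0 b' := fun r hr =>
    ⟨hr.1, (hall hr).2.2.trans_le (min_le_right _ _)⟩
  have hmono : ∀ r ∈ Ioo 0 b₀, ∀ s t, |s / r ^ 3 - α / uc ^ 2| < ε →
      |t / r ^ 3 - α / uc ^ 2| < ε → s ≤ t →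
      raySlope Ψ Y (r, t) 1 / t ≤ raySlope Ψ Y (r, s) 1 / s := by
    intro r hr s t hs ht hst
    obtain ⟨⟨⟨⟨hrb, hneg⟩, -⟩, -⟩, -⟩ := hall hr
    have hr3 : 0 < r ^ 3 := pow_pos hr.1 3
    have hin : ∀ w ∈ Icc s t, |w / r ^ 3 - α / uc ^ 2| < ε := fun w hw => by
      rw [abs_lt] at hs ht ⊢
      have e1 : s / r ^ 3 ≤ w / r ^ 3 := div_le_div_of_nonneg_right hw.1 hr3.le
      have e2 : w / r ^ 3 ≤ t / r ^ 3 := div_le_div_of_nonneg_right hw.2 hr3.le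
      exact ⟨by linarith, by linarith⟩
    have hder : ∀ w ∈ Icc s t, HasDerivAt (fun s => raySlope Ψ Y (r, s) 1 / s)
        (slopeDefect Ψ Y (r, w) / w) w := fun w hw => by
      obtain ⟨e0, e1, -⟩ := hneg w (hin w hw)
      exact H.hasDerivAt_raySlope_div e0 e1 hrb
    refine antitoneOn_of_hasDerivWithinAt_nonpos (convex_Icc s t)
      (fun w hw => (hder w hw).continuousAt.continuousWithinAt)
      (fun w hw => (hder w (interior_subset hw)).hasDerivWithinAt) (fun w hw => ?_)
      (left_mem_Icc.2 hst) (right_mem_Icc.2 hst) hst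
    obtain ⟨e0, -, e2⟩ := hneg w (hin w (interior_subset hw))
    exact (div_neg_of_neg_of_pos e2 e0).le
  -- The derivative of log R is slope/R, which decreases in R; so the two logarithms approach each
  -- other as r grows. Their difference tends to 0 at the centre, hence it vanishes.
  have hE := nonpos_of_deriv_nonpos (b := b₀) (f := fun r => (Real.log (R r) - Real.log (R' r)) ^ 2)
    (f' := fun r => 2 * (Real.log (R r) - Real.log (R' r)) *
      (raySlope Ψ Y (r, R r) 1 / R r - raySlope Ψ Y (r, R' r) 1 / R' r)) (fun r hr => ?_)
    (fun r hr => ?_) ?_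
  · filter_upwards [Ioo_mem_nhdsGT hb₀] with r hr
    have h2 := pow_eq_zero_iff (two_ne_zero) |>.1 (le_antisymm (hE r hr) (sq_nonneg _))
    exact Real.log_injOn_pos (h.pos r (hm r hr)) (h'.pos r (hm' r hr)) (sub_eq_zero.1 h2)
  · have d := (h.deriv_R r (hm r hr)).log (h.pos r (hm r hr)).ne'
    have d' := (h'.deriv_R r (hm' r hr)).log (h'.pos r (hm' r hr)).ne'
    rw [hq r (hm r hr)] at d
    rw [hq' r (hm' r hr)] at d'
    refine ((d.sub d').pow 2).congr_deriv ?_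
    simp
  · obtain ⟨⟨⟨-, h1⟩, h2⟩, -⟩ := hall hr
    rcases le_total (R r) (R' r) with hle | hle
    · have e1 := hmono r hr _ _ h1 h2 hle
      have e2 := Real.log_le_log (h.pos r (hm r hr)) hle
      exact mul_nonpos_of_nonpos_of_nonneg (by linarith) (by linarith)
    · have e1 := hmono r hr _ _ h2 h1 hle
      have e2 := Real.log_le_log (h'.pos r (hm' r hr)) hle
      exact mul_nonpos_of_nonneg_of_nonpos (by linarith) (by linarith)
  · have h1 := ((hd.log hx.ne').sub (hd'.log hx.ne')).pow 2
    rw [sub_self, zero_pow two_ne_zero] at h1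
    refine h1.congr' ?_
    filter_upwards [Ioo_mem_nhdsGT hb₀] with r hr
    have hr3 : r ^ 3 ≠ 0 := (pow_pos hr.1 3).ne'
    rw [Real.log_div (h.pos r (hm r hr)).ne' hr3, Real.log_div (h'.pos r (hm' r hr)).ne' hr3]
    ring

end IsCollapse

end Collapse
end

/-! ### The three classes -/

noncomputable section
namespace Collapse

variable {Ψ Y : ℝ → ℝ → ℝ} {rb α ξ u₁ u₂ uc : ℝ}

theorem Ray.HasDirection.unique {c : Ray} {x y : ℝ} (hx : c.HasDirection x)
    (hy : c.HasDirection y) : x = y :=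
  tendsto_nhds_unique (Ray.hasDirection_iff.1 hx) (Ray.hasDirection_iff.1 hy)

theorem Equilibria.directions_lt {ω : ℝ} (E : Equilibria ω u₁ u₂ uc) (hα : 0 < α) :
    α < α / u₁ ^ 2 ∧ α / u₁ ^ 2 < α / u₂ ^ 2 ∧ α / u₂ ^ 2 < α / uc ^ 2 := by
  have h0 := E.uc_pos
  have h1 := E.uc_lt.trans E.lt_u₂
  have h2 := E.u₂_lt
  have h3 := E.u₁_lt
  refine ⟨?_, ?_, ?_⟩
  · have : 0 < u₁ := by linarith
    rw [lt_div_iff₀ (by positivity)]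
    exact mul_lt_of_lt_one_right hα (pow_lt_one₀ this.le h3 two_ne_zero)
  · have : 0 < u₂ := by linarith
    exact div_lt_div_of_pos_left hα (by positivity) (pow_lt_pow_left₀ h2 this.le two_ne_zero)
  · exact div_lt_div_of_pos_left hα (by positivity) (pow_lt_pow_left₀ h1 h0.le two_ne_zero)

namespace IsCollapse

variable (H : IsCollapse Ψ Y rb α ξ) (E : Equilibria (ξ / α) u₁ u₂ uc)
include H E

theorem classification {c : Ray} (hc : c.IsSingular Ψ Y rb) :
    (c.HasDirection (α / u₁ ^ 2) ∧ (c.IsRadial ∨ c.IsNonradial)) ∨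
      (c.HasDirection (α / u₂ ^ 2) ∧ c.IsNonradial) ∨
      (c.HasDirection (α / uc ^ 2) ∧ c.IsRadial) := by
  obtain ⟨q, ℓ, hℓ, -, hL, -, -, -, T, -, S, -, -, -, h⟩ := hc.exists_tendsto H E
  rcases h with ⟨-, hd, rfl⟩ | ⟨-, hd⟩ | ⟨-, hd, hpos⟩
  · exact Or.inr (Or.inr ⟨hd, hL⟩)
  · refine Or.inl ⟨hd, ?_⟩
    rcases hℓ.eq_or_lt with rfl | hpos
    · exact Or.inl hL
    · exact Or.inr ⟨ℓ, hpos, hL⟩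
  · exact Or.inr (Or.inl ⟨hd, ℓ, hpos, hL⟩)

/-- The initial points (v, 1) on the bottom edge of the invariant rectangle at the sink,
parametrized by v. -/
theorem infinitelyMany_radial : InfinitelyMany
    (fun c => c.IsSingular Ψ Y rb ∧ c.HasDirection (α / u₁ ^ 2) ∧ c.IsRadial) := by
  obtain ⟨T, -, S, hS, hSc, hreg, ρ, hρ, σ, hσ, hfam⟩ := H.asymptotic.exists_sink_family E 0
  choose! ζ hζT hζ h1 _ hlim using fun v hv => hfam v hv 1 ⟨le_rfl, by linarith⟩
  have hu := E.uc_pos.trans (E.uc_lt.trans (E.lt_u₂.trans E.u₂_lt))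
  refine infinitelyMany_of_family H hS hSc hreg (Icc_infinite (by linarith : u₁ - ρ < u₁ + ρ)) ζ hζ
    (fun v hv v' hv' h => ?_) fun v hv => ?_
  · simp only [hζT v hv, hζT v' hv'] at h
    exact congrArg Prod.fst h
  · obtain ⟨c, ℓ, hcR, hc, hd, hL, h0, -⟩ := (hζ v hv).exists_isSingular H hS hSc hu E.u₁_lt
      ((continuous_fst.tendsto _).comp (hlim v hv))
    obtain rfl := h0 (h1 v hv rfl)
    exact ⟨c, ⟨hc, hd, hL⟩, hcR⟩

/-- The initial points on the top edge q = 1 + σ of the same rectangle. -/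
theorem infinitelyMany_nonradial : InfinitelyMany
    (fun c => c.IsSingular Ψ Y rb ∧ c.HasDirection (α / u₁ ^ 2) ∧ c.IsNonradial) := by
  obtain ⟨T, -, S, hS, hSc, hreg, ρ, hρ, σ, hσ, hfam⟩ := H.asymptotic.exists_sink_family E 0
  choose! ζ hζT hζ _ h1 hlim using fun v hv => hfam v hv (1 + σ) ⟨by linarith, le_rfl⟩
  have hu := E.uc_pos.trans (E.uc_lt.trans (E.lt_u₂.trans E.u₂_lt))
  refine infinitelyMany_of_family H hS hSc hreg (Icc_infinite (by linarith : u₁ - ρ < u₁ + ρ)) ζ hζ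
    (fun v hv v' hv' h => ?_) fun v hv => ?_
  · simp only [hζT v hv, hζT v' hv'] at h
    exact congrArg Prod.fst h
  · obtain ⟨c, ℓ, hcR, hc, hd, hL, -, h0⟩ := (hζ v hv).exists_isSingular H hS hSc hu E.u₁_lt
      ((continuous_fst.tendsto _).comp (hlim v hv))
    exact ⟨c, ⟨hc, hd, ℓ, h0 (h1 v hv (by linarith)), hL⟩, hcR⟩

theorem infinitelyMany_winding : InfinitelyMany
    (fun c => c.IsSingular Ψ Y rb ∧ c.HasDirection (α / u₂ ^ 2) ∧ c.IsNonradial) := by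
  obtain ⟨T, -, S, hS, hSc, hreg, ρ, hρ, ζ, hinj, hfam⟩ := H.asymptotic.exists_saddle_family E 0
  have hu := E.uc_pos.trans (E.uc_lt.trans E.lt_u₂)
  refine infinitelyMany_of_family H hS hSc hreg (Icc_infinite (by linarith : -ρ < ρ)) ζ
    (fun s hs => (hfam s hs).1) hinj fun s hs => ?_
  obtain ⟨hz, h1, hlim⟩ := hfam s hs
  obtain ⟨c, ℓ, hcR, hc, hd, hL, -, h0⟩ := hz.exists_isSingular H hS hSc hu
    (E.u₂_lt.trans E.u₁_lt) ((continuous_fst.tendsto _).comp hlim)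
  exact ⟨c, ⟨hc, hd, ℓ, h0 h1, hL⟩, hcR⟩

theorem exists_cauchyHorizon :
    ∃ c : Ray, c.IsSingular Ψ Y rb ∧ c.HasDirection (α / uc ^ 2) ∧ c.IsRadial := by
  obtain ⟨T, -, S, hS, hSc, z, hz, h1, hlim⟩ := H.asymptotic.exists_radial_saddle E 0
  obtain ⟨c, ℓ, -, hc, hd, hL, h0, -⟩ := hz.exists_isSingular H hS hSc E.uc_pos
    (E.uc_lt.trans (E.lt_u₂.trans (E.u₂_lt.trans E.u₁_lt))) ((continuous_fst.tendsto _).comp hlim)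
  obtain rfl := h0 h1
  exact ⟨c, hc, hd, hL⟩

theorem exists_tendsto_angle {c : Ray} (hc : c.IsSingular Ψ Y rb)
    (hd : c.HasDirection (α / u₁ ^ 2)) : ∃ φ₀ : ℝ, Tendsto c.φ (𝓝[>] 0) (𝓝 φ₀) := by
  obtain ⟨-, h12, h2c⟩ := E.directions_lt H.alpha_pos
  obtain ⟨q, ℓ, -, hray, -, hφ, -, -, T, -, S, hS, hSc, hz, h⟩ := hc.exists_tendsto H E
  rcases h with ⟨-, hd', -⟩ | ⟨hlim, -⟩ | ⟨-, hd', -⟩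
  · exact absurd (hd.unique hd') (h12.trans h2c).ne
  · exact hray.exists_tendsto_angle H hc.isNullGeodesic.rmax_pos hφ hS hSc
      (E.uc_pos.trans (E.uc_lt.trans (E.lt_u₂.trans E.u₂_lt))) E.omega_pos hz E.transverse_u₁ hlim
  · exact absurd (hd.unique hd') h12.ne

theorem tendsto_angle_atBot {c : Ray} (hc : c.IsSingular Ψ Y rb)
    (hd : c.HasDirection (α / u₂ ^ 2)) : Tendsto c.φ (𝓝[>] 0) atBot := by
  obtain ⟨-, h12, h2c⟩ := E.directions_lt H.alpha_pos
  obtain ⟨q, ℓ, -, hray, -, hφ, -, -, T, -, S, hS, hSc, hz, h⟩ := hc.exists_tendsto H E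
  rcases h with ⟨-, hd', -⟩ | ⟨-, hd'⟩ | ⟨hlim, -, -⟩
  · exact absurd (hd.unique hd') h2c.ne
  · exact absurd (hd.unique hd') h12.ne'
  · exact hray.tendsto_angle_atBot H hc.isNullGeodesic.rmax_pos hφ
      (E.uc_pos.trans (E.uc_lt.trans E.lt_u₂)) E.q₂_gt E.omega_pos hlim

/-- The direction alone forces a ray to be radial, so uniqueness and the upper bound need no
assumption on ℓ. -/
theorem exists_isLightRay_of_direction {c : Ray} (hc : c.IsSingular Ψ Y rb)
    (hd : c.HasDirection (α / uc ^ 2)) :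
    ∃ q, IsLightRay Ψ Y c.rmax c.R q ∧ ∀ r ∈ Ioo 0 c.rmax, q r = 1 := by
  obtain ⟨-, h12, h2c⟩ := E.directions_lt H.alpha_pos
  obtain ⟨q, ℓ, -, hray, -, -, hrad, -, T, -, S, -, -, -, h⟩ := hc.exists_tendsto H E
  rcases h with ⟨-, -, h0⟩ | ⟨-, hd'⟩ | ⟨-, hd', -⟩
  · exact ⟨q, hray, hrad h0⟩
  · exact absurd (hd.unique hd') (h12.trans h2c).ne'
  · exact absurd (hd.unique hd') h2c.ne'

/-- The germs agree; both rays being radial, the weak comparison applies in both directions and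
carries equality outwards. -/
theorem cauchyHorizon_unique {c c' : Ray} (hc : c.IsSingular Ψ Y rb)
    (hd : c.HasDirection (α / uc ^ 2)) (hc' : c'.IsSingular Ψ Y rb)
    (hd' : c'.HasDirection (α / uc ^ 2)) {r : ℝ} (hr : 0 < r) (h1 : r < c.rmax)
    (h1' : r < c'.rmax) : c.R r = c'.R r := by
  obtain ⟨q, h, hq⟩ := H.exists_isLightRay_of_direction E hc hd
  obtain ⟨q', h', hq'⟩ := H.exists_isLightRay_of_direction E hc' hd'
  have hev := H.eventuallyEq_of_direction E hc.isNullGeodesic.rmax_pos h hq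
    (Ray.hasDirection_iff.1 hd) hc'.isNullGeodesic.rmax_pos h' hq' (Ray.hasDirection_iff.1 hd')
  obtain ⟨r₀, he, hr₀⟩ := (hev.and (Ioo_mem_nhdsGT hr)).exists
  exact le_antisymm
    (h.le_of_le H hc.isNullGeodesic.rmax_le h' hc'.isNullGeodesic.rmax_le hq' hr₀.1 hr₀.2.le h1 h1'
      he.le)
    (h'.le_of_le H hc'.isNullGeodesic.rmax_le h hc.isNullGeodesic.rmax_le hq hr₀.1 hr₀.2.le h1' h1
      he.ge)

/-- The cubic coefficients are strictly ordered, so the inequality holds at some radius below r, and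
comparison with the radial ray carries it up to r. -/
theorem lt_cauchyHorizon {c c' : Ray} (hc : c.IsSingular Ψ Y rb)
    (hd : c.HasDirection (α / uc ^ 2)) (hc' : c'.IsSingular Ψ Y rb)
    (hd' : ¬ c'.HasDirection (α / uc ^ 2)) {r : ℝ} (hr : 0 < r) (h1 : r < c.rmax)
    (h1' : r < c'.rmax) : c'.R r < c.R r := by
  obtain ⟨-, h12, h2c⟩ := E.directions_lt H.alpha_pos
  obtain ⟨q, h, hq⟩ := H.exists_isLightRay_of_direction E hc hd
  obtain ⟨q', -, -, h', -⟩ := hc'.isNullGeodesic.exists_isLightRay H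
  obtain ⟨x, hx, hxd⟩ : ∃ x < α / uc ^ 2, c'.HasDirection x := by
    rcases H.classification E hc' with ⟨h, -⟩ | ⟨h, -⟩ | ⟨h, -⟩
    · exact ⟨_, h12.trans h2c, h⟩
    · exact ⟨_, h2c, h⟩
    · exact absurd h hd'
  obtain ⟨r₀, he, hr₀⟩ := (((Ray.hasDirection_iff.1 hxd).eventually_lt
    (Ray.hasDirection_iff.1 hd) hx).and (Ioo_mem_nhdsGT hr)).exists
  rw [div_lt_div_iff_of_pos_right (pow_pos hr₀.1 3)] at he
  exact h'.lt_of_lt H hc'.isNullGeodesic.rmax_le h hc.isNullGeodesic.rmax_le hq hr₀.1 hr₀.2.le h1'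
    h1 he

end IsCollapse

end Collapse
end

theorem proposition3p2 (α ξ : ℝ) (hα : 0 < α) (hξ : α * Collapse.omegaCrit < ξ) :
    ∃ x₁ x₂ xc : ℝ, α < x₁ ∧ x₁ < x₂ ∧ x₂ < xc ∧
      ∀ (Ψ Y : ℝ → ℝ → ℝ) (rb : ℝ), Collapse.IsCollapse Ψ Y rb α ξ →
        -- the three classes are all the null geodesics from the central singularity
        (∀ c : Collapse.Ray, c.IsSingular Ψ Y rb →
          (c.HasDirection x₁ ∧ (c.IsRadial ∨ c.IsNonradial)) ∨
          (c.HasDirection x₂ ∧ c.IsNonradial) ∨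
          (c.HasDirection xc ∧ c.IsRadial)) ∧
        -- class (1)
        Collapse.InfinitelyMany
          (fun c => c.IsSingular Ψ Y rb ∧ c.HasDirection x₁ ∧ c.IsRadial) ∧
        Collapse.InfinitelyMany
          (fun c => c.IsSingular Ψ Y rb ∧ c.HasDirection x₁ ∧ c.IsNonradial) ∧
        (∀ c : Collapse.Ray, c.IsSingular Ψ Y rb → c.HasDirection x₁ → c.IsNonradial →
          ∃ φ₀ : ℝ, Tendsto c.φ (𝓝[>] 0) (𝓝 φ₀)) ∧
        -- class (2)
        Collapse.InfinitelyMany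
          (fun c => c.IsSingular Ψ Y rb ∧ c.HasDirection x₂ ∧ c.IsNonradial) ∧
        (∀ c : Collapse.Ray, c.IsSingular Ψ Y rb → c.HasDirection x₂ → c.IsNonradial →
          Tendsto c.φ (𝓝[>] 0) atBot) ∧
        -- class (3): existence, uniqueness, and the bound from above
        (∃ c : Collapse.Ray, c.IsSingular Ψ Y rb ∧ c.HasDirection xc ∧ c.IsRadial) ∧
        (∀ c c' : Collapse.Ray, c.IsSingular Ψ Y rb → c.HasDirection xc →
          c'.IsSingular Ψ Y rb → c'.HasDirection xc →
          ∀ r, 0 < r → r < c.rmax → r < c'.rmax → c.R r = c'.R r) ∧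
        (∀ c c' : Collapse.Ray, c.IsSingular Ψ Y rb → c.HasDirection xc →
          c'.IsSingular Ψ Y rb → ¬ c'.HasDirection xc →
          ∀ r, 0 < r → r < c.rmax → r < c'.rmax → c'.R r < c.R r) := by
  have hω : Collapse.omegaCrit < ξ / α := by rwa [lt_div_iff₀ hα, mul_comm]
  obtain ⟨u₁, u₂, uc, E⟩ := Collapse.exists_equilibria hω
  obtain ⟨h1, h12, h2c⟩ := E.directions_lt hα
  -- The equilibria depend on ω = ξ/α alone, so the directions are fixed before the spacetime is
  -- chosen.
  refine ⟨α / u₁ ^ 2, α / u₂ ^ 2, α / uc ^ 2, h1, h12, h2c, fun Ψ Y rb H => ?_⟩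
  exact ⟨fun c hc => H.classification E hc, H.infinitelyMany_radial E,
    H.infinitelyMany_nonradial E, fun c hc hd _ => H.exists_tendsto_angle E hc hd,
    H.infinitelyMany_winding E, fun c hc hd _ => H.tendsto_angle_atBot E hc hd,
    H.exists_cauchyHorizon E,
    fun c c' hc hd hc' hd' r hr h h' => H.cauchyHorizon_unique E hc hd hc' hd' hr h h',
    fun c c' hc hd hc' hd' r hr h h' => H.lt_cauchyHorizon E hc hd hc' hd' hr h h'⟩
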